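/- **Setting.** Let $M$ be a closed smooth 3-manifold with a global frame $L_1,L_2,L_3$ of vector fields, let $\Omega=[0,\infty)\times M$ with coordinate $\tau$ on the first factor, $\partial_0=\partial_\tau$, and $C^\infty=C^\infty(\Omega,\mathbb R)$. Let $W$ be the free $C^\infty$-module on $\theta_0,\dots,\theta_3$ with $\langle\theta_i,\theta_j\rangle=\eta_{ij}=\mathrm{diag}(-1,1,1,1)_{ij}$. Let $\mathrm{CDer}(W)$ be the Lie algebra of degree zero derivations of $\wedge W$ that preserve $\langle\cdot,\cdot\rangle$ up to a factor; as a module it is spanned by $\mathrm{Der}(C^\infty)$ (extended by zero to the $\theta_i$), by $\sigma_0$ with $\sigma_0\theta_a=\theta_a$, and by $\sigma_{ab}$ with $\sigma_{ab}\theta_c=\eta_{bc}\theta_a-\eta_{ac}\theta_b$; set $\sigma_i=\sigma_{0i}$. On $\wedge W\otimes\mathrm{CDer}(W)$ use the bracket $[\omega\delta,\omega'\delta']=\omega\omega'[\delta,\delta']+\omega\delta(\omega')\delta'-\delta'(\omega)\omega'\delta$, and let $\mathcal E$ be its quotient by the ideal generated by $\mathrm{Re}\sum_{m,n}(\theta_0\theta_m+i\theta_{m+1}\theta_{m+2})S_{mn}(\sigma_n+i\sigma_{n+1,n+2})$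 (indices in $\{1,2,3\}$ modulo 3), $S$ symmetric traceless complex $3\times3$. Let $\mathcal E_\Phi=\mathcal E\oplus\Phi$ be the extension by a scalar field: $\Phi^0=0$, $\Phi^1=W$, $\Phi^2=\wedge^2W\oplus\wedge^4W$ (elements of $\Phi$ are underlined), with $w\cdot\underline\varphi=w\varphi\oplus w\varphi^*$ for $w\in W$, $\varphi\in W$ (basis Hodge dual $\theta_0^*=\theta_1\theta_2\theta_3$, $\theta_1^*=\theta_0\theta_2\theta_3$, $\theta_2^*=\theta_0\theta_3\theta_1$, $\theta_3^*=\theta_0\theta_1\theta_2$), $[\delta,\underline\varphi]=\underline{\delta(\varphi)}$ for $\delta\in\mathrm{CDer}(W)$, $[w\delta,\underline\varphi]=w\cdot\underline{\delta(\varphi)}$, and $[\underline\varphi,\underline\varphi]=\sum(-6a^pa^q+\eta_{bc}a^ba^c\eta^{pq})\eta^{ij}\theta_i\theta_p\sigma_{jq}$ for $\varphi=\sum a^i\theta_i$. For a graded Lie algebra $\mathfrak g$, $\mathrm{MC}(\mathfrak g)=\{u\in\mathfrak g^1:[u,u]=0\}$. **Filtration.** Let $(i,j,k)$ run over the cyclic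 permutations of $(1,2,3)$, and let $e_i$ be the unit vectors of $\mathbb N^3$. For $\alpha\in\mathbb N^3$ let $G_\alpha$ be the span of the following *gauge elements* (listed in homological degrees $0;1;2$) and of $\theta_0$ times them: - $\alpha=0$: $\mathrm{Der}(C^\infty),\sigma_0$; $\theta_0\sigma_0+\theta_i\sigma_i$ (all $i$), $\underline{\theta_0}$; $\sum_{(i,j,k)}(\theta_j\theta_k\sigma_{jk}+2\theta_0\theta_i\sigma_i)$. - $\alpha=2e_i$: (degree 1) $-\theta_i\sigma_{jk}+\theta_j\sigma_{ki}+\theta_k\sigma_{ij}$. - $\alpha=e_j+e_k$: $\sigma_i,\sigma_{jk}$; $\theta_i\mathrm{Der}(C^\infty)$, $\theta_0\sigma_i+\theta_i\sigma_0$, $\theta_j\sigma_k+\theta_k\sigma_j$, $\theta_k\sigma_{ki}$, $\theta_j\sigma_{ij}$, $\underline{\theta_i}$; $\theta_0\theta_j\sigma_{ij}+\theta_i\theta_j\sigma_j$. - $\alpha=2e_i+e_j+e_k$: (degree 1) $\theta_j\sigma_k-\theta_k\sigma_j$; (degree 2) $\theta_j\theta_k\mathrm{Der}(C^\infty)$,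 $\theta_0\theta_j\sigma_k-\theta_0\theta_k\sigma_j-2\theta_j\theta_k\sigma_0$, $\theta_0\theta_j\sigma_k+\theta_0\theta_k\sigma_j-2\theta_i\theta_j\sigma_{ki}$, $\underline{\theta_j\theta_k}$. - $\alpha=(2,2,2)$: (degree 2) $\sum_{(i,j,k)}(\theta_0\theta_i\sigma_{jk}-2\theta_j\theta_k\sigma_i)$. (Homological degrees above two are not needed.) Put $F_\alpha=\bigoplus_{\beta\le\alpha}G_\beta$. With $s=(s_1,s_2,s_3)$, let $\mathcal P=\{\sum_\alpha x_\alpha s^\alpha: x_\alpha\in F_\alpha\}\subset\mathcal E_\Phi[[s]]$, $s\mathcal P=s_1\mathcal P+s_2\mathcal P+s_3\mathcal P$ and $\mathcal A=\mathcal P/s\mathcal P\cong\bigoplus_\alpha G_\alpha$; let $\pi:\mathrm{MC}(\mathcal P)\to\mathrm{MC}(\mathcal A)$ be the projection. Let $\mathcal A_{\rm gauge}\subset\mathcal A^1$ be the $C^\infty$-span of $\theta_0\sigma_0+\theta_i\sigma_i$, $\underline{\theta_0}$ (degree $0$), $-\theta_i\sigma_{jk}+\theta_j\sigma_{ki}+\theta_k\sigma_{ij}$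 (degree $2e_i$), and $\theta_iL_1,\theta_iL_2,\theta_iL_3$, $\theta_0\sigma_i+\theta_i\sigma_0$, $\theta_k\sigma_{ki}$, $\theta_j\sigma_{ij}$, $\underline{\theta_i}$ (degree $e_j+e_k$). **The element $x$.** Let $x\in\mathrm{MC}(\mathcal A)\cap(\theta_0\partial_0+\mathcal A_{\rm gauge})$, and let $p_1,p_2,p_3$ be the coefficients of $\theta_0\sigma_0+\theta_i\sigma_i$ in $x$; they are functions on $M$. Let $\sum_i\theta_i(A_i+D_i)+\sum_i\varphi_i\underline{\theta_i}$, with $D_i\in\mathrm{Der}(C^\infty)$ and $A_i$ a combination of $\sigma$'s, be the element of $\mathcal E_\Phi^1$ obtained from $x$ by $s_1=s_2=s_3=1$, and let $w_i$ be the coefficient of $\sigma_0$ in $A_i$. Assume that $x$ is nondegenerate (the frame $\mathrm{Der}(C^\infty)^*\to W$, $\eta\mapsto\sum_i\eta(D_i)\theta_i$, is an isomorphism), exact (there are $f,g\in C^\infty$ with $D_if=w_i$ and $D_ig=\varphi_i$ for all $i$), that $p_1,p_2,p_3>0$, and that $p_1,p_2,p_3$ are pairwise different at every point of $M$. **The map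 $S_{\rm formal}$.** Let $t=(t_1,t_2,t_3)$ be formal parameters and let $X\in\mathrm{MC}(\mathcal A[[t]])\cap(x+t\mathcal A_{\rm gauge}[[t]])$. Then there is a unique $\gamma=\sum_{\beta,\alpha}\gamma_{\beta\alpha}t^\beta s^\alpha\in\mathrm{MC}(\mathcal P[[t]])$ such that: $\gamma\bmod s=X$; each coefficient of $\gamma-\theta_0\partial_0$ is, for every $\alpha$, a $C^\infty$-combination of gauge elements of the $G_{\alpha'}$ with $\alpha'\le\alpha$; and each $\gamma_{\beta\alpha}$ is $e^{-(\alpha_1p_1+\alpha_2p_2+\alpha_3p_3)\tau}$ times a combination of the basis elements of $\mathcal E_\Phi^1$ with coefficients in $C^\infty(M)[\tau]$. Set $S_{\rm formal}(X)=\gamma$. Setting $t=s$ in $S_{\rm formal}(X)$ yields an element of $\pi^{-1}(x)$. **Lemma (Formal completeness for anisotropic elements).** The map so induced, $$\mathrm{MC}(\mathcal A[[s]])\cap(x+s\mathcal A_{\rm gauge}[[s]])\;\to\;\frac{\pi^{-1}(x)}{\exp(s\mathcal P^0)},$$ is well defined and surjective: for every $y\in\pi^{-1}(x)$ there are $X$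 in the set on the left and $a\in s\mathcal P^0$ with $y=\exp(\mathrm{ad}_a)\,\big(S_{\rm formal}(X)|_{t=s}\big)$. -/

import Mathlib

open scoped Manifold ContDiff

noncomputable section

namespace BKL

section Fields
variable {E : Type*} [NormedAddCommGroup E] [NormedSpace ℝ E] {H : Type*} [TopologicalSpace H]
  (I : ModelWithCorners ℝ E H) {N : Type*} [TopologicalSpace N] [ChartedSpace H N]
  [IsManifold I ∞ N]

theorem contMDiff_fieldDeriv (V : (p : N) → TangentSpace I p)
    (hV : ContMDiff I I.tangent ∞ fun p => (⟨p, V p⟩ : TangentBundle I N))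
    (f : C^∞⟮I, N; ℝ⟯) :
    ContMDiff I 𝓘(ℝ, ℝ) ∞ fun p => (mfderiv I 𝓘(ℝ, ℝ) f p (V p) : ℝ) := by
  have h1 := (f.contMDiff.contMDiff_tangentMap (m := ∞) (by simp)).comp hV
  exact (contMDiff_snd_tangentBundle_modelSpace ℝ 𝓘(ℝ, ℝ)).comp h1

/-- The derivation of the algebra of smooth functions given by a smooth vector field. -/
def fieldDerivation (V : (p : N) → TangentSpace I p)
    (hV : ContMDiff I I.tangent ∞ fun p => (⟨p, V p⟩ : TangentBundle I N)) :
    Derivation ℝ C^∞⟮I, N; ℝ⟯ C^∞⟮I, N; ℝ⟯ where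
  toFun f := ⟨fun p => (mfderiv I 𝓘(ℝ, ℝ) f p (V p) : ℝ), contMDiff_fieldDeriv I V hV f⟩
  map_add' f g := by
    ext p
    have hf : MDifferentiableAt I 𝓘(ℝ, ℝ) f p := f.mdifferentiableAt
    have hg : MDifferentiableAt I 𝓘(ℝ, ℝ) g p := g.mdifferentiableAt
    change mfderiv I 𝓘(ℝ, ℝ) (⇑f + ⇑g) p (V p) = _
    rw [mfderiv_add hf hg]
    rfl
  map_smul' c f := by
    ext p
    have hf : MDifferentiableAt I 𝓘(ℝ, ℝ) f p := f.mdifferentiableAt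
    change mfderiv I 𝓘(ℝ, ℝ) (c • ⇑f) p (V p) = _
    rw [const_smul_mfderiv hf c]
    rfl
  map_one_eq_zero' := by
    ext p
    change mfderiv I 𝓘(ℝ, ℝ) (fun _ => (1 : ℝ)) p (V p) = 0
    rw [mfderiv_const]
    rfl
  leibniz' f g := by
    ext p
    have hf : MDifferentiableAt I 𝓘(ℝ, ℝ) f p := f.mdifferentiableAt
    have hg : MDifferentiableAt I 𝓘(ℝ, ℝ) g p := g.mdifferentiableAt
    change mfderiv I 𝓘(ℝ, ℝ) (⇑f * ⇑g) p (V p) = _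
    rw [(hf.hasMFDerivAt.mul hg.hasMFDerivAt).mfderiv]
    rfl
end Fields

section Algebra

/-! ### The graded Lie algebra of the Einstein equations with a massless scalar field

`R` plays the role of the algebra of smooth functions on the spacetime domain, and
`Derivation ℝ R R` that of its vector fields. The module `W` is free on `θ₀, θ₁, θ₂, θ₃`.
Maurer-Cartan elements have degree one, their curvature has degree two and infinitesimal gauge
transformations have degree zero, so these are the homogeneous pieces that are spelled out. -/

variable (R : Type*) [CommRing R] [Algebra ℝ R]

/-- The Minkowski matrix `diag(-1, 1, 1, 1)`, the conformal inner product on `W`. -/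
def eta : Matrix (Fin 4) (Fin 4) R := Matrix.diagonal fun i => if i = 0 then -1 else 1

/-- A degree zero derivation `δ` of the exterior algebra of `W` is a pair `(A, D)`: the
vector field `D` is its restriction to functions and `δ θ_c = ∑ d, A d c • θ_d`. It belongs to
`CDer(W)` if it preserves the conformal inner product. -/
def cDerSubmodule : Submodule R (Matrix (Fin 4) (Fin 4) R × Derivation ℝ R R) where
  carrier := {δ | ∃ f : R, δ.1.transpose * eta R + eta R * δ.1 = f • eta R}
  zero_mem' := ⟨0, by simp⟩
  add_mem' := by
    rintro x y ⟨f, hf⟩ ⟨g, hg⟩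
    refine ⟨f + g, ?_⟩
    simp only [Prod.fst_add, Matrix.transpose_add, add_mul, mul_add, add_smul]
    rw [← hf, ← hg]
    abel
  smul_mem' := by
    rintro c x ⟨f, hf⟩
    refine ⟨c * f, ?_⟩
    simp only [Prod.smul_fst, Matrix.transpose_smul, Matrix.smul_mul, Matrix.mul_smul]
    rw [← smul_add, hf, smul_smul]

/-- `CDer(W)`. This is the degree zero part of the graded Lie algebra (the scalar field has
none). -/
def CDer : Type _ := ↥(cDerSubmodule R)

instance : AddCommGroup (CDer R) := inferInstanceAs (AddCommGroup ↥(cDerSubmodule R))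

instance : Module R (CDer R) := inferInstanceAs (Module R ↥(cDerSubmodule R))

variable {R}

/-- The element of `CDer(W)` with given matrix and vector field. -/
def CDer.mk (A : Matrix (Fin 4) (Fin 4) R) (D : Derivation ℝ R R)
    (h : (A, D) ∈ cDerSubmodule R) : CDer R := ⟨(A, D), h⟩

/-- The matrix `A` with `δ θ_c = ∑ d, A d c • θ_d`. -/
def CDer.mat (x : CDer R) : Matrix (Fin 4) (Fin 4) R := x.val.1

/-- The vector field, the restriction to functions. -/
def CDer.field (x : CDer R) : Derivation ℝ R R := x.val.2

theorem CDer.mem (x : CDer R) : (x.mat, x.field) ∈ cDerSubmodule R := x.property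

/-- The action of `δ ∈ CDer(W)` on `W`. -/
def CDer.act (x : CDer R) (w : Fin 4 → R) : Fin 4 → R :=
  fun a => x.field (w a) + x.mat.mulVec w a

theorem CDer.bracket_mem (x y : CDer R) :
    (x.mat * y.mat - y.mat * x.mat + y.mat.map x.field - x.mat.map y.field,
      ⁅x.field, y.field⁆) ∈ cDerSubmodule R := by
  have key : ∀ (D : Derivation ℝ R R) (B : Matrix (Fin 4) (Fin 4) R) (g : R),
      B.transpose * eta R + eta R * B = g • eta R →
      (B.map D).transpose * eta R + eta R * (B.map D) = D g • eta R := by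
    intro D B g h
    ext i j
    have h1 := congrArg D (congrFun (congrFun h i) j)
    simp only [eta, Matrix.add_apply, Matrix.mul_diagonal, Matrix.diagonal_mul,
      Matrix.transpose_apply, Matrix.smul_apply, smul_eq_mul, Matrix.map_apply,
      Matrix.diagonal_apply, map_add] at h1 ⊢
    split_ifs at h1 ⊢ <;> simpa using h1
  obtain ⟨f, hf⟩ := x.mem
  obtain ⟨g, hg⟩ := y.mem
  generalize x.mat = A, x.field = D, y.mat = B, y.field = E at *
  have hA := key E A f hf
  have hB := key D B g hg
  refine ⟨D g - E f, ?_⟩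
  dsimp only at hf hg hA hB ⊢
  rw [sub_smul, ← hA, ← hB]
  have e1 : A.transpose * eta R = f • eta R - eta R * A := by rw [← hf]; abel
  have e2 : B.transpose * eta R = g • eta R - eta R * B := by rw [← hg]; abel
  simp only [Matrix.transpose_sub, Matrix.transpose_add, Matrix.transpose_mul, sub_mul, add_mul,
    mul_sub, mul_add, Matrix.mul_assoc, e1, e2, Matrix.mul_smul]
  simp only [← Matrix.mul_assoc, e1, e2, sub_mul, Matrix.smul_mul, smul_sub, smul_smul,
    mul_comm f g]
  abel

/-- The commutator of degree zero derivations. -/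
def CDer.bracket (x y : CDer R) : CDer R :=
  CDer.mk (x.mat * y.mat - y.mat * x.mat + y.mat.map x.field - x.mat.map y.field)
    ⁅x.field, y.field⁆ (CDer.bracket_mem x y)

/-- `σ₀`: it annihilates functions and `σ₀ θ_c = θ_c`. -/
def sigma0 : CDer R := CDer.mk 1 0 ⟨2, by simp [two_smul]⟩

/-- `σ_{ab}`: it annihilates functions and `σ_{ab} θ_c = η_{bc} θ_a - η_{ac} θ_b`. -/
def sigma (a b : Fin 4) : CDer R :=
  CDer.mk (Matrix.of fun d c => eta R b c * (if d = a then 1 else 0) -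
      eta R a c * (if d = b then 1 else 0)) 0 ⟨0, by
    ext i j
    simp only [eta, Matrix.add_apply, Matrix.mul_diagonal, Matrix.diagonal_mul,
      Matrix.transpose_apply, Matrix.of_apply, Matrix.diagonal_apply, zero_smul,
      Matrix.zero_apply]
    by_cases h1 : i = a <;> by_cases h2 : i = b <;> by_cases h3 : j = a <;> by_cases h4 : j = b <;>
      (subst_vars; simp_all [eq_comm]) <;> split_ifs <;> simp_all⟩

/-- A vector field, extended to annihilate `θ₀, θ₁, θ₂, θ₃`. -/
def ofDer (D : Derivation ℝ R R) : CDer R := CDer.mk 0 D ⟨0, by simp⟩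

/-- The spatial directions: `θ_{ax i}` for `i = 0, 1, 2` is `θ₁, θ₂, θ₃`. -/
def ax (i : Fin 3) : Fin 4 := i.succ

/-- `σ_i = σ_{0i}`. -/
def boost (i : Fin 3) : CDer R := sigma 0 (ax i)

/-- `σ_{jk}` for `(i, j, k)` cyclic, that is `σ₂₃, σ₃₁, σ₁₂`. -/
def rot (i : Fin 3) : CDer R := sigma (ax (i + 1)) (ax (i + 2))

section Alt
variable (R)
variable (N : Type*) [AddCommGroup N] [Module R N]

/-- `⋀² W ⊗ N`: the antisymmetric array `v` stands for `½ ∑ i j, θ_i θ_j v i j`. -/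
def Alt2 : Submodule R (Fin 4 → Fin 4 → N) where
  carrier := {v | ∀ i j, v i j = -v j i}
  zero_mem' := by intro i j; simp
  add_mem' := by
    intro x y hx hy i j
    simp only [Pi.add_apply, hx i j, hy i j, neg_add]
  smul_mem' := by
    intro c x hx i j
    simp only [Pi.smul_apply, hx i j, smul_neg]

variable {N}

/-- `θ_i θ_j v`. -/
def wedge (i j : Fin 4) (v : N) : Alt2 R N :=
  ⟨fun a b => (if a = i ∧ b = j then v else 0) - (if a = j ∧ b = i then v else 0), by
    intro a b
    simp only [neg_sub, and_comm]⟩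

end Alt

variable (R)

/-- The degree two part of the graded ideal by which `⋀ W ⊗ CDer(W)` is divided: the span of the
real parts of `∑ m n, (θ₀θ_m + i θ_{m+1}θ_{m+2}) S_{mn} (σ_n + i σ_{n+1,n+2})` for `S` a symmetric
traceless complex `3 × 3` matrix. -/
def ideal2 : Submodule R (Alt2 R (CDer R)) :=
  Submodule.span R
    {z | ∃ S : Matrix (Fin 3) (Fin 3) ℂ, S.IsSymm ∧ S.trace = 0 ∧
      z = ∑ m, ∑ n,
        (algebraMap ℝ R (S m n).re •
            (wedge R 0 (ax m) (boost n) - wedge R (ax (m + 1)) (ax (m + 2)) (rot n)) -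
          algebraMap ℝ R (S m n).im •
            (wedge R 0 (ax m) (rot n) + wedge R (ax (m + 1)) (ax (m + 2)) (boost n)))}

/-- Degree one: `W ⊗ CDer(W)` together with the scalar field part `W`. The pair `(u, φ)` stands for
`∑ i, θ_i u_i` plus `∑ i, φ_i` times the underlined basis element `θ_i`. -/
abbrev EPhi1 : Type _ := (Fin 4 → CDer R) × (Fin 4 → R)

/-- Degree two: `⋀² W ⊗ CDer(W)` modulo the ideal, together with the scalar field part
`⋀² W ⊕ ⋀⁴ W`, where `⋀⁴ W` has basis `θ₀θ₁θ₂θ₃`. -/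
abbrev EPhi2 : Type _ := (Alt2 R (CDer R) ⧸ ideal2 R) × (Alt2 R R × R)

variable {R}

/-- `θ_i δ` in degree one. -/
def th (i : Fin 4) (δ : CDer R) : EPhi1 R := (Pi.single i δ, 0)

/-- The underlined `θ_i`. -/
def uth (i : Fin 4) : EPhi1 R := (0, Pi.single i 1)

/-- `θ_i θ_j δ` in degree two. -/
def thth (i j : Fin 4) (δ : CDer R) : EPhi2 R := (Submodule.Quotient.mk (wedge R i j δ), 0)

/-- The underlined `θ_i θ_j`. -/
def uthth (i j : Fin 4) : EPhi2 R := (0, (wedge R i j 1, 0))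

/-- Multiplication by `θ_i` from scalar fields of degree one to those of degree two,
`φ ↦ θ_i φ ⊕ θ_i φ*`, where `*` is the basis Hodge dual with
`θ₀* = θ₁θ₂θ₃`, `θ₁* = θ₀θ₂θ₃`, `θ₂* = θ₀θ₃θ₁`, `θ₃* = θ₀θ₁θ₂`;
hence `θ_i θ_j* = -η_{ij} θ₀θ₁θ₂θ₃`. -/
def thetaMulPhi (i : Fin 4) (φ : Fin 4 → R) : Alt2 R R × R :=
  (∑ a, wedge R i a (φ a), -(eta R i i * φ i))

/-- Multiplication by `θ_i` from degree one to degree two. -/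
def thetaMul (i : Fin 4) (u : EPhi1 R) : EPhi2 R :=
  (Submodule.Quotient.mk (∑ j, wedge R i j (u.1 j)), thetaMulPhi i u.2)

/-- The bracket of degrees `0` and `1`. -/
def bracket01 (x : CDer R) (u : EPhi1 R) : EPhi1 R :=
  (fun i => CDer.bracket x (u.1 i) + ∑ j, x.mat i j • u.1 j, CDer.act x u.2)

/-- The bracket `[∑ θ_i x_i, ∑ θ_j y_j]` in `⋀ W ⊗ CDer(W)`, from
`[ωδ, ω'δ'] = ωω'[δ, δ'] + ωδ(ω')δ' - δ'(ω)ω'δ`. -/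
def bracketE (x y : Fin 4 → CDer R) : Alt2 R (CDer R) :=
  ∑ i, ∑ j, (wedge R i j (CDer.bracket (x i) (y j)) +
    ∑ a, (wedge R i a ((x i).mat a j • y j) - wedge R a j ((y j).mat a i • x i)))

/-- The bracket of two scalar fields of degree one: the symmetric bilinear map with
`[φ, φ] = ∑ (-6 φ^p φ^q + η(φ, φ) η^{pq}) η^{ij} θ_i θ_p σ_{jq}`. -/
def bracketPhi (φ ψ : Fin 4 → R) : Alt2 R (CDer R) :=
  ∑ i, ∑ p, ∑ q,
    ((-3 * (φ p * ψ q + φ q * ψ p) + (∑ b, eta R b b * (φ b * ψ b)) * eta R p q) * eta R i i) •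
      wedge R i p (sigma i q)

/-- The bracket `[∑ θ_i x_i, ψ] = ∑ θ_i x_i(ψ)` of degree one elements without respectively with
scalar field only. -/
def bracketEPhi (x : Fin 4 → CDer R) (ψ : Fin 4 → R) : Alt2 R R × R :=
  ∑ i, thetaMulPhi i (CDer.act (x i) ψ)

/-- The (symmetric) bracket of two elements of degree one. -/
def bracket11 (u v : EPhi1 R) : EPhi2 R :=
  (Submodule.Quotient.mk (bracketE u.1 v.1 + bracketPhi u.2 v.2),
    bracketEPhi u.1 v.2 + bracketEPhi v.1 u.2)

/-! ### The filtration -/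

/-- Filtration degrees, exponents of the formal parameters `s₁, s₂, s₃`. -/
abbrev Deg : Type := Fin 3 →₀ ℕ

/-- The degree with entry `a` in position `i` and `b` in the two other positions. -/
def deg (i : Fin 3) (a b : ℕ) : Deg :=
  Finsupp.single i a + Finsupp.single (i + 1) b + Finsupp.single (i + 2) b

/-- Generators of the gauge part `G_α 𝓔_{Φ,G}` in degree zero. -/
inductive Gen0 : Deg → CDer R → Prop
  | der (D : Derivation ℝ R R) : Gen0 0 (ofDer D)
  | sigma0 : Gen0 0 sigma0
  | boost (i : Fin 3) : Gen0 (deg i 0 1) (boost i)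
  | rot (i : Fin 3) : Gen0 (deg i 0 1) (rot i)

/-- Generators of the gauge part `G_α 𝓔_{Φ,G}` in degree one. The triple `(i, i + 1, i + 2)` is
cyclic. -/
inductive Gen1 : Deg → EPhi1 R → Prop
  | kasner (i : Fin 3) : Gen1 0 (th 0 sigma0 + th (ax i) (boost i))
  | scalar0 : Gen1 0 (uth 0)
  | twist (i : Fin 3) : Gen1 (deg i 2 0)
      (-th (ax i) (rot i) + th (ax (i + 1)) (rot (i + 1)) + th (ax (i + 2)) (rot (i + 2)))
  | frame (i : Fin 3) (D : Derivation ℝ R R) : Gen1 (deg i 0 1) (th (ax i) (ofDer D))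
  | conf (i : Fin 3) : Gen1 (deg i 0 1) (th 0 (boost i) + th (ax i) sigma0)
  | symm (i : Fin 3) : Gen1 (deg i 0 1)
      (th (ax (i + 1)) (boost (i + 2)) + th (ax (i + 2)) (boost (i + 1)))
  | rotA (i : Fin 3) : Gen1 (deg i 0 1) (th (ax (i + 2)) (rot (i + 1)))
  | rotB (i : Fin 3) : Gen1 (deg i 0 1) (th (ax (i + 1)) (rot (i + 2)))
  | scalar (i : Fin 3) : Gen1 (deg i 0 1) (uth (ax i))
  | skew (i : Fin 3) : Gen1 (deg i 2 1)
      (th (ax (i + 1)) (boost (i + 2)) - th (ax (i + 2)) (boost (i + 1)))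

/-- Generators of the gauge part `G_α 𝓔_{Φ,G}` in degree two. -/
inductive Gen2 : Deg → EPhi2 R → Prop
  | ham : Gen2 0 (∑ i : Fin 3, (thth (ax (i + 1)) (ax (i + 2)) (rot i) +
      2 • thth 0 (ax i) (boost i)))
  | mom (i : Fin 3) : Gen2 (deg i 0 1)
      (thth 0 (ax (i + 1)) (rot (i + 2)) + thth (ax i) (ax (i + 1)) (boost (i + 1)))
  | torsion (i : Fin 3) (D : Derivation ℝ R R) : Gen2 (deg i 2 1)
      (thth (ax (i + 1)) (ax (i + 2)) (ofDer D))
  | skewA (i : Fin 3) : Gen2 (deg i 2 1)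
      (thth 0 (ax (i + 1)) (boost (i + 2)) - thth 0 (ax (i + 2)) (boost (i + 1)) -
        2 • thth (ax (i + 1)) (ax (i + 2)) sigma0)
  | skewB (i : Fin 3) : Gen2 (deg i 2 1)
      (thth 0 (ax (i + 1)) (boost (i + 2)) + thth 0 (ax (i + 2)) (boost (i + 1)) -
        2 • thth (ax i) (ax (i + 1)) (rot (i + 1)))
  | scalar (i : Fin 3) : Gen2 (deg i 2 1) (uthth (ax (i + 1)) (ax (i + 2)))
  | twist : Gen2 (deg 0 2 2) (∑ i : Fin 3, (thth 0 (ax i) (rot i) -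
      2 • thth (ax (i + 1)) (ax (i + 2)) (boost i)))

variable (R)

/-- `G_α` in degree zero. -/
def G0 (α : Deg) : Submodule R (CDer R) := Submodule.span R {x | Gen0 α x}

/-- The gauge part of `G_α` in degree one. -/
def G1gauge (α : Deg) : Submodule R (EPhi1 R) := Submodule.span R {u | Gen1 α u}

/-- `G_α` in degree one: the gauge part and `θ₀` times the gauge part in degree zero. -/
def G1 (α : Deg) : Submodule R (EPhi1 R) :=
  Submodule.span R ({u | Gen1 α u} ∪ {u | ∃ x, Gen0 α x ∧ u = th 0 x})

/-- `G_α` in degree two: the gauge part and `θ₀` times the gauge part in degree one. -/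
def G2 (α : Deg) : Submodule R (EPhi2 R) :=
  Submodule.span R ({z | Gen2 α z} ∪ {z | ∃ u, Gen1 α u ∧ z = thetaMul 0 u})

/-- The filtration `F_α = ⨁ β ≤ α, G_β` in degree one. -/
def F1 (α : Deg) : Submodule R (EPhi1 R) := ⨆ β ≤ α, G1 R β

/-- The part of `F_α` in degree one spanned by gauge generators. -/
def F1gauge (α : Deg) : Submodule R (EPhi1 R) := ⨆ β ≤ α, G1gauge R β

/-- `F_{<α}` in degree zero: the sum of all `F_β` with `β < α`. -/
def F0lt (α : Deg) : Submodule R (CDer R) := ⨆ β < α, G0 R β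

/-- `F_{<α}` in degree one. -/
def F1lt (α : Deg) : Submodule R (EPhi1 R) := ⨆ β < α, G1 R β

/-- `F_{<α}` in degree two. -/
def F2lt (α : Deg) : Submodule R (EPhi2 R) := ⨆ β < α, G2 R β

variable {R}

/-! ### Rees algebra, associated graded algebra, Maurer-Cartan elements, gauge transformations

A formal power series `∑ α, y_α s^α` is the function `α ↦ y_α`. -/

/-- Degree one elements of the Rees algebra `𝓟 = {∑ y_α s^α | y_α ∈ F_α}`. -/
def IsRees1 (y : Deg → EPhi1 R) : Prop := ∀ α, y α ∈ F1 R α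

/-- Degree one elements of `s𝓟 = s₁𝓟 + s₂𝓟 + s₃𝓟`; the coefficient of `s^α` is in `F_{<α}`. -/
def IsSRees1 (y : Deg → EPhi1 R) : Prop := ∀ α, y α ∈ F1lt R α

/-- Degree zero elements of `s𝓟`. -/
def IsSRees0 (a : Deg → CDer R) : Prop := ∀ α, a α ∈ F0lt R α

/-- The bracket of two degree one elements of the Rees algebra. -/
def seriesBracket11 (y z : Deg → EPhi1 R) (α : Deg) : EPhi2 R :=
  ∑ b ∈ Finset.HasAntidiagonal.antidiagonal α, bracket11 (y b.1) (z b.2)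

/-- The adjoint action of degree zero elements of the Rees algebra in degree one. -/
def seriesBracket01 (a : Deg → CDer R) (y : Deg → EPhi1 R) (α : Deg) : EPhi1 R :=
  ∑ b ∈ Finset.HasAntidiagonal.antidiagonal α, bracket01 (a b.1) (y b.2)

/-- Maurer-Cartan elements of the Rees algebra `𝓟`. -/
def IsMCRees (y : Deg → EPhi1 R) : Prop :=
  IsRees1 y ∧ ∀ α, seriesBracket11 y y α = 0

/-- Maurer-Cartan elements of the associated graded algebra `𝓐 = 𝓟/s𝓟 ≅ ⨁ α, G_α`. An element of
degree one of `𝓐` is a family `x` with `x_α ∈ G_α`, representing the class of `∑ x_α s^α`.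
Its bracket vanishes iff the bracket of the representative is in `s𝓟`. -/
def IsMCGraded (x : Deg → EPhi1 R) : Prop :=
  (∀ α, x α ∈ G1 R α) ∧ ∀ α, seriesBracket11 x x α ∈ F2lt R α

/-- The fiber over `x` of the canonical projection from Maurer-Cartan elements of `𝓟` to those
of `𝓐`. -/
def fiber (x : Deg → EPhi1 R) : Set (Deg → EPhi1 R) :=
  {y | IsMCRees y ∧ IsSRees1 (y - x)}

/-- `exp(a) y = ∑ k, (1 / k!) ad(a)^k y` for `a ∈ s𝓟` of degree zero. Since `a` has no constant
term, only the summands with `k ≤ |α|` contribute to the coefficient of `s^α`. -/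
def expAct (a : Deg → CDer R) (y : Deg → EPhi1 R) (α : Deg) : EPhi1 R :=
  ∑ k ∈ Finset.range (α.degree + 1),
    (algebraMap ℝ R ((k.factorial : ℝ)⁻¹)) • ((seriesBracket01 a)^[k] y) α

/-- `y` and `z` are in the same orbit of the group `exp(s𝓟⁰)`. -/
def GaugeEquivalent (y z : Deg → EPhi1 R) : Prop :=
  ∃ a : Deg → CDer R, IsSRees0 a ∧ expAct a y = z

/-! ### Formal families

A power series in a further triple of formal parameters `t = (t₁, t₂, t₃)`, with coefficients
that are series in `s` or families indexed by filtration degrees, is a function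
`Deg → Deg → EPhi1 R`, where the first argument is the exponent of `t`. -/

/-- Maurer-Cartan elements of `𝓐[[t]]`. -/
def IsMCGradedFamily (X : Deg → Deg → EPhi1 R) : Prop :=
  (∀ β α, X β α ∈ G1 R α) ∧
    ∀ β α, ∑ b ∈ Finset.HasAntidiagonal.antidiagonal β, seriesBracket11 (X b.1) (X b.2) α ∈ F2lt R α

/-- Maurer-Cartan elements of `𝓟[[t]]`. -/
def IsMCReesFamily (γ : Deg → Deg → EPhi1 R) : Prop :=
  (∀ β, IsRees1 (γ β)) ∧
    ∀ β α, ∑ b ∈ Finset.HasAntidiagonal.antidiagonal β, seriesBracket11 (γ b.1) (γ b.2) α = 0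

/-- Setting `t = s`. -/
def setTeqS (γ : Deg → Deg → EPhi1 R) (α : Deg) : EPhi1 R :=
  ∑ b ∈ Finset.HasAntidiagonal.antidiagonal α, γ b.1 b.2

/-! ### Frame, nondegeneracy and exactness -/

/-- The frame of a degree one element `∑ θ_i (A_i, D_i)` is `∑ θ_i ⊗ D_i`, viewed as a map from
one-forms to `W`. -/
def frameMap (u : EPhi1 R) (η : Module.Dual R (Derivation ℝ R R)) : Fin 4 → R :=
  fun i => η (u.1 i).field

/-- The frame is an isomorphism. -/
def IsNondegenerate (u : EPhi1 R) : Prop := Function.Bijective (frameMap u)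

/-- The one-form that corresponds to `w ∈ W` via the frame of `u` is the differential of a
function. -/
def IsExactVia (u : EPhi1 R) (w : Fin 4 → R) : Prop := ∃ f : R, ∀ i, (u.1 i).field f = w i

/-- The component `w ∈ W` in the decomposition `u = w σ₀ + u'` where `u'` does not contain `σ₀`
(the matrices of all `σ_{ab}` have zero diagonal). -/
def sigma0Part (u : EPhi1 R) : Fin 4 → R := fun i => (u.1 i).mat 0 0

/-- The one-forms associated to the `σ₀` component and to the scalar field are exact. -/
def IsExact (u : EPhi1 R) : Prop := IsExactVia u (sigma0Part u) ∧ IsExactVia u u.2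

/-- The element of `𝓔_Φ` obtained from an element of `𝓐` by setting `s₁ = s₂ = s₃ = 1`; all
`G_α` with `α ≰ (2, 2, 2)` are zero. -/
def atOne (x : Deg → EPhi1 R) : EPhi1 R := ∑ α ∈ Finset.Iic (deg 0 2 2), x α

/-! ### The gauge -/

/-- Generators of the gauge subspace of `𝓐¹`; `L₁, L₂, L₃` are the spatial frame fields. -/
inductive GenGauge (L : Fin 3 → Derivation ℝ R R) : Deg → EPhi1 R → Prop
  | kasner (i : Fin 3) : GenGauge L 0 (th 0 sigma0 + th (ax i) (boost i))
  | scalar0 : GenGauge L 0 (uth 0)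
  | twist (i : Fin 3) : GenGauge L (deg i 2 0)
      (-th (ax i) (rot i) + th (ax (i + 1)) (rot (i + 1)) + th (ax (i + 2)) (rot (i + 2)))
  | frame (i a : Fin 3) : GenGauge L (deg i 0 1) (th (ax i) (ofDer (L a)))
  | conf (i : Fin 3) : GenGauge L (deg i 0 1) (th 0 (boost i) + th (ax i) sigma0)
  | rotA (i : Fin 3) : GenGauge L (deg i 0 1) (th (ax (i + 2)) (rot (i + 1)))
  | rotB (i : Fin 3) : GenGauge L (deg i 0 1) (th (ax (i + 1)) (rot (i + 2)))
  | scalar (i : Fin 3) : GenGauge L (deg i 0 1) (uth (ax i))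

/-- The component of filtration degree `α` of the gauge subspace of `𝓐¹`. -/
def gaugeSubspace (L : Fin 3 → Derivation ℝ R R) (α : Deg) : Submodule R (EPhi1 R) :=
  Submodule.span R {u | GenGauge L α u}

/-- `θ₀ ∂₀` as a family indexed by filtration degrees. -/
def thetaPartial (D₀ : Derivation ℝ R R) (α : Deg) : EPhi1 R :=
  if α = 0 then th 0 (ofDer D₀) else 0

/-- The coefficients `p₁, p₂, p₃` of `θ₀σ₀ + θ_iσ_i` in the leading term
`θ₀∂₀ + p₀ θ₀ + ∑ p_i (θ₀σ₀ + θ_iσ_i)` of `x`: read off as the coefficient of `θ_iσ_i`,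
using `σ_i θ_i = θ₀`. -/
def leadingExponent (x : Deg → EPhi1 R) (i : Fin 3) : R := ((x 0).1 (ax i)).mat 0 (ax i)

end Algebra

/-! ### The spacetime domain `[0, ∞) × M` -/

section Spacetime

variable (M : Type*) [TopologicalSpace M] [ChartedSpace (EuclideanSpace ℝ (Fin 3)) M]

/-- The manifold with boundary `[0, ∞) × M`. -/
abbrev Spacetime : Type _ := EuclideanHalfSpace 1 × M

/-- The model with corners of `[0, ∞) × M`. -/
abbrev spacetimeModel : ModelWithCorners ℝ (EuclideanSpace ℝ (Fin 1) × EuclideanSpace ℝ (Fin 3))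
    (ModelProd (EuclideanHalfSpace 1) (EuclideanSpace ℝ (Fin 3))) := (𝓡∂ 1).prod (𝓡 3)

/-- Smooth real functions on `[0, ∞) × M`. -/
abbrev Smooth : Type _ := C^∞⟮spacetimeModel, Spacetime M; ℝ⟯

/-- The coordinate `τ` on the first factor. -/
def tau : Smooth M :=
  ⟨fun q => q.1.1 0, by
    have h1 : ContMDiff (𝓡∂ 1) 𝓘(ℝ, EuclideanSpace ℝ (Fin 1)) ∞ (𝓡∂ 1) := (𝓡∂ 1).contMDiff
    have h2 : ContMDiff 𝓘(ℝ, EuclideanSpace ℝ (Fin 1)) 𝓘(ℝ, ℝ) ∞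
        (fun v : EuclideanSpace ℝ (Fin 1) => v 0) :=
      (EuclideanSpace.proj (𝕜 := ℝ) (0 : Fin 1)).contDiff.contMDiff
    exact h2.comp (h1.comp contMDiff_fst)⟩

/-- `C^∞(M)[τ]`: polynomials in `τ` whose coefficients are smooth functions on `M`. -/
def spatialPoly : Subalgebra ℝ (Smooth M) :=
  Algebra.adjoin ℝ
    ({tau M} ∪ Set.range fun f : C^∞⟮𝓡 3, M; ℝ⟯ =>
      (f.comp ⟨Prod.snd, contMDiff_snd⟩ : Smooth M))

variable {M}

/-- The function `e^{-f}`. -/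
def expNeg (f : Smooth M) : Smooth M :=
  ⟨fun q => Real.exp (-(f q)), Real.contDiff_exp.contMDiff.comp f.contMDiff.neg⟩

variable [IsManifold (𝓡 3) ∞ M]

theorem contMDiff_lift (c : ℝ) (X : (m : M) → TangentSpace (𝓡 3) m)
    (hX : ContMDiff (𝓡 3) (𝓡 3).tangent ∞ fun m => (⟨m, X m⟩ : TangentBundle (𝓡 3) M)) :
    ContMDiff spacetimeModel spacetimeModel.tangent ∞ fun q : Spacetime M =>
      (⟨q, ((EuclideanSpace.single 0 c : EuclideanSpace ℝ (Fin 1)), X q.2)⟩ :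
        TangentBundle spacetimeModel (Spacetime M)) := by
  have ht : ContMDiff (𝓡∂ 1) (𝓡∂ 1).tangent ∞ fun t : EuclideanHalfSpace 1 =>
      (⟨t, (EuclideanSpace.single 0 c : EuclideanSpace ℝ (Fin 1))⟩ :
        TangentBundle (𝓡∂ 1) (EuclideanHalfSpace 1)) := by
    have e : chartedSpaceSelf (ModelProd (EuclideanHalfSpace 1) (EuclideanSpace ℝ (Fin 1))) =
        prodChartedSpace _ _ _ _ := chartedSpaceSelf_prod.symm
    have hp : ContMDiff (M' := ModelProd (EuclideanHalfSpace 1) (EuclideanSpace ℝ (Fin 1)))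
        (𝓡∂ 1) (𝓡∂ 1).tangent ∞
        (fun t : EuclideanHalfSpace 1 => (t, EuclideanSpace.single 0 c)) := by
      rw [e]
      exact (contMDiff_id (I := 𝓡∂ 1) (M := EuclideanHalfSpace 1) (n := ∞)).prodMk
        (contMDiff_const (I := 𝓡∂ 1) (M := EuclideanHalfSpace 1) (n := ∞) (I' := 𝓡 1)
          (c := (EuclideanSpace.single 0 c : EuclideanSpace ℝ (Fin 1))))
    exact (contMDiff_tangentBundleModelSpaceHomeomorph_symm (I := 𝓡∂ 1) (n := ∞)).comp hp
  exact (contMDiff_equivTangentBundleProd_symm (n := ∞)).comp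
      ((ht.comp contMDiff_fst).prodMk (hX.comp contMDiff_snd))

variable (M)

/-- A frame of the tangent bundle of `M`: three smooth vector fields that are linearly independent
at every point. -/
structure SpatialFrame where
  /-- the vector fields `L₁, L₂, L₃` -/
  field : Fin 3 → (m : M) → TangentSpace (𝓡 3) m
  smooth : ∀ a, ContMDiff (𝓡 3) (𝓡 3).tangent ∞
    fun m => (⟨m, field a m⟩ : TangentBundle (𝓡 3) M)
  linearIndependent : ∀ m, LinearIndependent ℝ fun a => field a m

/-- The derivation `∂₀` along the first factor. -/
def partial0 : Derivation ℝ (Smooth M) (Smooth M) :=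
  fieldDerivation spacetimeModel
    (fun _ => ((EuclideanSpace.single 0 1 : EuclideanSpace ℝ (Fin 1)), 0))
    (contMDiff_lift 1 (fun _ => 0) (Bundle.contMDiff_zeroSection ℝ _))

variable {M}

/-- The derivations `L₁, L₂, L₃` of functions on `[0, ∞) × M`, acting along the second factor. -/
def SpatialFrame.der (L : SpatialFrame M) (a : Fin 3) : Derivation ℝ (Smooth M) (Smooth M) :=
  fieldDerivation spacetimeModel
    (fun q => ((EuclideanSpace.single 0 0 : EuclideanSpace ℝ (Fin 1)), L.field a q.2))
    (contMDiff_lift 0 (L.field a) (L.smooth a))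

/-! ### The gauged Maurer-Cartan elements of the associated graded algebra -/

/-- `x` is a Maurer-Cartan element of `𝓐` in the affine gauge subspace `θ₀∂₀ + 𝓐_gauge` that is
nondegenerate and exact and has positive `p₁, p₂, p₃`. -/
structure IsGaugedMCPos (L : SpatialFrame M) (x : Deg → EPhi1 (Smooth M)) : Prop where
  mc : IsMCGraded x
  gauged : ∀ α, x α - thetaPartial (partial0 M) α ∈ gaugeSubspace L.der α
  nondegenerate : IsNondegenerate (atOne x)
  exact : IsExact (atOne x)
  pos : ∀ i q, 0 < leadingExponent x i q

/-- The leading term is anisotropic: `p₁, p₂, p₃` are pairwise different at every point. -/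
def IsAnisotropic (x : Deg → EPhi1 (Smooth M)) : Prop :=
  ∀ i j, i ≠ j → ∀ q, leadingExponent x i q ≠ leadingExponent x j q

/-- `MC(𝓐[[t]]) ∩ (x + t 𝓐_gauge[[t]])` for three formal parameters `t = (t₁, t₂, t₃)`. -/
def formalFamilies (L : SpatialFrame M) (x : Deg → EPhi1 (Smooth M)) :
    Set (Deg → Deg → EPhi1 (Smooth M)) :=
  {X | IsMCGradedFamily X ∧ X 0 = x ∧ ∀ β, β ≠ 0 → ∀ α, X β α ∈ gaugeSubspace L.der α}

/-! ### The map `S_formal` -/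

/-- The distinguished basis in degree one. -/
def basis1 (L : SpatialFrame M) : Set (EPhi1 (Smooth M)) :=
  {u | ∃ i, u = uth i ∨ u = th i sigma0 ∨ (∃ j, u = th i (boost j)) ∨ (∃ j, u = th i (rot j)) ∨
    u = th i (ofDer (partial0 M)) ∨ ∃ a, u = th i (ofDer (L.der a))}

/-- `𝓤[τ]` in degree one: linear combinations of basis elements whose coefficients are polynomials
in `τ` with coefficients in `C^∞(M)`. -/
def polyPart (L : SpatialFrame M) : Submodule (spatialPoly M) (EPhi1 (Smooth M)) :=
  Submodule.span (spatialPoly M) (basis1 L)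

/-- `e^{-(α₁p₁ + α₂p₂ + α₃p₃)τ}` with the `p_i` of `x`. -/
def damping (x : Deg → EPhi1 (Smooth M)) (α : Deg) : Smooth M :=
  expNeg ((∑ i, (α i : ℝ) • leadingExponent x i) * tau M)

/-- The defining properties of `γ = S_formal(X)`, when the argument is a formal power series
`X ∈ 𝓐[[t]]` with constant term `x = X 0`. For `X` independent of `t` they are:
`γ` is a Maurer-Cartan element of the subalgebra `𝓟_p = {∑ u_α e^{-(α·p)τ} s^α | u_α ∈ F_α ∩ 𝓤[τ]}`
of the Rees algebra, its leading term is `X`, and aside from `θ₀∂₀` the coefficient of `s^α`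
is a combination of the elements of `F_α` that are in the gauge part.
Since `e^{-p(t)τ} = e^{-p(0)τ} e^{-(p(t) - p(0))τ}` and the second factor is a power series in `t`
whose coefficients are in `C^∞(M)[τ]`, the same condition applies to all coefficients. -/
structure IsFormalSolution (L : SpatialFrame M) (X γ : Deg → Deg → EPhi1 (Smooth M)) : Prop where
  mc : IsMCReesFamily γ
  leading : ∀ β, IsSRees1 (γ β - X β)
  gauged : ∀ β α, γ β α - (if β = 0 then thetaPartial (partial0 M) α else 0) ∈
    F1gauge (Smooth M) α
  poly : ∀ β α, ∃ u ∈ polyPart L, γ β α = damping (X 0) α • u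

open Classical in
/-- The map `S_formal` on formal families. -/
def sFormal (L : SpatialFrame M) (X : Deg → Deg → EPhi1 (Smooth M)) :
    Deg → Deg → EPhi1 (Smooth M) :=
  if h : ∃ γ, IsFormalSolution L X γ then h.choose else 0

end Spacetime

end BKL

end

noncomputable section

namespace BKL
open Finset.HasAntidiagonal (antidiagonal mem_antidiagonal)

section
variable {R : Type*} [CommRing R] [Algebra ℝ R]

/-! ### Coordinates on `CDer(W)` -/

section Cyclic

theorem cyc11 (i : Fin 3) : i + 1 + 1 = i + 2 := by revert i; decide
theorem cyc12 (i : Fin 3) : i + 1 + 2 = i := by revert i; decide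
theorem cyc21 (i : Fin 3) : i + 2 + 1 = i := by revert i; decide
theorem cyc22 (i : Fin 3) : i + 2 + 2 = i + 1 := by revert i; decide
theorem cyc_ne1 (i : Fin 3) : i ≠ i + 1 := by revert i; decide
theorem cyc_ne2 (i : Fin 3) : i ≠ i + 2 := by revert i; decide
theorem cyc_ne12 (i : Fin 3) : i + 1 ≠ i + 2 := by revert i; decide
theorem cyc_ne1' (i : Fin 3) : i + 1 ≠ i := by revert i; decide
theorem cyc_ne2' (i : Fin 3) : i + 2 ≠ i := by revert i; decide
theorem cyc_ne12' (i : Fin 3) : i + 2 ≠ i + 1 := by revert i; decide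

theorem cyc_or (i j : Fin 3) : j = i ∨ j = i + 1 ∨ j = i + 2 := by revert i j; decide

theorem sum_cyc {N : Type*} [AddCommMonoid N] (f : Fin 3 → N) (i : Fin 3) :
    ∑ p, f p = f i + f (i + 1) + f (i + 2) := by
  rw [Fin.sum_univ_three]
  fin_cases i
  · rfl
  · change f 0 + f 1 + f 2 = f 1 + f 2 + f 0
    abel
  · change f 0 + f 1 + f 2 = f 2 + f 0 + f 1
    abel

theorem ax_inj {i j : Fin 3} : ax i = ax j ↔ i = j := Fin.succ_inj
theorem ax_ne_zero (i : Fin 3) : ax i ≠ 0 := Fin.succ_ne_zero i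
theorem zero_ne_ax (i : Fin 3) : (0 : Fin 4) ≠ ax i := (ax_ne_zero i).symm

theorem sum_ax {N : Type*} [AddCommMonoid N] (f : Fin 4 → N) :
    ∑ p, f p = f 0 + ∑ i : Fin 3, f (ax i) := Fin.sum_univ_succ f

theorem sum_ax_cyc {N : Type*} [AddCommMonoid N] (f : Fin 4 → N) (i : Fin 3) :
    ∑ p, f p = f 0 + (f (ax i) + f (ax (i + 1)) + f (ax (i + 2))) := by
  rw [sum_ax, sum_cyc _ i]

theorem forall_ax {P : Fin 4 → Prop} : (∀ p, P p) ↔ P 0 ∧ ∀ i, P (ax i) := Fin.forall_fin_succ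

end Cyclic

theorem eta_apply (a b : Fin 4) : eta R a b = if a = b then (if a = 0 then -1 else 1) else 0 := rfl

theorem eta_zero : eta R 0 0 = -1 := by simp [eta_apply]
theorem eta_ax (i : Fin 3) : eta R (ax i) (ax i) = 1 := by simp [eta_apply, ax_ne_zero]

theorem two_smul_cancel {N : Type*} [AddCommGroup N] [Module R N] {x : N} (h : x + x = 0) :
    x = 0 := by
  have h1 : algebraMap ℝ R 2⁻¹ • (x + x) = x := by
    rw [← two_smul R x, smul_smul, show (2 : R) = algebraMap ℝ R 2 from (map_ofNat _ 2).symm,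
      ← map_mul]
    norm_num
  rw [← h1, h, smul_zero]

namespace CDer

/-- The coefficient of `σ₀`. -/
def w (x : CDer R) : R := x.mat 0 0

/-- The coefficient of `σ_i`. -/
def b (x : CDer R) (i : Fin 3) : R := x.mat 0 (ax i)

/-- The coefficient of `σ_{jk}` for `(i, j, k)` cyclic. -/
def r (x : CDer R) (i : Fin 3) : R := x.mat (ax (i + 1)) (ax (i + 2))

theorem conformal (x : CDer R) (p q : Fin 4) :
    x.mat q p * eta R q q + eta R p p * x.mat p q = if p = q then 2 * x.w * eta R p p else 0 := by
  obtain ⟨f, hf⟩ := x.mem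
  have key : ∀ p q, x.mat q p * eta R q q + eta R p p * x.mat p q = f * eta R p q := by
    intro p q
    have := congrFun (congrFun hf p) q
    simpa only [Matrix.add_apply, eta, Matrix.mul_diagonal, Matrix.diagonal_mul,
      Matrix.transpose_apply, Matrix.smul_apply, smul_eq_mul, Matrix.diagonal_apply_eq] using this
  have hw : f = 2 * x.w := by
    have := key 0 0
    rw [eta_zero] at this
    unfold w
    linear_combination this
  rw [key, hw]
  split_ifs with h
  · rw [h]
  · rw [eta_apply, if_neg h, mul_zero]

theorem mat_zero_zero (x : CDer R) : x.mat 0 0 = x.w := rfl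
theorem mat_zero_ax (x : CDer R) (i : Fin 3) : x.mat 0 (ax i) = x.b i := rfl

theorem mat_ax_zero (x : CDer R) (i : Fin 3) : x.mat (ax i) 0 = x.b i := by
  have := x.conformal 0 (ax i)
  rw [eta_zero, eta_ax, if_neg (zero_ne_ax i), mat_zero_ax] at this
  linear_combination this

theorem mat_ax_self (x : CDer R) (i : Fin 3) : x.mat (ax i) (ax i) = x.w := by
  have := x.conformal (ax i) (ax i)
  rw [eta_ax, if_pos rfl] at this
  rw [← sub_eq_zero]
  apply two_smul_cancel (R := R)
  linear_combination this

theorem mat_ax_one (x : CDer R) (i : Fin 3) : x.mat (ax i) (ax (i + 1)) = x.r (i + 2) := by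
  rw [r, cyc21, cyc22]

theorem mat_ax_two (x : CDer R) (i : Fin 3) : x.mat (ax i) (ax (i + 2)) = -x.r (i + 1) := by
  have := x.conformal (ax i) (ax (i + 2))
  rw [eta_ax, eta_ax, if_neg (by rw [ax_inj]; exact cyc_ne2 i)] at this
  rw [r, cyc11, cyc12]
  linear_combination this

theorem mat_one_ax (x : CDer R) (i : Fin 3) : x.mat (ax (i + 1)) (ax i) = -x.r (i + 2) := by
  have := x.mat_ax_two (i + 1)
  rwa [cyc12, cyc11] at this

theorem mat_two_ax (x : CDer R) (i : Fin 3) : x.mat (ax (i + 2)) (ax i) = x.r (i + 1) := by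
  have := x.mat_ax_one (i + 2)
  rwa [cyc21, cyc22] at this

theorem mat_one_two (x : CDer R) (i : Fin 3) : x.mat (ax (i + 1)) (ax (i + 2)) = x.r i := rfl

theorem mat_two_one (x : CDer R) (i : Fin 3) : x.mat (ax (i + 2)) (ax (i + 1)) = -x.r i := by
  have := x.mat_ax_two (i + 2)
  rwa [cyc22, cyc21] at this

theorem ext' {x y : CDer R} (hm : x.mat = y.mat) (hf : x.field = y.field) : x = y :=
  Subtype.ext (Prod.ext hm hf)

theorem ext_coord {x y : CDer R} (hw : x.w = y.w) (hb : ∀ i, x.b i = y.b i)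
    (hr : ∀ i, x.r i = y.r i) (hf : x.field = y.field) : x = y := by
  refine ext' ?_ hf
  ext p q
  revert p
  rw [forall_ax]
  constructor
  · revert q
    rw [forall_ax]
    exact ⟨hw, hb⟩
  · intro i
    revert q
    rw [forall_ax]
    constructor
    · rw [mat_ax_zero, mat_ax_zero, hb]
    · intro j
      obtain rfl | rfl | rfl := cyc_or i j
      · rw [mat_ax_self, mat_ax_self, hw]
      · rw [mat_ax_one, mat_ax_one, hr]
      · rw [mat_ax_two, mat_ax_two, hr]

@[simp] theorem mat_add (x y : CDer R) : (x + y).mat = x.mat + y.mat := rfl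
@[simp] theorem mat_sub (x y : CDer R) : (x - y).mat = x.mat - y.mat := rfl
@[simp] theorem mat_neg (x : CDer R) : (-x).mat = -x.mat := rfl
@[simp] theorem mat_smul (c : R) (x : CDer R) : (c • x).mat = c • x.mat := rfl
@[simp] theorem mat_zero : (0 : CDer R).mat = 0 := rfl
@[simp] theorem field_add (x y : CDer R) : (x + y).field = x.field + y.field := rfl
@[simp] theorem field_sub (x y : CDer R) : (x - y).field = x.field - y.field := rfl
@[simp] theorem field_neg (x : CDer R) : (-x).field = -x.field := rfl
@[simp] theorem field_smul (c : R) (x : CDer R) : (c • x).field = c • x.field := rfl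
@[simp] theorem field_zero : (0 : CDer R).field = 0 := rfl
@[simp] theorem w_add (x y : CDer R) : (x + y).w = x.w + y.w := rfl
@[simp] theorem w_sub (x y : CDer R) : (x - y).w = x.w - y.w := rfl
@[simp] theorem w_neg (x : CDer R) : (-x).w = -x.w := rfl
@[simp] theorem w_smul (c : R) (x : CDer R) : (c • x).w = c * x.w := rfl
@[simp] theorem w_zero : (0 : CDer R).w = 0 := rfl
@[simp] theorem b_add (x y : CDer R) (i : Fin 3) : (x + y).b i = x.b i + y.b i := rfl
@[simp] theorem b_sub (x y : CDer R) (i : Fin 3) : (x - y).b i = x.b i - y.b i := rfl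
@[simp] theorem b_neg (x : CDer R) (i : Fin 3) : (-x).b i = -x.b i := rfl
@[simp] theorem b_smul (c : R) (x : CDer R) (i : Fin 3) : (c • x).b i = c * x.b i := rfl
@[simp] theorem b_zero (i : Fin 3) : (0 : CDer R).b i = 0 := rfl
@[simp] theorem r_add (x y : CDer R) (i : Fin 3) : (x + y).r i = x.r i + y.r i := rfl
@[simp] theorem r_sub (x y : CDer R) (i : Fin 3) : (x - y).r i = x.r i - y.r i := rfl
@[simp] theorem r_neg (x : CDer R) (i : Fin 3) : (-x).r i = -x.r i := rfl
@[simp] theorem r_smul (c : R) (x : CDer R) (i : Fin 3) : (c • x).r i = c * x.r i := rfl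
@[simp] theorem r_zero (i : Fin 3) : (0 : CDer R).r i = 0 := rfl

/-- The matrix as a linear map. -/
def matₗ : CDer R →ₗ[R] Matrix (Fin 4) (Fin 4) R where
  toFun := mat
  map_add' _ _ := rfl
  map_smul' _ _ := rfl

/-- The vector field as a linear map. -/
def fieldₗ : CDer R →ₗ[R] Derivation ℝ R R where
  toFun := field
  map_add' _ _ := rfl
  map_smul' _ _ := rfl

theorem mat_sum {ι : Type*} (s : Finset ι) (f : ι → CDer R) :
    (∑ i ∈ s, f i).mat = ∑ i ∈ s, (f i).mat := map_sum (matₗ (R := R)) f s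
theorem field_sum {ι : Type*} (s : Finset ι) (f : ι → CDer R) :
    (∑ i ∈ s, f i).field = ∑ i ∈ s, (f i).field := map_sum (fieldₗ (R := R)) f s
theorem w_sum {ι : Type*} (s : Finset ι) (f : ι → CDer R) :
    (∑ i ∈ s, f i).w = ∑ i ∈ s, (f i).w := by
  simp only [w, mat_sum, Matrix.sum_apply]
theorem b_sum {ι : Type*} (s : Finset ι) (f : ι → CDer R) (i : Fin 3) :
    (∑ j ∈ s, f j).b i = ∑ j ∈ s, (f j).b i := by
  simp only [b, mat_sum, Matrix.sum_apply]
theorem r_sum {ι : Type*} (s : Finset ι) (f : ι → CDer R) (i : Fin 3) :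
    (∑ j ∈ s, f j).r i = ∑ j ∈ s, (f j).r i := by
  simp only [r, mat_sum, Matrix.sum_apply]

theorem mat_bracket (x y : CDer R) : (bracket x y).mat =
    x.mat * y.mat - y.mat * x.mat + y.mat.map x.field - x.mat.map y.field := rfl

@[simp] theorem field_bracket (x y : CDer R) : (bracket x y).field = ⁅x.field, y.field⁆ := rfl

@[simp] theorem w_bracket (x y : CDer R) :
    (bracket x y).w = x.field y.w - y.field x.w := by
  rw [w, mat_bracket]
  simp only [Matrix.sub_apply, Matrix.add_apply, Matrix.mul_apply, Matrix.map_apply,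
    sum_ax_cyc _ 0, mat_ax_zero, mat_zero_ax, mat_zero_zero]
  ring

@[simp] theorem b_bracket (x y : CDer R) (i : Fin 3) :
    (bracket x y).b i = x.field (y.b i) - y.field (x.b i)
      + (x.b (i + 2) * y.r (i + 1) - x.b (i + 1) * y.r (i + 2))
      - (y.b (i + 2) * x.r (i + 1) - y.b (i + 1) * x.r (i + 2)) := by
  rw [b, mat_bracket]
  simp only [Matrix.sub_apply, Matrix.add_apply, Matrix.mul_apply, Matrix.map_apply,
    sum_ax_cyc _ i, mat_zero_ax, mat_zero_zero, mat_ax_self, mat_one_ax, mat_two_ax]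
  ring

@[simp] theorem r_bracket (x y : CDer R) (i : Fin 3) :
    (bracket x y).r i = x.field (y.r i) - y.field (x.r i)
      + (x.b (i + 1) * y.b (i + 2) - y.b (i + 1) * x.b (i + 2))
      + (x.r (i + 2) * y.r (i + 1) - x.r (i + 1) * y.r (i + 2)) := by
  rw [r, mat_bracket]
  simp only [Matrix.sub_apply, Matrix.add_apply, Matrix.mul_apply, Matrix.map_apply,
    sum_ax_cyc _ i, mat_zero_ax, mat_ax_zero, mat_ax_self, mat_one_ax, mat_ax_two, mat_one_two]
  ring

theorem bracket_add (x y z : CDer R) : bracket x (y + z) = bracket x y + bracket x z := by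
  refine ext_coord ?_ (fun i => ?_) (fun i => ?_) ?_ <;> simp <;> ring

theorem add_bracket (x y z : CDer R) : bracket (x + y) z = bracket x z + bracket y z := by
  refine ext_coord ?_ (fun i => ?_) (fun i => ?_) ?_ <;> simp <;> ring

theorem bracket_smul (f : R) (x y : CDer R) :
    bracket x (f • y) = x.field f • y + f • bracket x y := by
  refine ext_coord ?_ (fun i => ?_) (fun i => ?_) ?_
  · simp; ring
  · simp; ring
  · simp; ring
  · ext g
    simp [Derivation.commutator_apply]
    ring

theorem bracket_swap (x y : CDer R) : bracket x y = -bracket y x := by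
  refine ext_coord ?_ (fun i => ?_) (fun i => ?_) ?_
  · simp
  · simp; ring
  · simp; ring
  · simp

theorem smul_bracket (f : R) (x y : CDer R) :
    bracket (f • x) y = f • bracket x y - y.field f • x := by
  rw [bracket_swap, bracket_smul, bracket_swap y x]
  module

theorem jacobi (x y z : CDer R) :
    bracket x (bracket y z) = bracket (bracket x y) z + bracket y (bracket x z) := by
  refine ext_coord ?_ (fun i => ?_) (fun i => ?_) ?_
  · simp [Derivation.commutator_apply]; ring
  · simp [Derivation.commutator_apply, cyc11, cyc12, cyc21, cyc22]; ring
  · simp [Derivation.commutator_apply, cyc11, cyc12, cyc21, cyc22]; ring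
  · simp

end CDer

@[simp] theorem mat_ofDer (D : Derivation ℝ R R) : (ofDer D).mat = 0 := rfl
@[simp] theorem field_ofDer (D : Derivation ℝ R R) : (ofDer D).field = D := rfl
@[simp] theorem w_ofDer (D : Derivation ℝ R R) : (ofDer D).w = 0 := rfl
@[simp] theorem b_ofDer (D : Derivation ℝ R R) (i : Fin 3) : (ofDer D).b i = 0 := rfl
@[simp] theorem r_ofDer (D : Derivation ℝ R R) (i : Fin 3) : (ofDer D).r i = 0 := rfl
@[simp] theorem field_sigma0 : (sigma0 : CDer R).field = 0 := rfl
@[simp] theorem w_sigma0 : (sigma0 : CDer R).w = 1 := rfl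
@[simp] theorem b_sigma0 (i : Fin 3) : (sigma0 : CDer R).b i = 0 := Matrix.one_apply_ne (zero_ne_ax i)
@[simp] theorem r_sigma0 (i : Fin 3) : (sigma0 : CDer R).r i = 0 :=
  Matrix.one_apply_ne (by rw [Ne, ax_inj]; exact cyc_ne12 i)
@[simp] theorem field_sigma (a b : Fin 4) : (sigma a b : CDer R).field = 0 := rfl
theorem mat_sigma (a b d c : Fin 4) : (sigma a b : CDer R).mat d c =
    eta R b c * (if d = a then 1 else 0) - eta R a c * (if d = b then 1 else 0) := rfl
@[simp] theorem field_boost (i : Fin 3) : (boost i : CDer R).field = 0 := rfl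
@[simp] theorem field_rot (i : Fin 3) : (rot i : CDer R).field = 0 := rfl
@[simp] theorem w_boost (i : Fin 3) : (boost i : CDer R).w = 0 := by
  simp [CDer.w, boost, mat_sigma, eta_apply, zero_ne_ax, ax_ne_zero]
@[simp] theorem w_rot (i : Fin 3) : (rot i : CDer R).w = 0 := by
  simp [CDer.w, rot, mat_sigma, eta_apply, zero_ne_ax, ax_ne_zero]
@[simp] theorem b_boost (i j : Fin 3) : (boost i : CDer R).b j = if i = j then 1 else 0 := by
  simp [CDer.b, boost, mat_sigma, eta_apply, zero_ne_ax, ax_ne_zero, ax_inj]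
@[simp] theorem b_rot (i j : Fin 3) : (rot i : CDer R).b j = 0 := by
  simp [CDer.b, rot, mat_sigma, eta_apply, zero_ne_ax, ax_ne_zero, ax_inj]
@[simp] theorem r_boost (i j : Fin 3) : (boost i : CDer R).r j = 0 := by
  simp [CDer.r, boost, mat_sigma, eta_apply, zero_ne_ax, ax_ne_zero, ax_inj]
@[simp] theorem r_rot (i j : Fin 3) : (rot i : CDer R).r j = if i = j then 1 else 0 := by
  obtain rfl | rfl | rfl := cyc_or i j <;>
  simp [CDer.r, rot, mat_sigma, eta_apply, ax_ne_zero, ax_inj, cyc11, cyc12, cyc21, cyc22]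

/-- `w σ₀ + ∑ b_i σ_i + ∑ r_i σ_{jk} + D`. -/
def cd (w : R) (b r : Fin 3 → R) (D : Derivation ℝ R R) : CDer R :=
  w • sigma0 + ∑ i, b i • boost i + ∑ i, r i • rot i + ofDer D

@[simp] theorem w_cd (w : R) (b r : Fin 3 → R) (D : Derivation ℝ R R) : (cd w b r D).w = w := by
  simp [cd, CDer.w_sum]
@[simp] theorem b_cd (w : R) (b r : Fin 3 → R) (D : Derivation ℝ R R) : (cd w b r D).b = b := by
  ext i; simp [cd, CDer.b_sum]
@[simp] theorem r_cd (w : R) (b r : Fin 3 → R) (D : Derivation ℝ R R) : (cd w b r D).r = r := by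
  ext i; simp [cd, CDer.r_sum]
@[simp] theorem field_cd (w : R) (b r : Fin 3 → R) (D : Derivation ℝ R R) :
    (cd w b r D).field = D := by
  simp [cd, CDer.field_sum]

theorem cd_coord (x : CDer R) : cd x.w x.b x.r x.field = x :=
  CDer.ext_coord (by simp) (by simp) (by simp) (by simp)

end

section
variable {R : Type*} [CommRing R] [Algebra ℝ R]

/-! ### Coordinates on `⋀² W ⊗ N` and on the degree two part -/

section Pairs
variable {N : Type*} [AddCommGroup N] [Module R N]

/-- The component of `θ_a θ_b`. -/
def ent (a b : Fin 4) : Alt2 R N →ₗ[R] N where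
  toFun z := z.1 a b
  map_add' _ _ := rfl
  map_smul' _ _ := rfl

theorem ent_swap (z : Alt2 R N) (a b : Fin 4) : ent a b z = -ent b a z := z.2 a b

theorem ent_self (z : Alt2 R N) (a : Fin 4) : ent a a z = 0 := by
  have := ent_swap z a a
  rw [eq_neg_iff_add_eq_zero] at this
  exact two_smul_cancel (R := R) this

theorem ent_wedge (i j a b : Fin 4) (v : N) : ent a b (wedge R i j v) =
    (if a = i ∧ b = j then v else 0) - (if a = j ∧ b = i then v else 0) := rfl

/-- The component of `θ₀ θ_i`. -/
def pX (i : Fin 3) : Alt2 R N →ₗ[R] N := ent 0 (ax i)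

/-- The component of `θ_j θ_k`, for `(i, j, k)` cyclic. -/
def pY (i : Fin 3) : Alt2 R N →ₗ[R] N := ent (ax (i + 1)) (ax (i + 2))

theorem Alt2_ext {z z' : Alt2 R N} (hX : ∀ i, pX i z = pX i z') (hY : ∀ i, pY i z = pY i z') :
    z = z' := by
  have h0 : ∀ p, ent 0 p z = ent 0 p z' := by
    rw [forall_ax]
    exact ⟨by rw [ent_self, ent_self], hX⟩
  have h1 : ∀ i j, ent (ax i) (ax j) z = ent (ax i) (ax j) z' := by
    intro i j
    obtain rfl | rfl | rfl := cyc_or i j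
    · rw [ent_self, ent_self]
    · have := hY (i + 2)
      rwa [pY, cyc21, cyc22] at this
    · have := hY (i + 1)
      rw [pY, cyc11, cyc12] at this
      rw [ent_swap z, ent_swap z', this]
  refine Subtype.ext (funext fun a => funext fun b => ?_)
  change ent a b z = ent a b z'
  revert a
  rw [forall_ax]
  refine ⟨h0 b, fun i => ?_⟩
  revert b
  rw [forall_ax]
  exact ⟨by rw [ent_swap z, ent_swap z', h0], h1 i⟩

theorem pX_wedge_zero (i j : Fin 3) (v : N) :
    pX j (wedge R 0 (ax i) v) = if j = i then v else 0 := by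
  simp [pX, ent_wedge, ax_inj, zero_ne_ax, ax_ne_zero]

theorem pX_wedge_ax (i i' j : Fin 3) (v : N) : pX j (wedge R (ax i) (ax i') v) = 0 := by
  simp [pX, ent_wedge, ax_inj, zero_ne_ax]

theorem pY_wedge_zero (i j : Fin 3) (v : N) : pY j (wedge R 0 (ax i) v) = 0 := by
  simp [pY, ent_wedge, ax_inj, ax_ne_zero]

theorem pY_wedge_ax (i i' j : Fin 3) (v : N) : pY j (wedge R (ax i) (ax i') v) =
    (if j + 1 = i ∧ j + 2 = i' then v else 0) - (if j + 1 = i' ∧ j + 2 = i then v else 0) := by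
  simp [pY, ent_wedge, ax_inj]

theorem pY_wedge_cyc (i j : Fin 3) (v : N) :
    pY j (wedge R (ax (i + 1)) (ax (i + 2)) v) = if j = i then v else 0 := by
  rw [pY_wedge_ax]
  obtain rfl | rfl | rfl := cyc_or i j <;>
  simp [cyc11, cyc12, cyc21, cyc22]

/-- The element with given components of `θ₀ θ_i` and `θ_j θ_k`. -/
def ofPairs (X Y : Fin 3 → N) : Alt2 R N :=
  ∑ i, wedge R 0 (ax i) (X i) + ∑ i, wedge R (ax (i + 1)) (ax (i + 2)) (Y i)

@[simp] theorem X_ofPairs (X Y : Fin 3 → N) (i : Fin 3) :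
    pX i (ofPairs (R := R) X Y) = X i := by
  simp [ofPairs, pX_wedge_zero, pX_wedge_ax]

@[simp] theorem Y_ofPairs (X Y : Fin 3 → N) (i : Fin 3) :
    pY i (ofPairs (R := R) X Y) = Y i := by
  simp [ofPairs, pY_wedge_zero, pY_wedge_cyc]

end Pairs

/-- Names of the coordinates on the degree two part other than vector fields: coordinates of the
gauge part, and of `θ₀` times the gauge part of degree one. -/
inductive Out
  | ham | twist | mom (i : Fin 3) | skA (i : Fin 3) | skB (i : Fin 3) | scal (i : Fin 3)
  | k (i : Fin 3) | s0 | tw (i : Fin 3) | cf (i : Fin 3) | sy (i : Fin 3) | rA (i : Fin 3)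
  | rB (i : Fin 3) | sc (i : Fin 3) | sk (i : Fin 3)

/-- The coordinates of degree two elements of `⋀ W ⊗ CDer(W)`, up to integer factors. -/
def altCoef (z : Alt2 R (CDer R)) : Out → R
  | .ham => ∑ i, (pY i z).r i
  | .twist => -∑ i, (pY i z).b i
  | .mom i => (pY (i + 2) z).b (i + 1) - (pY (i + 1) z).b (i + 2)
  | .skA i => -(pY i z).w
  | .skB i => (pY (i + 1) z).r (i + 2) - (pY (i + 2) z).r (i + 1)
  | .scal _ => 0
  | .k i => (pX i z).b i - (pY (i + 1) z).r (i + 1) - (pY (i + 2) z).r (i + 2)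
  | .s0 => 0
  | .tw i => (pX (i + 1) z).r (i + 1) + (pX (i + 2) z).r (i + 2) + (pY i z).b i
  | .cf i => (pX i z).w
  | .sy i => (pX (i + 1) z).b (i + 2) + (pX (i + 2) z).b (i + 1) + (pY (i + 2) z).r (i + 1)
      + (pY (i + 1) z).r (i + 2)
  | .rA i => (pX (i + 2) z).r (i + 1) - (pY (i + 1) z).b (i + 2)
  | .rB i => (pX (i + 1) z).r (i + 2) - (pY (i + 2) z).b (i + 1)
  | .sc _ => 0
  | .sk i => (pX (i + 1) z).b (i + 2) - (pX (i + 2) z).b (i + 1) + (pY i z).w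

/-- The coordinates as linear maps. -/
def altCoefₗ (n : Out) : Alt2 R (CDer R) →ₗ[R] R where
  toFun z := altCoef z n
  map_add' y z := by
    cases n <;> simp only [altCoef, map_add, CDer.w_add, CDer.b_add, CDer.r_add, Finset.sum_add_distrib] <;> ring
  map_smul' c z := by
    cases n <;> simp only [altCoef, map_smul, CDer.w_smul, CDer.b_smul, CDer.r_smul, ← Finset.mul_sum,
      RingHom.id_apply, smul_eq_mul] <;> ring

/-- The elements with trace free symmetric curvature, by which the algebra is divided. -/
def weyl (S T : Fin 3 → Fin 3 → R) : Alt2 R (CDer R) :=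
  ofPairs (fun m => cd 0 (S m) (T m) 0) (fun m => cd 0 (T m) (fun n => -S m n) 0)

theorem ideal2_generator (S : Matrix (Fin 3) (Fin 3) ℂ) :
    ∑ m, ∑ n,
        (algebraMap ℝ R (S m n).re •
            (wedge R 0 (ax m) (boost n) - wedge R (ax (m + 1)) (ax (m + 2)) (rot n)) -
          algebraMap ℝ R (S m n).im •
            (wedge R 0 (ax m) (rot n) + wedge R (ax (m + 1)) (ax (m + 2)) (boost n))) =
      weyl (fun m n => algebraMap ℝ R (S m n).re) (fun m n => -algebraMap ℝ R (S m n).im) := by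
  have h1 : ∀ (c : R) (j i : Fin 3), (if i = j then c else 0) = if j = i then c else 0 :=
    fun c j i => by simp only [eq_comm]
  refine Alt2_ext (fun i => ?_) fun i => ?_
  · simp only [weyl, X_ofPairs, map_sum, map_sub, map_add, map_smul, pX_wedge_zero,
      pX_wedge_ax, add_zero, sub_zero, smul_ite, smul_zero]
    rw [Finset.sum_eq_single i (by
      intro m _ hm
      simp [hm.symm]) (by simp)]
    simp only [if_true]
    refine CDer.ext_coord ?_ (fun j => ?_) (fun j => ?_) ?_ <;>
    simp [CDer.w_sum, CDer.b_sum, CDer.r_sum, CDer.field_sum]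
  · simp only [weyl, Y_ofPairs, map_sum, map_sub, map_add, map_smul, pY_wedge_zero,
      pY_wedge_cyc, zero_add, zero_sub, smul_ite, smul_zero]
    rw [Finset.sum_eq_single i (by
      intro m _ hm
      simp [hm.symm]) (by simp)]
    simp only [if_true]
    refine CDer.ext_coord ?_ (fun j => ?_) (fun j => ?_) ?_ <;>
    simp [CDer.w_sum, CDer.b_sum, CDer.r_sum, CDer.field_sum]

/-- The functionals vanish on the trace free symmetric part. -/
theorem altCoef_weyl {S T : Fin 3 → Fin 3 → R} (hS : ∀ m n, S m n = S n m)
    (hT : ∀ m n, T m n = T n m) (hS0 : ∑ m, S m m = 0) (hT0 : ∑ m, T m m = 0) (n : Out) :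
    altCoef (weyl S T) n = 0 := by
  cases n with
  | ham => simp [altCoef, weyl, hS0]
  | twist => simp [altCoef, weyl, hT0]
  | skA | scal | s0 | cf | sc => simp [altCoef, weyl]
  | k i =>
    rw [sum_cyc _ i] at hS0
    simp only [altCoef, weyl, X_ofPairs, Y_ofPairs, b_cd, r_cd]
    linear_combination hS0
  | tw i =>
    rw [sum_cyc _ i] at hT0
    simp only [altCoef, weyl, X_ofPairs, Y_ofPairs, b_cd, r_cd]
    linear_combination hT0
  | mom i | skB i | sy i | rA i | rB i | sk i =>
    simp only [altCoef, weyl, X_ofPairs, Y_ofPairs, b_cd, r_cd, w_cd, hS (i + 2) (i + 1),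
      hT (i + 2) (i + 1)]
    ring

/-- `weyl` as a linear map. -/
def weylₗ : (Fin 3 → Fin 3 → R) × (Fin 3 → Fin 3 → R) →ₗ[R] Alt2 R (CDer R) where
  toFun S := weyl S.1 S.2
  map_add' S S' := by
    refine Alt2_ext (fun i => ?_) fun i => ?_ <;>
    · simp only [weyl, X_ofPairs, Y_ofPairs, map_add]
      refine CDer.ext_coord ?_ (fun j => ?_) (fun j => ?_) ?_ <;> simp <;> ring
  map_smul' c S := by
    refine Alt2_ext (fun i => ?_) fun i => ?_ <;>
    · simp only [weyl, X_ofPairs, Y_ofPairs, map_smul]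
      refine CDer.ext_coord ?_ (fun j => ?_) (fun j => ?_) ?_ <;> simp

theorem weyl_mem_ideal2_of_real {A : Matrix (Fin 3) (Fin 3) ℝ} (hA : A.IsSymm) (h0 : A.trace = 0) :
    weylₗ (fun m n => algebraMap ℝ R (A m n), 0) ∈ ideal2 R ∧
      weylₗ (0, fun m n => algebraMap ℝ R (A m n)) ∈ ideal2 R := by
  constructor
  · refine Submodule.subset_span ⟨A.map Complex.ofReal, ?_, ?_, ?_⟩
    · ext m n
      simp [hA.apply m n]
    · have := congrArg (fun a : ℝ => (a : ℂ)) h0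
      simpa [Matrix.trace, Fin.sum_univ_three] using this
    · rw [ideal2_generator]
      change weyl _ _ = _
      congr 1
      ext m n
      simp
  · refine Submodule.subset_span ⟨A.map fun a => -Complex.I * a, ?_, ?_, ?_⟩
    · ext m n
      simp [hA.apply m n]
    · have := congrArg (fun a : ℝ => -Complex.I * (a : ℂ)) h0
      simpa [Matrix.trace, Finset.mul_sum, Fin.sum_univ_three, mul_add, add_assoc, add_comm,
        add_left_comm] using this
    · rw [ideal2_generator]
      change weyl _ _ = _
      congr 1
      · ext m n
        simp
      · ext m n
        simp

/-- The trace free symmetric elements are in the ideal. -/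
theorem weyl_mem {S T : Fin 3 → Fin 3 → R} (hS : ∀ m n, S m n = S n m)
    (hT : ∀ m n, T m n = T n m) (hS0 : ∑ m, S m m = 0) (hT0 : ∑ m, T m m = 0) :
    weyl S T ∈ ideal2 R := by
  have key : ∀ S : Fin 3 → Fin 3 → R, (∀ m n, S m n = S n m) → ∑ m, S m m = 0 →
      ∃ (ι : Type) (_ : Fintype ι) (c : ι → R) (A : ι → Matrix (Fin 3) (Fin 3) ℝ),
        (∀ a, (A a).IsSymm ∧ (A a).trace = 0) ∧
        S = ∑ a, c a • fun m n => algebraMap ℝ R (A a m n) := by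
    intro S h h0
    refine ⟨Fin 5, inferInstance, ![S 0 1, S 0 2, S 1 2, S 0 0, S 0 0 + S 1 1],
      ![!![0, 1, 0; 1, 0, 0; 0, 0, 0], !![0, 0, 1; 0, 0, 0; 1, 0, 0],
        !![0, 0, 0; 0, 0, 1; 0, 1, 0], !![1, 0, 0; 0, -1, 0; 0, 0, 0],
        !![0, 0, 0; 0, 1, 0; 0, 0, -1]], ?_, ?_⟩
    · intro a
      constructor
      · ext m n
        fin_cases a <;> fin_cases m <;> fin_cases n <;> simp
      · fin_cases a <;> simp [Matrix.trace, Fin.sum_univ_three]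
    · rw [Fin.sum_univ_three] at h0
      have h2 : S 2 2 = -(S 0 0 + S 1 1) := by linear_combination h0
      ext m n
      fin_cases m <;> fin_cases n <;> simp [Fin.sum_univ_five, h2, h 1 0, h 2 0, h 2 1]
  have hmem : ∀ S : Fin 3 → Fin 3 → R, (∀ m n, S m n = S n m) → ∑ m, S m m = 0 →
      weylₗ (S, 0) ∈ ideal2 R ∧ weylₗ (0, S) ∈ ideal2 R := by
    intro S h h0
    obtain ⟨ι, _, c, A, hA, rfl⟩ := key S h h0
    have e1 : ((∑ a, c a • fun m n => algebraMap ℝ R (A a m n), 0) :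
        (Fin 3 → Fin 3 → R) × (Fin 3 → Fin 3 → R)) =
        ∑ a, c a • (fun m n => algebraMap ℝ R (A a m n), 0) := by
      ext <;> simp [Prod.fst_sum, Prod.snd_sum]
    have e2 : ((0, ∑ a, c a • fun m n => algebraMap ℝ R (A a m n)) :
        (Fin 3 → Fin 3 → R) × (Fin 3 → Fin 3 → R)) =
        ∑ a, c a • (0, fun m n => algebraMap ℝ R (A a m n)) := by
      ext <;> simp [Prod.fst_sum, Prod.snd_sum]
    rw [e1, e2]
    simp only [map_sum, map_smul]
    exact ⟨Submodule.sum_mem _ fun a _ => Submodule.smul_mem _ _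
        (weyl_mem_ideal2_of_real (hA a).1 (hA a).2).1,
      Submodule.sum_mem _ fun a _ => Submodule.smul_mem _ _
        (weyl_mem_ideal2_of_real (hA a).1 (hA a).2).2⟩
  have : weyl S T = weylₗ (S, 0) + weylₗ (0, T) := by
    rw [← map_add]
    change _ = weyl _ _
    simp
  rw [this]
  exact Submodule.add_mem _ (hmem S hS hS0).1 (hmem T hT hT0).2

theorem altCoef_eq_zero_of_mem_ideal2 {z : Alt2 R (CDer R)} (hz : z ∈ ideal2 R) :
    (∀ n, altCoef z n = 0) ∧ (∀ i, (pX i z).field = 0) ∧ ∀ i, (pY i z).field = 0 := by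
  induction hz using Submodule.span_induction with
  | mem z h =>
    obtain ⟨S, hS, h0, rfl⟩ := h
    rw [ideal2_generator]
    refine ⟨altCoef_weyl (fun m n => ?_) (fun m n => ?_) ?_ ?_, fun i => by simp [weyl],
      fun i => by simp [weyl]⟩
    · rw [hS.apply]
    · rw [hS.apply]
    · rw [← map_sum, ← Complex.re_sum]
      change algebraMap ℝ R S.trace.re = 0
      simp [h0]
    · rw [Finset.sum_neg_distrib, ← map_sum, ← Complex.im_sum]
      change -algebraMap ℝ R S.trace.im = 0
      simp [h0]
  | zero => exact ⟨fun n => map_zero (altCoefₗ n), fun i => by simp, fun i => by simp⟩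
  | add y z _ _ hy hz =>
    refine ⟨fun n => ?_, fun i => ?_, fun i => ?_⟩
    · change altCoefₗ n (y + z) = 0
      rw [map_add]
      change altCoef y n + altCoef z n = 0
      rw [hy.1, hz.1, add_zero]
    · simp [hy.2.1, hz.2.1]
    · simp [hy.2.2, hz.2.2]
  | smul c z _ hz =>
    refine ⟨fun n => ?_, fun i => ?_, fun i => ?_⟩
    · change altCoefₗ n (c • z) = 0
      rw [map_smul]
      change c • altCoef z n = 0
      rw [hz.1, smul_zero]
    · simp [hz.2.1]
    · simp [hz.2.2]

/-- The ideal is the common kernel of the coordinates. -/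
theorem mem_ideal2_of_altCoef {z : Alt2 R (CDer R)} (h : ∀ n, altCoef z n = 0)
    (hX : ∀ i, (pX i z).field = 0) (hY : ∀ i, (pY i z).field = 0) : z ∈ ideal2 R := by
  have ham := h .ham
  have tw := h .twist
  have mom := fun i => h (.mom i)
  have skA := fun i => h (.skA i)
  have skB := fun i => h (.skB i)
  have k := fun i => h (.k i)
  have tw' := fun i => h (.tw i)
  have cf := fun i => h (.cf i)
  have sy := fun i => h (.sy i)
  have rA := fun i => h (.rA i)
  have rB := fun i => h (.rB i)
  have sk := fun i => h (.sk i)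
  simp only [altCoef, neg_eq_zero] at ham tw mom skA skB k tw' cf sy rA rB sk
  have skB' : ∀ i, (pY (i + 1) z).r (i + 2) = (pY (i + 2) z).r (i + 1) := fun i => by
    linear_combination skB i
  have sk' : ∀ i, (pX (i + 1) z).b (i + 2) = (pX (i + 2) z).b (i + 1) := fun i => by
    linear_combination sk i - skA i
  have sy' : ∀ i, (pY (i + 1) z).r (i + 2) = -(pX (i + 1) z).b (i + 2) := fun i => by
    rw [← sub_eq_zero]
    refine two_smul_cancel (R := R) ?_
    linear_combination sy i + skB' i + sk' i
  have mom' : ∀ i, (pY (i + 2) z).b (i + 1) = (pY (i + 1) z).b (i + 2) := fun i => by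
    linear_combination mom i
  have rA' : ∀ i, (pX (i + 2) z).r (i + 1) = (pY (i + 1) z).b (i + 2) := fun i => by
    linear_combination rA i
  have rB' : ∀ i, (pX (i + 1) z).r (i + 2) = (pY (i + 1) z).b (i + 2) := fun i => by
    linear_combination rB i + mom' i
  have k' : ∀ i, (pY i z).r i = -(pX i z).b i := fun i => by
    rw [sum_cyc _ i] at ham
    linear_combination ham + k i
  have hr : ∑ i, (pX i z).r i = 0 := by
    rw [sum_cyc _ 0]
    rw [sum_cyc _ 0] at tw
    have h0 := tw' 0
    have h1 := tw' (0 + 1)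
    have h2 := tw' (0 + 2)
    rw [cyc11, cyc12] at h1
    rw [cyc21, cyc22] at h2
    refine two_smul_cancel (R := R) ?_
    linear_combination h0 + h1 + h2 - tw
  have tw'' : ∀ i, (pY i z).b i = (pX i z).r i := fun i => by
    rw [sum_cyc _ i] at hr
    linear_combination tw' i - hr
  have hz : z = weyl (fun m => (pX m z).b) fun m => (pX m z).r := by
    refine Alt2_ext (fun i => ?_) fun i => ?_
    · simp only [weyl, X_ofPairs]
      refine CDer.ext_coord ?_ (fun j => ?_) (fun j => ?_) ?_ <;> simp [cf, hX]
    · simp only [weyl, Y_ofPairs]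
      refine CDer.ext_coord ?_ (fun j => ?_) (fun j => ?_) ?_
      · simp [skA]
      · rw [b_cd]
        obtain rfl | rfl | rfl := cyc_or i j
        · exact tw'' _
        · have h1 := rB' (i + 2)
          rw [cyc21, cyc22] at h1
          exact h1.symm
        · have h1 := mom' (i + 1)
          have h2 := rA' (i + 1)
          rw [cyc11, cyc12] at h1 h2
          rw [h1, ← h2]
      · rw [r_cd]
        obtain rfl | rfl | rfl := cyc_or i j
        · exact k' _
        · have h1 := sy' (i + 2)
          rw [cyc21, cyc22] at h1
          exact h1
        · have h1 := sy' (i + 1)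
          have h2 := skB' (i + 1)
          have h3 := sk' (i + 1)
          rw [cyc11, cyc12] at h1 h2 h3
          rw [← h2, h1, h3]
      · simp [hY]
  have symm_of : ∀ S : Fin 3 → Fin 3 → R, (∀ i, S (i + 1) (i + 2) = S (i + 2) (i + 1)) →
      ∀ m n, S m n = S n m := by
    intro S h m n
    obtain rfl | rfl | rfl := cyc_or m n
    · rfl
    · have := h (m + 2)
      rwa [cyc21, cyc22] at this
    · have := h (m + 1)
      rw [cyc11, cyc12] at this
      exact this.symm
  rw [hz]
  refine weyl_mem (symm_of _ sk') (symm_of _ fun i => ?_) ?_ hr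
  · rw [rA', rB']
  · rw [← neg_eq_zero, ← ham, ← Finset.sum_neg_distrib]
    exact Finset.sum_congr rfl fun i _ => (k' i).symm

/-- The coordinates of the scalar field part. -/
def phiCoef : Out → (Alt2 R R × R) →ₗ[R] R
  | .scal i => pY i ∘ₗ LinearMap.fst R _ _
  | .sc i => pX i ∘ₗ LinearMap.fst R _ _
  | .s0 => LinearMap.snd R _ _
  | _ => 0

theorem ideal2_le_ker (n : Out) : ideal2 R ≤ LinearMap.ker (altCoefₗ (R := R) n) :=
  fun _ hz => (altCoef_eq_zero_of_mem_ideal2 hz).1 n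

/-- The coordinates on the degree two part. -/
def coef2 (n : Out) : EPhi2 R →ₗ[R] R :=
  (ideal2 R).liftQ (altCoefₗ n) (ideal2_le_ker n) ∘ₗ LinearMap.fst R _ _ +
    phiCoef n ∘ₗ LinearMap.snd R _ _

theorem coef2_mk (n : Out) (z : Alt2 R (CDer R)) (φ : Alt2 R R × R) :
    coef2 n ((Submodule.Quotient.mk z, φ) : EPhi2 R) = altCoef z n + phiCoef n φ := by
  simp only [coef2, LinearMap.add_apply, LinearMap.comp_apply, LinearMap.fst_apply,
    LinearMap.snd_apply, ← Submodule.mkQ_apply]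
  rfl

/-- The vector field in `θ₀ θ_i`. -/
def fieldX (i : Fin 3) : EPhi2 R →ₗ[R] Derivation ℝ R R :=
  (ideal2 R).liftQ (CDer.fieldₗ ∘ₗ pX i) (fun _ hz => (altCoef_eq_zero_of_mem_ideal2 hz).2.1 i) ∘ₗ
    LinearMap.fst R _ _

/-- The vector field in `θ_j θ_k`. -/
def fieldY (i : Fin 3) : EPhi2 R →ₗ[R] Derivation ℝ R R :=
  (ideal2 R).liftQ (CDer.fieldₗ ∘ₗ pY i) (fun _ hz => (altCoef_eq_zero_of_mem_ideal2 hz).2.2 i) ∘ₗ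
    LinearMap.fst R _ _

theorem fieldX_mk (i : Fin 3) (z : Alt2 R (CDer R)) (φ : Alt2 R R × R) :
    fieldX i ((Submodule.Quotient.mk z, φ) : EPhi2 R) = (pX i z).field := rfl

theorem fieldY_mk (i : Fin 3) (z : Alt2 R (CDer R)) (φ : Alt2 R R × R) :
    fieldY i ((Submodule.Quotient.mk z, φ) : EPhi2 R) = (pY i z).field := rfl

theorem EPhi2_ext {z z' : EPhi2 R} (h : ∀ n, coef2 n z = coef2 n z')
    (hX : ∀ i, fieldX i z = fieldX i z') (hY : ∀ i, fieldY i z = fieldY i z') : z = z' := by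
  rw [← sub_eq_zero]
  replace h : ∀ n, coef2 n (z - z') = 0 := fun n => by rw [map_sub, h, sub_self]
  replace hX : ∀ i, fieldX i (z - z') = 0 := fun i => by rw [map_sub, hX, sub_self]
  replace hY : ∀ i, fieldY i (z - z') = 0 := fun i => by rw [map_sub, hY, sub_self]
  generalize z - z' = u at *
  obtain ⟨u, φ⟩ := u
  obtain ⟨u, rfl⟩ := Submodule.Quotient.mk_surjective _ u
  simp only [coef2_mk] at h
  simp only [fieldX_mk, fieldY_mk] at hX hY
  have h1 : φ = 0 := by
    refine Prod.ext (Alt2_ext (R := R) (fun i => ?_) fun i => ?_) ?_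
    · simpa [phiCoef, altCoef] using h (.sc i)
    · simpa [phiCoef, altCoef] using h (.scal i)
    · simpa [phiCoef, altCoef] using h .s0
  subst h1
  refine Prod.ext ((Submodule.Quotient.mk_eq_zero _).mpr ?_) rfl
  exact mem_ideal2_of_altCoef (fun n => by simpa using h n) hX hY

/-! ### The brackets in coordinates -/

theorem ent_sum_wedge_left {N : Type*} [AddCommGroup N] [Module R N] (f : Fin 4 → Fin 4 → N)
    (a b : Fin 4) : ent a b (∑ i, ∑ j, wedge R i j (f i j)) = f a b - f b a := by
  simp only [map_sum, ent_wedge, Finset.sum_sub_distrib]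
  congr 1
  · rw [Finset.sum_eq_single a (by intro i _ h; simp [h.symm]) (by simp),
      Finset.sum_eq_single b (by intro i _ h; simp [h.symm]) (by simp)]
    simp
  · rw [Finset.sum_eq_single b (by intro i _ h; simp [h.symm]) (by simp),
      Finset.sum_eq_single a (by intro i _ h; simp [h.symm]) (by simp)]
    simp

theorem wedge_add {N : Type*} [AddCommGroup N] [Module R N] (i j : Fin 4) (v v' : N) :
    wedge R i j (v + v') = wedge R i j v + wedge R i j v' := by
  refine Subtype.ext (funext fun a => funext fun b => ?_)
  change ent a b (wedge R i j (v + v')) = ent a b (wedge R i j v) + ent a b (wedge R i j v')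
  simp only [ent_wedge]
  split_ifs <;> abel

theorem wedge_smul {N : Type*} [AddCommGroup N] [Module R N] (i j : Fin 4) (c : R) (v : N) :
    wedge R i j (c • v) = c • wedge R i j v := by
  refine Subtype.ext (funext fun a => funext fun b => ?_)
  change ent a b (wedge R i j (c • v)) = c • ent a b (wedge R i j v)
  simp only [ent_wedge, smul_sub, smul_ite, smul_zero]

/-- `wedge` as a linear map. -/
def wedgeₗ {N : Type*} [AddCommGroup N] [Module R N] (i j : Fin 4) : N →ₗ[R] Alt2 R N where
  toFun := wedge R i j
  map_add' := wedge_add i j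
  map_smul' := wedge_smul i j

theorem wedge_sum {N ι : Type*} [AddCommGroup N] [Module R N] (i j : Fin 4) (s : Finset ι)
    (f : ι → N) : wedge R i j (∑ a ∈ s, f a) = ∑ a ∈ s, wedge R i j (f a) :=
  map_sum (wedgeₗ (R := R) i j) f s

theorem wedge_sub {N : Type*} [AddCommGroup N] [Module R N] (i j : Fin 4) (v v' : N) :
    wedge R i j (v - v') = wedge R i j v - wedge R i j v' :=
  map_sub (wedgeₗ (R := R) i j) v v'

/-- Before antisymmetrization, the bracket of degree one elements without scalar field. -/
def preE (x y : Fin 4 → CDer R) (a b : Fin 4) : CDer R :=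
  CDer.bracket (x a) (y b) + ∑ j, (x a).mat b j • y j - ∑ j, (y b).mat a j • x j

theorem bracketE_eq (x y : Fin 4 → CDer R) :
    bracketE x y = ∑ i, ∑ j, wedge R i j (preE x y i j) := by
  simp only [bracketE, preE, wedge_add, wedge_sub, wedge_sum, Finset.sum_add_distrib,
    Finset.sum_sub_distrib]
  rw [← add_sub_assoc]
  refine congrArg₂ _ (congrArg₂ _ rfl ?_) ?_
  · exact Finset.sum_congr rfl fun i _ => Finset.sum_comm
  · rw [Finset.sum_comm]
    conv_rhs => rw [Finset.sum_comm]
    exact Finset.sum_congr rfl fun j _ => Finset.sum_comm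

theorem ent_bracketE (x y : Fin 4 → CDer R) (a b : Fin 4) :
    ent a b (bracketE x y) = preE x y a b - preE x y b a := by
  rw [bracketE_eq, ent_sum_wedge_left]

/-- Before antisymmetrization, the bracket of scalar fields of degree one. -/
def prePhi (φ ψ : Fin 4 → R) (a b : Fin 4) : CDer R :=
  ∑ q, ((-3 * (φ b * ψ q + φ q * ψ b) + (∑ c, eta R c c * (φ c * ψ c)) * eta R b q) * eta R a a) •
    sigma a q

theorem bracketPhi_eq (φ ψ : Fin 4 → R) :
    bracketPhi φ ψ = ∑ i, ∑ j, wedge R i j (prePhi φ ψ i j) := by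
  simp only [bracketPhi, prePhi, wedge_sum, wedge_smul]

theorem ent_bracketPhi (φ ψ : Fin 4 → R) (a b : Fin 4) :
    ent a b (bracketPhi φ ψ) = prePhi φ ψ a b - prePhi φ ψ b a := by
  rw [bracketPhi_eq, ent_sum_wedge_left]

theorem ent_bracketEPhi (x : Fin 4 → CDer R) (ψ : Fin 4 → R) (a b : Fin 4) :
    ent a b (bracketEPhi x ψ).1 = CDer.act (x a) ψ b - CDer.act (x b) ψ a := by
  have : (bracketEPhi x ψ).1 = ∑ i, ∑ j, wedge R i j (CDer.act (x i) ψ j) := by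
    simp only [bracketEPhi, thetaMulPhi, Prod.fst_sum]
  rw [this, ent_sum_wedge_left]

theorem bracketEPhi_snd (x : Fin 4 → CDer R) (ψ : Fin 4 → R) :
    (bracketEPhi x ψ).2 = -∑ i, eta R i i * CDer.act (x i) ψ i := by
  simp only [bracketEPhi, thetaMulPhi, Prod.snd_sum, Finset.sum_neg_distrib]

end

section
variable {R : Type*} [CommRing R] [Algebra ℝ R]

theorem sigma_zero_ax (i : Fin 3) : (sigma 0 (ax i) : CDer R) = boost i := rfl

theorem sigma_swap (a b : Fin 4) : (sigma a b : CDer R) = -sigma b a := by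
  refine CDer.ext' ?_ (by simp)
  ext d c
  simp only [CDer.mat_neg, Matrix.neg_apply, mat_sigma]
  ring

theorem sigma_self (a : Fin 4) : (sigma a a : CDer R) = 0 := by
  refine CDer.ext' ?_ (by simp)
  ext d c
  simp [mat_sigma]

theorem sigma_ax_zero (i : Fin 3) : (sigma (ax i) 0 : CDer R) = -boost i := sigma_swap _ _
theorem sigma_one_two (i : Fin 3) : (sigma (ax (i + 1)) (ax (i + 2)) : CDer R) = rot i := rfl
theorem sigma_two_one (i : Fin 3) : (sigma (ax (i + 2)) (ax (i + 1)) : CDer R) = -rot i :=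
  sigma_swap _ _
theorem sigma_ax_one (i : Fin 3) : (sigma (ax i) (ax (i + 1)) : CDer R) = rot (i + 2) := by
  rw [← sigma_one_two, cyc21, cyc22]
theorem sigma_one_ax (i : Fin 3) : (sigma (ax (i + 1)) (ax i) : CDer R) = -rot (i + 2) := by
  rw [sigma_swap, sigma_ax_one]
theorem sigma_two_ax (i : Fin 3) : (sigma (ax (i + 2)) (ax i) : CDer R) = rot (i + 1) := by
  rw [← sigma_one_two, cyc11, cyc12]
theorem sigma_ax_two (i : Fin 3) : (sigma (ax i) (ax (i + 2)) : CDer R) = -rot (i + 1) := by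
  rw [sigma_swap, sigma_two_ax]

/-- Names of the unknowns: `z` is the coefficient of `θ₀∂₀`, the others are coefficients of the
gauge generators other than the skew ones, and `e i a` is the coefficient of `θ_i L_a`. -/
inductive Idx
  | z | k (i : Fin 3) | s0 | tw (i : Fin 3) | cf (i : Fin 3) | sy (i : Fin 3) | rA (i : Fin 3)
  | rB (i : Fin 3) | sc (i : Fin 3) | e (i a : Fin 3)

/-- The `σ_m` coefficients of the component of `θ_i`. -/
def bvec (v : Idx → R) (i m : Fin 3) : R :=
  if m = i then v (.k i) else if m = i + 1 then v (.sy (i + 2)) else v (.sy (i + 1))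

/-- The `σ_{m+1,m+2}` coefficients of the component of `θ_i`. -/
def rvec (v : Idx → R) (i m : Fin 3) : R :=
  if m = i then -v (.tw i) + v (.tw (i + 1)) + v (.tw (i + 2))
  else if m = i + 1 then v (.rB (i + 2)) else v (.rA (i + 1))

section
variable (v : Idx → R) (i : Fin 3)
theorem bvec_cyc : bvec v i i = v (.k i) ∧ bvec v i (i + 1) = v (.sy (i + 2)) ∧
    bvec v i (i + 2) = v (.sy (i + 1)) ∧ bvec v (i + 1) i = v (.sy (i + 2)) ∧
    bvec v (i + 1) (i + 2) = v (.sy i) ∧ bvec v (i + 2) i = v (.sy (i + 1)) ∧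
    bvec v (i + 2) (i + 1) = v (.sy i) := by
  fin_cases i <;> simp [bvec]
theorem rvec_cyc : rvec v i i = -v (.tw i) + v (.tw (i + 1)) + v (.tw (i + 2)) ∧
    rvec v (i + 1) (i + 1) = -v (.tw (i + 1)) + v (.tw (i + 2)) + v (.tw i) ∧
    rvec v (i + 2) (i + 2) = -v (.tw (i + 2)) + v (.tw i) + v (.tw (i + 1)) ∧
    rvec v i (i + 1) = v (.rB (i + 2)) ∧ rvec v i (i + 2) = v (.rA (i + 1)) ∧
    rvec v (i + 1) i = v (.rA (i + 2)) ∧ rvec v (i + 1) (i + 2) = v (.rB i) ∧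
    rvec v (i + 2) i = v (.rB (i + 1)) ∧ rvec v (i + 2) (i + 1) = v (.rA i) := by
  fin_cases i <;> simp [rvec]
end

/-- The vector field of `θ_i`. -/
def frameD (L : Fin 3 → Derivation ℝ R R) (v : Idx → R) (i : Fin 3) : Derivation ℝ R R := ∑ a, v (.e i a) • L a

theorem frameD_apply (L : Fin 3 → Derivation ℝ R R) (v : Idx → R) (i : Fin 3) (f : R) :
    frameD L v i f = ∑ a, v (.e i a) * L a f := by
  rw [frameD, ← Derivation.coeFnAddMonoidHom_apply, map_sum, Finset.sum_apply]
  rfl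

/-- The degree one element with given coefficients. -/
def mkE (d : Derivation ℝ R R) (L : Fin 3 → Derivation ℝ R R) (v : Idx → R) : Fin 4 → CDer R :=
  Fin.cons (cd (∑ i, v (.k i)) (fun i => v (.cf i)) 0 (v .z • d)) fun i =>
    cd (v (.cf i)) (bvec v i) (rvec v i) (frameD L v i)

/-- The scalar field with given coefficients. -/
def mkPhi (v : Idx → R) : Fin 4 → R := Fin.cons (v .s0) fun i => v (.sc i)

theorem mkE_zero (d : Derivation ℝ R R) (L : Fin 3 → Derivation ℝ R R) (v : Idx → R) :
    mkE d L v 0 = cd (∑ i, v (.k i)) (fun i => v (.cf i)) 0 (v .z • d) := rfl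
theorem mkE_ax (d : Derivation ℝ R R) (L : Fin 3 → Derivation ℝ R R) (v : Idx → R) (i : Fin 3) :
    mkE d L v (ax i) = cd (v (.cf i)) (bvec v i) (rvec v i) (frameD L v i) := rfl
theorem mkPhi_zero (v : Idx → R) : mkPhi v 0 = v .s0 := rfl
theorem mkPhi_ax (v : Idx → R) (i : Fin 3) : mkPhi v (ax i) = v (.sc i) := rfl

/-- The degree one element with given coefficients. -/
def mk (d : Derivation ℝ R R) (L : Fin 3 → Derivation ℝ R R) (v : Idx → R) : EPhi1 R :=
  (mkE d L v, mkPhi v)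

/-- The quadratic terms that occur in the Maurer-Cartan equation. -/
inductive Tm
  | mul (c : ℤ) (m n : Idx)
  | dz (c : ℤ) (m : Idx)
  | der (c : ℤ) (i : Fin 3) (m : Idx)
  | str (i j a : Fin 3)

section Eval
variable {A : Type*} [CommRing A] (d : A → A) (L : Fin 3 → A → A) (C : Fin 3 → Fin 3 → Fin 3 → A)

/-- Evaluation of the bilinear form given by a term. -/
def Tm.ev (t : Tm) (u v : Idx → A) : A :=
  match t with
  | .mul c m n => c * (u m * v n)
  | .dz c m => c * (u .z * d (v m))
  | .der c i m => c * ∑ a, u (.e i a) * L a (v m)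
  | .str i j a => ∑ b, ∑ c, C b c a * (u (.e i b) * v (.e j c))

/-- Evaluation of the bilinear form given by a list of terms. -/
def evL (l : List Tm) (u v : Idx → A) : A := (l.map fun t => t.ev d L C u v).sum

theorem evL_nil (u v : Idx → A) : evL d L C [] u v = 0 := rfl
theorem evL_cons (t : Tm) (l : List Tm) (u v : Idx → A) :
    evL d L C (t :: l) u v = t.ev d L C u v + evL d L C l u v := by simp [evL]
theorem evL_append (l l' : List Tm) (u v : Idx → A) :
    evL d L C (l ++ l') u v = evL d L C l u v + evL d L C l' u v := by simp [evL]

end Eval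

/-- Names of the components of the Maurer-Cartan equation for elements with given coefficients. -/
inductive Eqn
  | ham | mom (i : Fin 3) | skA (i : Fin 3) | skB (i : Fin 3) | scal (i : Fin 3) | T (i a : Fin 3)
  | k (i : Fin 3) | s0 | tw (i : Fin 3) | cf (i : Fin 3) | sy (i : Fin 3) | rA (i : Fin 3)
  | rB (i : Fin 3) | sc (i : Fin 3) | e (i a : Fin 3)

/-- The summands of the Hamiltonian constraint. -/
def hamTerms (i : Fin 3) : List Tm :=
  [.der (-1) i (.rA i), .der 1 i (.rB i), .mul (-1) (.cf i) (.rA i), .mul 1 (.cf i) (.rB i),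
    .mul (-1) (.rA i) (.rA i), .mul 1 (.rA i) (.rB i), .mul (-1) (.rB i) (.rB i),
    .mul (-3) (.sc i) (.sc i), .mul (-1) (.sy i) (.sy i), .mul (-1) (.tw i) (.tw i),
    .mul 1 (.k i) (.k (i + 1)), .mul 2 (.tw i) (.tw (i + 1))]

/-- The components of the quadratic map `u ↦ ½ [u, u]`. -/
def quad : Eqn → List Tm
  | .ham => hamTerms 0 ++ (hamTerms (0 + 1) ++ hamTerms (0 + 2)) ++ [.mul (-3) .s0 .s0]
  | .mom i => [.der 1 i (.k (i + 1)), .der 1 i (.k (i + 2)), .der (-1) (i + 1) (.sy (i + 2)),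
      .der (-1) (i + 2) (.sy (i + 1)), .mul 1 (.cf i) (.k (i + 1)), .mul 1 (.cf i) (.k (i + 2)),
      .mul (-1) (.cf (i + 1)) (.sy (i + 2)), .mul (-1) (.cf (i + 2)) (.sy (i + 1)),
      .mul (-1) (.k i) (.rA i), .mul 1 (.k i) (.rB i), .mul (-1) (.k (i + 1)) (.rB i),
      .mul 1 (.k (i + 2)) (.rA i), .mul (-2) (.rA (i + 1)) (.sy (i + 2)),
      .mul (-1) (.rA (i + 2)) (.sy (i + 1)), .mul 1 (.rB (i + 1)) (.sy (i + 2)),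
      .mul 2 (.rB (i + 2)) (.sy (i + 1)), .mul (-6) .s0 (.sc i),
      .mul (-2) (.sy i) (.tw (i + 1)), .mul 2 (.sy i) (.tw (i + 2))]
  | .skA i => [.der (-1) (i + 1) (.cf (i + 2)), .der 1 (i + 2) (.cf (i + 1)),
      .mul (-2) (.cf i) (.tw i), .mul 1 (.cf (i + 1)) (.rA (i + 2)),
      .mul 1 (.cf (i + 2)) (.rB (i + 1))]
  | .skB i => [.der (-2) i (.tw i), .der 1 (i + 1) (.rB (i + 2)), .der 1 (i + 2) (.rA (i + 1)),
      .mul (-2) (.cf i) (.tw i), .mul 1 (.cf (i + 1)) (.rB (i + 2)),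
      .mul 1 (.cf (i + 2)) (.rA (i + 1)), .mul (-2) (.rA i) (.tw i),
      .mul 1 (.rA (i + 1)) (.rA (i + 2)), .mul 2 (.rB i) (.tw i),
      .mul (-1) (.rB (i + 1)) (.rB (i + 2))]
  | .scal i => [.der 1 (i + 1) (.sc (i + 2)), .der (-1) (i + 2) (.sc (i + 1)),
      .mul 1 (.cf (i + 1)) (.sc (i + 2)), .mul (-1) (.cf (i + 2)) (.sc (i + 1)),
      .mul (-1) (.rA (i + 2)) (.sc (i + 1)), .mul (-1) (.rB (i + 1)) (.sc (i + 2)),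
      .mul 2 (.sc i) (.tw i)]
  | .T i a => [.der 1 (i + 1) (.e (i + 2) a), .der (-1) (i + 2) (.e (i + 1) a),
      .str (i + 1) (i + 2) a, .mul 2 (.tw i) (.e i a), .mul (-1) (.cf (i + 2)) (.e (i + 1) a),
      .mul (-1) (.rA (i + 2)) (.e (i + 1) a), .mul 1 (.cf (i + 1)) (.e (i + 2) a),
      .mul (-1) (.rB (i + 1)) (.e (i + 2) a)]
  | .k i => [.dz 1 (.k i), .der (-1) i (.cf i), .der 1 i (.rA i), .der (-1) i (.rB i),
      .der 1 (i + 1) (.rA (i + 1)), .der (-1) (i + 2) (.rB (i + 2)), .mul 1 (.cf i) (.rA i),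
      .mul (-1) (.cf i) (.rB i), .mul 1 (.rA i) (.rA i), .mul 1 (.rA (i + 1)) (.rA (i + 1)),
      .mul (-1) (.rA (i + 1)) (.rB (i + 1)), .mul (-1) (.rA (i + 2)) (.rB (i + 2)),
      .mul 1 (.rB i) (.rB i), .mul 1 (.rB (i + 2)) (.rB (i + 2)), .mul 6 (.sc i) (.sc i),
      .mul (-2) (.tw i) (.tw i), .mul 2 (.tw (i + 1)) (.tw (i + 1)),
      .mul (-4) (.tw (i + 1)) (.tw (i + 2)), .mul 2 (.tw (i + 2)) (.tw (i + 2))]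
  | .s0 => [.dz 1 .s0] ++ (quadS 0 ++ (quadS (0 + 1) ++ quadS (0 + 2)))
  | .tw i => [.dz 2 (.tw i), .mul 4 (.k i) (.tw i), .der 1 (i + 1) (.sy (i + 1)),
      .der (-1) (i + 2) (.sy (i + 2)), .mul (-1) (.rA (i + 1)) (.sy (i + 1)),
      .mul (-1) (.rA (i + 2)) (.sy (i + 2)), .mul (-1) (.rB (i + 1)) (.sy (i + 1)),
      .mul (-1) (.rB (i + 2)) (.sy (i + 2))]
  | .cf i => [.dz 1 (.cf i), .der (-1) i (.k i), .der (-1) i (.k (i + 1)),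
      .der (-1) i (.k (i + 2)), .mul 1 (.cf i) (.k (i + 1)), .mul 1 (.cf i) (.k (i + 2)),
      .mul (-1) (.cf (i + 1)) (.sy (i + 2)), .mul (-1) (.cf (i + 2)) (.sy (i + 1))]
  | .sy i => [.dz 2 (.sy i), .der (-2) i (.tw (i + 1)), .der 2 i (.tw (i + 2)),
      .der (-1) (i + 1) (.cf (i + 2)), .der (-1) (i + 1) (.rB (i + 2)),
      .der (-1) (i + 2) (.cf (i + 1)), .der 1 (i + 2) (.rA (i + 1)),
      .mul 1 (.cf (i + 1)) (.rA (i + 2)), .mul (-1) (.cf (i + 1)) (.rB (i + 2)),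
      .mul 1 (.cf (i + 2)) (.rA (i + 1)), .mul (-1) (.cf (i + 2)) (.rB (i + 1)),
      .mul (-2) (.rA i) (.tw i), .mul 4 (.rA i) (.tw (i + 2)),
      .mul (-1) (.rA (i + 1)) (.rA (i + 2)), .mul (-2) (.rA (i + 1)) (.rB (i + 2)),
      .mul (-2) (.rB i) (.tw i), .mul 4 (.rB i) (.tw (i + 1)),
      .mul (-1) (.rB (i + 1)) (.rB (i + 2)), .mul 12 (.sc (i + 1)) (.sc (i + 2))]
  | .rA i => [.dz 1 (.rA i), .der 1 i (.k (i + 2)), .der (-1) (i + 2) (.sy (i + 1)),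
      .mul 1 (.k (i + 1)) (.rA i), .mul 1 (.k (i + 2)) (.rA i),
      .mul 1 (.rB (i + 1)) (.sy (i + 2)), .mul 1 (.rB (i + 2)) (.sy (i + 1)),
      .mul (-2) (.sy i) (.tw (i + 1)), .mul (-2) (.sy i) (.tw (i + 2))]
  | .rB i => [.dz 1 (.rB i), .der (-1) i (.k (i + 1)), .der 1 (i + 1) (.sy (i + 2)),
      .mul 1 (.k (i + 1)) (.rB i), .mul 1 (.k (i + 2)) (.rB i),
      .mul 1 (.rA (i + 1)) (.sy (i + 2)), .mul 1 (.rA (i + 2)) (.sy (i + 1)),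
      .mul (-2) (.sy i) (.tw (i + 1)), .mul (-2) (.sy i) (.tw (i + 2))]
  | .sc i => [.dz 1 (.sc i), .der (-1) i .s0, .mul 1 (.k (i + 1)) (.sc i),
      .mul 1 (.k (i + 2)) (.sc i), .mul (-1) (.sc (i + 1)) (.sy (i + 2)),
      .mul (-1) (.sc (i + 2)) (.sy (i + 1))]
  | .e i a => [.dz 1 (.e i a), .mul 1 (.k (i + 1)) (.e i a), .mul 1 (.k (i + 2)) (.e i a),
      .mul (-1) (.sy (i + 2)) (.e (i + 1) a), .mul (-1) (.sy (i + 1)) (.e (i + 2) a)]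
where
  /-- The summands of the equation for the scalar field. -/
  quadS (i : Fin 3) : List Tm :=
    [.der (-1) i (.sc i), .mul (-1) (.rA i) (.sc i), .mul 1 (.rB i) (.sc i)]

/-- The coordinate of degree two elements that corresponds to an equation. -/
def Eqn.out : Eqn → Option Out
  | .ham => some .ham | .mom i => some (.mom i) | .skA i => some (.skA i)
  | .skB i => some (.skB i) | .scal i => some (.scal i) | .T _ _ => none
  | .k i => some (.k i) | .s0 => some .s0 | .tw i => some (.tw i) | .cf i => some (.cf i)
  | .sy i => some (.sy i) | .rA i => some (.rA i) | .rB i => some (.rB i)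
  | .sc i => some (.sc i) | .e _ _ => none

section
variable (d : Derivation ℝ R R) (L : Fin 3 → Derivation ℝ R R) (C : Fin 3 → Fin 3 → Fin 3 → R)

/-- The component of `½ [u, u]` named by `n`, polarized. -/
def quadR (n : Eqn) (u v : Idx → R) : R := evL (fun f => d f) (fun a f => L a f) C (quad n) u v

theorem coef2_bracket11 (u v : EPhi1 R) (n : Out) : coef2 n (bracket11 u v) =
    altCoef (bracketE u.1 v.1) n + altCoef (bracketPhi u.2 v.2) n +
      (phiCoef n (bracketEPhi u.1 v.2) + phiCoef n (bracketEPhi v.1 u.2)) := by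
  rw [bracket11, coef2_mk]
  change altCoefₗ n _ + _ = altCoefₗ n _ + altCoefₗ n _ + _
  rw [map_add, map_add]

set_option maxHeartbeats 4000000 in
theorem coef2_bracket11_mk (u v : Idx → R) (n : Eqn) (o : Out) (ho : n.out = some o) :
    coef2 o (bracket11 (mk d L u) (mk d L v)) = quadR d L C n u v + quadR d L C n v u := by
  obtain ⟨i, h₀⟩ : ∃ i : Fin 3, i = 0 := ⟨_, rfl⟩
  cases n
  case T => cases ho
  case e => cases ho
  all_goals obtain rfl := Option.some.inj ho
  all_goals
    try rename_i i
    simp only [coef2_bracket11, mk, quadR, quad, quad.quadS, hamTerms, List.cons_append,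
      List.nil_append, evL_cons, evL_nil, Tm.ev, ← frameD_apply, ← h₀]
    simp only [cyc11, cyc12, cyc21, cyc22, altCoef, phiCoef, LinearMap.zero_apply, LinearMap.comp_apply,
      LinearMap.fst_apply, LinearMap.snd_apply, map_add, add_zero,
      zero_add, sum_cyc _ i, pY, pX, ent_bracketE, ent_bracketPhi, ent_bracketEPhi,
      bracketEPhi_snd, CDer.act, Matrix.mulVec, dotProduct, preE, prePhi, sum_ax_cyc _ i, mkE_zero,
      mkE_ax, mkPhi_zero, mkPhi_ax, eta_zero, eta_ax, sigma_self, sigma_zero_ax, sigma_one_two,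
      sigma_two_one, sigma_ax_one, sigma_one_ax, sigma_two_ax, sigma_ax_two, sigma_ax_zero,
      CDer.b_add, CDer.b_sub, CDer.b_smul, CDer.b_neg, b_boost, b_rot, CDer.b_zero, CDer.b_bracket,
      CDer.w_add, CDer.w_sub, CDer.w_smul, CDer.w_neg, w_boost, w_rot, CDer.w_zero, CDer.w_bracket,
      CDer.r_add, CDer.r_sub, CDer.r_smul, CDer.r_neg, r_boost, r_rot, CDer.r_zero, CDer.r_bracket,
      b_cd, r_cd, w_cd, field_cd, Pi.zero_apply, map_zero,
      CDer.mat_zero_zero, CDer.mat_zero_ax, CDer.mat_ax_zero, CDer.mat_ax_self, CDer.mat_ax_one,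
      CDer.mat_ax_two, CDer.mat_one_ax, CDer.mat_two_ax, CDer.mat_one_two, CDer.mat_two_one,
      bvec_cyc, rvec_cyc]
    try simp only [eta_apply, ax_inj, ax_ne_zero, zero_ne_ax, cyc_ne1, cyc_ne2, cyc_ne12, cyc_ne1',
      cyc_ne2', cyc_ne12', if_true, if_false, Derivation.coe_smul, Pi.smul_apply, smul_eq_mul,
      map_neg]
    try push_cast
    ring

theorem coef2_twist_mk (u v : Idx → R) : coef2 .twist (bracket11 (mk d L u) (mk d L v)) = 0 := by
  obtain ⟨i, h₀⟩ : ∃ i : Fin 3, i = 0 := ⟨_, rfl⟩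
  simp only [coef2_bracket11, mk, cyc11, cyc12, cyc21, cyc22, altCoef, phiCoef,
    LinearMap.zero_apply, add_zero,
    sum_cyc _ i, pY, ent_bracketE, ent_bracketPhi, preE, prePhi, sum_ax_cyc _ i,
    mkE_zero, mkE_ax, mkPhi_zero, mkPhi_ax, eta_zero, eta_ax, sigma_self, sigma_one_two, sigma_two_one, sigma_ax_one, sigma_one_ax, sigma_two_ax, sigma_ax_two,
    sigma_ax_zero, CDer.b_add, CDer.b_sub, CDer.b_smul, CDer.b_neg, b_boost, b_rot, CDer.b_zero,
    CDer.b_bracket, b_cd, r_cd, w_cd, field_cd, CDer.mat_ax_zero, CDer.mat_ax_self, CDer.mat_ax_one,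
    CDer.mat_ax_two, CDer.mat_one_ax, CDer.mat_two_ax, CDer.mat_one_two, CDer.mat_two_one,
    bvec_cyc, rvec_cyc]
  simp only [eta_apply, ax_inj, ax_ne_zero, cyc_ne1, cyc_ne2, cyc_ne12, cyc_ne1',
    cyc_ne2', cyc_ne12', if_false]
  ring

theorem coef2_sk_mk (u v : Idx → R) (i : Fin 3) :
    coef2 (.sk i) (bracket11 (mk d L u) (mk d L v)) = 0 := by
  simp only [coef2_bracket11, mk, cyc11, cyc12, cyc21, cyc22, altCoef, phiCoef,
    LinearMap.zero_apply, add_zero,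
    sum_cyc _ i, pY, pX, ent_bracketE, ent_bracketPhi, preE, prePhi, sum_ax_cyc _ i,
    mkE_zero, mkE_ax, mkPhi_zero, mkPhi_ax, eta_zero, eta_ax, sigma_self, sigma_zero_ax,
    sigma_one_two, sigma_two_one, sigma_one_ax, sigma_two_ax, sigma_ax_zero, CDer.b_add, CDer.b_sub, CDer.b_smul, CDer.b_neg, b_boost, b_rot, CDer.b_zero,
    CDer.w_add, CDer.w_sub, CDer.w_smul, CDer.w_neg, w_boost, w_rot, CDer.w_zero, CDer.w_bracket,
    CDer.b_bracket, b_cd, r_cd, w_cd, field_cd, Pi.zero_apply, CDer.mat_zero_zero, CDer.mat_zero_ax, CDer.mat_ax_zero, CDer.mat_ax_self, CDer.mat_one_ax, CDer.mat_two_ax, CDer.mat_one_two, CDer.mat_two_one,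
    bvec_cyc, rvec_cyc]
  simp only [eta_apply, ax_inj, ax_ne_zero, zero_ne_ax, cyc_ne1, cyc_ne2, cyc_ne12, cyc_ne1',
    cyc_ne2', cyc_ne12', if_true, if_false]
  ring

/-- `[d, L_a] = 0`, and the `L_a` span a Lie algebra with structure functions `C`. -/
structure FrameRel : Prop where
  comm_d : ∀ a, ⁅d, L a⁆ = 0
  comm : ∀ a b, ⁅L a, L b⁆ = ∑ c, C a b c • L c
  skew : ∀ a b c, C a b c = -C b a c

variable {d L C}

theorem FrameRel.comm_d_apply (h : FrameRel d L C) (a : Fin 3) (f : R) : d (L a f) = L a (d f) := by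
  have := congrArg (fun D : Derivation ℝ R R => D f) (h.comm_d a)
  simpa [Derivation.commutator_apply, sub_eq_zero] using this

theorem FrameRel.comm_apply (h : FrameRel d L C) (a b : Fin 3) (f : R) :
    L a (L b f) = L b (L a f) + ∑ c, C a b c * L c f := by
  have := congrArg (fun D : Derivation ℝ R R => D f) (h.comm a b)
  simp only [Derivation.commutator_apply, Fin.sum_univ_three, Derivation.coe_add, Pi.add_apply,
    Derivation.coe_smul, Pi.smul_apply, smul_eq_mul] at this
  rw [Fin.sum_univ_three]
  linear_combination this

/-- The combination of the frame fields with given coefficients. -/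
def comb (L : Fin 3 → Derivation ℝ R R) (c : Fin 3 → R) : Derivation ℝ R R := ∑ a, c a • L a

theorem comb_apply (L : Fin 3 → Derivation ℝ R R) (c : Fin 3 → R) (f : R) :
    comb L c f = ∑ a, c a * L a f := frameD_apply L (fun n => match n with | .e _ a => c a | _ => 0) 0 f

theorem fieldX_bracket11_mk (h : FrameRel d L C) (u v : Idx → R) (hu : ∀ a, L a (u .z) = 0)
    (hv : ∀ a, L a (v .z) = 0) (i : Fin 3) :
    fieldX i (bracket11 (mk d L u) (mk d L v)) =
      comb L fun a => quadR d L C (.e i a) u v + quadR d L C (.e i a) v u := by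
  simp only [bracket11, fieldX_mk, mk, map_add, CDer.field_add, pX, ent_bracketE, ent_bracketPhi,
    preE, prePhi, sum_ax_cyc _ i, CDer.field_sub, CDer.field_smul, field_sigma, smul_zero, add_zero,
    sub_zero, mkE_zero, mkE_ax, CDer.field_bracket, field_cd, w_cd, b_cd, r_cd,
    CDer.mat_zero_zero, CDer.mat_zero_ax, CDer.mat_ax_zero, CDer.mat_ax_self, CDer.mat_ax_one,
    CDer.mat_ax_two, bvec_cyc, Pi.zero_apply, sum_cyc _ i]
  ext f
  simp only [comb_apply, quadR, quad, evL_cons, evL_nil, Tm.ev, Derivation.coe_add,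
    Derivation.coe_sub, Pi.sub_apply, Pi.add_apply, Derivation.coe_smul, Pi.smul_apply,
    smul_eq_mul, Derivation.commutator_apply, frameD_apply, Fin.sum_univ_three, Derivation.leibniz,
    map_add, hu, hv, h.comm_d_apply]
  push_cast
  ring

theorem fieldY_bracket11_mk (h : FrameRel d L C) (u v : Idx → R) (i : Fin 3) :
    fieldY i (bracket11 (mk d L u) (mk d L v)) =
      comb L fun a => quadR d L C (.T i a) u v + quadR d L C (.T i a) v u := by
  simp only [bracket11, fieldY_mk, mk, map_add, CDer.field_add, pY, ent_bracketE, ent_bracketPhi,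
    preE, prePhi, sum_ax_cyc _ i, CDer.field_sub, CDer.field_smul, field_sigma, smul_zero, add_zero,
    sub_zero, mkE_zero, mkE_ax, CDer.field_bracket, field_cd, w_cd, b_cd, r_cd,
    CDer.mat_ax_zero, CDer.mat_ax_self, CDer.mat_one_ax, CDer.mat_two_ax, CDer.mat_one_two, CDer.mat_two_one,
    bvec_cyc, rvec_cyc, sum_cyc _ i]
  have h1 : ∀ p q, ⁅frameD L u p, frameD L v q⁆ = comb L fun a =>
      (∑ b, u (.e p b) * L b (v (.e q a))) - (∑ b, v (.e q b) * L b (u (.e p a))) +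
        ∑ b, ∑ c, C b c a * (u (.e p b) * v (.e q c)) := by
    intro p q
    ext f
    simp only [comb_apply, Derivation.commutator_apply, frameD_apply, Fin.sum_univ_three,
      Derivation.leibniz, map_add, smul_eq_mul]
    have := fun b c => h.comm_apply b c f
    simp only [Fin.sum_univ_three] at this
    linear_combination u (.e p 0) * v (.e q 0) * this 0 0 + u (.e p 0) * v (.e q 1) * this 0 1 +
      u (.e p 0) * v (.e q 2) * this 0 2 + u (.e p 1) * v (.e q 0) * this 1 0 +
      u (.e p 1) * v (.e q 1) * this 1 1 + u (.e p 1) * v (.e q 2) * this 1 2 +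
      u (.e p 2) * v (.e q 0) * this 2 0 + u (.e p 2) * v (.e q 1) * this 2 1 +
      u (.e p 2) * v (.e q 2) * this 2 2
  rw [h1, h1]
  ext f
  simp only [comb_apply, quadR, quad, evL_cons, evL_nil, Tm.ev, Derivation.coe_add,
    Derivation.coe_sub, Pi.sub_apply, Pi.add_apply,
    Derivation.coe_smul, Pi.smul_apply, smul_eq_mul, frameD_apply, Fin.sum_univ_three, cyc11, cyc12, cyc21, cyc22]
  push_cast
  have hs : ∀ a c, C a a c = 0 := fun a c => two_smul_cancel (R := R) <| by
    linear_combination h.skew a a c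
  simp only [h.skew 1 0, h.skew 2 0, h.skew 2 1, hs]
  ring
end

end

section
/-! ### The contracted Bianchi identities -/

section Bianchi
variable {S : Type*} [CommRing S]

variable {Z : Derivation ℤ S S} {L : Fin 3 → Derivation ℤ S S} {C : Fin 3 → Fin 3 → Fin 3 → S}
  {v : Idx → S}

theorem derivation_ofNat (D : Derivation ℤ S S) (n : ℕ) [n.AtLeastTwo] :
    D (OfNat.ofNat n) = 0 := by
  have h := D.map_natCast (OfNat.ofNat n)
  rwa [Nat.cast_ofNat] at h

/-- `L` is a frame that commutes with `Z`, with structure functions `C`. -/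
structure IsFrame (Z : Derivation ℤ S S) (L : Fin 3 → Derivation ℤ S S)
    (C : Fin 3 → Fin 3 → Fin 3 → S) : Prop where
  comm_Z : ∀ a f, Z (L a f) = L a (Z f)
  comm : ∀ a b f, L a (L b f) = L b (L a f) + ∑ c, C a b c * L c f
  Z_C : ∀ a b c, Z (C a b c) = 0
  skew : ∀ a b c, C a b c = -C b a c
  diag : ∀ a c, C a a c = 0

/-- The frame fields `E_i = ∑ e_i^a L_a`. -/
def frameS (L : Fin 3 → Derivation ℤ S S) (v : Idx → S) (i : Fin 3) : Derivation ℤ S S :=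
  ∑ a, v (.e i a) • L a

theorem frameS_apply (L : Fin 3 → Derivation ℤ S S) (v : Idx → S) (i : Fin 3) (f : S) :
    frameS L v i f = ∑ a, v (.e i a) * L a f := by
  simp [frameS, Fin.sum_univ_three]

/-- The components of `½ [u, u]` for the element `u` with coefficients `v`. -/
def curv (Z : Derivation ℤ S S) (L : Fin 3 → Derivation ℤ S S) (C : Fin 3 → Fin 3 → Fin 3 → S)
    (v : Idx → S) (n : Eqn) : S := evL (fun f => Z f) (fun a f => L a f) C (quad n) v v

/-- The operators on functions with the coefficients of the torsion. -/
def curvOp (Z : Derivation ℤ S S) (L : Fin 3 → Derivation ℤ S S) (C : Fin 3 → Fin 3 → Fin 3 → S)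
    (v : Idx → S) (n : Fin 3 → Fin 3 → Eqn) (i : Fin 3) (f : S) : S :=
  ∑ a, curv Z L C v (n i a) * L a f

local notation "Q" => curv Z L C v
local notation "E" => frameS L v
local notation "𝓣" => curvOp Z L C v Eqn.T
local notation "𝓤" => curvOp Z L C v Eqn.e

theorem IsFrame.curvOp_T (h : IsFrame Z L C) (i : Fin 3) (f : S) :
    𝓣 i f = E (i + 1) (E (i + 2) f) - E (i + 2) (E (i + 1) f) + 2 * v (.tw i) * E i f -
      (v (.cf (i + 2)) + v (.rA (i + 2))) * E (i + 1) f +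
      (v (.cf (i + 1)) - v (.rB (i + 1))) * E (i + 2) f := by
  have := fun b c => h.comm b c f
  simp only [curvOp, curv, quad, evL_cons, evL_nil, Tm.ev, Fin.sum_univ_three, frameS_apply,
    Derivation.leibniz, map_add, smul_eq_mul] at this ⊢
  push_cast
  have key : ∀ b c, v (.e (i + 1) b) * v (.e (i + 2) c) * (L b (L c f) - (L c (L b f) +
      (C b c 0 * L 0 f + C b c 1 * L 1 f + C b c 2 * L 2 f))) = 0 := fun b c => by
    rw [this, sub_self, mul_zero]
  linear_combination -(key 0 0 + key 0 1 + key 0 2 + key 1 0 + key 1 1 + key 1 2 + key 2 0 +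
    key 2 1 + key 2 2)

theorem IsFrame.curvOp_e (h : IsFrame Z L C) (hz : v .z = 1) (i : Fin 3) (f : S) :
    𝓤 i f = Z (E i f) - E i (Z f) + (v (.k (i + 1)) + v (.k (i + 2))) * E i f -
      v (.sy (i + 2)) * E (i + 1) f - v (.sy (i + 1)) * E (i + 2) f := by
  simp only [curvOp, curv, quad, evL_cons, evL_nil, Tm.ev, Fin.sum_univ_three, frameS_apply,
    Derivation.leibniz, map_add, smul_eq_mul, hz, h.comm_Z]
  push_cast
  ring

theorem evL_cyc (i : Fin 3) (f : Fin 3 → List Tm) :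
    evL (fun f => Z f) (fun a f => L a f) C (f 0 ++ (f (0 + 1) ++ f (0 + 2))) v v =
      evL (fun f => Z f) (fun a f => L a f) C (f i ++ (f (i + 1) ++ f (i + 2))) v v := by
  simp only [evL_append, ← add_assoc]
  rw [← sum_cyc (fun i => evL (fun f => Z f) (fun a f => L a f) C (f i) v v),
    ← sum_cyc (fun i => evL (fun f => Z f) (fun a f => L a f) C (f i) v v)]

theorem curv_ham (i : Fin 3) : Q .ham = evL (fun f => Z f) (fun a f => L a f) C
    (hamTerms i ++ (hamTerms (i + 1) ++ hamTerms (i + 2))) v v +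
      evL (fun f => Z f) (fun a f => L a f) C [.mul (-3) .s0 .s0] v v := by
  rw [curv, quad, evL_append, evL_cyc i]

theorem curv_s0 (i : Fin 3) : Q .s0 = evL (fun f => Z f) (fun a f => L a f) C [.dz 1 .s0] v v +
    evL (fun f => Z f) (fun a f => L a f) C
      (quad.quadS i ++ (quad.quadS (i + 1) ++ quad.quadS (i + 2))) v v := by
  rw [curv, quad, evL_append, evL_cyc i]

section
variable (h : IsFrame Z L C) (hz : v .z = 1) {i j l : Fin 3} (hj : j = i + 1) (hl : l = i + 2)
include h hz hj hl

set_option maxHeartbeats 8000000 in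
theorem IsFrame.bianchi :
    (- E i (Q (.mom i)) + E i (Q (.rA i)) - E i (Q (.rB i)) - E j (Q (.mom j)) + E j (Q (.rA j))
    - E j (Q (.rB j)) - E l (Q (.mom l)) + E l (Q (.rA l)) - E l (Q (.rB l)) + 𝓤 i (v (.rA i)) -
    𝓤 i (v (.rB i)) + 𝓤 j (v (.rA j)) - 𝓤 j (v (.rB j)) + 𝓤 l (v (.rA l)) - 𝓤 l (v (.rB l)) + Z
    (Q .ham) + v (.cf i) * Q (.rA i) - v (.cf i) * Q (.rB i) + v (.cf j) * Q (.rA j) - v (.cf j)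
    * Q (.rB j) + v (.cf l) * Q (.rA l) - v (.cf l) * Q (.rB l) - v (.k i) * Q (.k j) - v (.k i)
    * Q (.k l) - v (.k j) * Q (.k i) - v (.k j) * Q (.k l) - v (.k l) * Q (.k i) - v (.k l) * Q
    (.k j) - Q (.mom i) * v (.rA i) + Q (.mom i) * v (.rB i) - Q (.mom j) * v (.rA j) + Q (.mom
    j) * v (.rB j) - Q (.mom l) * v (.rA l) + Q (.mom l) * v (.rB l) + Q (.cf i) * v (.rA i) - Q
    (.cf i) * v (.rB i) + Q (.cf j) * v (.rA j) - Q (.cf j) * v (.rB j) + Q (.cf l) * v (.rA l)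
    - Q (.cf l) * v (.rB l) + 2 * Q (.rA i) * v (.rA i) - Q (.rA i) * v (.rB i) + 2 * Q (.rA j)
    * v (.rA j) - Q (.rA j) * v (.rB j) + 2 * Q (.rA l) * v (.rA l) - Q (.rA l) * v (.rB l) - Q
    (.rB i) * v (.rA i) + 2 * Q (.rB i) * v (.rB i) - Q (.rB j) * v (.rA j) + 2 * Q (.rB j) * v
    (.rB j) - Q (.rB l) * v (.rA l) + 2 * Q (.rB l) * v (.rB l) + 6 * Q .s0 * v .s0 + 6 * Q (.sc
    i) * v (.sc i) + 6 * Q (.sc j) * v (.sc j) + 6 * Q (.sc l) * v (.sc l) + Q (.sy i) * v (.sy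
    i) + Q (.sy j) * v (.sy j) + Q (.sy l) * v (.sy l) + Q (.tw i) * v (.tw i) - Q (.tw i) * v
    (.tw j) - Q (.tw i) * v (.tw l) - Q (.tw j) * v (.tw i) + Q (.tw j) * v (.tw j) - Q (.tw j)
    * v (.tw l) - Q (.tw l) * v (.tw i) - Q (.tw l) * v (.tw j) + Q (.tw l) * v (.tw l) = 0) ∧
    (- 2 * E i (Q .ham) - 2 * E i (Q (.k j)) - 2 * E i (Q (.k l)) + E j (Q (.sy l)) + E j (Q
    (.skA l)) - E j (Q (.skB l)) + E l (Q (.sy j)) - E l (Q (.skA j)) + E l (Q (.skB j)) + 2 * 𝓣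
    i (v (.tw i)) - 2 * 𝓣 i (v (.tw j)) - 2 * 𝓣 i (v (.tw l)) + 2 * 𝓣 j (v (.cf l)) - 2 * 𝓣 j (v
    (.rA l)) - 2 * 𝓣 l (v (.cf j)) - 2 * 𝓣 l (v (.rB j)) - 2 * 𝓤 i (v (.k j)) - 2 * 𝓤 i (v (.k
    l)) + 2 * 𝓤 j (v (.sy l)) + 2 * 𝓤 l (v (.sy j)) + 2 * Z (Q (.mom i)) - 2 * v (.cf i) * Q (.k
    j) - 2 * v (.cf i) * Q (.k l) + v (.cf j) * Q (.sy l) + v (.cf j) * Q (.skA l) - v (.cf j) *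
    Q (.skB l) + v (.cf l) * Q (.sy j) - v (.cf l) * Q (.skA j) + v (.cf l) * Q (.skB j) + 2 * v
    (.k i) * Q (.rA i) - 2 * v (.k i) * Q (.rB i) + 2 * v (.k j) * Q (.mom i) - 2 * v (.k j) * Q
    (.cf i) + 2 * v (.k j) * Q (.rB i) + 2 * v (.k l) * Q (.mom i) - 2 * v (.k l) * Q (.cf i) -
    2 * v (.k l) * Q (.rA i) - 2 * Q (.mom j) * v (.sy l) - 2 * Q (.mom l) * v (.sy j) + 2 * Q
    (.cf j) * v (.sy l) + 2 * Q (.cf l) * v (.sy j) + 2 * Q (.k i) * v (.rA i) - 2 * Q (.k i) *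
    v (.rB i) + 2 * Q (.k j) * v (.rB i) - 2 * Q (.k l) * v (.rA i) + 4 * Q (.rA j) * v (.sy l)
    + 2 * Q (.rA l) * v (.sy j) - 2 * Q (.rB j) * v (.sy l) - 4 * Q (.rB l) * v (.sy j) + 12 * Q
    .s0 * v (.sc i) + 12 * Q (.sc i) * v .s0 + 2 * Q (.sy i) * v (.tw j) - 2 * Q (.sy i) * v
    (.tw l) + Q (.sy j) * v (.rA l) - 2 * Q (.sy j) * v (.rB l) + 2 * Q (.sy l) * v (.rA j) - Q
    (.sy l) * v (.rB j) + 2 * Q (.tw j) * v (.sy i) - 2 * Q (.tw l) * v (.sy i) + v (.rA l) * Q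
    (.skA j) + 3 * v (.rA l) * Q (.skB j) + v (.rB j) * Q (.skA l) + 3 * v (.rB j) * Q (.skB l)
    + 12 * v (.sc j) * Q (.scal l) - 12 * v (.sc l) * Q (.scal j) + 2 * Q (.skA i) * v (.tw j) +
    2 * Q (.skA i) * v (.tw l) - 4 * Q (.skB i) * v (.tw i) + 2 * Q (.skB i) * v (.tw j) + 2 * Q
    (.skB i) * v (.tw l) = 0) ∧
    (- E j (Q (.cf l)) + E l (Q (.cf j)) - 𝓣 i (v (.k i)) - 𝓣 i (v (.k j)) - 𝓣 i (v (.k l)) - 𝓤 j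
    (v (.cf l)) + 𝓤 l (v (.cf j)) - Z (Q (.skA i)) - v (.cf i) * Q (.tw i) + v (.cf j) * Q (.rA
    l) + v (.cf l) * Q (.rB j) - 2 * v (.k i) * Q (.skA i) - v (.k j) * Q (.skA i) - v (.k l) *
    Q (.skA i) - 2 * Q (.cf i) * v (.tw i) + Q (.cf j) * v (.rA l) + Q (.cf l) * v (.rB j) - Q
    (.skA j) * v (.sy l) - Q (.skA l) * v (.sy j) = 0) ∧
    (- E i (Q (.tw i)) + E j (Q (.rB l)) + E l (Q (.rA j)) + 𝓣 i (v (.k i)) + 𝓣 j (v (.sy l)) + 𝓣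
    l (v (.sy j)) - 2 * 𝓤 i (v (.tw i)) + 𝓤 j (v (.rB l)) + 𝓤 l (v (.rA j)) - Z (Q (.skB i)) - v
    (.cf i) * Q (.tw i) + v (.cf j) * Q (.rB l) + v (.cf l) * Q (.rA j) - 2 * v (.k i) * Q (.skB
    i) - v (.k j) * Q (.skB i) - v (.k l) * Q (.skB i) - 2 * Q (.cf i) * v (.tw i) + Q (.cf j) *
    v (.rB l) + Q (.cf l) * v (.rA j) - 2 * Q (.rA i) * v (.tw i) + Q (.rA j) * v (.rA l) + Q
    (.rA l) * v (.rA j) + 2 * Q (.rB i) * v (.tw i) - Q (.rB j) * v (.rB l) - Q (.rB l) * v (.rB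
    j) - Q (.tw i) * v (.rA i) + Q (.tw i) * v (.rB i) - Q (.skB j) * v (.sy l) - Q (.skB l) * v
    (.sy j) = 0) ∧
    (- E j (Q (.sc l)) + E l (Q (.sc j)) - 𝓣 i (v .s0) - 𝓤 j (v (.sc l)) + 𝓤 l (v (.sc j)) + Z (Q
    (.scal i)) - v (.cf j) * Q (.sc l) + v (.cf l) * Q (.sc j) + 2 * v (.k i) * Q (.scal i) + v
    (.k j) * Q (.scal i) + v (.k l) * Q (.scal i) - Q (.cf j) * v (.sc l) + Q (.cf l) * v (.sc
    j) + Q (.rA l) * v (.sc j) + Q (.rB j) * v (.sc l) - 2 * Q (.sc i) * v (.tw i) + Q (.sc j) *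
    v (.rA l) + Q (.sc l) * v (.rB j) - Q (.tw i) * v (.sc i) + Q (.scal j) * v (.sy l) + Q
    (.scal l) * v (.sy j) = 0) := by
  subst hj hl
  have hn := fun (D : Derivation ℤ S S) (n : ℕ) [n.AtLeastTwo] => derivation_ofNat D n
  refine ⟨?_, ?_, ?_, ?_, ?_⟩
  all_goals
    simp only [curv_ham i, curv_s0 i, h.curvOp_T, h.curvOp_e hz]
    simp only [curv, quad, quad.quadS, hamTerms, evL_append, evL_cons, evL_nil, Tm.ev,
      ← frameS_apply, hz, Int.cast_neg, Int.cast_one, Int.cast_ofNat, cyc11, cyc12, cyc21, cyc22,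
      map_add, map_sub, map_neg, Derivation.leibniz, smul_eq_mul, hn, Derivation.map_one_eq_zero,
      mul_zero, add_zero]
    ring

end

/-- The coefficients of the commutator of `∑ x_a L_a` and `∑ y_a L_a`. -/
def brk (L : Fin 3 → Derivation ℤ S S) (C : Fin 3 → Fin 3 → Fin 3 → S) (x y : Fin 3 → S)
    (a : Fin 3) : S :=
  ∑ b, x b * L b (y a) - ∑ b, y b * L b (x a) + ∑ b, ∑ c, C b c a * (x b * y c)

set_option maxHeartbeats 2000000 in
theorem IsFrame.bianchi_T (h : IsFrame Z L C) (hz : v .z = 1) (i a : Fin 3) :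
    Z (Q (.T i a)) =
      brk L C (fun b => Q (.e (i + 1) b)) (fun b => v (.e (i + 2) b)) a +
      brk L C (fun b => v (.e (i + 1) b)) (fun b => Q (.e (i + 2) b)) a +
      Q (.tw i) * v (.e i a) + 2 * v (.tw i) * Q (.e i a) -
      (Q (.cf (i + 2)) + Q (.rA (i + 2))) * v (.e (i + 1) a) -
      (v (.cf (i + 2)) + v (.rA (i + 2))) * Q (.e (i + 1) a) +
      (Q (.cf (i + 1)) - Q (.rB (i + 1))) * v (.e (i + 2) a) +
      (v (.cf (i + 1)) - v (.rB (i + 1))) * Q (.e (i + 2) a) -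
      (2 * v (.k i) + v (.k (i + 1)) + v (.k (i + 2))) * Q (.T i a) -
      v (.sy (i + 2)) * Q (.T (i + 1) a) -
      v (.sy (i + 1)) * Q (.T (i + 2) a) := by
  have hn := fun (D : Derivation ℤ S S) (n : ℕ) [n.AtLeastTwo] => derivation_ofNat D n
  simp only [brk, curv, quad, evL_cons, evL_nil, Tm.ev, hz, Int.cast_neg, Int.cast_one,
    Int.cast_ofNat, cyc11, cyc12, cyc21, cyc22]
  simp only [Fin.sum_univ_three, h.comm_Z, h.Z_C, map_add, map_neg, map_zero, Derivation.leibniz,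
    smul_eq_mul, hn, Derivation.map_one_eq_zero, mul_zero, add_zero]
  simp only [h.skew 1 0, h.skew 2 0, h.skew 2 1, h.diag]
  ring

/-- The components that do not contain time derivatives. -/
def Eqn.isConstraint : Eqn → Bool
  | .ham | .mom _ | .skA _ | .skB _ | .scal _ | .T _ _ => true
  | .k _ | .s0 | .tw _ | .cf _ | .sy _ | .rA _ | .rB _ | .sc _ | .e _ _ => false

/-- The unknowns that are small compared to the leading ones. -/
def Idx.isSmall : Idx → Bool
  | .z | .k _ | .s0 => false
  | .tw _ | .cf _ | .sy _ | .rA _ | .rB _ | .sc _ | .e _ _ => true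

theorem labels : (∀ i, (Eqn.mom i).isConstraint = true) ∧ (∀ i, (Eqn.skA i).isConstraint = true) ∧
    (∀ i, (Eqn.skB i).isConstraint = true) ∧ (∀ i, (Eqn.scal i).isConstraint = true) ∧
    (∀ i a, (Eqn.T i a).isConstraint = true) ∧ Eqn.ham.isConstraint = true ∧
    (∀ i, (Eqn.k i).isConstraint = false) ∧ Eqn.s0.isConstraint = false ∧
    (∀ i, (Eqn.tw i).isConstraint = false) ∧ (∀ i, (Eqn.cf i).isConstraint = false) ∧
    (∀ i, (Eqn.sy i).isConstraint = false) ∧ (∀ i, (Eqn.rA i).isConstraint = false) ∧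
    (∀ i, (Eqn.rB i).isConstraint = false) ∧ (∀ i, (Eqn.sc i).isConstraint = false) ∧
    (∀ i a, (Eqn.e i a).isConstraint = false) ∧ (∀ i, (Idx.tw i).isSmall = true) ∧
    (∀ i, (Idx.cf i).isSmall = true) ∧ (∀ i, (Idx.sy i).isSmall = true) ∧
    (∀ i, (Idx.rA i).isSmall = true) ∧ (∀ i, (Idx.rB i).isSmall = true) ∧
    (∀ i, (Idx.sc i).isSmall = true) ∧ ∀ i a, (Idx.e i a).isSmall = true := by
  simp [Eqn.isConstraint, Idx.isSmall]

/-- Ideals with respect to which the evolution equations are satisfied, whereas the constraints are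
satisfied to lower order. -/
structure IsPropagating (Z : Derivation ℤ S S) (L : Fin 3 → Derivation ℤ S S)
    (C : Fin 3 → Fin 3 → Fin 3 → S) (v : Idx → S) (I J M : Ideal S) : Prop where
  frame : IsFrame Z L C
  z : v .z = 1
  mul : ∀ x ∈ M, ∀ c ∈ J, x * c ∈ I
  L_I : ∀ a, ∀ c ∈ I, L a c ∈ I
  L_J : ∀ a, ∀ c ∈ J, L a c ∈ J
  L_M : ∀ a, ∀ c ∈ M, L a c ∈ M
  small : ∀ m : Idx, m.isSmall = true → v m ∈ M
  evol : ∀ n : Eqn, n.isConstraint = false → curv Z L C v n ∈ I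
  constr : ∀ n : Eqn, n.isConstraint = true → curv Z L C v n ∈ J

namespace IsPropagating
variable {I J M : Ideal S} (h : IsPropagating Z L C v I J M)
include h

theorem mul' {x c : S} (hx : x ∈ M) (hc : c ∈ J) : c * x ∈ I := by
  rw [mul_comm]
  exact h.mul x hx c hc

theorem frame_I (i : Fin 3) {c : S} (hc : c ∈ I) : frameS L v i c ∈ I := by
  rw [frameS_apply]
  exact I.sum_mem fun a _ => I.mul_mem_left _ (h.L_I a c hc)

theorem frame_J (i : Fin 3) {c : S} (hc : c ∈ J) : frameS L v i c ∈ I := by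
  rw [frameS_apply]
  exact I.sum_mem fun a _ => h.mul _ (h.small (.e i a) rfl) _ (h.L_J a c hc)

theorem U_I (i : Fin 3) (f : S) : 𝓤 i f ∈ I :=
  I.sum_mem fun a _ => I.mul_mem_right _ (h.evol _ rfl)

theorem T_M (i : Fin 3) {f : S} (hf : f ∈ M) : 𝓣 i f ∈ I :=
  I.sum_mem fun a _ => h.mul' (h.L_M a f hf) (h.constr _ rfl)

theorem T_I (i : Fin 3) (f : S) (hT : ∀ a, Q (.T i a) ∈ I) :
    𝓣 i f ∈ I :=
  I.sum_mem fun a _ => I.mul_mem_right _ (hT a)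

theorem frame_curv (i : Fin 3) (n : Eqn) : frameS L v i (Q n) ∈ I := by
  by_cases hn : n.isConstraint = true
  · exact h.frame_J i (h.constr n hn)
  · exact h.frame_I i (h.evol n (by simpa using hn))

theorem mk_evol (n : Eqn) (hn : n.isConstraint = false) : Ideal.Quotient.mk I (Q n) = 0 :=
  Ideal.Quotient.eq_zero_iff_mem.mpr (h.evol n hn)

theorem mk_frame (i : Fin 3) (n : Eqn) : Ideal.Quotient.mk I (E i (Q n)) = 0 :=
  Ideal.Quotient.eq_zero_iff_mem.mpr (h.frame_curv i n)

theorem mk_U (i : Fin 3) (f : S) : Ideal.Quotient.mk I (𝓤 i f) = 0 :=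
  Ideal.Quotient.eq_zero_iff_mem.mpr (h.U_I i f)

theorem mk_T (i : Fin 3) (m : Idx) (hm : m.isSmall = true) : Ideal.Quotient.mk I (𝓣 i (v m)) = 0 :=
  Ideal.Quotient.eq_zero_iff_mem.mpr (h.T_M i (h.small m hm))

theorem mk_mul (n : Eqn) (hn : n.isConstraint = true) (m : Idx) (hm : m.isSmall = true) :
    Ideal.Quotient.mk I (v m) * Ideal.Quotient.mk I (Q n) = 0 := by
  rw [← map_mul]
  exact Ideal.Quotient.eq_zero_iff_mem.mpr (h.mul _ (h.small m hm) _ (h.constr n hn))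

theorem mk_mul' (n : Eqn) (hn : n.isConstraint = true) (m : Idx) (hm : m.isSmall = true) :
    Ideal.Quotient.mk I (Q n) * Ideal.Quotient.mk I (v m) = 0 := by
  rw [mul_comm, h.mk_mul n hn m hm]

theorem ham : Z (Q .ham) ∈ I := by
  have hb := congrArg (Ideal.Quotient.mk I) (h.frame.bianchi h.z (i := 0) rfl rfl).1
  rw [← Ideal.Quotient.eq_zero_iff_mem]
  simp only [map_add, map_sub, map_neg, map_mul, map_zero, map_ofNat, mul_assoc, h.mk_frame, h.mk_U,
    h.mk_evol, h.mk_mul, h.mk_mul', h.mk_T, labels, mul_zero, zero_mul,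
    add_zero, zero_add, sub_zero, neg_zero] at hb ⊢
  linear_combination hb

theorem mom (i : Fin 3) :
    2 * (Z (Q (.mom i)) + (v (.k (i + 1)) + v (.k (i + 2))) * Q (.mom i)) ∈ I := by
  have hb := congrArg (Ideal.Quotient.mk I) (h.frame.bianchi h.z (i := i) rfl rfl).2.1
  rw [← Ideal.Quotient.eq_zero_iff_mem]
  simp only [map_add, map_sub, map_neg, map_mul, map_zero, map_ofNat, mul_assoc, h.mk_frame, h.mk_U,
    h.mk_evol, h.mk_mul, h.mk_mul', h.mk_T, labels, mul_zero, zero_mul,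
    add_zero, zero_add, sub_zero, neg_zero] at hb ⊢
  linear_combination hb

theorem skA (i : Fin 3) (hTI : ∀ a, Q (.T i a) ∈ I) :
    Z (Q (.skA i)) + (2 * v (.k i) + v (.k (i + 1)) + v (.k (i + 2))) * Q (.skA i) ∈ I := by
  have hb := congrArg (Ideal.Quotient.mk I) (h.frame.bianchi h.z (i := i) rfl rfl).2.2.1
  have hT := fun f => Ideal.Quotient.eq_zero_iff_mem.mpr (h.T_I i f hTI)
  rw [← Ideal.Quotient.eq_zero_iff_mem]
  simp only [map_add, map_sub, map_neg, map_mul, map_zero, map_ofNat, mul_assoc, h.mk_frame, h.mk_U,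
    hT, h.mk_evol, h.mk_mul, h.mk_mul', h.mk_T, labels, mul_zero, zero_mul,
    add_zero, zero_add, sub_zero, neg_zero] at hb ⊢
  linear_combination -hb

theorem skB (i : Fin 3) (hTI : ∀ a, Q (.T i a) ∈ I) :
    Z (Q (.skB i)) + (2 * v (.k i) + v (.k (i + 1)) + v (.k (i + 2))) * Q (.skB i) ∈ I := by
  have hb := congrArg (Ideal.Quotient.mk I) (h.frame.bianchi h.z (i := i) rfl rfl).2.2.2.1
  have hT := fun f => Ideal.Quotient.eq_zero_iff_mem.mpr (h.T_I i f hTI)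
  rw [← Ideal.Quotient.eq_zero_iff_mem]
  simp only [map_add, map_sub, map_neg, map_mul, map_zero, map_ofNat, mul_assoc, h.mk_frame, h.mk_U,
    hT, h.mk_evol, h.mk_mul, h.mk_mul', h.mk_T, labels, mul_zero, zero_mul,
    add_zero, zero_add, sub_zero, neg_zero] at hb ⊢
  linear_combination -hb

theorem scal (i : Fin 3) (hTI : ∀ a, Q (.T i a) ∈ I) :
    Z (Q (.scal i)) + (2 * v (.k i) + v (.k (i + 1)) + v (.k (i + 2))) * Q (.scal i) ∈ I := by
  have hb := congrArg (Ideal.Quotient.mk I) (h.frame.bianchi h.z (i := i) rfl rfl).2.2.2.2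
  have hT := fun f => Ideal.Quotient.eq_zero_iff_mem.mpr (h.T_I i f hTI)
  rw [← Ideal.Quotient.eq_zero_iff_mem]
  simp only [map_add, map_sub, map_neg, map_mul, map_zero, map_ofNat, mul_assoc, h.mk_frame, h.mk_U,
    hT, h.mk_evol, h.mk_mul, h.mk_mul', h.mk_T, labels, mul_zero, zero_mul,
    add_zero, zero_add, sub_zero, neg_zero] at hb ⊢
  linear_combination hb

theorem brk_left {x y : Fin 3 → S} (hx : ∀ a, x a ∈ I) (a : Fin 3) : brk L C x y a ∈ I :=
  I.add_mem (I.sub_mem (I.sum_mem fun b _ => I.mul_mem_right _ (hx b))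
    (I.sum_mem fun b _ => I.mul_mem_left _ (h.L_I b _ (hx a))))
    (I.sum_mem fun b _ => I.sum_mem fun _ _ => I.mul_mem_left _ (I.mul_mem_right _ (hx b)))

theorem brk_right {x y : Fin 3 → S} (hy : ∀ a, y a ∈ I) (a : Fin 3) : brk L C x y a ∈ I :=
  I.add_mem (I.sub_mem (I.sum_mem fun b _ => I.mul_mem_left _ (h.L_I b _ (hy a)))
    (I.sum_mem fun b _ => I.mul_mem_right _ (hy b)))
    (I.sum_mem fun _ _ => I.sum_mem fun c _ => I.mul_mem_left _ (I.mul_mem_left _ (hy c)))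

theorem torsion (i a : Fin 3) :
    Z (Q (.T i a)) + (2 * v (.k i) + v (.k (i + 1)) + v (.k (i + 2))) *
      Q (.T i a) ∈ I := by
  have hb := congrArg (Ideal.Quotient.mk I) (h.frame.bianchi_T h.z i a)
  have h1 := Ideal.Quotient.eq_zero_iff_mem.mpr
    (h.brk_left (y := fun b => v (.e (i + 2) b)) (fun b => h.evol (.e (i + 1) b) rfl) a)
  have h2 := Ideal.Quotient.eq_zero_iff_mem.mpr
    (h.brk_right (x := fun b => v (.e (i + 1) b)) (fun b => h.evol (.e (i + 2) b) rfl) a)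
  rw [← Ideal.Quotient.eq_zero_iff_mem]
  simp only [map_add, map_sub, map_neg, map_mul, map_zero, map_ofNat, mul_assoc, h.mk_frame, h.mk_U,
    h1, h2, h.mk_evol, h.mk_mul, h.mk_mul', h.mk_T, labels, mul_zero, zero_mul,
    add_zero, zero_add, sub_zero, neg_zero] at hb ⊢
  linear_combination hb

end IsPropagating

end Bianchi

end

section
/-! ### Formal power series in two triples of parameters -/

/-- Power series in two triples of formal parameters. -/
def PS (A : Type*) : Type _ := MvPowerSeries (Fin 3) (MvPowerSeries (Fin 3) A)

instance (A : Type*) [CommRing A] : CommRing (PS A) :=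
  inferInstanceAs (CommRing (MvPowerSeries (Fin 3) (MvPowerSeries (Fin 3) A)))

section Series
variable {A : Type*} [CommRing A] [Algebra ℝ A]

/-- The coefficient of `t^β s^ε`. -/
def co (β ε : Deg) : PS A →+ A where
  toFun f := MvPowerSeries.coeff ε (MvPowerSeries.coeff β f)
  map_zero' := rfl
  map_add' f g := rfl

theorem co_apply (β ε : Deg) (f : PS A) :
    co β ε f = MvPowerSeries.coeff ε (MvPowerSeries.coeff β f) := rfl

/-- The series with given coefficients. -/
def ofCo (f : Deg → Deg → A) : PS A := fun β ε => f β ε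

@[simp] theorem co_ofCo (f : Deg → Deg → A) (β ε : Deg) : co β ε (ofCo f) = f β ε := rfl

theorem PS_ext {f g : PS A} (h : ∀ β ε, co β ε f = co β ε g) : f = g :=
  MvPowerSeries.ext fun β => MvPowerSeries.ext fun ε => h β ε

theorem co_mul (f g : PS A) (β ε : Deg) : co β ε (f * g) =
    ∑ b ∈ antidiagonal β, ∑ e ∈ antidiagonal ε, co b.1 e.1 f * co b.2 e.2 g := by
  rw [co_apply]
  refine (congrArg _ (MvPowerSeries.coeff_mul β f g)).trans ?_
  rw [map_sum]
  exact Finset.sum_congr rfl fun b _ => MvPowerSeries.coeff_mul ε _ _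

/-- The constant series. -/
def constPS (c : A) : PS A := MvPowerSeries.C (MvPowerSeries.C c)

theorem co_constPS_mul (c : A) (f : PS A) (β ε : Deg) :
    co β ε (constPS c * f) = c * co β ε f := by
  rw [co_apply]
  refine (congrArg _ (MvPowerSeries.coeff_C_mul β f _)).trans ?_
  exact MvPowerSeries.coeff_C_mul ε _ c

theorem constPS_intCast (c : ℤ) : constPS (c : A) = (c : PS A) := by
  have : (MvPowerSeries.C (MvPowerSeries.C (c : A)) :
      MvPowerSeries (Fin 3) (MvPowerSeries (Fin 3) A)) = c := by simp
  exact this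

theorem co_intCast_mul (c : ℤ) (f : PS A) (β ε : Deg) : co β ε ((c : PS A) * f) = c * co β ε f := by
  rw [← constPS_intCast, co_constPS_mul]

theorem co_constPS (c : A) (β ε : Deg) :
    co β ε (constPS c) = if β = 0 ∧ ε = 0 then c else 0 := by
  classical
  rw [co_apply]
  refine (congrArg _ (MvPowerSeries.coeff_C β _)).trans ?_
  by_cases hβ : β = 0
  · simp [hβ, MvPowerSeries.coeff_C]
  · simp [hβ]

/-- A derivation, applied to all coefficients. -/
def derPS (D : Derivation ℝ A A) : Derivation ℤ (PS A) (PS A) :=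
  Derivation.mk' (AddMonoidHom.toIntLinearMap
    { toFun := fun f => ofCo fun β ε => D (co β ε f)
      map_zero' := PS_ext fun β ε => by simp
      map_add' := fun f g => PS_ext fun β ε => by simp }) fun f g => by
    refine PS_ext fun β ε => ?_
    change D (co β ε (f * g)) = co β ε (f * ofCo _ + g * ofCo _)
    rw [mul_comm g, map_add, co_mul, co_mul, co_mul, map_sum, ← Finset.sum_add_distrib]
    refine Finset.sum_congr rfl fun b _ => ?_
    rw [map_sum, ← Finset.sum_add_distrib]
    refine Finset.sum_congr rfl fun e _ => ?_
    simp only [Derivation.leibniz, smul_eq_mul]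
    change _ = co b.1 e.1 f * D (co b.2 e.2 g) + D (co b.1 e.1 f) * co b.2 e.2 g
    ring

@[simp] theorem co_derPS (D : Derivation ℝ A A) (f : PS A) (β ε : Deg) :
    co β ε (derPS D f) = D (co β ε f) := rfl

theorem derPS_constPS (D : Derivation ℝ A A) {c : A} (h : D c = 0) : derPS D (constPS c) = 0 := by
  refine PS_ext fun β ε => ?_
  rw [co_derPS, co_constPS]
  split_ifs <;> simp [h]

/-- The ideal of all series whose coefficients vanish in a lower set of exponents. -/
def vanishing (A : Type*) [CommRing A] [Algebra ℝ A] (P : LowerSet (Deg × Deg)) : Ideal (PS A) where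
  carrier := {f | ∀ β ε, (β, ε) ∈ P → co β ε f = 0}
  zero_mem' := fun _ _ _ => map_zero _
  add_mem' := fun hf hg β ε h => by rw [map_add, hf β ε h, hg β ε h, add_zero]
  smul_mem' := fun c f hf β ε h => by
    rw [smul_eq_mul, co_mul]
    refine Finset.sum_eq_zero fun b hb => Finset.sum_eq_zero fun e he => ?_
    rw [mem_antidiagonal] at hb he
    rw [hf b.2 e.2 (P.lower (a := (β, ε)) ⟨hb ▸ le_add_self, he ▸ le_add_self⟩ h), mul_zero]

theorem derPS_mem_vanishing (D : Derivation ℝ A A) {P : LowerSet (Deg × Deg)} {f : PS A}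
    (hf : f ∈ vanishing A P) : derPS D f ∈ vanishing A P := fun β ε h => by
  rw [co_derPS, hf β ε h, map_zero]

theorem mul_mem_vanishing_Iic (q : Deg × Deg) {f g : PS A}
    (hf : f ∈ vanishing A (LowerSet.Iic 0)) (hg : g ∈ vanishing A (LowerSet.Iio q)) :
    f * g ∈ vanishing A (LowerSet.Iic q) := by
  intro β ε h
  rw [co_mul]
  refine Finset.sum_eq_zero fun b hb => Finset.sum_eq_zero fun e he => ?_
  rw [mem_antidiagonal] at hb he
  by_cases h0 : b.1 = 0 ∧ e.1 = 0
  · rw [hf b.1 e.1 (show ((b.1, e.1) : Deg × Deg) ≤ 0 by rw [h0.1, h0.2]; rfl), zero_mul]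
  · rw [hg b.2 e.2, mul_zero]
    have h' : (β, ε) ≤ q := h
    refine lt_of_lt_of_le (b := (β, ε)) ?_ h'
    refine lt_of_le_of_ne ⟨hb ▸ le_add_self, he ▸ le_add_self⟩ fun h1 => h0 ?_
    rw [Prod.mk.injEq] at h1
    constructor
    · simpa [h1.1] using hb
    · simpa [h1.2] using he

end Series

/-! ### Coefficients of the quadratic terms -/

section Coefficients
variable {A : Type*} [CommRing A] [Algebra ℝ A] (d : Derivation ℝ A A)
  (L : Fin 3 → Derivation ℝ A A) (C : Fin 3 → Fin 3 → Fin 3 → A)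

/-- The series of a family of coefficients. -/
def ser (v : Deg → Deg → Idx → A) (m : Idx) : PS A := ofCo fun β ε => v β ε m

/-- The sum of a function over pairs of splittings. -/
def conv {N : Type*} [AddCommMonoid N] (β ε : Deg) (f : Deg → Deg → Deg → Deg → N) : N :=
  ∑ b ∈ antidiagonal β, ∑ e ∈ antidiagonal ε, f b.1 e.1 b.2 e.2

/-- The coefficients of the components of the Maurer-Cartan equation. -/
def curvCo (v : Deg → Deg → Idx → A) (n : Eqn) (β ε : Deg) : A :=
  conv β ε fun b e b' e' => quadR d L C n (v b e) (v b' e')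

theorem co_curv (v : Deg → Deg → Idx → A) (n : Eqn) (β ε : Deg) :
    co β ε (curv (derPS d) (fun a => derPS (L a)) (fun a b c => constPS (C a b c)) (ser v) n) =
      curvCo d L C v n β ε := by
  have key : ∀ l : List Tm, co β ε (evL (fun f => derPS d f) (fun a f => derPS (L a) f)
      (fun a b c => constPS (C a b c)) l (ser v) (ser v)) =
      conv β ε fun b e b' e' => evL (fun f => d f) (fun a f => L a f) C l (v b e) (v b' e') := by
    intro l
    induction l with
    | nil => simp [evL_nil, conv]
    | cons t l ih =>
      simp only [evL_cons, map_add, ih, conv, Finset.sum_add_distrib]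
      congr 1
      cases t with
      | mul c m n =>
        simp only [Tm.ev, co_intCast_mul]
        simp only [co_mul, ser, co_ofCo, Finset.mul_sum]
      | dz c m =>
        simp only [Tm.ev, co_intCast_mul]
        simp only [co_mul, ser, co_ofCo, co_derPS, Finset.mul_sum]
      | der c i m =>
        simp only [Tm.ev, co_intCast_mul]
        simp only [co_mul, ser, co_ofCo, co_derPS, Fin.sum_univ_three,
          map_add, mul_add, Finset.mul_sum, Finset.sum_add_distrib]
      | str i j a =>
        simp only [Tm.ev, Fin.sum_univ_three, map_add, co_constPS_mul]
        simp only [co_mul, ser, co_ofCo, Finset.mul_sum, Finset.sum_add_distrib]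
  exact key _

end Coefficients

/-! ### Filtration degrees -/

theorem deg_apply (i : Fin 3) (a b : ℕ) (l : Fin 3) : deg i a b l = if l = i then a else b := by
  obtain rfl | rfl | rfl := cyc_or i l <;>
  simp [deg]

/-- The filtration degree of an unknown. -/
def Idx.dg : Idx → Deg
  | .z | .k _ | .s0 => 0
  | .tw i => deg i 2 0
  | .cf i | .sy i | .rA i | .rB i | .sc i | .e i _ => deg i 0 1

/-- The filtration degree of a component of the Maurer-Cartan equation. -/
def Eqn.dg : Eqn → Deg
  | .ham | .k _ | .s0 => 0
  | .tw i => deg i 2 0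
  | .mom i | .cf i | .sy i | .rA i | .rB i | .sc i | .e i _ => deg i 0 1
  | .skA i | .skB i | .scal i | .T i _ => deg i 2 1

/-- The filtration degree of a term. -/
def Tm.dg : Tm → Deg
  | .mul _ m n => m.dg + n.dg
  | .dz _ m => m.dg
  | .der _ i m => deg i 0 1 + m.dg
  | .str i j _ => deg i 0 1 + deg j 0 1

theorem Deg.le_iff (α β : Deg) (i : Fin 3) :
    α ≤ β ↔ α i ≤ β i ∧ α (i + 1) ≤ β (i + 1) ∧ α (i + 2) ≤ β (i + 2) := by
  refine ⟨fun h => ⟨h _, h _, h _⟩, fun h l => ?_⟩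
  obtain rfl | rfl | rfl := cyc_or i l
  exacts [h.1, h.2.1, h.2.2]

theorem dg_le_of_mem_quad {n : Eqn} {t : Tm} (ht : t ∈ quad n) : n.dg ≤ t.dg := by
  have h0 : ∀ x : Deg, 0 ≤ x := fun x => zero_le
  cases n with
  | ham => exact h0 _
  | k i => exact h0 _
  | s0 => exact h0 _
  | mom i | skA i | skB i | scal i | T i _ | tw i | cf i | sy i | rA i | rB i | sc i | e i _ =>
    revert t
    simp [quad, Tm.dg, Idx.dg, Eqn.dg, Deg.le_iff _ _ i, deg_apply]

theorem not_dg_le_of_mem_quad_sy {i : Fin 3} {t : Tm} (ht : t ∈ quad (.sy i)) :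
    t = .dz 2 (.sy i) ∨ ¬t.dg ≤ (Eqn.sy i).dg := by
  revert t
  simp [quad, Tm.dg, Idx.dg, Eqn.dg, Deg.le_iff _ _ i, deg_apply]

/-! ### Bilinearity and support of the quadratic terms -/

section Bilinear
variable {A : Type*} [CommRing A] [Algebra ℝ A] (d : Derivation ℝ A A)
  (L : Fin 3 → Derivation ℝ A A) (C : Fin 3 → Fin 3 → Fin 3 → A)

/-- Evaluation of the bilinear form given by a term. -/
def Tm.evR (t : Tm) (u v : Idx → A) : A := t.ev (fun f => d f) (fun a f => L a f) C u v

theorem quadR_eq (n : Eqn) (u v : Idx → A) :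
    quadR d L C n u v = ((quad n).map fun t => t.evR d L C u v).sum := rfl

theorem Tm.evR_congr (t : Tm) {u u' v v' : Idx → A}
    (h : ∀ m n : Idx, m.dg + n.dg = t.dg → u m = u' m ∧ v n = v' n ∨
      (u m = 0 ∨ v n = 0) ∧ (u' m = 0 ∨ v' n = 0)) :
    t.evR d L C u v = t.evR d L C u' v' := by
  have key : ∀ (m n : Idx) (F : A → A), F 0 = 0 → m.dg + n.dg = t.dg →
      u m * F (v n) = u' m * F (v' n) := by
    intro m n F hF hmn
    rcases h m n hmn with ⟨h1, h2⟩ | ⟨h1 | h1, h2 | h2⟩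
    · rw [h1, h2]
    all_goals simp [h1, h2, hF]
  cases t with
  | mul c m n => exact congrArg _ (key m n id rfl rfl)
  | dz c m => exact congrArg _ (key .z m d (map_zero _) (zero_add _))
  | der c i m =>
    exact congrArg _ (Finset.sum_congr rfl fun a _ => key (.e i a) m (L a) (map_zero _) rfl)
  | str i j a =>
    simp only [evR, ev]
    refine Finset.sum_congr rfl fun b _ => Finset.sum_congr rfl fun c _ => ?_
    exact congrArg _ (key (.e i b) (.e j c) id rfl rfl)

/-- Only unknowns of filtration degree at most `ε` occur. -/
def SuppLE (ε : Deg) (u : Idx → A) : Prop := ∀ m : Idx, ¬m.dg ≤ ε → u m = 0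

/-- The part of filtration degree exactly `ε`. -/
def top (ε : Deg) (u : Idx → A) : Idx → A := by
  classical exact fun m => if m.dg = ε then u m else 0

theorem top_of_eq {ε : Deg} {m : Idx} (h : m.dg = ε) (u : Idx → A) : top ε u m = u m := if_pos h

theorem top_of_ne {ε : Deg} {m : Idx} (h : m.dg ≠ ε) (u : Idx → A) : top ε u m = 0 := if_neg h

theorem Tm.evR_eq_zero (t : Tm) {ε ε' : Deg} {u v : Idx → A} (hu : SuppLE ε u) (hv : SuppLE ε' v)
    (h : ¬t.dg ≤ ε + ε') : t.evR d L C u v = 0 := by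
  have : t.evR d L C (0 : Idx → A) 0 = 0 := by cases t <;> simp [evR, ev]
  rw [← this]
  refine t.evR_congr d L C fun m n hmn => Or.inr ⟨?_, Or.inl rfl⟩
  by_contra hc
  push Not at hc
  exact h (hmn ▸ add_le_add (a := m.dg) (c := n.dg) (not_not.mp (mt (hu m) hc.1))
    (not_not.mp (mt (hv n) hc.2)))

theorem quadR_eq_zero (n : Eqn) {ε ε' : Deg} {u v : Idx → A} (hu : SuppLE ε u) (hv : SuppLE ε' v)
    (h : ¬n.dg ≤ ε + ε') : quadR d L C n u v = 0 := by
  rw [quadR_eq]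
  apply List.sum_eq_zero
  intro x hx
  obtain ⟨t, ht, rfl⟩ := List.mem_map.mp hx
  exact t.evR_eq_zero d L C hu hv fun h' => h ((dg_le_of_mem_quad ht).trans h')

theorem Tm.evR_top (t : Tm) {ε ε' : Deg} {u v : Idx → A} (hu : SuppLE ε u) (hv : SuppLE ε' v)
    (h : ε + ε' ≤ t.dg) : t.evR d L C u v = t.evR d L C (top ε u) (top ε' v) := by
  refine t.evR_congr d L C fun m n hmn => ?_
  by_cases hm : m.dg = ε
  · by_cases hn : n.dg = ε'
    · exact Or.inl ⟨(top_of_eq hm u).symm, (top_of_eq hn v).symm⟩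
    · refine Or.inr ⟨Or.inr (hv n fun h' => hn (le_antisymm h' ?_)), Or.inr (top_of_ne hn v)⟩
      rw [← hmn, hm] at h
      exact le_of_add_le_add_left h
  · refine Or.inr ⟨?_, Or.inl (top_of_ne hm u)⟩
    by_contra hc
    push Not at hc
    have h1 := not_not.mp (mt (hu m) hc.1)
    have h2 := not_not.mp (mt (hv n) hc.2)
    rw [← hmn] at h
    exact hm (le_antisymm h1 (le_of_add_le_add_right (h.trans (add_le_add_right h2 _))))

theorem quadR_top (n : Eqn) {ε ε' : Deg} {u v : Idx → A} (hu : SuppLE ε u) (hv : SuppLE ε' v)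
    (h : ε + ε' ≤ n.dg) : quadR d L C n u v = quadR d L C n (top ε u) (top ε' v) := by
  rw [quadR_eq, quadR_eq]
  refine congrArg _ (List.map_congr_left fun t ht => ?_)
  exact t.evR_top d L C hu hv (h.trans (dg_le_of_mem_quad ht))

end Bilinear

end

section
/-! ### Linearization at the leading term -/

/-- The evolution equation for an unknown other than `.z`. -/
def Idx.eqn : Idx → Eqn
  | .z => .ham | .k i => .k i | .s0 => .s0 | .tw i => .tw i | .cf i => .cf i | .sy i => .sy i
  | .rA i => .rA i | .rB i => .rB i | .sc i => .sc i | .e i a => .e i a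

/-- The coefficient of the leading derivative in an evolution equation. -/
def Idx.lead : Idx → ℤ
  | .tw _ | .sy _ => 2
  | _ => 1

/-- The decay rate of an unknown, as a combination of the leading exponents. -/
def Idx.rate : Idx → Deg
  | .z | .k _ | .s0 | .sy _ => 0
  | .tw i => deg i 2 0
  | .cf i | .rA i | .rB i | .sc i | .e i _ => deg i 0 1

theorem Eqn.exists_idx (n : Eqn) (h : n.isConstraint = false) : ∃ m : Idx, m ≠ .z ∧ m.eqn = n := by
  cases n with
  | k i => exact ⟨.k i, by simp, rfl⟩
  | s0 => exact ⟨.s0, by simp, rfl⟩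
  | tw i => exact ⟨.tw i, by simp, rfl⟩
  | cf i => exact ⟨.cf i, by simp, rfl⟩
  | sy i => exact ⟨.sy i, by simp, rfl⟩
  | rA i => exact ⟨.rA i, by simp, rfl⟩
  | rB i => exact ⟨.rB i, by simp, rfl⟩
  | sc i => exact ⟨.sc i, by simp, rfl⟩
  | e i a => exact ⟨.e i a, by simp, rfl⟩
  | _ => simp [Eqn.isConstraint] at h

theorem Idx.isConstraint_eqn {m : Idx} (h : m ≠ .z) : m.eqn.isConstraint = false := by
  cases m <;> first | rfl | exact absurd rfl h

theorem Idx.dg_eqn (m : Idx) : m.eqn.dg = m.dg := by cases m <;> rfl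

theorem Idx.rate_eq (m : Idx) : m.rate = m.dg ∨ m.rate = 0 := by
  cases m <;> first | exact Or.inl rfl | exact Or.inr rfl

theorem Idx.rate_le (m : Idx) : m.rate ≤ m.dg := by
  rcases m.rate_eq with h | h <;> rw [h]
  exact zero_le

theorem Idx.dg_ne_zero {m : Idx} (hm : m.isSmall = true) : m.dg ≠ 0 := by
  intro h
  cases m with
  | z | k _ | s0 => simp [isSmall] at hm
  | tw i =>
    have := DFunLike.congr_fun h i
    simp [dg, deg_apply] at this
  | cf i | sy i | rA i | rB i | sc i | e i _ =>
    have := DFunLike.congr_fun h (i + 1)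
    simp [dg, deg_apply] at this

section Linear
variable {A : Type*} [CommRing A] [Algebra ℝ A] (d : Derivation ℝ A A)
  (L : Fin 3 → Derivation ℝ A A) (C : Fin 3 → Fin 3 → Fin 3 → A)

/-- The combination of exponents given by a filtration degree. -/
def wt (p : Fin 3 → A) (δ : Deg) : A := ∑ i, (δ i : A) * p i

theorem wt_zero (p : Fin 3 → A) : wt p 0 = 0 := by simp [wt]

theorem wt_deg (p : Fin 3 → A) (i : Fin 3) (a b : ℕ) :
    wt p (deg i a b) = a * p i + b * p (i + 1) + b * p (i + 2) := by
  rw [wt, sum_cyc _ i]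
  simp [deg_apply]

theorem wt_add (p : Fin 3 → A) (δ ε : Deg) : wt p (δ + ε) = wt p δ + wt p ε := by
  simp [wt, add_mul, Finset.sum_add_distrib]

/-- The contribution of the vector field of `θ_i` to the evolution equation for an unknown. -/
def Idx.drift (g : Idx → A) (w : Idx → A) : Idx → A
  | .cf i => -∑ a, w (.e i a) * L a (g (.k i) + g (.k (i + 1)) + g (.k (i + 2)))
  | .rA i => ∑ a, w (.e i a) * L a (g (.k (i + 2)))
  | .rB i => -∑ a, w (.e i a) * L a (g (.k (i + 1)))
  | .sc i => -∑ a, w (.e i a) * L a (g .s0)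
  | _ => 0

theorem Idx.drift_congr {g w w' : Idx → A} (m : Idx)
    (h : ∀ i a, (Idx.e i a).dg = m.dg → w (.e i a) = w' (.e i a)) :
    m.drift L g w = m.drift L g w' := by
  cases m with
  | cf i | rA i | rB i | sc i => simp only [drift, h i _ rfl]
  | _ => rfl

/-- A leading term: only `.z`, the `.k i` and `.s0` occur, and they do not depend on time. -/
structure IsLeading (g : Idx → A) : Prop where
  z : g .z = 1
  small : ∀ m : Idx, m.isSmall = true → g m = 0
  d_k : ∀ i, d (g (.k i)) = 0
  d_s0 : d (g .s0) = 0

variable {d L C}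

theorem IsLeading.quadR_add {g : Idx → A} (hg : IsLeading d g) {w : Idx → A} (hw : w .z = 0)
    {m : Idx} (hm : m ≠ .z) :
    quadR d L C m.eqn g w + quadR d L C m.eqn w g =
      m.lead * (d (w m) + wt (fun i => g (.k i)) m.rate * w m) + m.drift L g w := by
  have h1 := fun i => hg.small (.tw i) rfl
  have h2 := fun i => hg.small (.cf i) rfl
  have h3 := fun i => hg.small (.sy i) rfl
  have h4 := fun i => hg.small (.rA i) rfl
  have h5 := fun i => hg.small (.rB i) rfl
  have h6 := fun i => hg.small (.sc i) rfl
  have h7 := fun i a => hg.small (.e i a) rfl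
  cases m with
  | z => exact absurd rfl hm
  | _ =>
    simp only [Idx.eqn, quadR, quad, quad.quadS, evL_append, evL_cons, evL_nil, Tm.ev, h1, h2, h3,
      h4, h5, h6, h7, hw, hg.z, hg.d_k, hg.d_s0, map_zero, mul_zero, zero_mul, add_zero, zero_add,
      Finset.sum_const_zero, Idx.lead, Idx.rate, wt_zero, wt_deg, Idx.drift, map_add, mul_add, Finset.sum_add_distrib]
    push_cast
    ring

end Linear

/-! ### Time dependence -/

/-- Frame fields, exponents, and spaces of functions with prescribed time dependence. -/
structure Background (A : Type*) [CommRing A] [Algebra ℝ A] where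
  /-- the time derivative -/
  d : Derivation ℝ A A
  /-- the spatial frame -/
  L : Fin 3 → Derivation ℝ A A
  /-- the structure functions of the frame -/
  C : Fin 3 → Fin 3 → Fin 3 → A
  /-- the leading exponents -/
  p : Fin 3 → A
  /-- the functions with time dependence given by a degree -/
  Cl : Deg → Submodule ℝ A
  rel : FrameRel d L C
  d_C : ∀ a b c, d (C a b c) = 0
  C_mem : ∀ a b c, C a b c ∈ Cl 0
  d_p : ∀ i, d (p i) = 0
  mul_mem : ∀ {δ ε x y}, x ∈ Cl δ → y ∈ Cl ε → x * y ∈ Cl (δ + ε)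
  d_mem : ∀ {ε x}, x ∈ Cl ε → d x ∈ Cl ε
  L_mem : ∀ {ε x} a, x ∈ Cl ε → L a x ∈ Cl ε
  ker_mem : ∀ {x}, d x = 0 → x ∈ Cl 0
  solve : ∀ {δ κ b}, δ < κ → b ∈ Cl κ → ∃ c ∈ Cl κ, d c + wt p δ * c = b
  solve_unique : ∀ {δ κ c}, δ < κ → c ∈ Cl κ → d c + wt p δ * c = 0 → c = 0
  mem_of_eq : ∀ {κ b c}, b ∈ Cl κ → d c + wt p κ * c = b → c ∈ Cl κ

namespace Background
variable {A : Type*} [CommRing A] [Algebra ℝ A] (B : Background A)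

/-- Admissible coefficients of `t^β s^ε`. -/
structure Adm (β ε : Deg) (u : Idx → A) : Prop where
  supp : SuppLE ε u
  mem : ∀ m, u m ∈ B.Cl ε
  z : u .z = if β = 0 ∧ ε = 0 then 1 else 0
  k : β = 0 ∧ ε = 0 → ∀ i, u (.k i) = B.p i
  s0 : β = 0 ∧ ε = 0 → B.d (u .s0) = 0
  sy : ∀ i, ε = deg i 0 1 → u (.sy i) = 0

/-- The components of the Maurer-Cartan equation. -/
abbrev curv (v : Deg → Deg → Idx → A) (n : Eqn) (β ε : Deg) : A := curvCo B.d B.L B.C v n β ε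

/-- The coefficients of order `(β, ε)` are admissible and the Maurer-Cartan equation holds. -/
def Good (v : Deg → Deg → Idx → A) (q : Deg × Deg) : Prop :=
  B.Adm q.1 q.2 (v q.1 q.2) ∧ ∀ n, B.curv v n q.1 q.2 = 0

variable {B}

theorem Adm.isLeading {u : Idx → A} (h : B.Adm 0 0 u) : IsLeading B.d u where
  z := by simpa using h.z
  small m hm := h.supp m fun h' => by
    have h0 : m.dg = 0 := le_antisymm h' zero_le
    exact Idx.dg_ne_zero hm h0
  d_k i := by rw [h.k ⟨rfl, rfl⟩, B.d_p]
  d_s0 := h.s0 ⟨rfl, rfl⟩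

end Background

/-! ### Splitting off the linear terms -/

section Rest
variable {N : Type*} [AddCommMonoid N]

/-- The part of `conv` that involves only splittings into two smaller exponents. -/
def convRest (β ε : Deg) (f : Deg → Deg → Deg → Deg → N) : N := by
  classical
  exact ∑ x ∈ (antidiagonal β ×ˢ antidiagonal ε).filter fun x =>
    (x.1.1 ≠ 0 ∨ x.2.1 ≠ 0) ∧ (x.1.2 ≠ 0 ∨ x.2.2 ≠ 0), f x.1.1 x.2.1 x.1.2 x.2.2

theorem conv_split {β ε : Deg} (h : β ≠ 0 ∨ ε ≠ 0) (f : Deg → Deg → Deg → Deg → N) :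
    conv β ε f = f 0 0 β ε + f β ε 0 0 + convRest β ε f := by
  classical
  rw [conv, ← Finset.sum_product', convRest, ← Finset.sum_filter_add_sum_filter_not _ fun x =>
    (x.1.1 ≠ 0 ∨ x.2.1 ≠ 0) ∧ (x.1.2 ≠ 0 ∨ x.2.2 ≠ 0), add_comm]
  congr 1
  have : ((antidiagonal β ×ˢ antidiagonal ε).filter fun x =>
      ¬((x.1.1 ≠ 0 ∨ x.2.1 ≠ 0) ∧ (x.1.2 ≠ 0 ∨ x.2.2 ≠ 0))) =
      {((0, β), (0, ε)), ((β, 0), (ε, 0))} := by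
    ext ⟨⟨a, b⟩, c, e⟩
    simp only [Finset.mem_filter, Finset.mem_product, mem_antidiagonal, Finset.mem_insert,
      Finset.mem_singleton, Prod.mk.injEq]
    constructor
    · rintro ⟨⟨rfl, rfl⟩, h2⟩
      simp only [not_and_or, not_or, not_not] at h2
      rcases h2 with ⟨rfl, rfl⟩ | ⟨rfl, rfl⟩ <;> simp
    · rintro (⟨⟨rfl, rfl⟩, rfl, rfl⟩ | ⟨⟨rfl, rfl⟩, rfl, rfl⟩) <;> simp
  rw [this, Finset.sum_pair]
  intro hc
  simp only [Prod.mk.injEq] at hc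
  rcases h with h | h
  · exact h hc.1.2
  · exact h hc.2.2

theorem convRest_congr {β ε : Deg} {f g : Deg → Deg → Deg → Deg → N}
    (h : ∀ b e b' e', b + b' = β → e + e' = ε → (b, e) < (β, ε) → (b', e') < (β, ε) →
      f b e b' e' = g b e b' e') : convRest β ε f = convRest β ε g := by
  refine Finset.sum_congr rfl ?_
  rintro ⟨⟨a, b⟩, c, e⟩ hx
  simp only [Finset.mem_filter, Finset.mem_product, mem_antidiagonal] at hx
  obtain ⟨⟨rfl, rfl⟩, h1, h2⟩ := hx
  refine h a c b e rfl rfl (lt_of_le_of_ne ⟨le_self_add, le_self_add⟩ fun hc => ?_)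
    (lt_of_le_of_ne ⟨le_add_self, le_add_self⟩ fun hc => ?_)
  · simp only [Prod.mk.injEq, left_eq_add] at hc
    rcases h2 with h2 | h2
    exacts [h2 hc.1, h2 hc.2]
  · simp only [Prod.mk.injEq, right_eq_add] at hc
    rcases h1 with h1 | h1
    exacts [h1 hc.1, h1 hc.2]

theorem conv_congr {β ε : Deg} {f g : Deg → Deg → Deg → Deg → N}
    (h : ∀ b e b' e', b + b' = β → e + e' = ε → f b e b' e' = g b e b' e') :
    conv β ε f = conv β ε g :=
  Finset.sum_congr rfl fun x hx => Finset.sum_congr rfl fun y hy =>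
    h _ _ _ _ (mem_antidiagonal.mp hx) (mem_antidiagonal.mp hy)

theorem conv_eq_zero {β ε : Deg} {f : Deg → Deg → Deg → Deg → N}
    (h : ∀ b e b' e', b + b' = β → e + e' = ε → f b e b' e' = 0) : conv β ε f = 0 :=
  Finset.sum_eq_zero fun x hx => Finset.sum_eq_zero fun y hy =>
    h _ _ _ _ (mem_antidiagonal.mp hx) (mem_antidiagonal.mp hy)

end Rest

namespace Background
variable {A : Type*} [CommRing A] [Algebra ℝ A] {B : Background A} {v v' : Deg → Deg → Idx → A}
  {β ε : Deg}

theorem quadR_mem (B : Background A) (n : Eqn) {δ ε : Deg} {u w : Idx → A} (hu : ∀ m, u m ∈ B.Cl δ)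
    (hw : ∀ m, w m ∈ B.Cl ε) : quadR B.d B.L B.C n u w ∈ B.Cl (δ + ε) := by
  rw [quadR_eq]
  have hc : ∀ (c : ℤ) {x : A}, x ∈ B.Cl (δ + ε) → (c : A) * x ∈ B.Cl (δ + ε) := by
    intro c x hx
    rw [← zsmul_eq_mul]
    exact zsmul_mem hx c
  have : ∀ l : List Tm, (l.map fun t => t.evR B.d B.L B.C u w).sum ∈ B.Cl (δ + ε) := by
    intro l
    induction l with
    | nil => exact zero_mem _
    | cons t l ih =>
      rw [List.map_cons, List.sum_cons]
      refine add_mem ?_ ih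
      cases t with
      | mul c m n => exact hc c (B.mul_mem (hu m) (hw n))
      | dz c m => exact hc c (B.mul_mem (hu _) (B.d_mem (hw m)))
      | der c i m => exact hc c (Submodule.sum_mem _ fun a _ => B.mul_mem (hu _) (B.L_mem a (hw m)))
      | str i j a =>
        simp only [Tm.evR, Tm.ev]
        refine Submodule.sum_mem _ fun b _ => Submodule.sum_mem _ fun c _ => ?_
        have := B.mul_mem (B.C_mem b c a) (B.mul_mem (hu (.e i b)) (hw (.e j c)))
        rwa [zero_add] at this
  exact this _

/-- The terms of the Maurer-Cartan equation that involve only lower orders. -/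
def rest (B : Background A) (v : Deg → Deg → Idx → A) (n : Eqn) (β ε : Deg) : A :=
  convRest β ε fun b e b' e' => quadR B.d B.L B.C n (v b e) (v b' e')

/-- The linear terms of the Maurer-Cartan equation. -/
def lin (B : Background A) (g w : Idx → A) (m : Idx) : A :=
  m.lead * (B.d (w m) + wt B.p m.rate * w m) + m.drift B.L g w

theorem rest_congr (n : Eqn) (h : ∀ b e, (b, e) < (β, ε) → v b e = v' b e) :
    B.rest v n β ε = B.rest v' n β ε :=
  convRest_congr fun b e b' e' _ _ h1 h2 => by rw [h b e h1, h b' e' h2]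

theorem curv_congr (n : Eqn) (h : ∀ b e, (b, e) ≤ (β, ε) → v b e = v' b e) :
    B.curv v n β ε = B.curv v' n β ε :=
  conv_congr fun b e b' e' h1 h2 => by
    rw [h b e ⟨h1 ▸ le_self_add, h2 ▸ le_self_add⟩, h b' e' ⟨h1 ▸ le_add_self, h2 ▸ le_add_self⟩]

theorem Good.congr (h : ∀ b e, (b, e) ≤ (β, ε) → v b e = v' b e) (hv : B.Good v (β, ε)) :
    B.Good v' (β, ε) :=
  ⟨h β ε le_rfl ▸ hv.1, fun n => (curv_congr n h).symm.trans (hv.2 n)⟩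

open Classical in
theorem rest_mem (n : Eqn) (h : ∀ b e, (b, e) < (β, ε) → ∀ m, v b e m ∈ B.Cl e) :
    B.rest v n β ε ∈ B.Cl ε := by
  have key : B.rest v n β ε = convRest β ε fun b e b' e' =>
      if (b, e) < (β, ε) ∧ (b', e') < (β, ε) ∧ e + e' = ε then
        quadR B.d B.L B.C n (v b e) (v b' e') else 0 :=
    convRest_congr fun b e b' e' _ h2 h3 h4 => by rw [if_pos ⟨h3, h4, h2⟩]
  rw [key]
  refine Submodule.sum_mem _ fun x _ => ?_
  dsimp only
  split_ifs with hx
  · have := B.quadR_mem n (h _ _ hx.1) (h _ _ hx.2.1)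
    rwa [hx.2.2] at this
  · exact zero_mem _

theorem curv_eq (hg : B.Adm 0 0 (v 0 0)) (hq : β ≠ 0 ∨ ε ≠ 0) (hz : v β ε .z = 0) {m : Idx}
    (hm : m ≠ .z) : B.curv v m.eqn β ε = B.lin (v 0 0) (v β ε) m + B.rest v m.eqn β ε := by
  rw [curv, curvCo, conv_split hq, hg.isLeading.quadR_add hz hm]
  have : (fun i => v 0 0 (.k i)) = B.p := funext fun i => hg.k ⟨rfl, rfl⟩ i
  rw [this]
  rfl

theorem curv_eq_zero_of_not_le {n : Eqn} (h : ∀ b e, (b, e) ≤ (β, ε) → SuppLE e (v b e))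
    (hn : ¬n.dg ≤ ε) : B.curv v n β ε = 0 :=
  conv_eq_zero fun b e b' e' h1 h2 => quadR_eq_zero _ _ _ _
    (h b e ⟨h1 ▸ le_self_add, h2 ▸ le_self_add⟩) (h b' e' ⟨h1 ▸ le_add_self, h2 ▸ le_add_self⟩)
    (h2 ▸ hn)

theorem curv_top {n : Eqn} (h : ∀ b e, (b, e) ≤ (β, n.dg) → SuppLE e (v b e))
    (h' : ∀ b e, (b, e) ≤ (β, n.dg) → top e (v b e) = top e (v' b e))
    (h'' : ∀ b e, (b, e) ≤ (β, n.dg) → SuppLE e (v' b e)) :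
    B.curv v n β n.dg = B.curv v' n β n.dg :=
  conv_congr fun b e b' e' h1 h2 => by
    have l1 : (b, e) ≤ (β, n.dg) := ⟨h1 ▸ le_self_add, h2 ▸ le_self_add⟩
    have l2 : (b', e') ≤ (β, n.dg) := ⟨h1 ▸ le_add_self, h2 ▸ le_add_self⟩
    rw [quadR_top _ _ _ n (h b e l1) (h b' e' l2) h2.le,
      quadR_top _ _ _ n (h'' b e l1) (h'' b' e' l2) h2.le, h' b e l1, h' b' e' l2]

theorem curv_sy_top {i : Fin 3} (h : ∀ b e, (b, e) ≤ (β, deg i 0 1) → B.Adm b e (v b e)) :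
    B.curv v (.sy i) β (deg i 0 1) = 0 :=
  conv_eq_zero fun b e b' e' h1 h2 => by
    have l1 := h b e ⟨h1 ▸ le_self_add, h2 ▸ le_self_add⟩
    have l2 := h b' e' ⟨h1 ▸ le_add_self, h2 ▸ le_add_self⟩
    rw [quadR_eq]
    apply List.sum_eq_zero
    intro x hx
    obtain ⟨t, ht, rfl⟩ := List.mem_map.mp hx
    rcases not_dg_le_of_mem_quad_sy ht with rfl | ht
    · simp only [Tm.evR, Tm.ev, l1.z]
      split_ifs with h0
      · rw [h0.2, zero_add] at h2
        simp [l2.sy i h2]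
      · simp
    · exact t.evR_eq_zero _ _ _ l1.supp l2.supp (h2 ▸ ht)

theorem curv_mem (n : Eqn) (h : ∀ b e, (b, e) ≤ (β, ε) → ∀ m, v b e m ∈ B.Cl e) :
    B.curv v n β ε ∈ B.Cl ε := by
  refine Submodule.sum_mem _ fun x hx => Submodule.sum_mem _ fun y hy => ?_
  have h1 := mem_antidiagonal.mp hx
  have h2 := mem_antidiagonal.mp hy
  have := B.quadR_mem n (h x.1 y.1 ⟨h1 ▸ le_self_add, h2 ▸ le_self_add⟩)
    (h x.2 y.2 ⟨h1 ▸ le_add_self, h2 ▸ le_add_self⟩)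
  rwa [h2] at this

/-! ### Propagation of the constraints -/

theorem isFrame (B : Background A) : IsFrame (derPS B.d) (fun a => derPS (B.L a))
    (fun a b c => constPS (B.C a b c)) where
  comm_Z a f := PS_ext fun β ε => by simp [B.rel.comm_d_apply]
  comm a b f := PS_ext fun β ε => by
    simp only [co_derPS, map_add, map_sum, co_constPS_mul, B.rel.comm_apply a b]
  Z_C a b c := derPS_constPS _ (B.d_C a b c)
  skew a b c := PS_ext fun β ε => by
    rw [map_neg, co_constPS, co_constPS, B.rel.skew a b c]
    split_ifs <;> simp
  diag a c := PS_ext fun β ε => by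
    have : B.C a a c = 0 := two_smul_cancel (R := A) <| by linear_combination B.rel.skew a a c
    simp [co_constPS, this]

theorem co_mul_of_mem_vanishing {f g : PS A} (hg : g ∈ vanishing A (LowerSet.Iio (β, ε))) :
    co β ε (f * g) = co 0 0 f * co β ε g := by
  rw [co_mul]
  change conv β ε (fun b e b' e' => co b e f * co b' e' g) = _
  by_cases h : β = 0 ∧ ε = 0
  · simp [h.1, h.2, conv]
  · rw [not_and_or] at h
    have h0 : convRest β ε (fun b e b' e' => co b e f * co b' e' g) =
        convRest β ε fun _ _ _ _ => 0 :=
      convRest_congr fun b e b' e' _ _ _ h2 => by rw [hg b' e' h2, mul_zero]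
    have h1 : co 0 0 g = 0 := hg 0 0 (lt_of_le_of_ne (b := (β, ε)) zero_le fun hc => by
      simp only [Prod.mk.injEq] at hc
      rcases h with h | h
      exacts [h hc.1.symm, h hc.2.symm])
    rw [conv_split h, h0, h1]
    simp [convRest]

theorem propagate (hlow : ∀ q, q < (β, ε) → B.Good v q) (hq : B.Adm β ε (v β ε))
    (hev : ∀ n : Eqn, n.isConstraint = false → B.curv v n β ε = 0)
    (n : Eqn) (htop : n.isConstraint = true → n.dg = ε → B.curv v n β ε = 0) :
    B.curv v n β ε = 0 := by
  classical
  have hadm : ∀ b e, (b, e) ≤ (β, ε) → B.Adm b e (v b e) := by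
    intro b e h
    rcases h.lt_or_eq with h | h
    · exact (hlow (b, e) h).1
    · rw [Prod.mk.injEq] at h
      rw [h.1, h.2]
      exact hq
  by_cases hle : n.dg ≤ ε
  swap
  · exact curv_eq_zero_of_not_le (fun b e h => (hadm b e h).supp) hle
  by_cases hn : n.isConstraint = true
  swap
  · exact hev n (by simpa using hn)
  rcases hle.lt_or_eq with hlt | heq
  swap
  · exact htop hn heq
  set w : Deg → Deg → Idx → A := fun b e => if (b, e) ≤ (β, ε) then v b e else 0 with hw
  have hwv : ∀ b e, (b, e) ≤ (β, ε) → v b e = w b e := fun b e h => by simp only [hw, if_pos h]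
  have hcurv : ∀ (n : Eqn) b e, (b, e) ≤ (β, ε) → co b e (BKL.curv (derPS B.d)
      (fun a => derPS (B.L a)) (fun a b c => constPS (B.C a b c)) (ser w) n) = B.curv v n b e := by
    intro n b e h
    rw [co_curv]
    exact (curv_congr n fun b' e' h' => hwv b' e' (h'.trans h)).symm
  have h00 : ((0, 0) : Deg × Deg) ≤ (β, ε) := ⟨zero_le, zero_le⟩
  have hg := hadm 0 0 h00
  have hpos : ε ≠ 0 := fun h => by
    rw [h] at hlt
    exact absurd hlt not_lt_zero
  have hprop : IsPropagating (derPS B.d) (fun a => derPS (B.L a))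
      (fun a b c => constPS (B.C a b c)) (ser w) (vanishing A (LowerSet.Iic (β, ε)))
      (vanishing A (LowerSet.Iio (β, ε))) (vanishing A (LowerSet.Iic 0)) :=
    { frame := B.isFrame
      z := PS_ext fun b e => by
        have h1 : (1 : PS A) = constPS 1 := by
          have := constPS_intCast (A := A) 1
          simpa using this.symm
        rw [h1, co_constPS]
        simp only [ser, co_ofCo, hw]
        split_ifs with h2 h3 h3
        · rw [(hadm b e h2).z, if_pos h3]
        · rw [(hadm b e h2).z, if_neg h3]
        · rw [h3.1, h3.2] at h2
          exact absurd h00 h2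
        · rfl
      mul := fun x hx c hc => mul_mem_vanishing_Iic _ hx hc
      L_I := fun a c hc => derPS_mem_vanishing _ hc
      L_J := fun a c hc => derPS_mem_vanishing _ hc
      L_M := fun a c hc => derPS_mem_vanishing _ hc
      small := fun m hm b e h => by
        have h' : (b, e) = ((0, 0) : Deg × Deg) := le_antisymm h zero_le
        rw [Prod.mk.injEq] at h'
        rw [h'.1, h'.2]
        simp only [ser, co_ofCo]
        rw [← hwv 0 0 h00]
        exact hg.isLeading.small m hm
      evol := fun n hn b e h => by
        rw [hcurv n b e h]
        rcases LE.le.lt_or_eq (show (b, e) ≤ (β, ε) from h) with h | h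
        · exact (hlow (b, e) h).2 n
        · rw [Prod.mk.injEq] at h
          rw [h.1, h.2]
          exact hev n hn
      constr := fun n _ b e h => by
        rw [hcurv n b e (le_of_lt h)]
        exact (hlow (b, e) h).2 n }
  have hk : ∀ i, co 0 0 (ser w (.k i)) = B.p i := fun i => by
    simp only [ser, co_ofCo]
    rw [← hwv 0 0 h00]
    exact hg.k ⟨rfl, rfl⟩ i
  have hzero : ∀ c ∈ B.Cl ε, B.d c + wt B.p n.dg * c = 0 → c = 0 := fun c hc h =>
    B.solve_unique hlt hc h
  have hmem := curv_mem (B := B) n fun b e h => (hadm b e h).mem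
  have htwo : ∀ x : A, 2 * x = 0 → x = 0 := fun x hx => two_smul_cancel (R := A) (by
    rw [← two_mul]; exact hx)
  have hweak : ∀ (f : PS A) (n : Eqn), co β ε (f * BKL.curv (derPS B.d)
      (fun a => derPS (B.L a)) (fun a b c => constPS (B.C a b c)) (ser w) n) =
      co 0 0 f * B.curv v n β ε := fun f n => by
    rw [co_mul_of_mem_vanishing (f := f) (fun b e h => by
      rw [hcurv n b e (le_of_lt h)]
      exact (hlow (b, e) h).2 n), hcurv n β ε le_rfl]
  have hT : ∀ i, deg i 2 1 < ε → ∀ a, B.curv v (.T i a) β ε = 0 := by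
    intro i hi a
    have h := hprop.torsion i a β ε (le_refl (β, ε))
    rw [map_add, hweak, co_derPS, hcurv _ β ε le_rfl, two_mul] at h
    simp only [map_add, hk] at h
    refine B.solve_unique hi (curv_mem _ fun b e h => (hadm b e h).mem) ?_
    rw [wt_deg]
    push_cast
    linear_combination h
  have hTI : ∀ i, deg i 2 1 < ε → ∀ a, BKL.curv (derPS B.d) (fun a => derPS (B.L a))
      (fun a b c => constPS (B.C a b c)) (ser w) (.T i a) ∈ vanishing A (LowerSet.Iic (β, ε)) := by
    intro i hi a b e h
    rw [hcurv _ b e h]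
    rcases LE.le.lt_or_eq (show (b, e) ≤ (β, ε) from h) with h | h
    · exact (hlow (b, e) h).2 _
    · rw [Prod.mk.injEq] at h
      rw [h.1, h.2]
      exact hT i hi a
  cases n with
  | ham =>
    have h := hprop.ham β ε (le_refl (β, ε))
    rw [co_derPS, hcurv _ β ε le_rfl] at h
    refine hzero _ hmem ?_
    rw [h, Eqn.dg, wt_zero, zero_mul, add_zero]
  | mom i =>
    have h := hprop.mom i β ε (le_refl (β, ε))
    rw [two_mul, map_add, ← two_mul, map_add, hweak, co_derPS, hcurv _ β ε le_rfl] at h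
    simp only [map_add, hk] at h
    refine hzero _ hmem ?_
    rw [Eqn.dg, wt_deg]
    push_cast
    linear_combination htwo _ h
  | skA i =>
    have h := hprop.skA i (hTI i hlt) β ε (le_refl (β, ε))
    rw [map_add, hweak, co_derPS, hcurv _ β ε le_rfl, two_mul] at h
    simp only [map_add, hk] at h
    refine hzero _ hmem ?_
    rw [Eqn.dg, wt_deg]
    push_cast
    linear_combination h
  | skB i =>
    have h := hprop.skB i (hTI i hlt) β ε (le_refl (β, ε))
    rw [map_add, hweak, co_derPS, hcurv _ β ε le_rfl, two_mul] at h
    simp only [map_add, hk] at h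
    refine hzero _ hmem ?_
    rw [Eqn.dg, wt_deg]
    push_cast
    linear_combination h
  | scal i =>
    have h := hprop.scal i (hTI i hlt) β ε (le_refl (β, ε))
    rw [map_add, hweak, co_derPS, hcurv _ β ε le_rfl, two_mul] at h
    simp only [map_add, hk] at h
    refine hzero _ hmem ?_
    rw [Eqn.dg, wt_deg]
    push_cast
    linear_combination h
  | T i a => exact hT i hlt a
  | _ => simp [Eqn.isConstraint] at hn

end Background

end

section
/-! ### Order by order solution -/

section Recursion
variable {ι : Type*} [PartialOrder ι] [WellFoundedLT ι] {T : ι → Type*} [∀ i, Nonempty (T i)]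

theorem exists_forall_of_step (P : (∀ i, T i) → ι → Prop)
    (hloc : ∀ v v' i, (∀ j ≤ i, v j = v' j) → P v i → P v' i)
    (hstep : ∀ v i, (∀ j < i, P v j) → ∃ v', (∀ j < i, v' j = v j) ∧ P v' i) :
    ∃ v, ∀ i, P v i := by
  classical
  let v₀ : ∀ i, T i := fun i => Classical.arbitrary _
  let ext : ∀ i, (∀ j, j < i → T j) → ∀ j, T j := fun i f j => if h : j < i then f j h else v₀ j
  let F : ∀ i, (∀ j, j < i → T j) → T i := fun i f =>
    if h : ∃ v', (∀ j < i, v' j = ext i f j) ∧ P v' i then h.choose i else v₀ i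
  let v : ∀ i, T i := (wellFounded_lt (α := ι)).fix F
  have hv : ∀ i, v i = F i fun j _ => v j := fun i => WellFounded.fix_eq _ F i
  refine ⟨v, fun i => ?_⟩
  induction i using (wellFounded_lt (α := ι)).induction with
  | _ i ih =>
    have hext : ∀ j < i, ext i (fun j _ => v j) j = v j := fun j hj => dif_pos hj
    have hex : ∃ v', (∀ j < i, v' j = ext i (fun j _ => v j) j) ∧ P v' i := by
      obtain ⟨v', h1, h2⟩ := hstep v i ih
      exact ⟨v', fun j hj => (h1 j hj).trans (hext j hj).symm, h2⟩
    refine hloc hex.choose v i (fun j hj => ?_) hex.choose_spec.2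
    rcases hj.lt_or_eq with hj | rfl
    · rw [hex.choose_spec.1 j hj, hext j hj]
    · rw [hv j]
      simp only [F]
      rw [dif_pos hex]

end Recursion

/-- A family with one entry replaced. -/
def upd {N : Type*} (v : Deg → Deg → N) (β ε : Deg) (w : N) : Deg → Deg → N := by
  classical exact fun b e => if b = β ∧ e = ε then w else v b e

theorem upd_self {N : Type*} (v : Deg → Deg → N) (β ε : Deg) (w : N) : upd v β ε w β ε = w :=
  if_pos ⟨rfl, rfl⟩

theorem upd_of_lt {N : Type*} (v : Deg → Deg → N) {β ε b e : Deg} (w : N) (h : (b, e) < (β, ε)) :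
    upd v β ε w b e = v b e :=
  if_neg fun h' => by
    rw [h'.1, h'.2] at h
    exact lt_irrefl _ h

namespace Background
variable {A : Type*} [CommRing A] [Algebra ℝ A] {B : Background A} {v v' : Deg → Deg → Idx → A}
  {β ε : Deg}

theorem drift_mem {g w : Idx → A} (hg : B.Adm 0 0 g) (m : Idx)
    (h : ∀ i a, (Idx.e i a).dg = m.dg → w (.e i a) ∈ B.Cl ε) : m.drift B.L g w ∈ B.Cl ε := by
  have key : ∀ i, (Idx.e i 0).dg = m.dg → ∀ f ∈ B.Cl 0, ∑ a, w (.e i a) * B.L a f ∈ B.Cl ε := by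
    intro i hi f hf
    refine Submodule.sum_mem _ fun a _ => ?_
    have := B.mul_mem (h i a hi) (B.L_mem a hf)
    rwa [add_zero] at this
  cases m with
  | cf i => exact neg_mem (key i rfl _ (add_mem (add_mem (hg.mem _) (hg.mem _)) (hg.mem _)))
  | rA i => exact key i rfl _ (hg.mem _)
  | rB i => exact neg_mem (key i rfl _ (hg.mem _))
  | sc i => exact neg_mem (key i rfl _ (hg.mem _))
  | _ => exact zero_mem _

theorem exists_lead_mul_eq (m : Idx) {κ : Deg} {b : A} (hb : b ∈ B.Cl κ) :
    ∃ b' ∈ B.Cl κ, (m.lead : A) * b' = b := by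
  have h : ∃ r : ℝ, (m.lead : ℝ) * r = 1 := by
    cases m with
    | tw _ | sy _ => exact ⟨2⁻¹, by simp [Idx.lead]⟩
    | _ => exact ⟨1, by simp [Idx.lead]⟩
  obtain ⟨r, hr⟩ := h
  refine ⟨r • b, (B.Cl κ).smul_mem r hb, ?_⟩
  rw [← zsmul_eq_mul, ← Int.cast_smul_eq_zsmul ℝ, smul_smul, hr, one_smul]

theorem exists_lower (hq : β ≠ 0 ∨ ε ≠ 0) (hlow : ∀ q, q < (β, ε) → B.Good v q) (t : Idx → A)
    (ht : ∀ m : Idx, m.dg = ε → t m ∈ B.Cl ε) (hz : t .z = 0)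
    (hsy : ∀ i, (Idx.sy i).dg = ε → t (.sy i) = 0) :
    ∃ w, B.Adm β ε w ∧ (∀ m : Idx, m.dg = ε → w m = t m) ∧
      ∀ m : Idx, m ≠ .z → m.dg < ε → B.lin (v 0 0) w m + B.rest v m.eqn β ε = 0 := by
  classical
  have hg : B.Adm 0 0 (v 0 0) := (hlow (0, 0) (lt_of_le_of_ne zero_le fun hc => by
      rw [Prod.mk.injEq] at hc
      rcases hq with h | h
      exacts [h hc.1.symm, h hc.2.symm])).1
  have hsol : ∀ (m : Idx) (b : A), ∃ c, m.dg < ε → b ∈ B.Cl ε →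
      c ∈ B.Cl ε ∧ m.lead * (B.d c + wt B.p m.rate * c) = b := by
    intro m b
    by_cases h : m.dg < ε ∧ b ∈ B.Cl ε
    · obtain ⟨b', hb', h1⟩ := exists_lead_mul_eq m h.2
      obtain ⟨c, hc, h2⟩ := B.solve (m.rate_le.trans_lt h.1) hb'
      exact ⟨c, fun _ _ => ⟨hc, by rw [h2, h1]⟩⟩
    · exact ⟨0, fun h1 h2 => absurd ⟨h1, h2⟩ h⟩
  choose sol hsol using hsol
  have hrest : ∀ n, B.rest v n β ε ∈ B.Cl ε := fun n => rest_mem n fun b e h => (hlow _ h).1.mem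
  let F : (Idx → A) → Idx → A := fun w m => if m.dg = ε then t m else
    if m.dg < ε ∧ m ≠ .z then sol m (-(m.drift B.L (v 0 0) w + B.rest v m.eqn β ε)) else 0
  have hFe : ∀ w i a, (Idx.e i a).dg < ε → F w (.e i a) ∈ B.Cl ε := by
    intro w i a h
    simp only [F, if_neg h.ne, if_pos (And.intro h (show Idx.e i a ≠ .z by simp))]
    exact (hsol _ _ h (neg_mem (add_mem (zero_mem _) (hrest _)))).1
  have hsol' : ∀ m : Idx, m ≠ .z → m.dg < ε → F (F 0) m ∈ B.Cl ε ∧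
      m.lead * (B.d (F (F 0) m) + wt B.p m.rate * F (F 0) m) =
        -(m.drift B.L (v 0 0) (F 0) + B.rest v m.eqn β ε) := by
    intro m hm h
    have : F (F 0) m = sol m (-(m.drift B.L (v 0 0) (F 0) + B.rest v m.eqn β ε)) := by
      simp only [F, if_neg h.ne, if_pos (And.intro h hm)]
    rw [this]
    exact hsol m _ h (neg_mem (add_mem (drift_mem hg m fun i a hia => hFe 0 i a (hia ▸ h)) (hrest _)))
  refine ⟨F (F 0), ⟨fun m hm => ?_, fun m => ?_, ?_, fun h => ?_, fun h => ?_, fun i h => ?_⟩,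
    fun m h => if_pos h, fun m hm h => ?_⟩
  · simp only [F, if_neg fun h : m.dg = ε => hm h.le,
      if_neg fun h : m.dg < ε ∧ m ≠ .z => hm h.1.le]
  · by_cases h : m.dg = ε
    · rw [show F (F 0) m = t m from if_pos h]
      exact ht m h
    · by_cases h' : m.dg < ε ∧ m ≠ .z
      · exact (hsol' m h'.2 h'.1).1
      · simp only [F, if_neg h, if_neg h']
        exact zero_mem _
  · rw [if_neg (by tauto)]
    by_cases h : (Idx.z).dg = ε
    · rw [← hz]
      exact if_pos h
    · simp [F, h]
  · rcases hq with h' | h'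
    exacts [absurd h.1 h', absurd h.2 h']
  · rcases hq with h' | h'
    exacts [absurd h.1 h', absurd h.2 h']
  · rw [← hsy i h.symm]
    exact if_pos h.symm
  · have he : ∀ i a, (Idx.e i a).dg = m.dg → F (F 0) (.e i a) = F 0 (.e i a) := by
      intro i a hia
      have h1 : (Idx.e i a).dg < ε := hia ▸ h
      simp only [F, if_neg h1.ne, Idx.drift]
    rw [lin, (hsol' m hm h).2, m.drift_congr B.L he]
    ring

/-- Unknowns of top degree have the required time dependence if their equations are satisfied. -/
theorem top_mem {g w : Idx → A} (hg : B.Adm 0 0 g) (r : Eqn → A) (hr : ∀ n, r n ∈ B.Cl ε)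
    (hsy : ∀ i, (Idx.sy i).dg = ε → w (.sy i) = 0) (hz : w .z = 0)
    (h : ∀ m : Idx, m ≠ .z → m.dg = ε → B.lin g w m + r m.eqn = 0) (m : Idx) (hm : m.dg = ε) :
    w m ∈ B.Cl ε := by
  have key : ∀ m : Idx, m ≠ .z → (∀ i, m ≠ .sy i) → m.dg = ε → m.drift B.L g w ∈ B.Cl ε →
      w m ∈ B.Cl ε := by
    intro m h1 h2 h3 h4
    obtain ⟨b, hb, hb'⟩ := exists_lead_mul_eq m (neg_mem (add_mem h4 (hr m.eqn)))
    obtain ⟨b0, hb0, hb0'⟩ := exists_lead_mul_eq m (B.Cl ε).zero_mem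
    have hrate : m.rate = ε := by
      rw [← h3]
      cases m <;> first | rfl | exact absurd rfl (h2 _)
    have hu : IsUnit (m.lead : A) := by
      have h : ∃ r : ℝ, (m.lead : ℝ) * r = 1 := by
        cases m with
        | tw _ | sy _ => exact ⟨2⁻¹, by simp [Idx.lead]⟩
        | _ => exact ⟨1, by simp [Idx.lead]⟩
      obtain ⟨r, hr⟩ := h
      refine IsUnit.of_mul_eq_one (algebraMap ℝ A r) ?_
      rw [← map_intCast (algebraMap ℝ A), ← map_mul, hr, map_one]
    refine B.mem_of_eq hb (hu.mul_left_cancel ?_)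
    have := h m h1 h3
    rw [lin, hrate] at this
    rw [hb']
    linear_combination this
  have he : ∀ i a, (Idx.e i a).dg = ε → w (.e i a) ∈ B.Cl ε := fun i a h =>
    key _ (by simp) (by simp) h (zero_mem _)
  by_cases h1 : m = .z
  · rw [h1, hz]
    exact zero_mem _
  by_cases h2 : ∀ i, m ≠ .sy i
  · exact key m h1 h2 hm (drift_mem hg m fun i a h => he i a (h.trans hm))
  · push Not at h2
    obtain ⟨i, rfl⟩ := h2
    rw [hsy i hm]
    exact zero_mem _

/-- Coefficients of top degree can be changed without affecting the lower equations. -/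
theorem lin_congr {g w w' : Idx → A} {m : Idx} (h : ∀ m' : Idx, m'.dg = m.dg → w m' = w' m') :
    B.lin g w m = B.lin g w' m := by
  rw [lin, lin, h m rfl, m.drift_congr B.L fun i a hi => h _ hi]

theorem good_of_eqs (hq : β ≠ 0 ∨ ε ≠ 0) (hlow : ∀ q, q < (β, ε) → B.Good v q)
    (hadm : B.Adm β ε (v β ε))
    (h : ∀ m : Idx, m ≠ .z → m.dg < ε → B.lin (v 0 0) (v β ε) m + B.rest v m.eqn β ε = 0)
    (htop : ∀ n : Eqn, n.dg = ε → B.curv v n β ε = 0) : B.Good v (β, ε) := by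
  have hall : ∀ b e, (b, e) ≤ (β, ε) → B.Adm b e (v b e) := by
    intro b e h
    rcases h.lt_or_eq with h | h
    · exact (hlow (b, e) h).1
    · rw [Prod.mk.injEq] at h
      rw [h.1, h.2]
      exact hadm
  refine ⟨hadm, fun n => propagate hlow hadm (fun n hn => ?_) n fun _ hn => htop n hn⟩
  by_cases hle : n.dg ≤ ε
  swap
  · exact curv_eq_zero_of_not_le (fun b e h => (hall b e h).supp) hle
  rcases hle.lt_or_eq with hlt | heq
  · obtain ⟨m, hm, rfl⟩ := n.exists_idx hn
    rw [curv_eq (hall 0 0 ⟨zero_le, zero_le⟩) hq (by rw [hadm.z, if_neg (by tauto)]) hm]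
    exact h m hm (by rwa [m.dg_eqn] at hlt)
  · exact htop n heq

theorem top_eq_zero_of_lt {u : Idx → A} : SuppLE ε (top ε u) := fun m hm =>
  top_of_ne (fun h => hm h.le) u

theorem top_top (u : Idx → A) : top ε (top ε u) = top ε u := by
  funext m
  by_cases h : m.dg = ε
  · rw [top_of_eq h]
  · rw [top_of_ne h, top_of_ne h]

theorem top_congr {u w : Idx → A} (h : ∀ m : Idx, m.dg = ε → u m = w m) : top ε u = top ε w := by
  funext m
  by_cases h' : m.dg = ε
  · rw [top_of_eq h', top_of_eq h', h m h']
  · rw [top_of_ne h', top_of_ne h']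

/-- Coefficients of leading terms in the gauge that satisfy the leading equations. -/
structure IsTops (B : Background A) (X : Deg → Idx → A) : Prop where
  z : ∀ β, X β .z = if β = 0 then 1 else 0
  k : ∀ i, X 0 (.k i) = B.p i
  sy : ∀ β i, X β (.sy i) = 0
  eqs : ∀ n β, B.curv (fun b e => top e (X b)) n β n.dg = 0

theorem IsTops.d_s0 {X : Deg → Idx → A} (h : B.IsTops X) : B.d (X 0 .s0) = 0 := by
  have h1 := h.eqs .s0 0
  have ht : ∀ m : Idx, m.dg = 0 → top 0 (X 0) m = X 0 m := fun m hm => top_of_eq hm _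
  have hs : ∀ m : Idx, m.isSmall = true → top 0 (X 0) m = 0 := fun m hm =>
    top_of_ne (Idx.dg_ne_zero hm) _
  have h0 : ∀ F : Deg → Deg → Deg → Deg → A, conv 0 0 F = F 0 0 0 0 := fun F => by simp [conv]
  have hs1 := fun i => hs (.sc i) rfl
  have hs2 := fun i a => hs (.e i a) rfl
  have hs3 := fun i => hs (.rA i) rfl
  have hs4 := fun i => hs (.rB i) rfl
  rw [curv, curvCo, Eqn.dg, h0] at h1
  simpa [quadR, quad, quad.quadS, evL_append, evL_cons, evL_nil, Tm.ev, hs1, hs2, hs3, hs4,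
    ht .z rfl, ht .s0 rfl, h.z] using h1

theorem IsTops.adm_zero {X : Deg → Idx → A} (h : B.IsTops X) : B.Adm 0 0 (top 0 (X 0)) where
  supp := top_eq_zero_of_lt
  mem m := by
    by_cases h' : m.dg = 0
    · rw [top_of_eq h']
      by_cases hm : m.isSmall = true
      · exact absurd h' (Idx.dg_ne_zero hm)
      · cases m with
        | z => exact B.ker_mem (by rw [h.z, if_pos rfl, Derivation.map_one_eq_zero])
        | k i => exact B.ker_mem (by rw [h.k, B.d_p])
        | s0 => exact B.ker_mem h.d_s0
        | _ => simp [Idx.isSmall] at hm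
    · rw [top_of_ne h']
      exact zero_mem _
  z := by rw [top_of_eq (m := .z) (ε := 0) rfl, h.z, if_pos rfl, if_pos ⟨rfl, rfl⟩]
  k _ i := by rw [top_of_eq (m := .k i) (ε := 0) rfl, h.k]
  s0 _ := by rw [top_of_eq (m := .s0) (ε := 0) rfl, h.d_s0]
  sy i hi := by
    have := DFunLike.congr_fun hi (i + 1)
    simp [deg_apply] at this

/-- Existence of a solution with given leading terms. -/
theorem IsTops.exists_good {X : Deg → Idx → A} (h : B.IsTops X) :
    ∃ v, ∀ β ε, B.Good v (β, ε) ∧ top ε (v β ε) = top ε (X β) := by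
  suffices hs : ∃ v : Deg × Deg → Idx → A, ∀ q, B.Good (fun b e => v (b, e)) q ∧
      top q.2 (v q) = top q.2 (X q.1) by
    obtain ⟨v, hv⟩ := hs
    exact ⟨fun b e => v (b, e), fun β ε => hv (β, ε)⟩
  refine exists_forall_of_step (T := fun _ => Idx → A)
    (fun v q => B.Good (fun b e => v (b, e)) q ∧ top q.2 (v q) = top q.2 (X q.1)) ?_ ?_
  · rintro v v' ⟨β, ε⟩ hv ⟨h1, h2⟩
    exact ⟨h1.congr fun b e hbe => hv _ hbe, hv (β, ε) le_rfl ▸ h2⟩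
  rintro v ⟨β, ε⟩ hlow
  set V : Deg → Deg → Idx → A := fun b e => v (b, e) with hV
  suffices hs : ∃ w, B.Good (upd V β ε w) (β, ε) ∧ top ε w = top ε (X β) by
    obtain ⟨w, h1, h2⟩ := hs
    refine ⟨fun q => upd V β ε w q.1 q.2, fun q hq => upd_of_lt V w hq, h1, ?_⟩
    exact (congrArg (top ε) (upd_self V β ε w)).trans h2
  have hlow' : ∀ w, ∀ q, q < (β, ε) → B.Good (upd V β ε w) q := fun w q hq =>
    (hlow q hq).1.congr fun b e hbe => (upd_of_lt V w (hbe.trans_lt hq)).symm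
  have htops : ∀ w n, SuppLE ε w → top ε w = top ε (X β) → n.dg = ε →
      B.curv (upd V β ε w) n β ε = 0 := by
    intro w n hw hw' hn
    subst hn
    rw [curv_top (v' := fun b e => top e (X b)) ?_ ?_ ?_, h.eqs]
    · intro b e hbe
      rcases hbe.lt_or_eq with hbe | hbe
      · rw [upd_of_lt V w hbe]
        exact (hlow _ hbe).1.1.supp
      · rw [Prod.mk.injEq] at hbe
        rw [hbe.1, hbe.2, upd_self]
        exact hw
    · intro b e hbe
      rw [top_top]
      rcases hbe.lt_or_eq with hbe | hbe
      · rw [upd_of_lt V w hbe]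
        exact (hlow _ hbe).2
      · rw [Prod.mk.injEq] at hbe
        rw [hbe.1, hbe.2, upd_self]
        exact hw'
    · exact fun b e _ => top_eq_zero_of_lt
  by_cases hq : β ≠ 0 ∨ ε ≠ 0
  swap
  · push Not at hq
    obtain ⟨rfl, rfl⟩ := hq
    refine ⟨top 0 (X 0), ⟨by rw [upd_self]; exact h.adm_zero, fun n => ?_⟩, top_top _⟩
    by_cases hn : n.dg = 0
    · exact htops _ n top_eq_zero_of_lt (top_top _) hn
    · refine curv_eq_zero_of_not_le (fun b e hbe => ?_) fun h' => hn (le_antisymm h' zero_le)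
      have : (b, e) = ((0, 0) : Deg × Deg) := le_antisymm hbe zero_le
      rw [Prod.mk.injEq] at this
      rw [this.1, this.2, upd_self]
      exact top_eq_zero_of_lt
  have h00 : ((0, 0) : Deg × Deg) < (β, ε) := lt_of_le_of_ne zero_le fun hc => by
      rw [Prod.mk.injEq] at hc
      rcases hq with h | h
      exacts [h hc.1.symm, h hc.2.symm]
  have hg : B.Adm 0 0 (V 0 0) := (hlow _ h00).1.1
  have hrw : ∀ w n, B.rest (upd V β ε w) n β ε = B.rest V n β ε := fun w n =>
    rest_congr n fun b e hbe => upd_of_lt V w hbe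
  have hz : top ε (X β) .z = 0 := by
    by_cases h0 : (Idx.z).dg = ε
    · rw [top_of_eq h0, h.z, if_neg]
      rintro rfl
      exact hq.elim (fun h => h rfl) fun h => h h0.symm
    · exact top_of_ne h0 _
  have hsy : ∀ i, top ε (X β) (.sy i) = 0 := by
    intro i
    by_cases h0 : (Idx.sy i).dg = ε
    · rw [top_of_eq h0, h.sy]
    · exact top_of_ne h0 _
  have ht : ∀ m : Idx, m.dg = ε → top ε (X β) m ∈ B.Cl ε := by
    refine top_mem hg (fun n => B.rest V n β ε) (fun n => rest_mem n fun b e h => (hlow _ h).1.1.mem)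
      (fun i _ => hsy i) hz fun m hm hmε => ?_
    have h1 := htops (top ε (X β)) m.eqn top_eq_zero_of_lt (top_top _) (by rw [m.dg_eqn, hmε])
    have hgu : B.Adm 0 0 (upd V β ε (top ε (X β)) 0 0) := by rwa [upd_of_lt V _ h00]
    rwa [curv_eq hgu hq (by rw [upd_self]; exact hz) hm, upd_self, upd_of_lt V _ h00, hrw] at h1
  obtain ⟨w, hw1, hw2, hw3⟩ := exists_lower hq (fun q hq => (hlow q hq).1) _ ht hz fun i _ => hsy i
  have hwt : top ε w = top ε (X β) := (top_congr hw2).trans (top_top _)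
  refine ⟨w, good_of_eqs hq (hlow' w) (by rwa [upd_self]) (fun m hm hmε => ?_)
    (fun n hn => htops w n hw1.supp hwt hn), hwt⟩
  rw [upd_self, upd_of_lt V _ h00, hrw]
  exact hw3 m hm hmε

end Background

end

section
variable {R : Type*} [CommRing R] [Algebra ℝ R]

/-! ### The action of degree zero elements and the Jacobi identity -/

/-- The conformal relation with indices raised. -/
theorem CDer.conformal' (x : CDer R) (p q : Fin 4) :
    x.mat q p * eta R p p + eta R q q * x.mat p q = 2 * x.w * eta R p q := by
  have h := x.conformal p q
  have e : ∀ a : Fin 4, eta R a a * eta R a a = 1 := fun a => by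
    rw [eta_apply, if_pos rfl]
    split_ifs <;> ring
  by_cases hpq : p = q
  · subst hpq
    rw [if_pos rfl] at h
    exact h
  · rw [if_neg hpq] at h
    rw [eta_apply p q, if_neg hpq]
    linear_combination eta R p p * eta R q q * h - x.mat q p * eta R p p * e q -
      x.mat p q * eta R q q * e p

theorem CDer.add_bracket_sum {ι : Type*} (x : CDer R) (s : Finset ι) (f : ι → CDer R) :
    CDer.bracket x (∑ i ∈ s, f i) = ∑ i ∈ s, CDer.bracket x (f i) :=
  map_sum (AddMonoidHom.mk' (CDer.bracket x) (CDer.bracket_add x)) f s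

theorem CDer.mat_bracket_apply (x y : CDer R) (a b : Fin 4) : (CDer.bracket x y).mat a b =
    (∑ k, x.mat a k * y.mat k b) - (∑ k, y.mat a k * x.mat k b) + x.field (y.mat a b) -
      y.field (x.mat a b) := rfl

/-- The commutator with generators of the conformal Lorentz algebra. -/
theorem bracket_sigma (x : CDer R) (a q : Fin 4) : CDer.bracket x (sigma a q) =
    ∑ k, x.mat k a • sigma k q + ∑ k, x.mat k q • sigma a k - (2 * x.w) • sigma a q := by
  refine CDer.ext' ?_ ?_
  swap
  · ext f
    simp [CDer.field_sum]
  ext d c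
  have hconst : ∀ d c, x.field ((sigma a q : CDer R).mat d c) = 0 := by
    intro d c
    rw [mat_sigma]
    simp only [eta_apply]
    split_ifs <;> simp
  simp only [CDer.mat_bracket_apply, CDer.mat_add, CDer.mat_sub, CDer.mat_sum, CDer.mat_smul,
    Matrix.add_apply, Matrix.sub_apply, Matrix.sum_apply, Matrix.smul_apply, smul_eq_mul, field_sigma, Derivation.coe_zero, Pi.zero_apply, mat_sigma, sub_zero]
  simp only [mat_sigma] at hconst
  rw [hconst]
  have e1 : ∀ (f : Fin 4 → R) (b : Fin 4), ∑ k, f k * (if k = b then 1 else 0) = f b := by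
    intro f b
    simp
  have e2 : ∀ (f : Fin 4 → R) (b : Fin 4), ∑ k, f k * eta R k b = f b * eta R b b := by
    intro f b
    rw [Finset.sum_eq_single b (fun k _ hk => by simp [eta_apply, hk]) (by simp)]
  have e3 : ∀ (f : Fin 4 → R) (b : Fin 4), ∑ k, eta R b k * f k = eta R b b * f b := by
    intro f b
    rw [Finset.sum_eq_single b (fun k _ hk => by simp [eta_apply, hk.symm]) (by simp)]
  have s1 : ∑ k, x.mat d k * (eta R q c * (if k = a then 1 else 0) -
      eta R a c * (if k = q then 1 else 0)) = x.mat d a * eta R q c - x.mat d q * eta R a c := by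
    rw [← e1 (fun k => x.mat d k) a, ← e1 (fun k => x.mat d k) q, Finset.sum_mul, Finset.sum_mul,
      ← Finset.sum_sub_distrib]
    exact Finset.sum_congr rfl fun k _ => by ring
  have s2 : ∑ k, (eta R q k * (if d = a then 1 else 0) - eta R a k * (if d = q then 1 else 0)) *
      x.mat k c = (if d = a then 1 else 0) * (eta R q q * x.mat q c) -
        (if d = q then 1 else 0) * (eta R a a * x.mat a c) := by
    rw [← e3 (fun k => x.mat k c) q, ← e3 (fun k => x.mat k c) a, Finset.mul_sum, Finset.mul_sum,
      ← Finset.sum_sub_distrib]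
    exact Finset.sum_congr rfl fun k _ => by ring
  have s3 : ∑ k, x.mat k a * (eta R q c * (if d = k then 1 else 0) -
      eta R k c * (if d = q then 1 else 0)) = eta R q c * x.mat d a -
        (if d = q then 1 else 0) * (x.mat c a * eta R c c) := by
    rw [← e1 (fun k => x.mat k a) d, ← e2 (fun k => x.mat k a) c, Finset.mul_sum, Finset.mul_sum,
      ← Finset.sum_sub_distrib]
    exact Finset.sum_congr rfl fun k _ => by simp only [eq_comm (a := d)]; ring
  have s4 : ∑ k, x.mat k q * (eta R k c * (if d = a then 1 else 0) -
      eta R a c * (if d = k then 1 else 0)) = (if d = a then 1 else 0) * (x.mat c q * eta R c c) -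
        eta R a c * x.mat d q := by
    rw [← e1 (fun k => x.mat k q) d, ← e2 (fun k => x.mat k q) c, Finset.mul_sum, Finset.mul_sum,
      ← Finset.sum_sub_distrib]
    exact Finset.sum_congr rfl fun k _ => by simp only [eq_comm (a := d)]; ring
  rw [s1, s2, s3, s4]
  have h1 := x.conformal q c
  have h2 := x.conformal a c
  have h3 : ∀ p, (if p = c then 2 * x.w * eta R p p else 0) = 2 * x.w * eta R p c := by
    intro p
    split_ifs with h
    · rw [h]
    · rw [eta_apply, if_neg h, mul_zero]
  rw [h3] at h1 h2
  linear_combination -(if d = a then 1 else 0) * h1 + (if d = q then 1 else 0) * h2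

/-- The action of degree zero elements on degree one elements without scalar field. -/
def br1 (δ : CDer R) (x : Fin 4 → CDer R) (a : Fin 4) : CDer R :=
  CDer.bracket δ (x a) + ∑ j, δ.mat a j • x j

theorem preE_jacobi (δ : CDer R) (x y : Fin 4 → CDer R) (a b : Fin 4) :
    CDer.bracket δ (preE x y a b) + ∑ j, δ.mat a j • preE x y j b + ∑ j, δ.mat b j • preE x y a j =
      preE (br1 δ x) y a b + preE x (br1 δ y) a b := by
  simp only [preE, br1, CDer.bracket_add, CDer.add_bracket, CDer.bracket_smul, CDer.smul_bracket,
    Fin.sum_univ_four, CDer.mat_add, CDer.mat_smul, Matrix.add_apply, Matrix.smul_apply,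
    smul_eq_mul, CDer.mat_bracket_apply, CDer.jacobi δ (x a) (y b), sub_eq_add_neg,
    show ∀ u v : CDer R, CDer.bracket u (-v) = -CDer.bracket u v from fun u v =>
      map_neg (AddMonoidHom.mk' (CDer.bracket u) (CDer.bracket_add u)) v]
  module

/-- The coefficients in the bracket of scalar fields. -/
def phiC (φ ψ : Fin 4 → R) (b q : Fin 4) : R :=
  -3 * (φ b * ψ q + φ q * ψ b) + (∑ c, eta R c c * (φ c * ψ c)) * eta R b q

theorem prePhi_eq (φ ψ : Fin 4 → R) (a b : Fin 4) :
    prePhi φ ψ a b = ∑ q, (phiC φ ψ b q * eta R a a) • sigma a q := rfl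

theorem CDer.act_apply (δ : CDer R) (φ : Fin 4 → R) (a : Fin 4) :
    CDer.act δ φ a = δ.field (φ a) + ∑ j, δ.mat a j * φ j := rfl

theorem field_eta (D : Derivation ℝ R R) (a b : Fin 4) : D (eta R a b) = 0 := by
  rw [eta_apply]
  split_ifs <;> simp

theorem phiC_jacobi (δ : CDer R) (φ ψ : Fin 4 → R) (b q : Fin 4) :
    δ.field (phiC φ ψ b q) + ∑ k, δ.mat q k * phiC φ ψ b k + ∑ j, δ.mat b j * phiC φ ψ j q =
      phiC (CDer.act δ φ) ψ b q + phiC φ (CDer.act δ ψ) b q := by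
  have e : ∀ (f : Fin 4 → R) (b : Fin 4), ∑ k, f k * eta R k b = f b * eta R b b := by
    intro f b
    rw [Finset.sum_eq_single b (fun k _ hk => by simp [eta_apply, hk]) (by simp)]
  have e' : ∀ (f : Fin 4 → R) (b : Fin 4), ∑ k, f k * eta R b k = f b * eta R b b := by
    intro f b
    rw [Finset.sum_eq_single b (fun k _ hk => by simp [eta_apply, hk.symm]) (by simp)]
  have hc := δ.conformal' b q
  have h1 : ∀ f : R, ∑ k, δ.mat q k * (f * eta R b k) = f * (δ.mat q b * eta R b b) := fun f => by
    rw [← e' (fun k => δ.mat q k), Finset.mul_sum]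
    exact Finset.sum_congr rfl fun k _ => by ring
  have h2 : ∀ f : R, ∑ k, δ.mat b k * (f * eta R k q) = f * (δ.mat b q * eta R q q) := fun f => by
    rw [← e (fun k => δ.mat b k), Finset.mul_sum]
    exact Finset.sum_congr rfl fun k _ => by ring
  have hip : (∑ c, eta R c c * (CDer.act δ φ c * ψ c)) + ∑ c, eta R c c * (φ c * CDer.act δ ψ c) =
      δ.field (∑ c, eta R c c * (φ c * ψ c)) + 2 * δ.w * ∑ c, eta R c c * (φ c * ψ c) := by
    have hcc := fun p q => δ.conformal p q
    simp only [Derivation.leibniz, smul_eq_mul, field_eta, mul_zero, add_zero,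
      CDer.act_apply, Fin.sum_univ_four, map_add]
    have c01 := hcc 0 1
    have c02 := hcc 0 2
    have c03 := hcc 0 3
    have c12 := hcc 1 2
    have c13 := hcc 1 3
    have c23 := hcc 2 3
    have c00 := hcc 0 0
    have c11 := hcc 1 1
    have c22 := hcc 2 2
    have c33 := hcc 3 3
    simp only [if_true, if_neg (show (0 : Fin 4) ≠ 1 by decide), if_neg (show (0 : Fin 4) ≠ 2 by decide),
      if_neg (show (0 : Fin 4) ≠ 3 by decide), if_neg (show (1 : Fin 4) ≠ 2 by decide),
      if_neg (show (1 : Fin 4) ≠ 3 by decide), if_neg (show (2 : Fin 4) ≠ 3 by decide)] at c00 c11 c22 c33 c01 c02 c03 c12 c13 c23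
    linear_combination (φ 0 * ψ 1 + φ 1 * ψ 0) * c01 + (φ 0 * ψ 2 + φ 2 * ψ 0) * c02 +
      (φ 0 * ψ 3 + φ 3 * ψ 0) * c03 + (φ 1 * ψ 2 + φ 2 * ψ 1) * c12 +
      (φ 1 * ψ 3 + φ 3 * ψ 1) * c13 + (φ 2 * ψ 3 + φ 3 * ψ 2) * c23 + φ 0 * ψ 0 * c00 +
      φ 1 * ψ 1 * c11 + φ 2 * ψ 2 * c22 + φ 3 * ψ 3 * c33
  simp only [phiC, mul_add (δ.mat _ _), Finset.sum_add_distrib, h1, h2, map_add, Derivation.leibniz,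
    smul_eq_mul, field_eta, mul_zero, zero_add]
  generalize (∑ c, eta R c c * (φ c * ψ c)) = S at *
  generalize (∑ c, eta R c c * (CDer.act δ φ c * ψ c)) = S1 at *
  generalize (∑ c, eta R c c * (φ c * CDer.act δ ψ c)) = S2 at *
  have hn : δ.field (-3) = 0 := by
    have := δ.field.map_intCast (-3)
    simpa using this
  simp only [CDer.act_apply, Fin.sum_univ_four, hn]
  linear_combination S * hc - eta R b q * hip

theorem prePhi_jacobi (δ : CDer R) (φ ψ : Fin 4 → R) (a b : Fin 4) :
    CDer.bracket δ (prePhi φ ψ a b) + ∑ j, δ.mat a j • prePhi φ ψ j b +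
        ∑ j, δ.mat b j • prePhi φ ψ a j =
      prePhi (CDer.act δ φ) ψ a b + prePhi φ (CDer.act δ ψ) a b := by
  have hc : ∀ q, ∑ k, (eta R a a * δ.mat k a + δ.mat a k * eta R k k) • (sigma k q : CDer R) =
      (2 * δ.w * eta R a a) • sigma a q := by
    intro q
    rw [Finset.sum_eq_single a]
    · have := δ.conformal' a a
      congr 1
      linear_combination this
    · intro k _ hk
      have := δ.conformal' a k
      rw [eta_apply a k, if_neg (Ne.symm hk)] at this
      rw [show eta R a a * δ.mat k a + δ.mat a k * eta R k k = 0 by linear_combination this,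
        zero_smul]
    · simp
  have hJ := fun q => congrArg (fun c => (c * eta R a a) • (sigma a q : CDer R))
    (phiC_jacobi δ φ ψ b q)
  simp only [prePhi_eq, CDer.add_bracket_sum, CDer.bracket_smul, bracket_sigma, Derivation.leibniz,
    field_eta, smul_eq_mul, mul_zero, zero_add]
  simp only [Fin.sum_univ_four] at hJ hc ⊢
  linear_combination (norm := module) hJ 0 + hJ 1 + hJ 2 + hJ 3 + phiC φ ψ b 0 • hc 0 +
    phiC φ ψ b 1 • hc 1 + phiC φ ψ b 2 • hc 2 + phiC φ ψ b 3 • hc 3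

/-- The action of degree zero elements on `⋀² W ⊗ CDer(W)`. -/
def brAlt (δ : CDer R) (z : Alt2 R (CDer R)) : Alt2 R (CDer R) :=
  ⟨fun a b => CDer.bracket δ (ent a b z) + ∑ j, δ.mat a j • ent j b z + ∑ j, δ.mat b j • ent a j z, by
    intro a b
    have h : CDer.bracket δ (ent a b z) = -CDer.bracket δ (ent b a z) := by
      rw [ent_swap z]
      exact map_neg (AddMonoidHom.mk' (CDer.bracket δ) (CDer.bracket_add δ)) _
    have h1 : ∀ j, ent j b z = -ent b j z := fun j => ent_swap z j b
    have h2 : ∀ j, ent a j z = -ent j a z := fun j => ent_swap z a j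
    beta_reduce
    rw [h]
    simp only [h1, h2, smul_neg, Finset.sum_neg_distrib]
    abel⟩

theorem ent_brAlt (δ : CDer R) (z : Alt2 R (CDer R)) (a b : Fin 4) : ent a b (brAlt δ z) =
    CDer.bracket δ (ent a b z) + ∑ j, δ.mat a j • ent j b z + ∑ j, δ.mat b j • ent a j z := rfl

/-- The action of degree zero elements on `⋀² W ⊕ ⋀⁴ W`. -/
def brPhi (δ : CDer R) (z : Alt2 R R × R) : Alt2 R R × R :=
  (⟨fun a b => δ.field (ent a b z.1) + ∑ j, δ.mat a j * ent j b z.1 + ∑ j, δ.mat b j * ent a j z.1, by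
    intro a b
    have h : δ.field (ent a b z.1) = -δ.field (ent b a z.1) := by
      rw [ent_swap z.1, map_neg]
    have h1 : ∀ j, ent j b z.1 = -ent b j z.1 := fun j => ent_swap z.1 j b
    have h2 : ∀ j, ent a j z.1 = -ent j a z.1 := fun j => ent_swap z.1 a j
    beta_reduce
    rw [h]
    simp only [h1, h2, mul_neg, Finset.sum_neg_distrib]
    abel⟩, δ.field z.2 + 2 * δ.w * z.2)

theorem ent_brPhi (δ : CDer R) (z : Alt2 R R × R) (a b : Fin 4) : ent a b (brPhi δ z).1 =
    δ.field (ent a b z.1) + ∑ j, δ.mat a j * ent j b z.1 + ∑ j, δ.mat b j * ent a j z.1 := rfl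

theorem Alt2_ext_ent {N : Type*} [AddCommGroup N] [Module R N] {z z' : Alt2 R N}
    (h : ∀ a b, ent a b z = ent a b z') : z = z' :=
  Subtype.ext (funext fun a => funext fun b => h a b)

theorem brAlt_bracket (δ : CDer R) (u v : EPhi1 R) :
    brAlt δ (bracketE u.1 v.1 + bracketPhi u.2 v.2) =
      (bracketE (bracket01 δ u).1 v.1 + bracketPhi (bracket01 δ u).2 v.2) +
        (bracketE u.1 (bracket01 δ v).1 + bracketPhi u.2 (bracket01 δ v).2) := by
  refine Alt2_ext_ent fun a b => ?_
  have h1 := preE_jacobi δ u.1 v.1 a b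
  have h2 := preE_jacobi δ u.1 v.1 b a
  have h3 := prePhi_jacobi δ u.2 v.2 a b
  have h4 := prePhi_jacobi δ u.2 v.2 b a
  simp only [ent_brAlt, map_add, ent_bracketE, ent_bracketPhi, CDer.bracket_add, sub_eq_add_neg,
    show ∀ u v : CDer R, CDer.bracket u (-v) = -CDer.bracket u v from fun u v =>
      map_neg (AddMonoidHom.mk' (CDer.bracket u) (CDer.bracket_add u)) v]
  change _ = preE (br1 δ u.1) v.1 a b + -preE (br1 δ u.1) v.1 b a +
    (prePhi (CDer.act δ u.2) v.2 a b + -prePhi (CDer.act δ u.2) v.2 b a) +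
    (preE u.1 (br1 δ v.1) a b + -preE u.1 (br1 δ v.1) b a +
    (prePhi u.2 (CDer.act δ v.2) a b + -prePhi u.2 (CDer.act δ v.2) b a))
  simp only [Fin.sum_univ_four] at h1 h2 h3 h4 ⊢
  linear_combination (norm := module) h1 - h2 + h3 - h4

theorem act_jacobi (δ x : CDer R) (ψ : Fin 4 → R) (b : Fin 4) :
    δ.field (CDer.act x ψ b) + ∑ j, δ.mat b j * CDer.act x ψ j =
      CDer.act (CDer.bracket δ x) ψ b + CDer.act x (CDer.act δ ψ) b := by
  simp only [CDer.act_apply, CDer.field_bracket, CDer.mat_bracket_apply, Fin.sum_univ_four, map_add,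
    Derivation.leibniz, smul_eq_mul, Derivation.commutator_apply]
  ring

theorem act_br1 (δ : CDer R) (x : Fin 4 → CDer R) (ψ : Fin 4 → R) (a b : Fin 4) :
    CDer.act (br1 δ x a) ψ b = CDer.act (CDer.bracket δ (x a)) ψ b +
      ∑ j, δ.mat a j * CDer.act (x j) ψ b := by
  simp only [br1, CDer.act_apply, CDer.field_add, CDer.mat_add, Fin.sum_univ_four, CDer.field_smul, CDer.mat_smul, Derivation.coe_add, Pi.add_apply,
    Derivation.coe_smul, Pi.smul_apply, smul_eq_mul, Matrix.add_apply, Matrix.smul_apply]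
  ring

theorem brPhi_bracketEPhi (δ : CDer R) (x : Fin 4 → CDer R) (ψ : Fin 4 → R) :
    brPhi δ (bracketEPhi x ψ) = bracketEPhi (br1 δ x) ψ + bracketEPhi x (CDer.act δ ψ) := by
  refine Prod.ext (Alt2_ext_ent (R := R) fun a b => ?_) ?_
  · have h1 := act_jacobi δ (x a) ψ b
    have h2 := act_jacobi δ (x b) ψ a
    simp only [ent_brPhi, ent_bracketEPhi, Prod.fst_add, map_add, act_br1, map_sub]
    simp only [Fin.sum_univ_four] at h1 h2 ⊢
    linear_combination h1 - h2
  · have h1 := fun a => act_jacobi δ (x a) ψ a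
    have hc := fun p q => δ.conformal p q
    change δ.field (bracketEPhi x ψ).2 + 2 * δ.w * (bracketEPhi x ψ).2 = (bracketEPhi (br1 δ x) ψ).2 + (bracketEPhi x (CDer.act δ ψ)).2
    simp only [bracketEPhi_snd, act_br1, map_neg, map_sum, Derivation.leibniz, field_eta, smul_eq_mul,
      mul_zero, add_zero]
    have c01 := hc 0 1
    have c02 := hc 0 2
    have c03 := hc 0 3
    have c12 := hc 1 2
    have c13 := hc 1 3
    have c23 := hc 2 3
    have c00 := hc 0 0
    have c11 := hc 1 1
    have c22 := hc 2 2
    have c33 := hc 3 3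
    simp only [if_true, if_neg (show (0 : Fin 4) ≠ 1 by decide), if_neg (show (0 : Fin 4) ≠ 2 by decide),
      if_neg (show (0 : Fin 4) ≠ 3 by decide), if_neg (show (1 : Fin 4) ≠ 2 by decide),
      if_neg (show (1 : Fin 4) ≠ 3 by decide), if_neg (show (2 : Fin 4) ≠ 3 by decide)]
      at c00 c11 c22 c33 c01 c02 c03 c12 c13 c23
    simp only [Fin.sum_univ_four] at h1 ⊢
    linear_combination -eta R 0 0 * h1 0 - eta R 1 1 * h1 1 - eta R 2 2 * h1 2 - eta R 3 3 * h1 3 +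
      CDer.act (x 0) ψ 0 * c00 + CDer.act (x 1) ψ 1 * c11 + CDer.act (x 2) ψ 2 * c22 +
      CDer.act (x 3) ψ 3 * c33 + (CDer.act (x 0) ψ 1 + CDer.act (x 1) ψ 0) * c01 +
      (CDer.act (x 0) ψ 2 + CDer.act (x 2) ψ 0) * c02 +
      (CDer.act (x 0) ψ 3 + CDer.act (x 3) ψ 0) * c03 +
      (CDer.act (x 1) ψ 2 + CDer.act (x 2) ψ 1) * c12 +
      (CDer.act (x 1) ψ 3 + CDer.act (x 3) ψ 1) * c13 +
      (CDer.act (x 2) ψ 3 + CDer.act (x 3) ψ 2) * c23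

/-! ### Invariance of the ideal -/

theorem brAlt_add (δ : CDer R) (z z' : Alt2 R (CDer R)) :
    brAlt δ (z + z') = brAlt δ z + brAlt δ z' := by
  refine Alt2_ext_ent fun a b => ?_
  simp only [ent_brAlt, map_add, CDer.bracket_add, smul_add, Finset.sum_add_distrib]
  abel

theorem brAlt_smul (δ : CDer R) (f : R) (z : Alt2 R (CDer R)) :
    brAlt δ (f • z) = δ.field f • z + f • brAlt δ z := by
  refine Alt2_ext_ent fun a b => ?_
  simp only [ent_brAlt, map_add, map_smul, CDer.bracket_smul, Fin.sum_univ_four]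
  module

theorem brAlt_weyl (δ : CDer R) {S T : Fin 3 → Fin 3 → R} (hS : ∀ m n, S m n = S n m)
    (hT : ∀ m n, T m n = T n m) (hS0 : ∑ m, S m m = 0) (hT0 : ∑ m, T m m = 0) :
    brAlt δ (weyl S T) ∈ ideal2 R := by
  have hX : ∀ i, ent 0 (ax i) (weyl S T) = cd 0 (S i) (T i) 0 := fun i => X_ofPairs _ _ i
  have hX' : ∀ i, ent (ax i) 0 (weyl S T) = -cd 0 (S i) (T i) 0 := fun i => by rw [ent_swap, hX]
  have hY : ∀ i, ent (ax (i + 1)) (ax (i + 2)) (weyl S T) = cd 0 (T i) (fun n => -S i n) 0 :=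
    fun i => Y_ofPairs _ _ i
  have hY' : ∀ i, ent (ax (i + 2)) (ax (i + 1)) (weyl S T) = -cd 0 (T i) (fun n => -S i n) 0 :=
    fun i => by rw [ent_swap, hY]
  have hY1 : ∀ i, ent (ax i) (ax (i + 1)) (weyl S T) = cd 0 (T (i + 2)) (fun n => -S (i + 2) n) 0 :=
    fun i => by have := hY (i + 2); rwa [cyc21, cyc22] at this
  have hY1' : ∀ i, ent (ax (i + 1)) (ax i) (weyl S T) = -cd 0 (T (i + 2)) (fun n => -S (i + 2) n) 0 :=
    fun i => by rw [ent_swap, hY1]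
  have hY2 : ∀ i, ent (ax (i + 2)) (ax i) (weyl S T) = cd 0 (T (i + 1)) (fun n => -S (i + 1) n) 0 :=
    fun i => by have := hY (i + 1); rwa [cyc12, cyc11] at this
  have hY2' : ∀ i, ent (ax i) (ax (i + 2)) (weyl S T) = -cd 0 (T (i + 1)) (fun n => -S (i + 1) n) 0 :=
    fun i => by rw [ent_swap, hY2]
  have hpX : ∀ i, pX i (brAlt δ (weyl S T)) = CDer.bracket δ (cd 0 (S i) (T i) 0) +
      δ.w • cd 0 (S i) (T i) 0 + δ.b (i + 1) • -cd 0 (T (i + 2)) (fun n => -S (i + 2) n) 0 +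
      δ.b (i + 2) • cd 0 (T (i + 1)) (fun n => -S (i + 1) n) 0 + δ.w • cd 0 (S i) (T i) 0 +
      δ.r (i + 2) • cd 0 (S (i + 1)) (T (i + 1)) 0 - δ.r (i + 1) • cd 0 (S (i + 2)) (T (i + 2)) 0 := by
    intro i
    rw [pX, ent_brAlt, sum_ax_cyc _ i, sum_ax_cyc _ i]
    simp only [hX, hY1', hY2, ent_self, CDer.mat_zero_zero, CDer.mat_zero_ax,
      CDer.mat_ax_zero, CDer.mat_ax_self, CDer.mat_ax_one, CDer.mat_ax_two]
    module
  have hpY : ∀ i, pY i (brAlt δ (weyl S T)) = CDer.bracket δ (cd 0 (T i) (fun n => -S i n) 0) +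
      (2 * δ.w) • cd 0 (T i) (fun n => -S i n) 0 + δ.b (i + 1) • cd 0 (S (i + 2)) (T (i + 2)) 0 -
      δ.b (i + 2) • cd 0 (S (i + 1)) (T (i + 1)) 0 +
      δ.r (i + 2) • cd 0 (T (i + 1)) (fun n => -S (i + 1) n) 0 -
      δ.r (i + 1) • cd 0 (T (i + 2)) (fun n => -S (i + 2) n) 0 := by
    intro i
    rw [pY, ent_brAlt, sum_ax_cyc _ i, sum_ax_cyc _ i]
    simp only [hX, hX', hY, hY1', hY2', ent_self, CDer.mat_ax_zero, CDer.mat_ax_self, CDer.mat_one_ax, CDer.mat_two_ax, CDer.mat_one_two, CDer.mat_two_one]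
    module
  have hS2 : ∀ i, S (i + 2) (i + 2) = -S i i - S (i + 1) (i + 1) := fun i => by
    rw [sum_cyc _ i] at hS0
    linear_combination hS0
  have hT2 : ∀ i, T (i + 2) (i + 2) = -T i i - T (i + 1) (i + 1) := fun i => by
    rw [sum_cyc _ i] at hT0
    linear_combination hT0
  have hSa := fun i => hS (i + 1) i
  have hSb := fun i => hS (i + 2) i
  have hSc := fun i => hS (i + 2) (i + 1)
  have hTa := fun i => hT (i + 1) i
  have hTb := fun i => hT (i + 2) i
  have hTc := fun i => hT (i + 2) (i + 1)
  refine mem_ideal2_of_altCoef (fun n => ?_) (fun i => ?_) fun i => ?_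
  · have key : ∀ i, ∀ n ∈ [Out.ham, .twist, .mom i, .skA i, .skB i, .scal i, .k i, .s0, .tw i, .cf i,
        .sy i, .rA i, .rB i, .sc i, .sk i], altCoef (brAlt δ (weyl S T)) n = 0 := by
      intro i n hn
      simp only [List.mem_cons, List.not_mem_nil, or_false] at hn
      rcases hn with rfl | rfl | rfl | rfl | rfl | rfl | rfl | rfl | rfl | rfl | rfl | rfl | rfl |
        rfl | rfl <;>
      · simp only [altCoef, sum_cyc _ i, hpX, hpY, CDer.w_add, CDer.w_sub, CDer.w_smul, CDer.w_neg,
          CDer.b_add, CDer.b_sub, CDer.b_smul, CDer.b_neg, CDer.r_add, CDer.r_sub, CDer.r_smul,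
          CDer.r_neg, CDer.w_bracket, CDer.b_bracket, CDer.r_bracket, w_cd, b_cd, r_cd, field_cd,
          Derivation.coe_zero, Pi.zero_apply, cyc11, cyc12, cyc21, cyc22, hSa, hSb, hSc, hTa, hTb,
          hTc, hS2 i, hT2 i, map_neg, map_sub, map_zero]
        try ring
    cases n with
    | ham | twist | s0 => exact key 0 _ (by simp)
    | mom i | skA i | skB i | scal i | k i | tw i | cf i | sy i | rA i | rB i | sc i | sk i =>
      exact key i _ (by simp)
  · rw [hpX]
    simp
  · rw [hpY]
    simp

theorem brAlt_mem_ideal2 (δ : CDer R) {z : Alt2 R (CDer R)} (hz : z ∈ ideal2 R) :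
    brAlt δ z ∈ ideal2 R := by
  induction hz using Submodule.span_induction with
  | mem z h =>
    obtain ⟨S, hS, h0, rfl⟩ := h
    rw [ideal2_generator]
    refine brAlt_weyl δ (fun m n => ?_) (fun m n => ?_) ?_ ?_
    · rw [hS.apply]
    · rw [hS.apply]
    · rw [← map_sum, ← Complex.re_sum]
      change algebraMap ℝ R S.trace.re = 0
      simp [h0]
    · rw [Finset.sum_neg_distrib, ← map_sum, ← Complex.im_sum]
      change -algebraMap ℝ R S.trace.im = 0
      simp [h0]
  | zero =>
    have : brAlt δ 0 = 0 := map_zero (AddMonoidHom.mk' (brAlt δ) (brAlt_add δ))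
    rw [this]
    exact zero_mem _
  | add y z _ _ hy hz =>
    rw [brAlt_add]
    exact add_mem hy hz
  | smul c z hz hz' =>
    rw [brAlt_smul]
    exact add_mem (Submodule.smul_mem _ _ hz) (Submodule.smul_mem _ _ hz')

end

section
variable {R : Type*} [CommRing R] [Algebra ℝ R]

/-! ### Gauge transformations -/

section Antidiagonal
variable {N : Type*} [AddCommMonoid N]

theorem sum_antidiagonal_assoc (α : Deg) (F : Deg → Deg → Deg → N) :
    ∑ x ∈ antidiagonal α, ∑ y ∈ antidiagonal x.2, F x.1 y.1 y.2 =
      ∑ x ∈ antidiagonal α, ∑ y ∈ antidiagonal x.1, F y.1 y.2 x.2 := by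
  rw [Finset.sum_sigma', Finset.sum_sigma']
  refine Finset.sum_nbij' (fun x => ⟨(x.1.1 + x.2.1, x.2.2), (x.1.1, x.2.1)⟩)
    (fun x => ⟨(x.2.1, x.2.2 + x.1.2), (x.2.2, x.1.2)⟩) ?_ ?_ ?_ ?_ ?_
  all_goals
    rintro ⟨⟨a, b⟩, c, d⟩ h
    simp only [Finset.mem_sigma, mem_antidiagonal] at h ⊢
    try (obtain ⟨rfl, rfl⟩ := h; simp [add_assoc])

theorem sum_antidiagonal_left_comm (α : Deg) (F : Deg → Deg → Deg → N) :
    ∑ x ∈ antidiagonal α, ∑ y ∈ antidiagonal x.2, F y.1 x.1 y.2 =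
      ∑ x ∈ antidiagonal α, ∑ y ∈ antidiagonal x.2, F x.1 y.1 y.2 := by
  rw [sum_antidiagonal_assoc α fun p q r => F q p r, sum_antidiagonal_assoc α F]
  refine Finset.sum_congr rfl fun x _ => ?_
  rw [← Finset.HasAntidiagonal.map_swap_antidiagonal, Finset.sum_map, Finset.HasAntidiagonal.map_swap_antidiagonal]
  rfl

end Antidiagonal

/-- The bracket of degree one elements before division by the ideal. -/
def pre11 (u v : EPhi1 R) : Alt2 R (CDer R) × (Alt2 R R × R) :=
  (bracketE u.1 v.1 + bracketPhi u.2 v.2, bracketEPhi u.1 v.2 + bracketEPhi v.1 u.2)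

/-- The action of degree zero elements in degree two, before division by the ideal. -/
def br2 (δ : CDer R) (z : Alt2 R (CDer R) × (Alt2 R R × R)) : Alt2 R (CDer R) × (Alt2 R R × R) :=
  (brAlt δ z.1, brPhi δ z.2)

/-- The elements that represent zero. -/
def nullPart (R : Type*) [CommRing R] [Algebra ℝ R] :
    Submodule R (Alt2 R (CDer R) × (Alt2 R R × R)) := (ideal2 R).prod ⊥

/-- The projection to degree two elements. -/
def toE2 : (Alt2 R (CDer R) × (Alt2 R R × R)) →ₗ[R] EPhi2 R :=
  LinearMap.prodMap (ideal2 R).mkQ LinearMap.id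

theorem toE2_eq_zero {z : Alt2 R (CDer R) × (Alt2 R R × R)} : toE2 z = 0 ↔ z ∈ nullPart R := by
  rw [nullPart, Submodule.mem_prod, Submodule.mem_bot, toE2, LinearMap.prodMap_apply, Prod.mk_eq_zero,
    Submodule.mkQ_apply, Submodule.Quotient.mk_eq_zero]
  rfl

theorem brPhi_add (δ : CDer R) (z z' : Alt2 R R × R) :
    brPhi δ (z + z') = brPhi δ z + brPhi δ z' := by
  refine Prod.ext (Alt2_ext_ent (R := R) fun a b => ?_) ?_
  · simp only [ent_brPhi, Prod.fst_add, map_add, mul_add, Finset.sum_add_distrib]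
    abel
  · simp only [brPhi, Prod.snd_add, map_add, mul_add]
    abel

theorem br2_add (δ : CDer R) (z z' : Alt2 R (CDer R) × (Alt2 R R × R)) :
    br2 δ (z + z') = br2 δ z + br2 δ z' := Prod.ext (brAlt_add _ _ _) (brPhi_add _ _ _)

theorem br2_sum {ι : Type*} (δ : CDer R) (s : Finset ι)
    (f : ι → Alt2 R (CDer R) × (Alt2 R R × R)) : br2 δ (∑ i ∈ s, f i) = ∑ i ∈ s, br2 δ (f i) :=
  map_sum (AddMonoidHom.mk' (br2 δ) (br2_add δ)) f s

theorem br2_zero_left (z : Alt2 R (CDer R) × (Alt2 R R × R)) : br2 (0 : CDer R) z = 0 := by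
  refine Prod.ext (Alt2_ext_ent (R := R) fun a b => ?_)
    (Prod.ext (Alt2_ext_ent (R := R) fun a b => ?_) ?_)
  · have : CDer.bracket 0 (ent a b z.1) = 0 := map_zero
      (AddMonoidHom.mk' (fun x => CDer.bracket x (ent a b z.1)) fun x y => CDer.add_bracket x y _)
    change ent a b (brAlt 0 z.1) = 0
    simp [ent_brAlt, this]
  · change ent a b (brPhi 0 z.2).1 = 0
    simp [ent_brPhi]
  · change (0 : CDer R).field z.2.2 + 2 * (0 : CDer R).w * z.2.2 = 0
    simp

theorem br2_mem {δ : CDer R} {z : Alt2 R (CDer R) × (Alt2 R R × R)} (hz : z ∈ nullPart R) :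
    br2 δ z ∈ nullPart R := by
  rw [nullPart, Submodule.mem_prod, Submodule.mem_bot] at hz ⊢
  refine ⟨brAlt_mem_ideal2 δ hz.1, ?_⟩
  change brPhi δ z.2 = 0
  rw [hz.2]
  exact map_zero (AddMonoidHom.mk' (brPhi δ) (brPhi_add δ))

theorem bracketE_add_left (x x' y : Fin 4 → CDer R) :
    bracketE (x + x') y = bracketE x y + bracketE x' y := by
  refine Alt2_ext_ent fun a b => ?_
  simp only [map_add, ent_bracketE, preE, Pi.add_apply, CDer.add_bracket, CDer.mat_add, Matrix.add_apply, add_smul, smul_add, Finset.sum_add_distrib]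
  abel

theorem bracketE_add_right (x y y' : Fin 4 → CDer R) :
    bracketE x (y + y') = bracketE x y + bracketE x y' := by
  refine Alt2_ext_ent fun a b => ?_
  simp only [map_add, ent_bracketE, preE, Pi.add_apply, CDer.bracket_add,
    CDer.mat_add, Matrix.add_apply, add_smul, smul_add, Finset.sum_add_distrib]
  abel

theorem bracketPhi_add_left (φ φ' ψ : Fin 4 → R) :
    bracketPhi (φ + φ') ψ = bracketPhi φ ψ + bracketPhi φ' ψ := by
  simp only [bracketPhi, ← Finset.sum_add_distrib, ← add_smul]
  refine Finset.sum_congr rfl fun i _ => Finset.sum_congr rfl fun p _ =>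
    Finset.sum_congr rfl fun q _ => ?_
  congr 1
  simp only [Pi.add_apply, add_mul, mul_add, Finset.sum_add_distrib]
  ring

theorem bracketPhi_add_right (φ ψ ψ' : Fin 4 → R) :
    bracketPhi φ (ψ + ψ') = bracketPhi φ ψ + bracketPhi φ ψ' := by
  simp only [bracketPhi, ← Finset.sum_add_distrib, ← add_smul]
  refine Finset.sum_congr rfl fun i _ => Finset.sum_congr rfl fun p _ =>
    Finset.sum_congr rfl fun q _ => ?_
  congr 1
  simp only [Pi.add_apply, add_mul, mul_add, Finset.sum_add_distrib]
  ring

theorem bracketEPhi_add_left (x x' : Fin 4 → CDer R) (ψ : Fin 4 → R) :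
    bracketEPhi (x + x') ψ = bracketEPhi x ψ + bracketEPhi x' ψ := by
  refine Prod.ext (Alt2_ext_ent (R := R) fun a b => ?_) ?_
  · simp only [Prod.fst_add, map_add, ent_bracketEPhi, CDer.act_apply, Pi.add_apply, CDer.field_add,
      CDer.mat_add, Derivation.coe_add, Matrix.add_apply, add_mul, Finset.sum_add_distrib]
    ring
  · simp only [Prod.snd_add, bracketEPhi_snd, CDer.act_apply, Pi.add_apply, CDer.field_add,
      CDer.mat_add, Derivation.coe_add, Matrix.add_apply, add_mul, mul_add, Finset.sum_add_distrib]
    ring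

theorem bracketEPhi_add_right (x : Fin 4 → CDer R) (ψ ψ' : Fin 4 → R) :
    bracketEPhi x (ψ + ψ') = bracketEPhi x ψ + bracketEPhi x ψ' := by
  refine Prod.ext (Alt2_ext_ent (R := R) fun a b => ?_) ?_
  · simp only [Prod.fst_add, map_add, ent_bracketEPhi, CDer.act_apply, Pi.add_apply, mul_add,
      Finset.sum_add_distrib]
    ring
  · simp only [Prod.snd_add, bracketEPhi_snd, CDer.act_apply, Pi.add_apply, map_add, mul_add,
      Finset.sum_add_distrib]
    ring

theorem pre11_add_left (u u' v : EPhi1 R) : pre11 (u + u') v = pre11 u v + pre11 u' v := by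
  refine Prod.ext ?_ ?_
  · simp only [pre11, Prod.fst_add, Prod.snd_add, bracketE_add_left, bracketPhi_add_left]
    abel
  · simp only [pre11, Prod.fst_add, Prod.snd_add, bracketEPhi_add_left, bracketEPhi_add_right]
    abel

theorem pre11_add_right (u v v' : EPhi1 R) : pre11 u (v + v') = pre11 u v + pre11 u v' := by
  refine Prod.ext ?_ ?_
  · simp only [pre11, Prod.fst_add, Prod.snd_add, bracketE_add_right, bracketPhi_add_right]
    abel
  · simp only [pre11, Prod.fst_add, Prod.snd_add, bracketEPhi_add_left, bracketEPhi_add_right]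
    abel

/-- The bracket before division by the ideal, as a biadditive map. -/
def pre11Hom : EPhi1 R →+ EPhi1 R →+ Alt2 R (CDer R) × (Alt2 R R × R) :=
  AddMonoidHom.mk' (fun u => AddMonoidHom.mk' (pre11 u) (pre11_add_right u)) fun u u' => by
    ext1 v
    exact pre11_add_left u u' v

/-- The bracket of degree one elements, as a biadditive map. -/
def br11 : EPhi1 R →+ EPhi1 R →+ EPhi2 R :=
  (AddMonoidHom.compHom toE2.toAddMonoidHom).comp pre11Hom

theorem br11_apply (u v : EPhi1 R) : br11 u v = bracket11 u v := rfl

theorem bracket01_eq (δ : CDer R) (u : EPhi1 R) : bracket01 δ u = (br1 δ u.1, CDer.act δ u.2) := rfl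

theorem bracket01_add (δ : CDer R) (u v : EPhi1 R) :
    bracket01 δ (u + v) = bracket01 δ u + bracket01 δ v := by
  refine Prod.ext (funext fun a => ?_) (funext fun a => ?_)
  · simp only [bracket01_eq, br1, Prod.fst_add, Pi.add_apply, CDer.bracket_add, smul_add,
      Finset.sum_add_distrib]
    abel
  · simp only [bracket01_eq, CDer.act_apply, Prod.snd_add, Pi.add_apply, map_add, mul_add,
      Finset.sum_add_distrib]
    ring

theorem add_bracket01 (δ δ' : CDer R) (u : EPhi1 R) :
    bracket01 (δ + δ') u = bracket01 δ u + bracket01 δ' u := by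
  refine Prod.ext (funext fun a => ?_) (funext fun a => ?_)
  · simp only [bracket01_eq, br1, Prod.fst_add, Pi.add_apply, CDer.add_bracket, CDer.mat_add,
      Matrix.add_apply, add_smul, Finset.sum_add_distrib]
    abel
  · simp only [bracket01_eq, CDer.act_apply, Prod.snd_add, Pi.add_apply, CDer.field_add, CDer.mat_add,
      Derivation.coe_add, Matrix.add_apply, add_mul, Finset.sum_add_distrib]
    ring

/-- The action of degree zero on degree one elements, as a biadditive map. -/
def br01 : CDer R →+ EPhi1 R →+ EPhi1 R :=
  AddMonoidHom.mk' (fun δ => AddMonoidHom.mk' (bracket01 δ) (bracket01_add δ)) fun δ δ' => by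
    ext1 v
    exact add_bracket01 δ δ' v

theorem bracket01_zero (δ : CDer R) : bracket01 δ (0 : EPhi1 R) = 0 := map_zero (br01 δ)
theorem zero_bracket01 (u : EPhi1 R) : bracket01 (0 : CDer R) u = 0 :=
  congrArg (fun f : EPhi1 R →+ EPhi1 R => f u) (map_zero (br01 (R := R)))

theorem bracket01_real (δ : CDer R) (c : ℝ) (u : EPhi1 R) :
    bracket01 δ (algebraMap ℝ R c • u) = algebraMap ℝ R c • bracket01 δ u := by
  refine Prod.ext (funext fun a => ?_) (funext fun a => ?_)
  · simp only [bracket01_eq, br1, Prod.smul_fst, Pi.smul_apply, CDer.bracket_smul,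
      Derivation.map_algebraMap, zero_smul, zero_add, Fin.sum_univ_four]
    module
  · simp only [bracket01_eq, CDer.act_apply, Prod.smul_snd, Pi.smul_apply, smul_eq_mul,
      Derivation.leibniz, Derivation.map_algebraMap, mul_zero, add_zero, Fin.sum_univ_four]
    ring

theorem br2_pre11 (δ : CDer R) (u v : EPhi1 R) :
    br2 δ (pre11 u v) = pre11 (bracket01 δ u) v + pre11 u (bracket01 δ v) := by
  refine Prod.ext (brAlt_bracket δ u v) ?_
  change brPhi δ (bracketEPhi u.1 v.2 + bracketEPhi v.1 u.2) =
    (bracketEPhi (br1 δ u.1) v.2 + bracketEPhi v.1 (CDer.act δ u.2)) +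
      (bracketEPhi u.1 (CDer.act δ v.2) + bracketEPhi (br1 δ v.1) u.2)
  rw [brPhi_add, brPhi_bracketEPhi, brPhi_bracketEPhi]
  abel

section Series
variable (a : Deg → CDer R)

/-- The bracket of series before division by the ideal. -/
def serPre (y z : Deg → EPhi1 R) (α : Deg) : Alt2 R (CDer R) × (Alt2 R R × R) :=
  ∑ b ∈ antidiagonal α, pre11Hom (y b.1) (z b.2)

/-- The adjoint action on series of degree two elements. -/
def serBr2 (z : Deg → Alt2 R (CDer R) × (Alt2 R R × R)) (α : Deg) :
    Alt2 R (CDer R) × (Alt2 R R × R) := ∑ b ∈ antidiagonal α, br2 (a b.1) (z b.2)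

theorem serBr2_serPre (y z : Deg → EPhi1 R) (α : Deg) : serBr2 a (serPre y z) α =
    serPre (seriesBracket01 a y) z α + serPre y (seriesBracket01 a z) α := by
  have h1 : serPre (seriesBracket01 a y) z α = ∑ x ∈ antidiagonal α, ∑ e ∈ antidiagonal x.2,
      pre11 (bracket01 (a x.1) (y e.1)) (z e.2) := by
    rw [sum_antidiagonal_assoc α fun p q r => pre11 (bracket01 (a p) (y q)) (z r)]
    simp only [serPre, seriesBracket01, map_sum, AddMonoidHom.finsetSum_apply]
    rfl
  have h2 : serPre y (seriesBracket01 a z) α = ∑ x ∈ antidiagonal α, ∑ e ∈ antidiagonal x.2,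
      pre11 (y e.1) (bracket01 (a x.1) (z e.2)) := by
    rw [← sum_antidiagonal_left_comm α fun p q r => pre11 (y q) (bracket01 (a p) (z r))]
    simp only [serPre, seriesBracket01, map_sum]
    rfl
  rw [h1, h2, ← Finset.sum_add_distrib]
  refine Finset.sum_congr rfl fun x _ => ?_
  rw [← Finset.sum_add_distrib, serPre, br2_sum]
  exact Finset.sum_congr rfl fun e _ => br2_pre11 _ _ _

/-- The summands of the exponential series. -/
def expTerm (y : Deg → EPhi1 R) (n : ℕ) (α : Deg) : EPhi1 R :=
  algebraMap ℝ R ((n.factorial : ℝ)⁻¹) • ((seriesBracket01 a)^[n] y) α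

theorem seriesBracket01_expTerm (y : Deg → EPhi1 R) (n : ℕ) (α : Deg) :
    seriesBracket01 a (expTerm a y n) α = (n + 1) • expTerm a y (n + 1) α := by
  have h1 : seriesBracket01 a (expTerm a y n) α =
      algebraMap ℝ R ((n.factorial : ℝ)⁻¹) • ((seriesBracket01 a)^[n + 1] y) α := by
    rw [Function.iterate_succ_apply']
    simp only [seriesBracket01, expTerm, bracket01_real, Finset.smul_sum]
  rw [h1, expTerm, ← Nat.cast_smul_eq_nsmul R, smul_smul, ← map_natCast (algebraMap ℝ R), ← map_mul]
  congr 2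
  rw [Nat.factorial_succ]
  push_cast
  field_simp

variable {a}

theorem iterate_eq_zero (ha : a 0 = 0) (y : Deg → EPhi1 R) {n : ℕ} {α : Deg} (h : α.degree < n) :
    ((seriesBracket01 a)^[n] y) α = 0 := by
  induction n generalizing α with
  | zero => exact absurd h (Nat.not_lt_zero _)
  | succ n ih =>
    rw [Function.iterate_succ_apply', seriesBracket01]
    refine Finset.sum_eq_zero fun b hb => ?_
    rw [mem_antidiagonal] at hb
    by_cases hb1 : b.1 = 0
    · rw [hb1, ha, zero_bracket01]
    · rw [ih, bracket01_zero]
      have h1 : b.1.degree ≠ 0 := fun h0 => hb1 ((Finsupp.degree_eq_zero_iff _).mp h0)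
      have h2 : α.degree = b.1.degree + b.2.degree := by rw [← hb, map_add]
      omega

theorem expTerm_eq_zero (ha : a 0 = 0) (y : Deg → EPhi1 R) {n : ℕ} {α : Deg} (h : α.degree < n) :
    expTerm a y n α = 0 := by
  rw [expTerm, iterate_eq_zero ha y h, smul_zero]

theorem expAct_eq_sum (ha : a 0 = 0) (y : Deg → EPhi1 R) {N : ℕ} {α : Deg} (h : α.degree < N) :
    expAct a y α = ∑ k ∈ Finset.range N, expTerm a y k α := by
  refine Finset.sum_subset (Finset.range_subset_range.mpr h) fun k _ hk => ?_
  rw [Finset.mem_range] at hk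
  exact expTerm_eq_zero ha y (by omega)

/-- The terms of the exponential series for the bracket. -/
def expPre (a : Deg → CDer R) (y : Deg → EPhi1 R) (n : ℕ) (α : Deg) :
    Alt2 R (CDer R) × (Alt2 R R × R) :=
  ∑ k ∈ antidiagonal n, serPre (expTerm a y k.1) (expTerm a y k.2) α

theorem serPre_nsmul_left (n : ℕ) (y z : Deg → EPhi1 R) (α : Deg) :
    serPre (fun β => n • y β) z α = n • serPre y z α := by
  simp only [serPre, map_nsmul, AddMonoidHom.nsmul_apply, Finset.smul_sum]

theorem serPre_nsmul_right (n : ℕ) (y z : Deg → EPhi1 R) (α : Deg) :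
    serPre y (fun β => n • z β) α = n • serPre y z α := by
  simp only [serPre, map_nsmul, Finset.smul_sum]

theorem serBr2_expPre (y : Deg → EPhi1 R) (n : ℕ) (α : Deg) :
    serBr2 a (expPre a y n) α = (n + 1) • expPre a y (n + 1) α := by
  have h1 : serBr2 a (expPre a y n) α =
      ∑ k ∈ antidiagonal n, serBr2 a (serPre (expTerm a y k.1) (expTerm a y k.2)) α := by
    simp only [serBr2]
    rw [Finset.sum_comm]
    exact Finset.sum_congr rfl fun b _ => br2_sum _ _ _
  have h2 : ∀ k, seriesBracket01 a (expTerm a y k) = fun β => (k + 1) • expTerm a y (k + 1) β :=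
    fun k => funext fun β => seriesBracket01_expTerm a y k β
  set f : ℕ → ℕ → Alt2 R (CDer R) × (Alt2 R R × R) :=
    fun k l => serPre (expTerm a y k) (expTerm a y l) α with hf
  have h3 : serBr2 a (expPre a y n) α = ∑ k ∈ antidiagonal n, (k.1 + 1) • f (k.1 + 1) k.2 +
      ∑ k ∈ antidiagonal n, (k.2 + 1) • f k.1 (k.2 + 1) := by
    rw [h1, ← Finset.sum_add_distrib]
    refine Finset.sum_congr rfl fun k _ => ?_
    rw [serBr2_serPre, h2, h2, serPre_nsmul_left, serPre_nsmul_right]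
  have h4 := Finset.Nat.sum_antidiagonal_succ (n := n) (f := fun k => k.1 • f k.1 k.2)
  have h5 := Finset.Nat.sum_antidiagonal_succ' (n := n) (f := fun k => k.2 • f k.1 k.2)
  simp only [zero_smul, zero_add] at h4 h5
  rw [h3, ← h4, ← h5, ← Finset.sum_add_distrib, expPre, Finset.smul_sum]
  refine Finset.sum_congr rfl fun k hk => ?_
  rw [← add_smul, mem_antidiagonal.mp hk]

theorem nullPart_of_nsmul {z : Alt2 R (CDer R) × (Alt2 R R × R)} {n : ℕ}
    (h : (n + 1) • z ∈ nullPart R) : z ∈ nullPart R := by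
  have h1 := (nullPart R).smul_mem (algebraMap ℝ R ((n + 1 : ℕ) : ℝ)⁻¹) h
  rw [← Nat.cast_smul_eq_nsmul R, smul_smul, ← map_natCast (algebraMap ℝ R), ← map_mul,
    inv_mul_cancel₀ (by positivity), map_one, one_smul] at h1
  exact h1

theorem expPre_mem (ha : a 0 = 0) {y : Deg → EPhi1 R} {α : Deg}
    (h : ∀ β < α, serPre y y β ∈ nullPart R) :
    (∀ n, ∀ β < α, expPre a y n β ∈ nullPart R) ∧ ∀ n, expPre a y (n + 1) α ∈ nullPart R := by
  have hstep : ∀ n β, (∀ β' < β, expPre a y n β' ∈ nullPart R) →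
      expPre a y (n + 1) β ∈ nullPart R := by
    intro n β hn
    refine nullPart_of_nsmul (n := n) ?_
    rw [← serBr2_expPre]
    refine Submodule.sum_mem _ fun b hb => ?_
    rw [mem_antidiagonal] at hb
    by_cases hb1 : b.1 = 0
    · rw [hb1, ha, br2_zero_left]
      exact zero_mem _
    · refine br2_mem (hn _ (lt_of_le_of_ne (hb ▸ le_add_self) fun hc => hb1 ?_))
      rw [hc] at hb
      simpa using hb
  have hlow : ∀ n, ∀ β < α, expPre a y n β ∈ nullPart R := by
    intro n
    induction n with
    | zero =>
      intro β hβ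
      have h0 : expTerm a y 0 = y := funext fun β => by simp [expTerm]
      simpa [expPre, h0] using h β hβ
    | succ n ih => exact fun β hβ => hstep n β fun β' hβ' => ih β' (hβ'.trans hβ)
  exact ⟨hlow, fun n => hstep n α (hlow n)⟩

theorem toE2_serPre (y z : Deg → EPhi1 R) (α : Deg) : toE2 (serPre y z α) = seriesBracket11 y z α := by
  rw [serPre, map_sum]
  rfl

/-- Gauge transformations preserve the lowest order of the curvature. -/
theorem seriesBracket11_expAct (ha : a 0 = 0) {y : Deg → EPhi1 R} {α : Deg}
    (h : ∀ β < α, seriesBracket11 y y β = 0) :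
    seriesBracket11 (expAct a y) (expAct a y) α = seriesBracket11 y y α := by
  have h' : ∀ β < α, serPre y y β ∈ nullPart R := fun β hβ => by
    rw [← toE2_eq_zero, toE2_serPre, h β hβ]
  set N := α.degree + 1 with hN
  set f : ℕ → ℕ → Alt2 R (CDer R) × (Alt2 R R × R) :=
    fun k l => serPre (expTerm a y k) (expTerm a y l) α with hf
  have h1 : serPre (expAct a y) (expAct a y) α = ∑ k ∈ Finset.range N, ∑ l ∈ Finset.range N, f k l := by
    have : serPre (expAct a y) (expAct a y) α =
        serPre (fun β => ∑ k ∈ Finset.range N, expTerm a y k β)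
          (fun β => ∑ k ∈ Finset.range N, expTerm a y k β) α := by
      refine Finset.sum_congr rfl fun b hb => ?_
      rw [mem_antidiagonal] at hb
      have hd : α.degree = b.1.degree + b.2.degree := by rw [← hb, map_add]
      rw [expAct_eq_sum ha y (N := N) (by omega), expAct_eq_sum ha y (N := N) (by omega)]
    rw [this]
    simp only [serPre, map_sum, AddMonoidHom.finsetSum_apply, hf]
    calc _ = ∑ b ∈ antidiagonal α, ∑ k ∈ Finset.range N, ∑ l ∈ Finset.range N,
          pre11Hom (expTerm a y k b.1) (expTerm a y l b.2) :=
          Finset.sum_congr rfl fun b _ => Finset.sum_comm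
      _ = _ := by
          rw [Finset.sum_comm]
          exact Finset.sum_congr rfl fun k _ => Finset.sum_comm
  have h0 : ∀ k l, N ≤ k + l → f k l = 0 := by
    intro k l hkl
    refine Finset.sum_eq_zero fun b hb => ?_
    rw [mem_antidiagonal] at hb
    have hd : α.degree = b.1.degree + b.2.degree := by rw [← hb, map_add]
    by_cases hk : b.1.degree < k
    · rw [expTerm_eq_zero ha y hk, map_zero]
      rfl
    · rw [expTerm_eq_zero ha y (n := l) (by omega), map_zero]
  have h2 : ∑ k ∈ Finset.range N, ∑ l ∈ Finset.range N, f k l =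
      ∑ n ∈ Finset.range N, expPre a y n α := by
    have h3 := Finset.sum_range_diag_flip N f
    have h4 : ∀ n, ∑ k ∈ Finset.range (n + 1), f k (n - k) = expPre a y n α := fun n =>
      (Finset.Nat.sum_antidiagonal_eq_sum_range_succ f n).symm
    simp only [h4] at h3
    rw [h3]
    refine Finset.sum_congr rfl fun k _ => ?_
    refine (Finset.sum_subset (Finset.range_subset_range.mpr (Nat.sub_le N k)) fun l _ hl => ?_).symm
    rw [Finset.mem_range] at hl
    exact h0 k l (by omega)
  rw [← toE2_serPre, ← toE2_serPre, ← sub_eq_zero, ← map_sub, toE2_eq_zero, h1, h2,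
    Finset.sum_range_succ']
  have h3 : expPre a y 0 α = serPre y y α := by
    have h0 : expTerm a y 0 = y := funext fun β => by simp [expTerm]
    simp [expPre, h0]
  rw [h3, add_sub_cancel_right]
  exact Submodule.sum_mem _ fun n _ => (expPre_mem ha h').2 n

/-! ### The dependence on the leading terms -/

theorem iterate_congr {a' : Deg → CDer R} {y y' : Deg → EPhi1 R} {α : Deg}
    (ha : ∀ β ≤ α, a β = a' β) (hy : ∀ β ≤ α, y β = y' β) (n : ℕ) :
    ∀ β ≤ α, ((seriesBracket01 a)^[n] y) β = ((seriesBracket01 a')^[n] y') β := by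
  induction n with
  | zero => exact hy
  | succ n ih =>
    intro β hβ
    rw [Function.iterate_succ_apply', Function.iterate_succ_apply']
    refine Finset.sum_congr rfl fun b hb => ?_
    rw [mem_antidiagonal] at hb
    rw [ha b.1 (le_trans (hb ▸ le_self_add) hβ), ih b.2 (le_trans (hb ▸ le_add_self) hβ)]

theorem expAct_congr {a' : Deg → CDer R} {y y' : Deg → EPhi1 R} {α : Deg}
    (ha : ∀ β ≤ α, a β = a' β) (hy : ∀ β ≤ α, y β = y' β) : expAct a y α = expAct a' y' α :=
  Finset.sum_congr rfl fun n _ => by rw [iterate_congr ha hy n α le_rfl]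

theorem expAct_change {a' : Deg → CDer R} {y y' : Deg → EPhi1 R} {α : Deg} (hα : α ≠ 0) (ha0 : a 0 = 0)
    (ha : ∀ β < α, a β = a' β) (hy : ∀ β < α, y β = y' β) :
    expAct a' y' α = expAct a y α + (y' α - y α) + bracket01 (a' α - a α) (y 0) := by
  have hpos : 0 < α := pos_iff_ne_zero.mpr hα
  have hit : ∀ n, ∀ β < α, ((seriesBracket01 a')^[n] y') β = ((seriesBracket01 a)^[n] y) β :=
    fun n β hβ => (iterate_congr (fun b hb => ha b (hb.trans_lt hβ))
      (fun b hb => hy b (hb.trans_lt hβ)) n β le_rfl).symm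
  have ha0' : a' 0 = 0 := by rw [← ha 0 hpos, ha0]
  have h1 : ∀ n, ((seriesBracket01 a')^[n + 1] y') α = ((seriesBracket01 a)^[n + 1] y) α +
      bracket01 (a' α - a α) (((seriesBracket01 a)^[n] y) 0) := by
    intro n
    rw [Function.iterate_succ_apply', Function.iterate_succ_apply', ← sub_eq_iff_eq_add',
      seriesBracket01, seriesBracket01, ← Finset.sum_sub_distrib,
      Finset.sum_eq_single (α, (0 : Deg))]
    · rw [hit n 0 hpos]
      exact (congrArg (fun f : EPhi1 R →+ EPhi1 R => f (((seriesBracket01 a)^[n] y) 0))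
        (map_sub (br01 (R := R)) (a' α) (a α))).symm
    · rintro ⟨b, c⟩ hb hne
      rw [mem_antidiagonal] at hb
      dsimp only at hb ⊢
      by_cases hb0 : b = 0
      · rw [hb0, ha0, ha0', zero_bracket01, zero_bracket01, sub_zero]
      · have hc : c < α := lt_of_le_of_ne (hb ▸ le_add_self) fun hc => hb0 (by
          rw [hc] at hb
          simpa using hb)
        have hbα : b < α := lt_of_le_of_ne (hb ▸ le_self_add) fun hc => hne (by
          rw [hc] at hb
          have : c = 0 := by simpa using hb
          rw [hc, this])
        rw [hit n c hc, ha b hbα, sub_self]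
    · intro h
      simp [mem_antidiagonal] at h
  have hdeg : α.degree ≠ 0 := fun h0 => hα ((Finsupp.degree_eq_zero_iff _).mp h0)
  obtain ⟨m, hm⟩ := Nat.exists_eq_succ_of_ne_zero hdeg
  have h2 : ∀ n, ((seriesBracket01 a)^[n + 1] y) 0 = 0 := fun n =>
    iterate_eq_zero ha0 y (by simp)
  rw [expAct, expAct, Finset.sum_range_succ', Finset.sum_range_succ', hm, Finset.sum_range_succ',
    Finset.sum_range_succ']
  simp only [h1, h2, bracket01_zero, add_zero, Function.iterate_zero, id_eq, Nat.factorial_zero,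
    Nat.factorial_one, zero_add, Nat.cast_one, inv_one, map_one, one_smul]
  abel

end Series

end

section
variable {R : Type*} [CommRing R] [Algebra ℝ R]

/-! ### Coordinates and filtration in degree one -/

/-- Names of the coordinates on the degree one part other than vector fields. The last four kinds
vanish on elements with given coefficients. -/
inductive Co1
  | k (i : Fin 3) | s0 | tw (i : Fin 3) | cf (i : Fin 3) | sy (i : Fin 3) | rA (i : Fin 3)
  | rB (i : Fin 3) | sc (i : Fin 3) | sk (i : Fin 3) | z0 | zb (i : Fin 3) | zr (i : Fin 3)

/-- The coordinates, up to integer factors. -/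
def Co1.val (u : EPhi1 R) : Co1 → R
  | .k i => (u.1 (ax i)).b i
  | .s0 => u.2 0
  | .tw i => (u.1 (ax (i + 1))).r (i + 1) + (u.1 (ax (i + 2))).r (i + 2)
  | .cf i => (u.1 (ax i)).w
  | .sy i => (u.1 (ax (i + 1))).b (i + 2) + (u.1 (ax (i + 2))).b (i + 1)
  | .rA i => (u.1 (ax (i + 2))).r (i + 1)
  | .rB i => (u.1 (ax (i + 1))).r (i + 2)
  | .sc i => u.2 (ax i)
  | .sk i => (u.1 (ax (i + 1))).b (i + 2) - (u.1 (ax (i + 2))).b (i + 1)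
  | .z0 => (u.1 0).w - ∑ i, (u.1 (ax i)).b i
  | .zb i => (u.1 0).b i - (u.1 (ax i)).w
  | .zr i => (u.1 0).r i

/-- The filtration degree. -/
def Co1.dg : Co1 → Deg
  | .k _ | .s0 | .z0 => 0
  | .tw i => deg i 2 0
  | .sk i => deg i 2 1
  | .cf i | .sy i | .rA i | .rB i | .sc i | .zb i | .zr i => deg i 0 1

/-- The generator dual to a coordinate. -/
def Co1.gen : Co1 → EPhi1 R
  | .k i => th 0 sigma0 + th (ax i) (boost i)
  | .s0 => uth 0
  | .tw i => -th (ax i) (rot i) + th (ax (i + 1)) (rot (i + 1)) + th (ax (i + 2)) (rot (i + 2))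
  | .cf i => th 0 (boost i) + th (ax i) sigma0
  | .sy i => th (ax (i + 1)) (boost (i + 2)) + th (ax (i + 2)) (boost (i + 1))
  | .rA i => th (ax (i + 2)) (rot (i + 1))
  | .rB i => th (ax (i + 1)) (rot (i + 2))
  | .sc i => uth (ax i)
  | .sk i => th (ax (i + 1)) (boost (i + 2)) - th (ax (i + 2)) (boost (i + 1))
  | .z0 => th 0 sigma0
  | .zb i => th 0 (boost i)
  | .zr i => th 0 (rot i)

/-- The value of a coordinate on its dual generator. -/
def Co1.fac : Co1 → ℕ
  | .tw _ | .sy _ | .sk _ => 2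
  | _ => 1

/-- The coordinates as linear maps. -/
def Co1.valₗ (c : Co1) : EPhi1 R →ₗ[R] R where
  toFun u := c.val u
  map_add' u v := by
    cases c <;> simp only [Co1.val, Prod.fst_add, Prod.snd_add, Pi.add_apply, CDer.b_add, CDer.r_add,
      CDer.w_add, Finset.sum_add_distrib] <;> ring
  map_smul' f u := by
    cases c <;> simp only [Co1.val, Prod.smul_fst, Prod.smul_snd, Pi.smul_apply, CDer.b_smul,
      CDer.r_smul, CDer.w_smul, ← Finset.mul_sum, smul_eq_mul, RingHom.id_apply] <;> ring

theorem Co1.valₗ_apply (c : Co1) (u : EPhi1 R) : c.valₗ u = c.val u := rfl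

/-- The vector field of a component. -/
def fieldAt (p : Fin 4) : EPhi1 R →ₗ[R] Derivation ℝ R R where
  toFun u := (u.1 p).field
  map_add' u v := by simp
  map_smul' f u := by simp

theorem fieldAt_apply (p : Fin 4) (u : EPhi1 R) : fieldAt p u = (u.1 p).field := rfl

theorem fst_th (p q : Fin 4) (δ : CDer R) : (th p δ).1 q = if q = p then δ else 0 :=
  Pi.single_apply _ _ _

theorem w_th (p q : Fin 4) (δ : CDer R) : ((th p δ).1 q).w = if q = p then δ.w else 0 := by
  rw [fst_th, apply_ite CDer.w, CDer.w_zero]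
theorem b_th (p q : Fin 4) (δ : CDer R) (i : Fin 3) :
    ((th p δ).1 q).b i = if q = p then δ.b i else 0 := by
  rw [fst_th, apply_ite (fun δ => CDer.b δ i), CDer.b_zero]
theorem r_th (p q : Fin 4) (δ : CDer R) (i : Fin 3) :
    ((th p δ).1 q).r i = if q = p then δ.r i else 0 := by
  rw [fst_th, apply_ite (fun δ => CDer.r δ i), CDer.r_zero]
theorem field_th (p q : Fin 4) (δ : CDer R) : ((th p δ).1 q).field = if q = p then δ.field else 0 := by
  rw [fst_th, apply_ite CDer.field, CDer.field_zero]
theorem snd_th (p q : Fin 4) (δ : CDer R) : (th p δ).2 q = 0 := rfl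
theorem fst_uth (p q : Fin 4) : (uth p : EPhi1 R).1 q = 0 := rfl
theorem snd_uth (p q : Fin 4) : (uth p : EPhi1 R).2 q = if q = p then 1 else 0 :=
  Pi.single_apply _ _ _
set_option maxHeartbeats 1600000 in
theorem Co1.val_gen (c c' : Co1) [Decidable (c = c')] :
    c.val (c'.gen : EPhi1 R) = if c = c' then (c.fac : R) else 0 := by
  cases c <;> cases c'
  all_goals
    try (rename Fin 3 => j; revert j; rename Fin 3 => i; intro j; obtain rfl | rfl | rfl := cyc_or i j)
  all_goals
    simp [Co1.val, Co1.gen, Co1.fac, Prod.fst_add, Prod.snd_add, w_th, b_th, r_th, snd_th, fst_uth,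
      snd_uth, ax_inj, ax_ne_zero, zero_ne_ax, cyc11, cyc12, cyc21, cyc22, Finset.sum_add_distrib]
  all_goals try norm_num

theorem fieldAt_gen (p : Fin 4) (c : Co1) : fieldAt p (c.gen : EPhi1 R) = 0 := by
  cases c <;> simp [Co1.gen, fieldAt_apply, field_th, fst_uth]

end

section
variable {R : Type*} [CommRing R] [Algebra ℝ R]

theorem eq_zero_of_add_self {x : R} (h : x + x = 0) : x = 0 := two_smul_cancel (R := R) h

theorem EPhi1_eq_zero {u : EPhi1 R} (h : ∀ c : Co1, c.val u = 0) (hf : ∀ p, fieldAt p u = 0) :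
    u = 0 := by
  have hcf := fun i => h (.cf i)
  have htw := fun i => h (.tw i)
  have hsy := fun i => h (.sy i)
  have hsk := fun i => h (.sk i)
  have hzb := fun i => h (.zb i)
  have hk := fun i => h (.k i)
  have hrA := fun i => h (.rA i)
  have hrB := fun i => h (.rB i)
  have hz0 := h .z0
  simp only [Co1.val] at hcf htw hsy hsk hzb hk hrA hrB hz0
  have hb1 : ∀ i, (u.1 (ax (i + 1))).b (i + 2) = 0 := fun i =>
    eq_zero_of_add_self (by linear_combination hsy i + hsk i)
  have hb2 : ∀ i, (u.1 (ax (i + 2))).b (i + 1) = 0 := fun i =>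
    eq_zero_of_add_self (by linear_combination hsy i - hsk i)
  have hr : ∀ i, (u.1 (ax i)).r i = 0 := fun i => by
    have h1 := htw (i + 1)
    have h2 := htw (i + 2)
    simp only [cyc11, cyc12, cyc21, cyc22] at h1 h2
    exact eq_zero_of_add_self (by linear_combination h1 + h2 - htw i)
  refine Prod.ext (funext fun p => ?_) (funext fun p => ?_)
  · revert p
    refine forall_ax.mpr ⟨CDer.ext_coord ?_ (fun i => ?_) (fun i => ?_) (hf 0), fun i =>
      CDer.ext_coord (hcf i) (fun j => ?_) (fun j => ?_) (hf (ax i))⟩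
    · simp only [hk, Finset.sum_const_zero, sub_zero] at hz0
      exact hz0
    · exact (sub_eq_zero.mp (hzb i)).trans (hcf i)
    · exact h (.zr i)
    · obtain rfl | rfl | rfl := cyc_or i j
      · exact hk j
      · have := hb1 (i + 2); rwa [cyc21, cyc22] at this
      · have := hb2 (i + 1); rwa [cyc11, cyc12] at this
    · obtain rfl | rfl | rfl := cyc_or i j
      · exact hr j
      · have := hrB (i + 2); rwa [cyc21, cyc22] at this
      · have := hrA (i + 1); rwa [cyc11, cyc12] at this
  · revert p
    exact forall_ax.mpr ⟨h .s0, fun i => h (.sc i)⟩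

theorem EPhi1_ext {u v : EPhi1 R} (h : ∀ c : Co1, c.val u = c.val v)
    (hf : ∀ p, fieldAt p u = fieldAt p v) : u = v := by
  rw [← sub_eq_zero]
  refine EPhi1_eq_zero (fun c => ?_) fun p => by rw [map_sub, hf, sub_self]
  rw [← Co1.valₗ_apply, map_sub, Co1.valₗ_apply, Co1.valₗ_apply, h, sub_self]

instance : Finite Co1 := by
  refine Finite.of_surjective (fun x : Fin 12 × Fin 3 => match x with
    | (0, i) => .k i | (1, _) => .s0 | (2, i) => .tw i | (3, i) => .cf i | (4, i) => .sy i
    | (5, i) => .rA i | (6, i) => .rB i | (7, i) => .sc i | (8, i) => .sk i | (9, _) => .z0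
    | (10, i) => .zb i | (11, i) => .zr i) fun c => ?_
  cases c
  exacts [⟨(0, _), rfl⟩, ⟨(1, 0), rfl⟩, ⟨(2, _), rfl⟩, ⟨(3, _), rfl⟩, ⟨(4, _), rfl⟩, ⟨(5, _), rfl⟩,
    ⟨(6, _), rfl⟩, ⟨(7, _), rfl⟩, ⟨(8, _), rfl⟩, ⟨(9, 0), rfl⟩, ⟨(10, _), rfl⟩, ⟨(11, _), rfl⟩]

instance : Fintype Co1 := Fintype.ofFinite _

/-- The inverse of `Co1.fac`. -/
def Co1.inv (R : Type*) [CommRing R] [Algebra ℝ R] (c : Co1) : R := algebraMap ℝ R (c.fac : ℝ)⁻¹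

theorem Co1.fac_ne_zero (c : Co1) : (c.fac : ℝ) ≠ 0 := by cases c <;> simp [Co1.fac]

theorem Co1.inv_mul_fac (c : Co1) : c.inv R * (c.fac : R) = 1 := by
  rw [Co1.inv, ← map_natCast (algebraMap ℝ R), ← map_mul, inv_mul_cancel₀ c.fac_ne_zero, map_one]

theorem val_th_ofDer (c : Co1) (p : Fin 4) (D : Derivation ℝ R R) : c.val (th p (ofDer D)) = 0 := by
  cases c <;> simp [Co1.val, w_th, b_th, r_th, snd_th]

theorem fieldAt_th_ofDer (p q : Fin 4) (D : Derivation ℝ R R) :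
    fieldAt q (th p (ofDer D)) = if q = p then D else 0 := by
  rw [fieldAt_apply, field_th, field_ofDer]

theorem eq_sum_gen (u : EPhi1 R) :
    u = ∑ c : Co1, (c.inv R * c.val u) • c.gen + ∑ p, th p (ofDer (fieldAt p u)) := by
  classical
  refine EPhi1_ext (fun c => ?_) fun p => ?_
  · rw [← Co1.valₗ_apply c (_ + _), map_add, map_sum, map_sum]
    simp only [map_smul, Co1.valₗ_apply, val_th_ofDer, Finset.sum_const_zero, add_zero,
      Co1.val_gen, smul_eq_mul, mul_ite, mul_zero, Finset.sum_ite_eq, Finset.mem_univ, if_true]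
    linear_combination -c.val u * c.inv_mul_fac (R := R)
  · rw [map_add, map_sum, map_sum]
    simp only [map_smul, fieldAt_gen, smul_zero, Finset.sum_const_zero, zero_add,
      fieldAt_th_ofDer, Finset.sum_ite_eq, Finset.mem_univ, if_true]

/-- The generators in the gauge part. -/
def Co1.IsGauge : Co1 → Prop
  | .z0 | .zb _ | .zr _ => False
  | _ => True

theorem Co1.gen_gauge {c : Co1} (h : c.IsGauge) : Gen1 c.dg (c.gen : EPhi1 R) := by
  cases c
  exacts [.kasner _, .scalar0, .twist _, .conf _, .symm _, .rotA _, .rotB _, .scalar _, .skew _,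
    h.elim, h.elim, h.elim]

theorem Co1.gen_not_gauge {c : Co1} (h : ¬c.IsGauge) :
    ∃ x : CDer R, Gen0 c.dg x ∧ c.gen = th 0 x := by
  cases c
  case z0 => exact ⟨_, .sigma0, rfl⟩
  case zb i => exact ⟨_, .boost i, rfl⟩
  case zr i => exact ⟨_, .rot i, rfl⟩
  all_goals exact (h trivial).elim

theorem Gen1.cases {β : Deg} {u : EPhi1 R} (h : Gen1 β u) :
    (∃ c : Co1, c.IsGauge ∧ β = c.dg ∧ u = c.gen) ∨
      ∃ i D, β = deg i 0 1 ∧ u = th (ax i) (ofDer D) := by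
  cases h
  case kasner i => exact .inl ⟨.k i, trivial, rfl, rfl⟩
  case scalar0 => exact .inl ⟨.s0, trivial, rfl, rfl⟩
  case twist i => exact .inl ⟨.tw i, trivial, rfl, rfl⟩
  case frame i D => exact .inr ⟨i, D, rfl, rfl⟩
  case conf i => exact .inl ⟨.cf i, trivial, rfl, rfl⟩
  case symm i => exact .inl ⟨.sy i, trivial, rfl, rfl⟩
  case rotA i => exact .inl ⟨.rA i, trivial, rfl, rfl⟩
  case rotB i => exact .inl ⟨.rB i, trivial, rfl, rfl⟩
  case scalar i => exact .inl ⟨.sc i, trivial, rfl, rfl⟩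
  case skew i => exact .inl ⟨.sk i, trivial, rfl, rfl⟩

theorem Gen0.cases {β : Deg} {x : CDer R} (h : Gen0 β x) :
    (∃ c : Co1, β = c.dg ∧ th 0 x = c.gen) ∨ ∃ D, β = 0 ∧ x = ofDer D := by
  cases h
  case der D => exact .inr ⟨D, rfl, rfl⟩
  case sigma0 => exact .inl ⟨.z0, rfl, rfl⟩
  case boost i => exact .inl ⟨.zb i, rfl, rfl⟩
  case rot i => exact .inl ⟨.zr i, rfl, rfl⟩

theorem mem_iSup_G1 {P : Set Deg} {u : EPhi1 R} : u ∈ ⨆ β ∈ P, G1 R β ↔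
    (∀ c : Co1, c.dg ∉ P → c.val u = 0) ∧ (0 ∉ P → fieldAt 0 u = 0) ∧
      ∀ i, deg i 0 1 ∉ P → fieldAt (ax i) u = 0 := by
  classical
  constructor
  · intro hu
    have key : ∀ {N : Type _} [AddCommGroup N] [Module R N] (f : EPhi1 R →ₗ[R] N),
        (∀ β ∈ P, ∀ u, Gen1 β u ∨ (∃ x, Gen0 β x ∧ u = th 0 x) → f u = 0) → f u = 0 := by
      intro N _ _ f hf
      have : ⨆ β ∈ P, G1 R β ≤ LinearMap.ker f :=
        iSup₂_le fun β hβ => Submodule.span_le.mpr fun u hu => hf β hβ u hu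
      exact this hu
    refine ⟨fun c hc => key c.valₗ ?_, fun h0 => key (fieldAt 0) ?_, fun i hi => key (fieldAt (ax i)) ?_⟩
    · rintro β hβ u (hu | ⟨x, hx, rfl⟩)
      · obtain ⟨c', -, rfl, rfl⟩ | ⟨i, D, -, rfl⟩ := hu.cases
        · rw [Co1.valₗ_apply, Co1.val_gen, if_neg fun h : c = c' => hc (h ▸ hβ)]
        · exact val_th_ofDer _ _ _
      · obtain ⟨c', rfl, h⟩ | ⟨D, -, rfl⟩ := hx.cases
        · rw [h, Co1.valₗ_apply, Co1.val_gen, if_neg fun h : c = c' => hc (h ▸ hβ)]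
        · exact val_th_ofDer _ _ _
    · rintro β hβ u (hu | ⟨x, hx, rfl⟩)
      · obtain ⟨c', -, rfl, rfl⟩ | ⟨i, D, -, rfl⟩ := hu.cases
        · exact fieldAt_gen _ _
        · rw [fieldAt_th_ofDer, if_neg (zero_ne_ax i)]
      · obtain ⟨c', rfl, h⟩ | ⟨D, rfl, rfl⟩ := hx.cases
        · rw [h, fieldAt_gen]
        · exact (h0 hβ).elim
    · rintro β hβ u (hu | ⟨x, hx, rfl⟩)
      · obtain ⟨c', -, rfl, rfl⟩ | ⟨j, D, rfl, rfl⟩ := hu.cases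
        · exact fieldAt_gen _ _
        · rw [fieldAt_th_ofDer, if_neg]
          intro h
          exact hi (ax_inj.mp h ▸ hβ)
      · obtain ⟨c', rfl, h⟩ | ⟨D, rfl, rfl⟩ := hx.cases
        · rw [h, fieldAt_gen]
        · rw [fieldAt_th_ofDer, if_neg (ax_ne_zero i)]
  · rintro ⟨hc, h0, hi⟩
    have hle : ∀ {β} {u : EPhi1 R}, β ∈ P → (Gen1 β u ∨ ∃ x, Gen0 β x ∧ u = th 0 x) →
        u ∈ ⨆ β ∈ P, G1 R β := fun hβ hu =>
      Submodule.mem_iSup_of_mem _ (Submodule.mem_iSup_of_mem hβ (Submodule.subset_span hu))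
    rw [eq_sum_gen u]
    refine add_mem (Submodule.sum_mem _ fun c _ => ?_) (Submodule.sum_mem _ fun p _ => ?_)
    · by_cases h : c.dg ∈ P
      · refine Submodule.smul_mem _ _ (hle h ?_)
        by_cases hg : c.IsGauge
        · exact .inl (Co1.gen_gauge hg)
        · exact .inr (Co1.gen_not_gauge hg)
      · rw [hc c h, mul_zero, zero_smul]
        exact zero_mem _
    · have hz : (th p (ofDer (0 : Derivation ℝ R R)) : EPhi1 R) = 0 := by
        refine EPhi1_eq_zero (fun c => val_th_ofDer _ _ _) fun q => ?_
        rw [fieldAt_th_ofDer, ite_self]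
      revert p
      refine forall_ax.mpr ⟨fun _ hz => ?_, fun i _ hz => ?_⟩
      · by_cases h : (0 : Deg) ∈ P
        · exact hle h (.inr ⟨_, .der _, rfl⟩)
        · rw [h0 h, hz]
          exact zero_mem _
      · by_cases h : deg i 0 1 ∈ P
        · exact hle h (.inl (.frame i _))
        · rw [hi i h, hz]
          exact zero_mem _

theorem mem_F1gauge {α : Deg} {u : EPhi1 R} : u ∈ F1gauge R α ↔
    u ∈ F1 R α ∧ (∀ c : Co1, ¬c.IsGauge → c.val u = 0) ∧ fieldAt 0 u = 0 := by
  classical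
  constructor
  · intro hu
    refine ⟨?_, fun c hc => ?_, ?_⟩
    · have h : F1gauge R α ≤ F1 R α :=
        iSup₂_mono fun β _ => Submodule.span_mono Set.subset_union_left
      exact h hu
    · have : F1gauge R α ≤ LinearMap.ker (c.valₗ (R := R)) := by
        refine iSup₂_le fun β _ => Submodule.span_le.mpr fun u (hu : Gen1 β u) => ?_
        obtain ⟨c', h', -, rfl⟩ | ⟨i, D, -, rfl⟩ := hu.cases
        · change c.val _ = 0
          rw [Co1.val_gen, if_neg fun h : c = c' => hc (h ▸ h')]
        · exact val_th_ofDer _ _ _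
      exact this hu
    · have : F1gauge R α ≤ LinearMap.ker (fieldAt (R := R) 0) := by
        refine iSup₂_le fun β _ => Submodule.span_le.mpr fun u (hu : Gen1 β u) => ?_
        obtain ⟨c', h', -, rfl⟩ | ⟨i, D, -, rfl⟩ := hu.cases
        · exact fieldAt_gen _ _
        · change fieldAt 0 _ = 0
          rw [fieldAt_th_ofDer, if_neg (zero_ne_ax i)]
      exact this hu
  · rintro ⟨hu, hg, hf⟩
    obtain ⟨hc, -, hi⟩ := (mem_iSup_G1 (P := {β | β ≤ α})).mp hu
    have hle : ∀ {β} {u : EPhi1 R}, β ≤ α → Gen1 β u → u ∈ F1gauge R α := fun {β} _ hβ hu =>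
      Submodule.mem_iSup_of_mem β (Submodule.mem_iSup_of_mem hβ (Submodule.subset_span hu))
    rw [eq_sum_gen u]
    refine add_mem (Submodule.sum_mem _ fun c _ => ?_) (Submodule.sum_mem _ fun p _ => ?_)
    · by_cases h : c.dg ≤ α ∧ c.IsGauge
      · exact Submodule.smul_mem _ _ (hle h.1 (Co1.gen_gauge h.2))
      · have : c.val u = 0 := by
          by_cases h' : c.IsGauge
          · exact hc c fun h'' => h ⟨h'', h'⟩
          · exact hg c h'
        rw [this, mul_zero, zero_smul]
        exact zero_mem _
    · have hz : (th p (ofDer (0 : Derivation ℝ R R)) : EPhi1 R) = 0 := by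
        refine EPhi1_eq_zero (fun c => val_th_ofDer _ _ _) fun q => ?_
        rw [fieldAt_th_ofDer, ite_self]
      revert p
      refine forall_ax.mpr ⟨fun _ hz => ?_, fun i _ hz => ?_⟩
      · rw [hf, hz]
        exact zero_mem _
      · by_cases h : deg i 0 1 ≤ α
        · exact hle h (.frame i _)
        · rw [hi i h, hz]
          exact zero_mem _

theorem mem_iSup_G0 {P : Set Deg} {x : CDer R} : x ∈ ⨆ β ∈ P, G0 R β ↔
    (0 ∉ P → x.w = 0 ∧ x.field = 0) ∧ ∀ i, deg i 0 1 ∉ P → x.b i = 0 ∧ x.r i = 0 := by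
  constructor
  · intro hx
    let S : Submodule R (CDer R) :=
      { carrier := {x | (0 ∉ P → x.w = 0 ∧ x.field = 0) ∧ ∀ i, deg i 0 1 ∉ P → x.b i = 0 ∧ x.r i = 0}
        zero_mem' := by simp
        add_mem' := by
          rintro x y ⟨hx, hx'⟩ ⟨hy, hy'⟩
          refine ⟨fun h => ?_, fun i h => ?_⟩
          · simp [hx h, hy h]
          · simp [hx' i h, hy' i h]
        smul_mem' := by
          rintro c x ⟨hx, hx'⟩
          refine ⟨fun h => ?_, fun i h => ?_⟩
          · simp [hx h]
          · simp [hx' i h] }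
    have : ⨆ β ∈ P, G0 R β ≤ S := by
      refine iSup₂_le fun β hβ => Submodule.span_le.mpr fun x (hx : Gen0 β x) => ?_
      cases hx
      case der D => exact ⟨fun h => (h hβ).elim, fun i _ => by simp⟩
      case sigma0 => exact ⟨fun h => (h hβ).elim, fun i _ => by simp⟩
      case boost i =>
        refine ⟨fun _ => by simp, fun j hj => ?_⟩
        have : i ≠ j := fun h => hj (h ▸ hβ)
        simp [this]
      case rot i =>
        refine ⟨fun _ => by simp, fun j hj => ?_⟩
        have : i ≠ j := fun h => hj (h ▸ hβ)
        simp [this]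
    exact this hx
  · rintro ⟨h0, hi⟩
    have hle : ∀ {β} {x : CDer R}, β ∈ P → Gen0 β x → x ∈ ⨆ β ∈ P, G0 R β := fun hβ hu =>
      Submodule.mem_iSup_of_mem _ (Submodule.mem_iSup_of_mem hβ (Submodule.subset_span hu))
    have hz : (ofDer (0 : Derivation ℝ R R) : CDer R) = 0 := CDer.ext_coord (by simp) (by simp) (by simp) (by simp)
    rw [← cd_coord x, cd]
    refine add_mem (add_mem (add_mem ?_ (Submodule.sum_mem _ fun i _ => ?_))
      (Submodule.sum_mem _ fun i _ => ?_)) ?_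
    · by_cases h : (0 : Deg) ∈ P
      · exact Submodule.smul_mem _ _ (hle h .sigma0)
      · rw [(h0 h).1, zero_smul]; exact zero_mem _
    · by_cases h : deg i 0 1 ∈ P
      · exact Submodule.smul_mem _ _ (hle h (.boost i))
      · rw [(hi i h).1, zero_smul]; exact zero_mem _
    · by_cases h : deg i 0 1 ∈ P
      · exact Submodule.smul_mem _ _ (hle h (.rot i))
      · rw [(hi i h).2, zero_smul]; exact zero_mem _
    · by_cases h : (0 : Deg) ∈ P
      · exact hle h (.der _)
      · rw [(h0 h).2, hz]; exact zero_mem _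

end

section
variable {R : Type*} [CommRing R] [Algebra ℝ R]

/-! ### The adjoint action and the filtration -/

section
variable (x : CDer R) (u : EPhi1 R)

theorem fst_bracket01_zero : (bracket01 x u).1 0 = CDer.bracket x (u.1 0) + (x.w • u.1 0 +
    ∑ j, x.b j • u.1 (ax j)) := by
  simp only [bracket01, sum_ax, CDer.mat_zero_zero, CDer.mat_zero_ax]

theorem fst_bracket01_ax (i : Fin 3) : (bracket01 x u).1 (ax i) = CDer.bracket x (u.1 (ax i)) +
    (x.b i • u.1 0 + (x.w • u.1 (ax i) + (x.r (i + 2) • u.1 (ax (i + 1)) -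
      x.r (i + 1) • u.1 (ax (i + 2))))) := by
  simp only [bracket01, sum_ax_cyc _ i, CDer.mat_ax_zero, CDer.mat_ax_self, CDer.mat_ax_one,
    CDer.mat_ax_two, neg_smul, sub_eq_add_neg, add_assoc]

theorem snd_bracket01_ax (i : Fin 3) : (bracket01 x u).2 (ax i) = x.field (u.2 (ax i)) +
    (x.b i * u.2 0 + (x.w * u.2 (ax i) + (x.r (i + 2) * u.2 (ax (i + 1)) -
      x.r (i + 1) * u.2 (ax (i + 2))))) := by
  simp only [bracket01_eq, CDer.act_apply, sum_ax_cyc _ i, CDer.mat_ax_zero, CDer.mat_ax_self, CDer.mat_ax_one,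
    CDer.mat_ax_two]
  ring

theorem val_bracket01_cf (i : Fin 3) : Co1.val (bracket01 x u) (.cf i) =
    x.field (Co1.val u (.cf i)) - fieldAt (ax i) u x.w + x.w * Co1.val u (.cf i) +
      x.b i * (u.1 0).w + x.r (i + 2) * Co1.val u (.cf (i + 1)) -
      x.r (i + 1) * Co1.val u (.cf (i + 2)) := by
  simp only [Co1.val, fst_bracket01_ax, fieldAt_apply, CDer.w_add, CDer.w_sub, CDer.w_smul, CDer.w_bracket]
  ring

theorem val_bracket01_sc (i : Fin 3) : Co1.val (bracket01 x u) (.sc i) =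
    x.field (Co1.val u (.sc i)) + x.w * Co1.val u (.sc i) +
      x.b i * Co1.val u .s0 + x.r (i + 2) * Co1.val u (.sc (i + 1)) -
      x.r (i + 1) * Co1.val u (.sc (i + 2)) := by
  simp only [Co1.val, snd_bracket01_ax]
  ring

theorem fieldAt_bracket01 (i : Fin 3) : fieldAt (ax i) (bracket01 x u) =
    ⁅x.field, fieldAt (ax i) u⁆ + x.w • fieldAt (ax i) u + x.b i • fieldAt 0 u +
      x.r (i + 2) • fieldAt (ax (i + 1)) u - x.r (i + 1) • fieldAt (ax (i + 2)) u := by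
  simp only [fieldAt_apply, fst_bracket01_ax, CDer.field_add, CDer.field_sub, CDer.field_smul, CDer.field_bracket]
  abel

theorem val_bracket01_zb (i : Fin 3) : Co1.val (bracket01 x u) (.zb i) =
    x.field (Co1.val u (.zb i)) - fieldAt 0 u (x.b i) + fieldAt (ax i) u x.w +
      x.w * Co1.val u (.zb i)
      - x.b (i + 1) * (u.1 0).r (i + 2) + x.b (i + 2) * (u.1 0).r (i + 1)
      + x.r (i + 2) * Co1.val u (.zb (i + 1)) - x.r (i + 1) * Co1.val u (.zb (i + 2))
      + x.b i * ((u.1 (ax i)).b i - (u.1 0).w) + x.b (i + 1) * (u.1 (ax (i + 1))).b i + x.b (i + 2) * (u.1 (ax (i + 2))).b i := by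
  simp only [Co1.val, fieldAt_apply, map_sub, fst_bracket01_ax, fst_bracket01_zero, CDer.w_add, CDer.w_sub, CDer.w_smul,
    CDer.w_bracket, CDer.b_add, CDer.b_smul, CDer.b_bracket, sum_cyc _ i]
  ring

theorem val_bracket01_zr (i : Fin 3) : Co1.val (bracket01 x u) (.zr i) =
    x.field (Co1.val u (.zr i)) - fieldAt 0 u (x.r i) + x.w * Co1.val u (.zr i) +
      x.b (i + 1) * (u.1 0).b (i + 2) - x.b (i + 2) * (u.1 0).b (i + 1) +
      x.r (i + 2) * Co1.val u (.zr (i + 1)) - x.r (i + 1) * Co1.val u (.zr (i + 2)) +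
      x.b i * (u.1 (ax i)).r i + x.b (i + 1) * (u.1 (ax (i + 1))).r i + x.b (i + 2) * (u.1 (ax (i + 2))).r i := by
  simp only [Co1.val, fieldAt_apply, fst_bracket01_zero, CDer.r_add, CDer.r_smul, CDer.r_bracket, sum_cyc _ i]
  ring

theorem val_bracket01_sy (i : Fin 3) : Co1.val (bracket01 x u) (.sy i) =
    x.field (Co1.val u (.sy i)) - fieldAt (ax (i + 1)) u (x.b (i + 2)) -
      fieldAt (ax (i + 2)) u (x.b (i + 1)) + x.w * Co1.val u (.sy i)
      + x.b i * ((u.1 (ax (i + 2))).r (i + 2) - (u.1 (ax (i + 1))).r (i + 1)) + x.b (i + 1) * Co1.val u (.rA (i + 2))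
      - x.b (i + 2) * Co1.val u (.rB (i + 1)) + x.b (i + 1) * (u.1 0).b (i + 2)
      + x.b (i + 2) * (u.1 0).b (i + 1)
      + x.r i * (2 * (u.1 (ax (i + 2))).b (i + 2) - 2 * (u.1 (ax (i + 1))).b (i + 1))
      + x.r (i + 1) * Co1.val u (.sy (i + 2)) - x.r (i + 2) * Co1.val u (.sy (i + 1)) := by
  simp only [Co1.val, fieldAt_apply, map_add, fst_bracket01_ax, CDer.b_add, CDer.b_sub, CDer.b_smul,
    CDer.b_bracket, cyc11, cyc12, cyc21, cyc22]
  ring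

theorem val_bracket01_sk (i : Fin 3) : Co1.val (bracket01 x u) (.sk i) =
    x.field (Co1.val u (.sk i)) - fieldAt (ax (i + 1)) u (x.b (i + 2)) +
      fieldAt (ax (i + 2)) u (x.b (i + 1)) + x.w * Co1.val u (.sk i)
      - x.b i * Co1.val u (.tw i) + x.b (i + 1) * Co1.val u (.rA (i + 2))
      + x.b (i + 2) * Co1.val u (.rB (i + 1)) + x.b (i + 1) * (Co1.val u (.zb (i + 2)) +
        Co1.val u (.cf (i + 2)))
      - x.b (i + 2) * (Co1.val u (.zb (i + 1)) + Co1.val u (.cf (i + 1)))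
      - x.r (i + 1) * Co1.val u (.sk (i + 2)) + x.r (i + 2) * Co1.val u (.sk (i + 1)) := by
  simp only [Co1.val, fieldAt_apply, map_sub, fst_bracket01_ax, CDer.b_add, CDer.b_sub, CDer.b_smul,
    CDer.b_bracket, cyc11, cyc12, cyc21, cyc22]
  ring

theorem val_bracket01_rA (i : Fin 3) : Co1.val (bracket01 x u) (.rA i) =
    x.field (Co1.val u (.rA i)) - fieldAt (ax (i + 2)) u (x.r (i + 1)) + x.w * Co1.val u (.rA i)
      + x.b (i + 2) * (u.1 (ax (i + 2))).b i - x.b i * (u.1 (ax (i + 2))).b (i + 2) + x.r i * (u.1 (ax (i + 2))).r (i + 2)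
      - x.r (i + 2) * Co1.val u (.rB (i + 1)) + x.b (i + 2) * Co1.val u (.zr (i + 1))
      + x.r (i + 1) * Co1.val u (.rB (i + 2)) - x.r i * (u.1 (ax (i + 1))).r (i + 1) := by
  simp only [Co1.val, fieldAt_apply, fst_bracket01_ax, CDer.r_add, CDer.r_sub, CDer.r_smul,
    CDer.r_bracket, cyc11, cyc12, cyc21, cyc22]
  ring

theorem val_bracket01_rB (i : Fin 3) : Co1.val (bracket01 x u) (.rB i) =
    x.field (Co1.val u (.rB i)) - fieldAt (ax (i + 1)) u (x.r (i + 2)) + x.w * Co1.val u (.rB i)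
      + x.b i * (u.1 (ax (i + 1))).b (i + 1) - x.b (i + 1) * (u.1 (ax (i + 1))).b i + x.r (i + 1) * Co1.val u (.rA (i + 2))
      - x.r i * (u.1 (ax (i + 1))).r (i + 1) + x.b (i + 1) * Co1.val u (.zr (i + 2)) + x.r i * (u.1 (ax (i + 2))).r (i + 2)
      - x.r (i + 2) * Co1.val u (.rA (i + 1)) := by
  simp only [Co1.val, fieldAt_apply, fst_bracket01_ax, CDer.r_add, CDer.r_sub, CDer.r_smul,
    CDer.r_bracket, cyc11, cyc12, cyc21, cyc22]
  ring

theorem val_bracket01_tw (i : Fin 3) : Co1.val (bracket01 x u) (.tw i) =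
    x.field (Co1.val u (.tw i)) - fieldAt (ax (i + 1)) u (x.r (i + 1)) -
      fieldAt (ax (i + 2)) u (x.r (i + 2)) + x.w * Co1.val u (.tw i)
      - x.b i * Co1.val u (.sk i) + x.b (i + 2) * (u.1 (ax (i + 1))).b i - x.b (i + 1) * (u.1 (ax (i + 2))).b i
      - x.r (i + 2) * Co1.val u (.rA (i + 2)) + x.r (i + 1) * Co1.val u (.rB (i + 1))
      + x.b (i + 1) * Co1.val u (.zr (i + 1)) + x.b (i + 2) * Co1.val u (.zr (i + 2))
      - x.r (i + 2) * Co1.val u (.rB (i + 2)) + x.r (i + 1) * Co1.val u (.rA (i + 1)) := by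
  simp only [Co1.val, fieldAt_apply, map_add, fst_bracket01_ax, CDer.r_add, CDer.r_sub, CDer.r_smul,
    CDer.r_bracket, cyc11, cyc12, cyc21, cyc22]
  ring
end

end

section
variable {R : Type*} [CommRing R] [Algebra ℝ R]

theorem deg_01_le (i : Fin 3) : deg i 0 1 ≤ deg (i + 1) 0 1 + deg (i + 2) 0 1 := by
  simp [Deg.le_iff _ _ i, deg_apply]
theorem deg_20_le (i : Fin 3) : deg i 2 0 ≤ deg (i + 1) 0 1 + deg (i + 2) 0 1 := by
  simp [Deg.le_iff _ _ i, deg_apply]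
theorem deg_21_le (i : Fin 3) : deg i 2 1 ≤ deg (i + 1) 0 1 + deg (i + 2) 0 1 := by
  simp [Deg.le_iff _ _ i, deg_apply]
theorem deg_20_le_one (i : Fin 3) : deg i 2 0 ≤ deg (i + 1) 0 1 + deg (i + 1) 0 1 := by
  simp [Deg.le_iff _ _ i, deg_apply]
theorem deg_20_le_two (i : Fin 3) : deg i 2 0 ≤ deg (i + 2) 0 1 + deg (i + 2) 0 1 := by
  simp [Deg.le_iff _ _ i, deg_apply]
theorem deg_20_le_self (i : Fin 3) : deg i 2 0 ≤ deg i 0 1 + deg i 2 1 := by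
  simp [Deg.le_iff _ _ i, deg_apply]
theorem deg_21_le_self (i : Fin 3) : deg i 2 1 ≤ deg i 0 1 + deg i 2 0 := by
  simp [Deg.le_iff _ _ i, deg_apply]
theorem deg_21_le_one (i : Fin 3) : deg i 2 1 ≤ deg (i + 1) 0 1 + deg (i + 2) 2 1 := by
  simp [Deg.le_iff _ _ i, deg_apply]
theorem deg_21_le_two (i : Fin 3) : deg i 2 1 ≤ deg (i + 2) 0 1 + deg (i + 1) 2 1 := by
  simp [Deg.le_iff _ _ i, deg_apply]
theorem deg_01_le_21 (i : Fin 3) : deg i 0 1 ≤ deg i 2 1 := by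
  simp [Deg.le_iff _ _ i, deg_apply]

theorem eq_zero_of_mem_F0lt_zero {x : CDer R} (hx : x ∈ F0lt R 0) : x = 0 := by
  obtain ⟨h0, hi⟩ := (mem_iSup_G0 (P := {β | β < 0})).mp hx
  have h : ∀ β : Deg, β ∉ {β : Deg | β < 0} := fun β (h : β < 0) => not_lt_zero h
  exact CDer.ext_coord (h0 (h _)).1 (fun i => (hi i (h _)).1) (fun i => (hi i (h _)).2) (h0 (h _)).2

theorem b_raw_eq_zero {ε : Deg} {u : EPhi1 R} (hu : u ∈ F1 R ε) {i : Fin 3} (h : ¬deg i 0 1 ≤ ε) :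
    (u.1 (ax (i + 1))).b (i + 2) = 0 ∧ (u.1 (ax (i + 2))).b (i + 1) = 0 := by
  obtain ⟨hc, -, -⟩ := (mem_iSup_G1 (P := {β | β ≤ ε})).mp hu
  have h1 := hc (.sy i) h
  have h2 := hc (.sk i) fun h' => h ((deg_01_le_21 i).trans h')
  simp only [Co1.val] at h1 h2
  exact ⟨eq_zero_of_add_self (by linear_combination h1 + h2),
    eq_zero_of_add_self (by linear_combination h1 - h2)⟩

theorem bracket01_mem {β ε : Deg} {x : CDer R} {u : EPhi1 R} (hx : x ∈ F0lt R β) (hu : u ∈ F1 R ε) :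
    bracket01 x u ∈ F1lt R (β + ε) := by
  by_cases hx0 : x = 0
  · rw [hx0, zero_bracket01]
    exact zero_mem _
  have hβ : 0 < β := by
    rw [pos_iff_ne_zero]
    rintro rfl
    exact hx0 (eq_zero_of_mem_F0lt_zero hx)
  obtain ⟨h0, hi⟩ := (mem_iSup_G0 (P := {δ | δ < β})).mp hx
  obtain ⟨hc, hf0, hf⟩ := (mem_iSup_G1 (P := {δ | δ ≤ ε})).mp hu
  have hbr := fun i => b_raw_eq_zero hu (i := i)
  have hb : ∀ i, ¬deg i 0 1 < β → x.b i = 0 := fun i h => (hi i h).1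
  have hr : ∀ i, ¬deg i 0 1 < β → x.r i = 0 := fun i h => (hi i h).2
  have hpos : 0 < β + ε := hβ.trans_le le_self_add
  have hzb : ∀ i, ¬deg i 0 1 ≤ ε → (u.1 0).b i = 0 := fun i h => by
    have h1 := hc (.zb i) h
    have h2 := hc (.cf i) h
    simp only [Co1.val] at h1 h2
    exact (sub_eq_zero.mp h1).trans h2
  have kill : ∀ {g d1 d2 : Deg} {s t : R}, ¬g < β + ε → g ≤ d1 + d2 → (¬d1 < β → s = 0) →
      (¬d2 ≤ ε → t = 0) → s * t = 0 := by
    intro g d1 d2 s t hg h hs ht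
    by_cases h1 : d1 < β
    · by_cases h2 : d2 ≤ ε
      · exact (hg (h.trans_lt (add_lt_add_of_lt_of_le h1 h2))).elim
      · rw [ht h2, mul_zero]
    · rw [hs h1, zero_mul]
  have killD : ∀ {g d1 d2 : Deg} {s : R} {D : Derivation ℝ R R}, ¬g < β + ε → g ≤ d1 + d2 →
      (¬d1 < β → s = 0) → (¬d2 ≤ ε → D = 0) → D s = 0 := by
    intro g d1 d2 s D hg h hs ht
    by_cases h1 : d1 < β
    · by_cases h2 : d2 ≤ ε
      · exact (hg (h.trans_lt (add_lt_add_of_lt_of_le h1 h2))).elim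
      · rw [ht h2, Derivation.zero_apply]
    · rw [hs h1, map_zero]
  have kx : ∀ {g d : Deg} {s : R}, ¬g < β + ε → g ≤ d → (¬d < β → s = 0) → s = 0 :=
    fun {g d s} hg h hs => hs fun h' => hg (h.trans_lt (h'.trans_le le_self_add))
  have ku : ∀ {c : Co1}, ¬c.dg < β + ε → c.val u = 0 := fun {c} hg =>
    hc c fun h => hg (lt_of_le_of_lt h (lt_add_of_pos_left ε hβ))
  have kF : ∀ {c : Co1}, ¬c.dg < β + ε → x.field (c.val u) = 0 := fun {c} hg => by
    rw [ku hg, map_zero]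
  have kf : ∀ {i}, ¬deg i 0 1 < β + ε → fieldAt (ax i) u = 0 := fun {i} hg =>
    hf i fun h => hg (lt_of_le_of_lt h (lt_add_of_pos_left ε hβ))
  have comm : ∀ {i : Fin 3} {g : Deg}, g ≤ deg (i + 1) 0 1 + deg (i + 2) 0 1 →
    g ≤ deg (i + 2) 0 1 + deg (i + 1) 0 1 := fun h => h.trans_eq (add_comm _ _)
  refine (mem_iSup_G1 (P := {δ | δ < β + ε})).mpr ⟨fun c hg => ?_, fun h => (h hpos).elim,
    fun i hg => ?_⟩
  · simp only [Set.mem_setOf_eq] at hg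
    cases c
    case k i => exact (hg hpos).elim
    case s0 => exact (hg hpos).elim
    case z0 => exact (hg hpos).elim
    case cf i =>
      have l := deg_01_le i
      have t1 := killD (s := x.w) hg (zero_add (deg i 0 1)).ge (fun h => (h hβ).elim) (hf i)
      have t2 := kx hg le_rfl (hb i)
      have t3 := kill hg (comm l) (hr (i + 2)) (hc (.cf (i + 1)))
      have t4 := kill hg l (hr (i + 1)) (hc (.cf (i + 2)))
      rw [val_bracket01_cf]
      linear_combination kF hg - t1 + x.w * ku hg + (u.1 0).w * t2 + t3 - t4
    case sc i =>
      have l := deg_01_le i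
      have t2 := kx hg le_rfl (hb i)
      have t3 := kill hg (comm l) (hr (i + 2)) (hc (.sc (i + 1)))
      have t4 := kill hg l (hr (i + 1)) (hc (.sc (i + 2)))
      rw [val_bracket01_sc]
      linear_combination kF hg + x.w * ku hg + Co1.val u .s0 * t2 + t3 - t4
    case zb i =>
      have l := deg_01_le i
      have t1 := killD (s := x.w) hg (zero_add (deg i 0 1)).ge (fun h => (h hβ).elim) (hf i)
      have t2 := kx hg le_rfl (hb i)
      have t0 : fieldAt 0 u (x.b i) = 0 := by rw [t2, map_zero]
      have t3 := kill hg (comm l) (hr (i + 2)) (hc (.zb (i + 1)))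
      have t4 := kill hg l (hr (i + 1)) (hc (.zb (i + 2)))
      have t5 := kill hg l (hb (i + 1)) (hc (.zr (i + 2)))
      have t6 := kill hg (comm l) (hb (i + 2)) (hc (.zr (i + 1)))
      have t7 := kill hg l (hb (i + 1)) fun h => (hbr (i + 2) h).2
      have t8 := kill hg (comm l) (hb (i + 2)) fun h => (hbr (i + 1) h).1
      simp only [Co1.val, cyc21, cyc22, cyc11, cyc12] at t5 t6 t7 t8
      rw [val_bracket01_zb]
      linear_combination kF hg + t1 - t0 + x.w * ku hg + t3 - t4 - t5 + t6 + t7 + t8 +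
        ((u.1 (ax i)).b i - (u.1 0).w) * t2
    case zr i =>
      have l := deg_01_le i
      have t2 := kx hg le_rfl (hb i)
      have t0 : fieldAt 0 u (x.r i) = 0 := by rw [kx hg le_rfl (hr i), map_zero]
      have t3 := kill hg (comm l) (hr (i + 2)) (hc (.zr (i + 1)))
      have t4 := kill hg l (hr (i + 1)) (hc (.zr (i + 2)))
      have t5 := kill hg l (hb (i + 1)) (hzb (i + 2))
      have t6 := kill hg (comm l) (hb (i + 2)) (hzb (i + 1))
      have t7 := kill hg l (hb (i + 1)) (hc (.rA (i + 2)))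
      have t8 := kill hg (comm l) (hb (i + 2)) (hc (.rB (i + 1)))
      simp only [Co1.val, cyc21, cyc22, cyc11, cyc12] at t7 t8
      rw [val_bracket01_zr]
      linear_combination kF hg - t0 + x.w * ku hg + t3 - t4 + t5 - t6 + t7 + t8 +
        (u.1 (ax i)).r i * t2
    case sy i =>
      have l := deg_01_le i
      have t1 := killD hg (comm l) (hb (i + 2)) (hf (i + 1))
      have t2 := killD hg l (hb (i + 1)) (hf (i + 2))
      have t3 := kx hg le_rfl (hb i)
      have t4 := kx hg le_rfl (hr i)
      have t5 := kill hg l (hb (i + 1)) (hc (.rA (i + 2)))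
      have t6 := kill hg (comm l) (hb (i + 2)) (hc (.rB (i + 1)))
      have t7 := kill hg l (hb (i + 1)) (hzb (i + 2))
      have t8 := kill hg (comm l) (hb (i + 2)) (hzb (i + 1))
      have t9 := kill hg l (hr (i + 1)) (hc (.sy (i + 2)))
      have s1 := kill hg (comm l) (hr (i + 2)) (hc (.sy (i + 1)))
      rw [val_bracket01_sy]
      linear_combination kF hg - t1 - t2 + x.w * ku hg + t5 - t6 + t7 + t8 + t9 - s1 +
        ((u.1 (ax (i + 2))).r (i + 2) - (u.1 (ax (i + 1))).r (i + 1)) * t3 +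
        (2 * (u.1 (ax (i + 2))).b (i + 2) - 2 * (u.1 (ax (i + 1))).b (i + 1)) * t4
    case sk i =>
      have l := deg_21_le i
      have t1 := killD hg (comm l) (hb (i + 2)) (hf (i + 1))
      have t2 := killD hg l (hb (i + 1)) (hf (i + 2))
      have t3 := kill hg (deg_21_le_self i) (hb i) (hc (.tw i))
      have t5 := kill hg l (hb (i + 1)) (hc (.rA (i + 2)))
      have t6 := kill hg (comm l) (hb (i + 2)) (hc (.rB (i + 1)))
      have t7 := kill hg l (hb (i + 1)) (hc (.zb (i + 2)))
      have t8 := kill hg (comm l) (hb (i + 2)) (hc (.zb (i + 1)))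
      have t9 := kill hg l (hb (i + 1)) (hc (.cf (i + 2)))
      have s1 := kill hg (comm l) (hb (i + 2)) (hc (.cf (i + 1)))
      have s2 := kill hg (deg_21_le_one i) (hr (i + 1)) (hc (.sk (i + 2)))
      have s3 := kill hg (deg_21_le_two i) (hr (i + 2)) (hc (.sk (i + 1)))
      rw [val_bracket01_sk]
      linear_combination kF hg - t1 + t2 + x.w * ku hg - t3 + t5 + t6 + t7 - t8 + t9 - s1 - s2 + s3
    case rA i =>
      have l := deg_01_le i
      have t1 := killD hg l (hr (i + 1)) (hf (i + 2))
      have t2 := kx hg le_rfl (hb i)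
      have t3 := kx hg le_rfl (hr i)
      have t4 := kill hg (comm l) (hb (i + 2)) fun h => (hbr (i + 1) h).1
      have t5 := kill hg (comm l) (hr (i + 2)) (hc (.rB (i + 1)))
      have t6 := kill hg (comm l) (hb (i + 2)) (hc (.zr (i + 1)))
      have t7 := kill hg l (hr (i + 1)) (hc (.rB (i + 2)))
      simp only [cyc11, cyc12] at t4
      rw [val_bracket01_rA]
      linear_combination kF hg - t1 + x.w * ku hg + t4 - t5 + t6 + t7 - (u.1 (ax (i + 2))).b (i + 2) * t2
        + ((u.1 (ax (i + 2))).r (i + 2) - (u.1 (ax (i + 1))).r (i + 1)) * t3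
    case rB i =>
      have l := deg_01_le i
      have t1 := killD hg (comm l) (hr (i + 2)) (hf (i + 1))
      have t2 := kx hg le_rfl (hb i)
      have t3 := kx hg le_rfl (hr i)
      have t4 := kill hg l (hb (i + 1)) fun h => (hbr (i + 2) h).2
      have t5 := kill hg l (hr (i + 1)) (hc (.rA (i + 2)))
      have t6 := kill hg l (hb (i + 1)) (hc (.zr (i + 2)))
      have t7 := kill hg (comm l) (hr (i + 2)) (hc (.rA (i + 1)))
      simp only [cyc21, cyc22] at t4
      rw [val_bracket01_rB]
      linear_combination kF hg - t1 + x.w * ku hg - t4 + t5 + t6 - t7 + (u.1 (ax (i + 1))).b (i + 1) * t2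
        + ((u.1 (ax (i + 2))).r (i + 2) - (u.1 (ax (i + 1))).r (i + 1)) * t3
    case tw i =>
      have l := deg_20_le i
      have l1 := deg_20_le_one i
      have l2 := deg_20_le_two i
      have t1 := killD hg l1 (hr (i + 1)) (hf (i + 1))
      have t2 := killD hg l2 (hr (i + 2)) (hf (i + 2))
      have t3 := kill hg (deg_20_le_self i) (hb i) (hc (.sk i))
      have t4 := kill hg l2 (hb (i + 2)) fun h => (hbr (i + 2) h).2
      have t5 := kill hg l1 (hb (i + 1)) fun h => (hbr (i + 1) h).1
      have t6 := kill hg l2 (hr (i + 2)) (hc (.rA (i + 2)))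
      have t7 := kill hg l1 (hr (i + 1)) (hc (.rB (i + 1)))
      have t8 := kill hg l1 (hb (i + 1)) (hc (.zr (i + 1)))
      have t9 := kill hg l2 (hb (i + 2)) (hc (.zr (i + 2)))
      have s1 := kill hg l2 (hr (i + 2)) (hc (.rB (i + 2)))
      have s2 := kill hg l1 (hr (i + 1)) (hc (.rA (i + 1)))
      simp only [cyc21, cyc22, cyc11, cyc12] at t4 t5
      rw [val_bracket01_tw]
      linear_combination kF hg - t1 - t2 + x.w * ku hg - t3 + t4 - t5 - t6 + t7 + t8 + t9 - s1 + s2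
  · simp only [Set.mem_setOf_eq] at hg
    have l := deg_01_le i
    have killf : ∀ {d1 d2 : Deg} {s : R} {D : Derivation ℝ R R}, deg i 0 1 ≤ d1 + d2 →
        (¬d1 < β → s = 0) → (¬d2 ≤ ε → D = 0) → s • D = 0 := by
      intro d1 d2 s D h hs ht
      by_cases h1 : d1 < β
      · by_cases h2 : d2 ≤ ε
        · exact (hg (h.trans_lt (add_lt_add_of_lt_of_le h1 h2))).elim
        · rw [ht h2, smul_zero]
      · rw [hs h1, zero_smul]
    rw [fieldAt_bracket01, kf hg, kx hg le_rfl (hb i), killf (comm l) (hr (i + 2)) (hf (i + 1)),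
      killf l (hr (i + 1)) (hf (i + 2))]
    simp

theorem F1lt_le_F1 (α : Deg) : F1lt R α ≤ F1 R α :=
  iSup_mono fun _ => iSup_mono' fun h => ⟨h.le, le_rfl⟩

theorem F1_le_F1lt {β α : Deg} (h : β < α) : F1 R β ≤ F1lt R α :=
  iSup_mono fun _ => iSup_mono' fun h' => ⟨h'.trans_lt h, le_rfl⟩

theorem seriesBracket01_mem {a : Deg → CDer R} {y : Deg → EPhi1 R} {α : Deg} (ha : IsSRees0 a)
    (hy : ∀ β ≤ α, y β ∈ F1 R β) : seriesBracket01 a y α ∈ F1lt R α := by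
  refine Submodule.sum_mem _ fun b hb => ?_
  rw [mem_antidiagonal] at hb
  rw [← hb]
  exact bracket01_mem (ha _) (hy _ (hb ▸ le_add_self))

theorem expAct_sub_mem {a : Deg → CDer R} {y : Deg → EPhi1 R} {α : Deg} (ha : IsSRees0 a)
    (hy : ∀ β ≤ α, y β ∈ F1 R β) : expAct a y α - y α ∈ F1lt R α := by
  have hit : ∀ n, ∀ β ≤ α, ((seriesBracket01 a)^[n] y) β ∈ F1 R β := by
    intro n
    induction n with
    | zero => exact hy
    | succ n ih =>
      intro β hβ
      rw [Function.iterate_succ_apply']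
      exact F1lt_le_F1 _ (seriesBracket01_mem ha fun δ hδ => ih δ (hδ.trans hβ))
  rw [expAct, Finset.sum_range_succ']
  have h0 : algebraMap ℝ R (((0 : ℕ).factorial : ℝ)⁻¹) • ((seriesBracket01 a)^[0] y) α = y α := by simp
  rw [h0, add_sub_cancel_right]
  refine Submodule.sum_mem _ fun n _ => Submodule.smul_mem _ _ ?_
  rw [Function.iterate_succ_apply']
  exact seriesBracket01_mem ha fun δ hδ => hit n δ hδ

end

section
variable {R : Type*} [CommRing R] [Algebra ℝ R]

/-! ### Coordinates and filtration in degree two -/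

/-- The filtration degree of a coordinate. -/
def Out.dg : Out → Deg
  | .ham | .k _ | .s0 => 0
  | .tw i => deg i 2 0
  | .mom i | .cf i | .sy i | .rA i | .rB i | .sc i => deg i 0 1
  | .skA i | .skB i | .scal i | .sk i => deg i 2 1
  | .twist => deg 0 2 2

/-- The degree one coordinate that gives a degree two coordinate after multiplication by `θ₀`. -/
def Out.co : Out → Option Co1
  | .k i => some (.k i) | .s0 => some .s0 | .tw i => some (.tw i) | .cf i => some (.cf i)
  | .sy i => some (.sy i) | .rA i => some (.rA i) | .rB i => some (.rB i)
  | .sc i => some (.sc i) | .sk i => some (.sk i) | _ => none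

/-- The generator dual to a coordinate. -/
def Out.gen : Out → EPhi2 R
  | .ham => ∑ i : Fin 3, (thth (ax (i + 1)) (ax (i + 2)) (rot i) + 2 • thth 0 (ax i) (boost i))
  | .mom i => thth 0 (ax (i + 1)) (rot (i + 2)) + thth (ax i) (ax (i + 1)) (boost (i + 1))
  | .skA i => thth 0 (ax (i + 1)) (boost (i + 2)) - thth 0 (ax (i + 2)) (boost (i + 1)) -
      2 • thth (ax (i + 1)) (ax (i + 2)) sigma0
  | .skB i => thth 0 (ax (i + 1)) (boost (i + 2)) + thth 0 (ax (i + 2)) (boost (i + 1)) -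
      2 • thth (ax i) (ax (i + 1)) (rot (i + 1))
  | .scal i => uthth (ax (i + 1)) (ax (i + 2))
  | .twist => ∑ i : Fin 3, (thth 0 (ax i) (rot i) - 2 • thth (ax (i + 1)) (ax (i + 2)) (boost i))
  | .k i => thetaMul 0 (Co1.k i).gen
  | .s0 => thetaMul 0 Co1.s0.gen
  | .tw i => thetaMul 0 (Co1.tw i).gen
  | .cf i => thetaMul 0 (Co1.cf i).gen
  | .sy i => thetaMul 0 (Co1.sy i).gen
  | .rA i => thetaMul 0 (Co1.rA i).gen
  | .rB i => thetaMul 0 (Co1.rB i).gen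
  | .sc i => thetaMul 0 (Co1.sc i).gen
  | .sk i => thetaMul 0 (Co1.sk i).gen

/-- The value of a coordinate on its dual generator. -/
def Out.fac : Out → ℕ
  | .ham => 3
  | .twist => 6
  | .skA _ | .skB _ | .tw _ | .sy _ | .sk _ => 2
  | _ => 1

theorem Out.gen_of_co {n : Out} {c : Co1} (h : n.co = some c) :
    n.gen (R := R) = thetaMul 0 c.gen ∧ n.dg = c.dg ∧ n.fac = c.fac ∧ c.IsGauge := by
  cases n <;> simp only [Out.co, Option.some.injEq, reduceCtorEq] at h <;> subst h <;>
    exact ⟨rfl, rfl, rfl, trivial⟩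

theorem Out.co_inj {n m : Out} {c : Co1} (hn : n.co = some c) (hm : m.co = some c) : n = m := by
  cases n <;> simp only [Out.co, Option.some.injEq, reduceCtorEq] at hn <;> subst hn <;>
  cases m <;> simp_all [Out.co]

theorem Out.exists_co {c : Co1} (h : c.IsGauge) : ∃ n : Out, n.co = some c := by
  cases c
  exacts [⟨.k _, rfl⟩, ⟨.s0, rfl⟩, ⟨.tw _, rfl⟩, ⟨.cf _, rfl⟩, ⟨.sy _, rfl⟩, ⟨.rA _, rfl⟩,
    ⟨.rB _, rfl⟩, ⟨.sc _, rfl⟩, ⟨.sk _, rfl⟩, h.elim, h.elim, h.elim]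

theorem pX_sum_wedge {N : Type*} [AddCommGroup N] [Module R N] (f : Fin 4 → N) (i : Fin 3) : pX i (∑ j, wedge R 0 j (f j)) = f (ax i) := by
  rw [pX, map_sum, Finset.sum_eq_single (ax i)]
  · simp [ent_wedge, ax_ne_zero]
  · intro j _ hj
    simp [ent_wedge, ax_ne_zero, hj.symm]
  · simp

theorem pY_sum_wedge {N : Type*} [AddCommGroup N] [Module R N] (f : Fin 4 → N) (i : Fin 3) : pY i (∑ j, wedge R 0 j (f j)) = 0 := by
  rw [pY, map_sum]
  exact Finset.sum_eq_zero fun j _ => by simp [ent_wedge, ax_ne_zero]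

theorem fieldX_thetaMul (i : Fin 3) (u : EPhi1 R) : fieldX i (thetaMul 0 u) = fieldAt (ax i) u := by
  rw [thetaMul, fieldX_mk, pX_sum_wedge]
  rfl

theorem fieldY_thetaMul (i : Fin 3) (u : EPhi1 R) : fieldY i (thetaMul 0 u) = 0 := by
  rw [thetaMul, fieldY_mk, pY_sum_wedge]
  rfl

theorem coef2_thetaMul (n : Out) (u : EPhi1 R) :
    coef2 n (thetaMul 0 u) = (n.co.map fun c => c.val u).getD 0 := by
  rw [thetaMul, coef2_mk]
  cases n <;>
    simp [-map_sum, altCoef, phiCoef, pX_sum_wedge, pY_sum_wedge, Out.co, Co1.val, thetaMulPhi, eta_zero]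

theorem fieldX_thth (i : Fin 3) (p q : Fin 4) (δ : CDer R) :
    fieldX i (thth p q δ) = (pX i (wedge R p q δ)).field := rfl

theorem fieldY_thth (i : Fin 3) (p q : Fin 4) (δ : CDer R) :
    fieldY i (thth p q δ) = (pY i (wedge R p q δ)).field := rfl

theorem coef2_uthth (n : Out) (p q : Fin 4) :
    coef2 n (uthth p q : EPhi2 R) = phiCoef n (wedge R p q 1, 0) := by
  have : (uthth p q : EPhi2 R) = (Submodule.Quotient.mk 0, (wedge R p q 1, 0)) := rfl
  rw [this, coef2_mk]
  have : altCoef (0 : Alt2 R (CDer R)) n = 0 := map_zero (altCoefₗ (R := R) n)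
  rw [this, zero_add]

/-- The components of a generator. -/
def Out.pairs : Out → (Fin 3 → CDer R) × (Fin 3 → CDer R)
  | .ham => (fun i => 2 • boost i, rot)
  | .mom i => (Pi.single (i + 1) (rot (i + 2)), Pi.single (i + 2) (boost (i + 1)))
  | .skA i => (Pi.single (i + 1) (boost (i + 2)) - Pi.single (i + 2) (boost (i + 1)),
      -(2 • Pi.single i sigma0))
  | .skB i => (Pi.single (i + 1) (boost (i + 2)) + Pi.single (i + 2) (boost (i + 1)),
      -(2 • Pi.single (i + 2) (rot (i + 1))))
  | .twist => (rot, fun i => -(2 • boost i))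
  | _ => 0

theorem thth_zero (i : Fin 3) (δ : CDer R) :
    thth 0 (ax i) δ = toE2 (ofPairs (Pi.single i δ) 0, 0) := by
  rw [thth]
  have : wedge R 0 (ax i) δ = ofPairs (Pi.single i δ) 0 := by
    refine Alt2_ext (R := R) (fun j => ?_) fun j => ?_
    · rw [pX_wedge_zero, X_ofPairs, Pi.single_apply]
    · rw [pY_wedge_zero, Y_ofPairs, Pi.zero_apply]
  rw [this]
  rfl

theorem thth_ax (i : Fin 3) (δ : CDer R) :
    thth (ax (i + 1)) (ax (i + 2)) δ = toE2 (ofPairs 0 (Pi.single i δ), 0) := by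
  rw [thth]
  have : wedge R (ax (i + 1)) (ax (i + 2)) δ = ofPairs 0 (Pi.single i δ) := by
    refine Alt2_ext (R := R) (fun j => ?_) fun j => ?_
    · rw [pX_wedge_ax, X_ofPairs, Pi.zero_apply]
    · rw [pY_wedge_cyc, Y_ofPairs, Pi.single_apply]
  rw [this]
  rfl

theorem thth_ax' (i : Fin 3) (δ : CDer R) :
    thth (ax i) (ax (i + 1)) δ = toE2 (ofPairs 0 (Pi.single (i + 2) δ), 0) := by
  rw [← thth_ax, cyc21, cyc22]

theorem ofPairs_add (X Y X' Y' : Fin 3 → CDer R) :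
    ofPairs (R := R) X Y + ofPairs X' Y' = ofPairs (X + X') (Y + Y') :=
  Alt2_ext (R := R) (fun i => by simp only [map_add, X_ofPairs, Pi.add_apply])
    fun i => by simp only [map_add, Y_ofPairs, Pi.add_apply]

theorem ofPairs_neg (X Y : Fin 3 → CDer R) : -ofPairs (R := R) X Y = ofPairs (-X) (-Y) :=
  Alt2_ext (R := R) (fun i => by simp only [map_neg, X_ofPairs, Pi.neg_apply])
    fun i => by simp only [map_neg, Y_ofPairs, Pi.neg_apply]

theorem toE2_ofPairs_add (X Y X' Y' : Fin 3 → CDer R) : toE2 (ofPairs (R := R) X Y, 0) +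
    toE2 (ofPairs X' Y', 0) = toE2 (ofPairs (X + X') (Y + Y'), 0) := by
  rw [← map_add, Prod.mk_add_mk, ofPairs_add, add_zero]

theorem toE2_ofPairs_neg (X Y : Fin 3 → CDer R) :
    -toE2 (ofPairs (R := R) X Y, 0) = toE2 (ofPairs (-X) (-Y), 0) := by
  rw [← map_neg, Prod.neg_mk, ofPairs_neg, neg_zero]

theorem Out.gen_eq_pairs {m : Out} (h : m.co = none) (h' : ∀ i, m ≠ .scal i) :
    (m.gen : EPhi2 R) = toE2 (ofPairs m.pairs.1 m.pairs.2, 0) := by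
  cases m
  case scal i => exact (h' i rfl).elim
  all_goals first | cases h | skip
  case ham =>
    simp only [Out.gen, thth_zero, thth_ax, two_nsmul, toE2_ofPairs_add, Fin.sum_univ_three]
    congr 3 <;> ext1 j <;> fin_cases j <;> simp [Out.pairs, two_nsmul]
  case twist =>
    simp only [Out.gen, thth_zero, thth_ax, two_nsmul, toE2_ofPairs_add, Fin.sum_univ_three,
      sub_eq_add_neg, toE2_ofPairs_neg]
    congr 3 <;> ext1 j <;> fin_cases j <;> simp [Out.pairs, two_nsmul]
  all_goals
    simp [Out.gen, thth_zero, thth_ax, thth_ax', two_nsmul, toE2_ofPairs_add, sub_eq_add_neg,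
      toE2_ofPairs_neg, Out.pairs]

theorem coef2_ofPairs (n : Out) (X Y : Fin 3 → CDer R) :
    coef2 n (toE2 (ofPairs (R := R) X Y, 0)) = altCoef (ofPairs X Y) n := by
  have : toE2 (ofPairs (R := R) X Y, 0) = (Submodule.Quotient.mk (ofPairs X Y), 0) := rfl
  rw [this, coef2_mk, map_zero, add_zero]

set_option maxHeartbeats 1600000 in
theorem Out.coef2_gen (n m : Out) [Decidable (n = m)] :
    coef2 n (m.gen : EPhi2 R) = if n = m then (n.fac : R) else 0 := by
  classical
  rcases hm : m.co with _ | c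
  · by_cases hs : ∃ i, m = .scal i
    · obtain ⟨i, rfl⟩ := hs
      rw [Out.gen, coef2_uthth]
      cases n
      case scal j => simp [phiCoef, pY_wedge_cyc, Out.fac]
      all_goals simp [phiCoef, pX_wedge_ax]
    rw [Out.gen_eq_pairs hm fun i h => hs ⟨i, h⟩, coef2_ofPairs]
    cases m <;> first | cases hm | skip
    all_goals try exact (hs ⟨_, rfl⟩).elim
    all_goals cases n
    all_goals
      try (rename Fin 3 => j; revert j; rename Fin 3 => i; intro j; obtain rfl | rfl | rfl := cyc_or i j)
    all_goals
      simp [Out.pairs, Out.fac, altCoef, Pi.single_apply, ite_apply,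
        apply_ite CDer.b, apply_ite CDer.r, cyc11, cyc12, cyc21, cyc22, two_nsmul]
    all_goals first
      | (norm_num; done)
      | (rename Fin 3 => i; simp [sum_cyc _ i])
  · rw [(Out.gen_of_co hm).1, coef2_thetaMul]
    rcases hn : n.co with _ | c'
    · rw [if_neg (by rintro rfl; rw [hm] at hn; cases hn)]
      rfl
    · simp only [Option.map_some, Option.getD_some, Co1.val_gen]
      by_cases h : n = m
      · subst h
        rw [hm] at hn
        obtain rfl := Option.some.inj hn
        rw [if_pos rfl, if_pos rfl, (Out.gen_of_co (R := R) hm).2.2.1]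
      · rw [if_neg h, if_neg]
        rintro rfl
        exact h (Out.co_inj hn hm)

theorem fieldX_gen (i : Fin 3) (m : Out) : fieldX i (m.gen : EPhi2 R) = 0 := by
  rcases hm : m.co with _ | c
  · by_cases hs : ∃ i, m = .scal i
    · obtain ⟨j, rfl⟩ := hs
      exact map_zero (CDer.fieldₗ (R := R) ∘ₗ pX i)
    rw [Out.gen_eq_pairs hm fun i h => hs ⟨i, h⟩]
    change (pX i (ofPairs m.pairs.1 m.pairs.2)).field = 0
    rw [X_ofPairs]
    cases m <;> simp [Out.pairs, Pi.single_apply, apply_ite CDer.field, two_nsmul]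
  · rw [(Out.gen_of_co hm).1, fieldX_thetaMul, fieldAt_gen]

theorem fieldY_gen (i : Fin 3) (m : Out) : fieldY i (m.gen : EPhi2 R) = 0 := by
  rcases hm : m.co with _ | c
  · by_cases hs : ∃ i, m = .scal i
    · obtain ⟨j, rfl⟩ := hs
      exact map_zero (CDer.fieldₗ (R := R) ∘ₗ pX i)
    rw [Out.gen_eq_pairs hm fun i h => hs ⟨i, h⟩]
    change (pY i (ofPairs m.pairs.1 m.pairs.2)).field = 0
    rw [Y_ofPairs]
    cases m <;> simp [Out.pairs, Pi.single_apply, apply_ite CDer.field, two_nsmul]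
  · rw [(Out.gen_of_co hm).1, fieldY_thetaMul]

instance : Finite Out := by
  refine Finite.of_surjective (fun x : Option Co1 × Fin 6 × Fin 3 => match x with
    | (none, 0, _) => Out.ham | (none, 1, _) => .twist | (none, 2, i) => .mom i
    | (none, 3, i) => .skA i | (none, 4, i) => .skB i | (none, 5, i) => .scal i
    | (some (.k i), _) => .k i | (some .s0, _) => .s0 | (some (.tw i), _) => .tw i
    | (some (.cf i), _) => .cf i | (some (.sy i), _) => .sy i | (some (.rA i), _) => .rA i
    | (some (.rB i), _) => .rB i | (some (.sc i), _) => .sc i | (some (.sk i), _) => .sk i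
    | (some _, _) => .ham) fun n => ?_
  cases n
  exacts [⟨(none, 0, 0), rfl⟩, ⟨(none, 1, 0), rfl⟩, ⟨(none, 2, _), rfl⟩, ⟨(none, 3, _), rfl⟩,
    ⟨(none, 4, _), rfl⟩, ⟨(none, 5, _), rfl⟩, ⟨(some (.k _), 0), rfl⟩, ⟨(some .s0, 0), rfl⟩,
    ⟨(some (.tw _), 0), rfl⟩, ⟨(some (.cf _), 0), rfl⟩, ⟨(some (.sy _), 0), rfl⟩,
    ⟨(some (.rA _), 0), rfl⟩, ⟨(some (.rB _), 0), rfl⟩, ⟨(some (.sc _), 0), rfl⟩,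
    ⟨(some (.sk _), 0), rfl⟩]

instance : Fintype Out := Fintype.ofFinite _

/-- The inverse of `Out.fac`. -/
def Out.inv (R : Type*) [CommRing R] [Algebra ℝ R] (n : Out) : R := algebraMap ℝ R (n.fac : ℝ)⁻¹

theorem Out.inv_mul_fac (n : Out) : n.inv R * (n.fac : R) = 1 := by
  have h : (n.fac : ℝ) ≠ 0 := by cases n <;> simp [Out.fac]
  rw [Out.inv, ← map_natCast (algebraMap ℝ R), ← map_mul, inv_mul_cancel₀ h, map_one]

theorem coef2_torsion (n : Out) (i : Fin 3) (D : Derivation ℝ R R) :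
    coef2 n (thth (ax (i + 1)) (ax (i + 2)) (ofDer D)) = 0 := by
  rw [thth_ax, coef2_ofPairs]
  cases n <;> simp [altCoef, Pi.single_apply, apply_ite CDer.w, apply_ite CDer.b, apply_ite CDer.r, ite_apply]

theorem coef2_thetaMul_ofDer (n : Out) (p : Fin 4) (D : Derivation ℝ R R) :
    coef2 n (thetaMul 0 (th p (ofDer D))) = 0 := by
  rw [coef2_thetaMul]
  cases n.co <;> simp [val_th_ofDer]

theorem fieldX_torsion (j i : Fin 3) (D : Derivation ℝ R R) :
    fieldX j (thth (ax (i + 1)) (ax (i + 2)) (ofDer D)) = 0 := by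
  rw [fieldX_thth, pX_wedge_ax]
  rfl

theorem fieldY_torsion (j i : Fin 3) (D : Derivation ℝ R R) :
    fieldY j (thth (ax (i + 1)) (ax (i + 2)) (ofDer D)) = if j = i then D else 0 := by
  rw [fieldY_thth, pY_wedge_cyc, apply_ite CDer.field, field_ofDer, CDer.field_zero]

theorem fieldX_thetaMul_ofDer (j i : Fin 3) (D : Derivation ℝ R R) :
    fieldX j (thetaMul 0 (th (ax i) (ofDer D))) = if j = i then D else 0 := by
  rw [fieldX_thetaMul, fieldAt_th_ofDer]
  simp only [ax_inj]

theorem eq_sum_gen2 (z : EPhi2 R) :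
    z = ∑ n : Out, (n.inv R * coef2 n z) • n.gen +
      (∑ i, thetaMul 0 (th (ax i) (ofDer (fieldX i z))) +
        ∑ i : Fin 3, thth (ax (i + 1)) (ax (i + 2)) (ofDer (fieldY i z))) := by
  classical
  refine EPhi2_ext (fun n => ?_) (fun j => ?_) fun j => ?_
  · simp only [map_add, map_sum, map_smul, coef2_torsion, coef2_thetaMul_ofDer,
      Finset.sum_const_zero, add_zero, Out.coef2_gen, smul_eq_mul, mul_ite, mul_zero,
      Finset.sum_ite_eq, Finset.mem_univ, if_true]
    linear_combination -coef2 n z * n.inv_mul_fac (R := R)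
  · simp only [map_add, map_sum, map_smul, fieldX_gen, smul_zero, Finset.sum_const_zero, zero_add,
      fieldX_torsion, fieldX_thetaMul_ofDer, Finset.sum_ite_eq, Finset.mem_univ, if_true, add_zero]
  · simp only [map_add, map_sum, map_smul, fieldY_gen, smul_zero, Finset.sum_const_zero, zero_add,
      fieldY_torsion, fieldY_thetaMul, Finset.sum_ite_eq, Finset.mem_univ, if_true]

theorem Out.gen_mem (n : Out) : Gen2 n.dg (n.gen : EPhi2 R) ∨
    ∃ u : EPhi1 R, Gen1 n.dg u ∧ n.gen = thetaMul 0 u := by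
  rcases hn : n.co with _ | c
  · refine .inl ?_
    cases n <;> first | cases hn | skip
    exacts [.ham, .twist, .mom _, .skewA _, .skewB _, .scalar _]
  · obtain ⟨h1, h2, -, h3⟩ := Out.gen_of_co (R := R) hn
    exact .inr ⟨_, h2 ▸ Co1.gen_gauge h3, h1⟩

theorem gen2_cases {β : Deg} {z : EPhi2 R}
    (h : Gen2 β z ∨ ∃ u : EPhi1 R, Gen1 β u ∧ z = thetaMul 0 u) :
    (∃ n : Out, β = n.dg ∧ z = n.gen) ∨
      (∃ i D, β = deg i 0 1 ∧ z = thetaMul 0 (th (ax i) (ofDer D))) ∨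
      ∃ i D, β = deg i 2 1 ∧ z = thth (ax (i + 1)) (ax (i + 2)) (ofDer D) := by
  obtain h | ⟨u, hu, rfl⟩ := h
  · cases h
    case ham => exact .inl ⟨.ham, rfl, rfl⟩
    case mom i => exact .inl ⟨.mom i, rfl, rfl⟩
    case torsion i D => exact .inr (.inr ⟨i, D, rfl, rfl⟩)
    case skewA i => exact .inl ⟨.skA i, rfl, rfl⟩
    case skewB i => exact .inl ⟨.skB i, rfl, rfl⟩
    case scalar i => exact .inl ⟨.scal i, rfl, rfl⟩
    case twist => exact .inl ⟨.twist, rfl, rfl⟩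
  · obtain ⟨c, hc, rfl, rfl⟩ | ⟨i, D, rfl, rfl⟩ := hu.cases
    · obtain ⟨n, hn⟩ := Out.exists_co hc
      obtain ⟨h1, h2, -⟩ := Out.gen_of_co (R := R) hn
      exact .inl ⟨n, h2.symm, h1.symm⟩
    · exact .inr (.inl ⟨i, D, rfl, rfl⟩)

theorem mem_iSup_G2 {P : Set Deg} {z : EPhi2 R} : z ∈ ⨆ β ∈ P, G2 R β ↔
    (∀ n : Out, n.dg ∉ P → coef2 n z = 0) ∧ (∀ i, deg i 0 1 ∉ P → fieldX i z = 0) ∧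
      ∀ i, deg i 2 1 ∉ P → fieldY i z = 0 := by
  classical
  constructor
  · intro hz
    have key : ∀ {N : Type _} [AddCommGroup N] [Module R N] (f : EPhi2 R →ₗ[R] N),
        (∀ β ∈ P, ∀ z, (Gen2 β z ∨ ∃ u : EPhi1 R, Gen1 β u ∧ z = thetaMul 0 u) → f z = 0) →
        f z = 0 := by
      intro N _ _ f hf
      have : ⨆ β ∈ P, G2 R β ≤ LinearMap.ker f :=
        iSup₂_le fun β hβ => Submodule.span_le.mpr fun u hu => hf β hβ u hu
      exact this hz
    refine ⟨fun n hn => key _ fun β hβ z hz => ?_, fun i hi => key _ fun β hβ z hz => ?_,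
      fun i hi => key _ fun β hβ z hz => ?_⟩ <;>
      obtain ⟨m, rfl, rfl⟩ | ⟨j, D, rfl, rfl⟩ | ⟨j, D, rfl, rfl⟩ := gen2_cases hz
    · rw [Out.coef2_gen, if_neg fun h : n = m => hn (h ▸ hβ)]
    · exact coef2_thetaMul_ofDer _ _ _
    · exact coef2_torsion _ _ _
    · exact fieldX_gen _ _
    · rw [fieldX_thetaMul_ofDer, if_neg fun h : i = j => hi (h ▸ hβ)]
    · exact fieldX_torsion _ _ _
    · exact fieldY_gen _ _
    · exact fieldY_thetaMul _ _
    · rw [fieldY_torsion, if_neg fun h : i = j => hi (h ▸ hβ)]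
  · rintro ⟨hn, hX, hY⟩
    have hle : ∀ {β} {z : EPhi2 R}, β ∈ P →
        (Gen2 β z ∨ ∃ u : EPhi1 R, Gen1 β u ∧ z = thetaMul 0 u) → z ∈ ⨆ β ∈ P, G2 R β := fun hβ hu =>
      Submodule.mem_iSup_of_mem _ (Submodule.mem_iSup_of_mem hβ (Submodule.subset_span hu))
    rw [eq_sum_gen2 z]
    refine add_mem (Submodule.sum_mem _ fun n _ => ?_)
      (add_mem (Submodule.sum_mem _ fun i _ => ?_) (Submodule.sum_mem _ fun i _ => ?_))
    · by_cases h : n.dg ∈ P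
      · exact Submodule.smul_mem _ _ (hle h n.gen_mem)
      · rw [hn n h, mul_zero, zero_smul]
        exact zero_mem _
    · by_cases h : deg i 0 1 ∈ P
      · exact hle h (.inr ⟨_, .frame i _, rfl⟩)
      · rw [hX i h]
        convert zero_mem (⨆ β ∈ P, G2 R β)
        refine EPhi2_ext (fun n => ?_) (fun j => ?_) fun j => ?_
        · rw [coef2_thetaMul_ofDer, map_zero]
        · rw [fieldX_thetaMul_ofDer, ite_self, map_zero]
        · rw [fieldY_thetaMul, map_zero]
    · by_cases h : deg i 2 1 ∈ P
      · exact hle h (.inl (.torsion i _))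
      · rw [hY i h]
        convert zero_mem (⨆ β ∈ P, G2 R β)
        refine EPhi2_ext (fun n => ?_) (fun j => ?_) fun j => ?_
        · rw [coef2_torsion, map_zero]
        · rw [fieldX_torsion, map_zero]
        · rw [fieldY_torsion, ite_self, map_zero]

end

section
variable {R : Type*} [CommRing R] [Algebra ℝ R]

/-! ### The adjoint action of the leading term -/

section Lead
variable (d : Derivation ℝ R R) (k : Fin 3 → R) (s : R)

/-- The leading term `θ₀∂₀ + ∑ k_i (θ₀σ₀ + θ_iσ_i)` together with the scalar field `s θ₀`. -/
def leadE : EPhi1 R :=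
  (Fin.cons (cd (∑ i, k i) 0 0 d) fun i => cd 0 (Pi.single i (k i)) 0 0, Fin.cons s 0)

theorem leadE_zero : (leadE d k s).1 0 = cd (∑ i, k i) 0 0 d := rfl
theorem leadE_ax (i : Fin 3) : (leadE d k s).1 (ax i) = cd 0 (Pi.single i (k i)) 0 0 := rfl
theorem leadE_phi_zero : (leadE d k s).2 0 = s := rfl
theorem leadE_phi_ax (i : Fin 3) : (leadE d k s).2 (ax i) = 0 := rfl

variable (u : EPhi1 R) (i : Fin 3)

theorem fieldX_bracket11_leadE : fieldX i (bracket11 (leadE d k s) u) =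
    ⁅d, fieldAt (ax i) u⁆ + (k (i + 1) + k (i + 2)) • fieldAt (ax i) u + Co1.val u (.zb i) • d := by
  simp only [bracket11, fieldX_mk, map_add, CDer.field_add, pX, ent_bracketE, ent_bracketPhi,
    preE, prePhi, sum_ax_cyc _ i, CDer.field_sub, CDer.field_smul, field_sigma, smul_zero, add_zero,
    sub_zero, leadE_zero, leadE_ax, CDer.field_bracket, field_cd, w_cd, b_cd, r_cd,
    CDer.mat_zero_zero, CDer.mat_zero_ax, CDer.mat_ax_zero, CDer.mat_ax_self, CDer.mat_ax_one,
    CDer.mat_ax_two]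
  simp [Co1.val, fieldAt_apply, sum_cyc _ i]
  module

theorem fieldY_bracket11_leadE :
    fieldY i (bracket11 (leadE d k s) u) = Co1.val u (.sk i) • d := by
  simp only [bracket11, fieldY_mk, map_add, CDer.field_add, pY, ent_bracketE, ent_bracketPhi,
    preE, prePhi, sum_ax_cyc _ i, CDer.field_sub, CDer.field_smul, field_sigma, smul_zero, add_zero,
    sub_zero, leadE_zero, leadE_ax, CDer.field_bracket, field_cd, w_cd, b_cd, r_cd,
    CDer.mat_ax_zero, CDer.mat_ax_self, CDer.mat_one_ax, CDer.mat_two_ax, CDer.mat_one_two,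
    CDer.mat_two_one]
  simp [Co1.val]
  module

theorem coef2_sk_bracket11_leadE : coef2 (.sk i) (bracket11 (leadE d k s) u) =
    d (Co1.val u (.sk i)) + (2 * k i + k (i + 1) + k (i + 2)) * Co1.val u (.sk i) := by
  simp only [coef2_bracket11]
  simp only [cyc11, cyc12, cyc21, cyc22, altCoef, phiCoef, LinearMap.zero_apply,
    add_zero, sum_cyc _ i, pY, pX, ent_bracketE, ent_bracketPhi, preE, prePhi,
    sum_ax_cyc _ i, leadE_zero, leadE_ax, leadE_phi_zero, leadE_phi_ax, eta_zero, eta_ax,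
    sigma_self, sigma_zero_ax, sigma_one_two,
    sigma_two_one, sigma_one_ax, sigma_two_ax, sigma_ax_zero,
    CDer.b_add, CDer.b_sub, CDer.b_smul, CDer.b_neg, b_boost, b_rot, CDer.b_zero, CDer.b_bracket,
    CDer.w_add, CDer.w_sub, CDer.w_smul, CDer.w_neg, w_boost, w_rot, CDer.w_zero, CDer.w_bracket,
    b_cd, r_cd, w_cd, field_cd, Pi.zero_apply, map_zero, CDer.mat_zero_zero, CDer.mat_zero_ax,
    CDer.mat_ax_zero, CDer.mat_ax_self, CDer.mat_one_ax,
    CDer.mat_two_ax, CDer.mat_one_two, CDer.mat_two_one]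
  simp [Co1.val,
    eta_apply, ax_inj]
  ring

theorem coef2_sy_bracket11_leadE : coef2 (.sy i) (bracket11 (leadE d k s) u) =
    d (Co1.val u (.sy i)) - 2 * (k (i + 1) - k (i + 2)) * Co1.val u (.zr i) := by
  simp only [coef2_bracket11]
  simp only [cyc11, cyc12, cyc21, cyc22, altCoef, phiCoef, LinearMap.zero_apply,
    add_zero, sum_cyc _ i, pY, pX, ent_bracketE, ent_bracketPhi, preE, prePhi,
    sum_ax_cyc _ i, leadE_zero, leadE_ax, leadE_phi_zero, leadE_phi_ax, eta_zero, eta_ax,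
    sigma_self, sigma_zero_ax, sigma_one_two,
    sigma_two_one, sigma_ax_one, sigma_one_ax, sigma_two_ax, sigma_ax_two, sigma_ax_zero,
    CDer.b_add, CDer.b_sub, CDer.b_smul, CDer.b_neg, b_boost, b_rot, CDer.b_zero, CDer.b_bracket,
    CDer.r_add, CDer.r_sub, CDer.r_smul, CDer.r_neg, r_boost, r_rot, CDer.r_zero, CDer.r_bracket,
    b_cd, r_cd, w_cd, field_cd, Pi.zero_apply, map_zero, CDer.mat_zero_zero, CDer.mat_zero_ax,
    CDer.mat_ax_zero, CDer.mat_ax_self, CDer.mat_ax_one, CDer.mat_ax_two, CDer.mat_one_ax,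
    CDer.mat_two_ax, CDer.mat_one_two, CDer.mat_two_one]
  simp [Co1.val,
    eta_apply, ax_inj]
  ring

variable (x : CDer R)

theorem sy_bracket01_leadE : Co1.val (bracket01 x (leadE d k s)) (.sy i) =
    -(2 * (k (i + 1) - k (i + 2)) * x.r i) := by
  rw [val_bracket01_sy]
  simp [fieldAt_apply, Co1.val, leadE_zero, leadE_ax, cyc11, cyc12, cyc21, cyc22]
  ring

theorem z0_bracket01_leadE : Co1.val (bracket01 x (leadE d k s)) .z0 = -d x.w := by
  simp only [Co1.val, fst_bracket01_zero, fst_bracket01_ax]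
  simp [leadE_zero, leadE_ax, Finset.sum_add_distrib, CDer.w_sum, Finset.mul_sum]

theorem fieldAt_zero_bracket01_leadE :
    fieldAt 0 (bracket01 x (leadE d k s)) = ⁅x.field, d⁆ + x.w • d := by
  simp [fieldAt_apply, fst_bracket01_zero, leadE_zero, leadE_ax, CDer.field_sum]

theorem fieldAt_ax_bracket01_leadE : fieldAt (ax i) (bracket01 x (leadE d k s)) = x.b i • d := by
  rw [fieldAt_bracket01]
  simp [fieldAt_apply, leadE_zero, leadE_ax]

theorem mk_eq_leadE (L : Fin 3 → Derivation ℝ R R) {g : Idx → R} (hg : IsLeading d g) :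
    mk d L g = leadE d (fun i => g (.k i)) (g .s0) := by
  have h1 := fun i => hg.small (.tw i) rfl
  have h2 := fun i => hg.small (.cf i) rfl
  have h3 := fun i => hg.small (.sy i) rfl
  have h4 := fun i => hg.small (.rA i) rfl
  have h5 := fun i => hg.small (.rB i) rfl
  have h6 := fun i => hg.small (.sc i) rfl
  have h7 := fun i a => hg.small (.e i a) rfl
  refine Prod.ext (funext fun p => ?_) (funext fun p => ?_)
  · revert p
    refine forall_ax.mpr ⟨?_, fun i => ?_⟩
    · change mkE d L g 0 = _
      rw [mkE_zero, leadE_zero, hg.z, one_smul]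
      simp only [h2]
      rfl
    · change mkE d L g (ax i) = _
      rw [mkE_ax, leadE_ax]
      have e1 : bvec g i = Pi.single i (g (.k i)) := by
        funext m
        simp only [bvec, h3, Pi.single_apply, ite_self]
      have e2 : rvec g i = 0 := by
        funext m
        simp [rvec, h1, h4, h5]
      have e3 : frameD L g i = 0 := by simp [frameD, h7]
      rw [h2, e1, e2, e3]
  · revert p
    exact forall_ax.mpr ⟨rfl, fun i => h6 i⟩
end Lead

/-! ### Elements with given coefficients -/

section Mk
variable (d : Derivation ℝ R R) (L : Fin 3 → Derivation ℝ R R) (v : Idx → R)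

theorem val_mk (c : Co1) : c.val (mk d L v) = match c with
    | .k i => v (.k i) | .s0 => v .s0 | .tw i => 2 * v (.tw i) | .cf i => v (.cf i)
    | .sy i => 2 * v (.sy i) | .rA i => v (.rA i) | .rB i => v (.rB i) | .sc i => v (.sc i)
    | _ => 0 := by
  cases c <;> simp only [Co1.val, mk, mkE_zero, mkE_ax, mkPhi_zero, mkPhi_ax, w_cd, b_cd, r_cd,
    bvec_cyc, rvec_cyc, cyc11, cyc12, cyc21, cyc22, sub_self, Pi.zero_apply] <;> ring

theorem fieldAt_zero_mk : fieldAt 0 (mk d L v) = v .z • d := by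
  simp only [fieldAt_apply, mk, mkE_zero, field_cd]

theorem fieldAt_ax_mk (i : Fin 3) : fieldAt (ax i) (mk d L v) = frameD L v i := by
  simp only [fieldAt_apply, mk, mkE_ax, field_cd]

/-- The linear map to degree one elements given by a frame. -/
def mkₗ : (Idx → R) →ₗ[R] EPhi1 R where
  toFun := mk d L
  map_add' u v := by
    refine EPhi1_ext (fun c => ?_) (forall_ax.mpr ⟨?_, fun i => ?_⟩)
    · rw [← Co1.valₗ_apply c (_ + _), map_add, Co1.valₗ_apply, Co1.valₗ_apply]
      cases c <;> simp only [val_mk, Pi.add_apply] <;> ring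
    · simp only [map_add, fieldAt_zero_mk, Pi.add_apply, add_smul]
    · simp only [map_add, fieldAt_ax_mk, frameD, Pi.add_apply, add_smul, Finset.sum_add_distrib]
  map_smul' f u := by
    refine EPhi1_ext (fun c => ?_) (forall_ax.mpr ⟨?_, fun i => ?_⟩)
    · rw [← Co1.valₗ_apply c (RingHom.id R f • _), map_smul, Co1.valₗ_apply]
      cases c <;> simp only [val_mk, Pi.smul_apply, smul_eq_mul, RingHom.id_apply] <;> ring
    · simp only [map_smul, fieldAt_zero_mk, Pi.smul_apply, smul_smul, smul_eq_mul, RingHom.id_apply]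
    · simp only [map_smul, fieldAt_ax_mk, frameD, Pi.smul_apply, smul_smul, smul_eq_mul,
        RingHom.id_apply, Finset.smul_sum]

theorem mkₗ_apply : mkₗ d L v = mk d L v := rfl

variable {d L v}

theorem mk_mem_iSup_G1 {P : Set Deg} (h : ∀ m : Idx, m.dg ∉ P → v m = 0) :
    mk d L v ∈ ⨆ β ∈ P, G1 R β := by
  refine mem_iSup_G1.mpr ⟨fun c hc => ?_, fun h0 => ?_, fun i hi => ?_⟩
  · rw [val_mk]
    cases c
    case k i => exact h (.k i) hc
    case s0 => exact h .s0 hc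
    case tw i => exact (congrArg _ (h (.tw i) hc)).trans (mul_zero _)
    case cf i => exact h (.cf i) hc
    case sy i => exact (congrArg _ (h (.sy i) hc)).trans (mul_zero _)
    case rA i => exact h (.rA i) hc
    case rB i => exact h (.rB i) hc
    case sc i => exact h (.sc i) hc
    all_goals rfl
  · rw [fieldAt_zero_mk, h .z h0, zero_smul]
  · rw [fieldAt_ax_mk, frameD]
    exact Finset.sum_eq_zero fun a _ => by rw [h (.e i a) hi, zero_smul]

theorem mk_mem_F1 {ε : Deg} (h : SuppLE ε v) : mk d L v ∈ F1 R ε :=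
  mk_mem_iSup_G1 (P := {β | β ≤ ε}) h

theorem mk_mem_F1lt {ε : Deg} (h : ∀ m : Idx, ¬m.dg < ε → v m = 0) : mk d L v ∈ F1lt R ε :=
  mk_mem_iSup_G1 (P := {β | β < ε}) h

theorem mk_mem_G1 {ε : Deg} (h : ∀ m : Idx, m.dg ≠ ε → v m = 0) : mk d L v ∈ G1 R ε := by
  have := mk_mem_iSup_G1 (d := d) (L := L) (P := {ε}) h
  simpa using this

theorem mk_mem_F1gauge {ε : Deg} (h : SuppLE ε v) (hz : v .z = 0) : mk d L v ∈ F1gauge R ε := by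
  refine mem_F1gauge.mpr ⟨mk_mem_F1 h, fun c hc => ?_, ?_⟩
  · cases c <;> first | exact (hc trivial).elim | (rw [val_mk])
  · rw [fieldAt_zero_mk, hz, zero_smul]

theorem mk_z_one : mk d L (fun m => match m with | .z => 1 | _ => 0) = th 0 (ofDer d) := by
  refine EPhi1_ext (fun c => ?_) (forall_ax.mpr ⟨?_, fun i => ?_⟩)
  · rw [val_mk, val_th_ofDer]
    cases c <;> simp
  · rw [fieldAt_zero_mk, fieldAt_th_ofDer, if_pos rfl, one_smul]
  · rw [fieldAt_ax_mk, fieldAt_th_ofDer, if_neg (ax_ne_zero i), frameD]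
    simp

end Mk

end

section
section Symmetry
variable {R : Type*} [CommRing R] [Algebra ℝ R]

theorem bracket11_comm (u v : EPhi1 R) : bracket11 u v = bracket11 v u := by
  have h1 : bracketE u.1 v.1 = bracketE v.1 u.1 := Alt2_ext_ent fun a b => by
    have h : ∀ x y : CDer R, CDer.bracket x y = -CDer.bracket y x := fun x y =>
      CDer.ext_coord (by simp only [CDer.w_bracket, CDer.w_neg]; ring)
        (by intro i; simp only [CDer.b_bracket, CDer.b_neg]; ring)
        (by intro i; simp only [CDer.r_bracket, CDer.r_neg]; ring)
        (by simp only [CDer.field_bracket, CDer.field_neg, lie_skew])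
    rw [ent_bracketE, ent_bracketE, preE, preE, preE, preE, h (v.1 a), h (v.1 b)]
    abel
  have h2 : bracketPhi u.2 v.2 = bracketPhi v.2 u.2 := Alt2_ext_ent fun a b => by
    have h : ∀ a b, prePhi u.2 v.2 a b = prePhi v.2 u.2 a b := fun a b =>
      Finset.sum_congr rfl fun q _ => by
        congr 2
        rw [Finset.sum_congr rfl fun c _ => by rw [mul_comm (u.2 c)]]
        ring
    rw [ent_bracketPhi, ent_bracketPhi, h, h]
  rw [bracket11, bracket11, h1, h2, add_comm (bracketEPhi u.1 v.2)]

/-- The coefficients of the curvature of a double series. -/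
def curvE (γ : Deg → Deg → EPhi1 R) (β ε : Deg) : EPhi2 R :=
  conv β ε fun b e b' e' => bracket11 (γ b e) (γ b' e')

theorem seriesBracket11_setTeqS (γ : Deg → Deg → EPhi1 R) (α : Deg) :
    seriesBracket11 (setTeqS γ) (setTeqS γ) α = ∑ b ∈ antidiagonal α, curvE γ b.1 b.2 := by
  have key : seriesBracket11 (setTeqS γ) (setTeqS γ) α = ∑ x ∈ antidiagonal α,
      ∑ y ∈ antidiagonal x.1, ∑ z ∈ antidiagonal x.2, br11 (γ y.1 y.2) (γ z.1 z.2) := by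
    refine Finset.sum_congr rfl fun x _ => ?_
    rw [← br11_apply, setTeqS, setTeqS, map_sum (br11 (R := R)), AddMonoidHom.finsetSum_apply]
    exact Finset.sum_congr rfl fun y _ => by rw [map_sum]
  rw [key, ← sum_antidiagonal_assoc α fun a b y =>
    ∑ z ∈ antidiagonal y, br11 (γ a b) (γ z.1 z.2)]
  have h2 : ∀ x ∈ antidiagonal α, (∑ y ∈ antidiagonal x.2, ∑ z ∈ antidiagonal y.2,
      br11 (γ x.1 y.1) (γ z.1 z.2)) = ∑ y ∈ antidiagonal x.2, ∑ z ∈ antidiagonal y.2,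
      br11 (γ x.1 z.1) (γ y.1 z.2) := fun x _ =>
    (sum_antidiagonal_left_comm x.2 fun b c d => br11 (γ x.1 b) (γ c d)).symm.trans
      (Finset.sum_congr rfl fun y _ => rfl)
  rw [Finset.sum_congr rfl h2, sum_antidiagonal_assoc α fun a c y =>
    ∑ z ∈ antidiagonal y, br11 (γ a z.1) (γ c z.2)]
  rfl

end Symmetry

/-- A background whose frame is a basis of the vector fields, with distinct exponents. -/
structure AnisotropicBackground (A : Type*) [CommRing A] [Algebra ℝ A] extends Background A where
  /-- the component of a vector field along the time derivative -/
  c0 : Derivation ℝ A A →ₗ[A] A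
  /-- the components of a vector field along the spatial frame -/
  cL : Fin 3 → Derivation ℝ A A →ₗ[A] A
  decomp : ∀ D, D = c0 D • d + comb L fun a => cL a D
  c0_d : c0 d = 1
  c0_L : ∀ a, c0 (L a) = 0
  cL_d : ∀ a, cL a d = 0
  cL_L : ∀ a b, cL a (L b) = if b = a then 1 else 0
  prim : ∀ f, ∃ F, d F = f
  unit : ∀ i, IsUnit (p (i + 1) - p (i + 2))

namespace AnisotropicBackground
variable {A : Type*} [CommRing A] [Algebra ℝ A] (B : AnisotropicBackground A)

theorem cL_comb (c : Fin 3 → A) (a : Fin 3) : B.cL a (comb B.L c) = c a := by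
  simp only [comb, map_sum, map_smul, B.cL_L, smul_eq_mul, mul_ite, mul_one, mul_zero,
    Finset.sum_ite_eq', Finset.mem_univ, if_true]

theorem c0_comb (c : Fin 3 → A) : B.c0 (comb B.L c) = 0 := by
  simp only [comb, map_sum, map_smul, B.c0_L, smul_zero, Finset.sum_const_zero]

theorem comb_eq_zero {c : Fin 3 → A} : comb B.L c = 0 ↔ ∀ a, c a = 0 :=
  ⟨fun h a => by rw [← B.cL_comb c a, h, map_zero], fun h => by simp [comb, h]⟩

theorem field_ext {D E : Derivation ℝ A A} (h0 : B.c0 D = B.c0 E) (h : ∀ a, B.cL a D = B.cL a E) :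
    D = E := by
  rw [B.decomp D, B.decomp E, h0, funext h]

theorem lie_d (F : Derivation ℝ A A) :
    ⁅B.d, F⁆ = B.d (B.c0 F) • B.d + comb B.L fun a => B.d (B.cL a F) := by
  have h : ∀ (f : A) (D : Derivation ℝ A A), ⁅B.d, f • D⁆ = B.d f • D + f • ⁅B.d, D⁆ := fun f D => by
    ext g
    simp only [Derivation.commutator_apply, Derivation.coe_smul, Pi.smul_apply, smul_eq_mul,
      Derivation.leibniz, Derivation.coe_add, Pi.add_apply]
    ring
  conv_lhs => rw [B.decomp F]
  rw [lie_add, h, comb, lie_sum, lie_self, smul_zero, add_zero]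
  simp only [h, B.rel.comm_d, smul_zero, add_zero, comb]

theorem c0_lie_d (F : Derivation ℝ A A) : B.c0 ⁅B.d, F⁆ = B.d (B.c0 F) := by
  rw [lie_d, map_add, map_smul, B.c0_d, c0_comb, smul_eq_mul, mul_one, add_zero]

theorem cL_lie_d (F : Derivation ℝ A A) (a : Fin 3) : B.cL a ⁅B.d, F⁆ = B.d (B.cL a F) := by
  rw [lie_d, map_add, map_smul, B.cL_d, cL_comb, smul_zero, zero_add]

/-- The coefficients of elements in the gauge. -/
def coord : Idx → EPhi1 A →ₗ[A] A
  | .z => B.c0 ∘ₗ fieldAt 0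
  | .k i => (Co1.k i).valₗ
  | .s0 => Co1.s0.valₗ
  | .tw i => algebraMap ℝ A 2⁻¹ • (Co1.tw i).valₗ
  | .cf i => (Co1.cf i).valₗ
  | .sy i => algebraMap ℝ A 2⁻¹ • (Co1.sy i).valₗ
  | .rA i => (Co1.rA i).valₗ
  | .rB i => (Co1.rB i).valₗ
  | .sc i => (Co1.sc i).valₗ
  | .e i a => B.cL a ∘ₗ fieldAt (ax i)

theorem half_mul_two (x : A) : algebraMap ℝ A 2⁻¹ * (2 * x) = x := by
  rw [← mul_assoc, ← map_ofNat (algebraMap ℝ A), ← map_mul, inv_mul_cancel₀ two_ne_zero, map_one,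
    one_mul]

theorem two_mul_half (x : A) : 2 * (algebraMap ℝ A 2⁻¹ * x) = x := by
  rw [mul_left_comm, half_mul_two]

/-- The elements that are determined by their coefficients. -/
structure InGauge (u : EPhi1 A) : Prop where
  sk : ∀ i, Co1.val u (.sk i) = 0
  z0 : Co1.val u .z0 = 0
  zb : ∀ i, Co1.val u (.zb i) = 0
  zr : ∀ i, Co1.val u (.zr i) = 0
  time : ∀ a, B.cL a (fieldAt 0 u) = 0
  space : ∀ i, B.c0 (fieldAt (ax i) u) = 0

variable {B}

theorem InGauge.mk_coord {u : EPhi1 A} (h : B.InGauge u) :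
    BKL.mk B.d B.L (fun m => B.coord m u) = u := by
  refine EPhi1_ext (fun c => ?_) (forall_ax.mpr ⟨?_, fun i => ?_⟩)
  · rw [val_mk]
    cases c with
    | sk i => exact (h.sk i).symm
    | z0 => exact h.z0.symm
    | zb i => exact (h.zb i).symm
    | zr i => exact (h.zr i).symm
    | tw i | sy i => simp only [coord, LinearMap.smul_apply, Co1.valₗ_apply, smul_eq_mul,
        two_mul_half]
    | _ => rfl
  · rw [fieldAt_zero_mk]
    refine B.field_ext ?_ fun a => ?_
    · rw [map_smul, B.c0_d, smul_eq_mul, mul_one]; rfl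
    · rw [map_smul, B.cL_d, smul_zero, h.time]
  · rw [fieldAt_ax_mk]
    refine B.field_ext ?_ fun a => ?_
    · rw [h.space]; exact B.c0_comb _
    · exact B.cL_comb _ a

theorem coord_eq_zero {P : Set Deg} {u : EPhi1 A} (hu : u ∈ ⨆ β ∈ P, G1 A β) {m : Idx}
    (h : m.dg ∉ P) : B.coord m u = 0 := by
  obtain ⟨h1, h2, h3⟩ := mem_iSup_G1.mp hu
  cases m with
  | z => simp only [coord, LinearMap.comp_apply, h2 h, map_zero]
  | k i => exact h1 (.k i) h
  | s0 => exact h1 .s0 h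
  | tw i => simp only [coord, LinearMap.smul_apply, Co1.valₗ_apply, h1 (.tw i) h, smul_zero]
  | sy i => simp only [coord, LinearMap.smul_apply, Co1.valₗ_apply, h1 (.sy i) h, smul_zero]
  | cf i => exact h1 (.cf i) h
  | rA i => exact h1 (.rA i) h
  | rB i => exact h1 (.rB i) h
  | sc i => exact h1 (.sc i) h
  | e i a => simp only [coord, LinearMap.comp_apply, h3 i h, map_zero]

/-! ### The curvature of series in the gauge -/

theorem conv_swap {N : Type*} [AddCommMonoid N] (β ε : Deg) (f : Deg → Deg → Deg → Deg → N) :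
    conv β ε (fun b e b' e' => f b' e' b e) = conv β ε f := by
  have h : ∀ (α : Deg) (g : Deg → Deg → N),
      ∑ x ∈ antidiagonal α, g x.2 x.1 = ∑ x ∈ antidiagonal α, g x.1 x.2 := fun α g => by
    conv_rhs => rw [← Finset.HasAntidiagonal.map_swap_antidiagonal, Finset.sum_map]
    rfl
  rw [conv, h β fun b b' => ∑ e ∈ antidiagonal ε, f b e.2 b' e.1]
  exact Finset.sum_congr rfl fun x _ => h ε fun e e' => f x.1 e x.2 e'

theorem conv_add {N : Type*} [AddCommMonoid N] (β ε : Deg) (f g : Deg → Deg → Deg → Deg → N) :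
    (conv β ε fun b e b' e' => f b e b' e' + g b e b' e') = conv β ε f + conv β ε g := by
  simp only [conv, Finset.sum_add_distrib]

theorem map_conv {N N' F : Type*} [AddCommMonoid N] [AddCommMonoid N'] [FunLike F N N']
    [AddMonoidHomClass F N N'] (φ : F) (β ε : Deg) (f : Deg → Deg → Deg → Deg → N) :
    φ (conv β ε f) = conv β ε fun b e b' e' => φ (f b e b' e') := by
  simp only [conv, map_sum]

theorem conv_symm (v : Deg → Deg → Idx → A) (n : Eqn) (β ε : Deg) :
    (conv β ε fun b e b' e' => quadR B.d B.L B.C n (v b e) (v b' e') +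
      quadR B.d B.L B.C n (v b' e') (v b e)) = 2 * B.curv v n β ε := by
  rw [conv_add, conv_swap β ε fun b e b' e' => quadR B.d B.L B.C n (v b e) (v b' e'), two_mul]
  rfl

theorem coef2_curvE {v : Deg → Deg → Idx → A} {n : Eqn} {o : Out} (ho : n.out = some o) (β ε : Deg) :
    coef2 o (curvE (fun b e => BKL.mk B.d B.L (v b e)) β ε) = 2 * B.curv v n β ε := by
  rw [curvE, map_conv, ← conv_symm]
  exact conv_congr fun b e b' e' _ _ => coef2_bracket11_mk _ _ B.C _ _ n o ho

theorem conv_comb (β ε : Deg) (f : Deg → Deg → Deg → Deg → Fin 3 → A) :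
    (conv β ε fun b e b' e' => comb B.L (f b e b' e')) =
      comb B.L fun a => conv β ε fun b e b' e' => f b e b' e' a := by
  refine B.field_ext ?_ fun a => ?_
  · rw [map_conv, c0_comb]
    exact conv_eq_zero fun b e b' e' _ _ => B.c0_comb _
  · rw [map_conv, cL_comb]
    exact conv_congr fun b e b' e' _ _ => B.cL_comb _ a

theorem fieldX_curvE {v : Deg → Deg → Idx → A} (hv : ∀ b e a, B.L a (v b e .z) = 0) (i : Fin 3)
    (β ε : Deg) : fieldX i (curvE (fun b e => BKL.mk B.d B.L (v b e)) β ε) =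
      comb B.L fun a => 2 * B.curv v (.e i a) β ε := by
  rw [curvE, map_conv]
  simp only [fieldX_bracket11_mk B.rel _ _ (hv _ _) (hv _ _), conv_comb, conv_symm]

theorem fieldY_curvE (v : Deg → Deg → Idx → A) (i : Fin 3) (β ε : Deg) :
    fieldY i (curvE (fun b e => BKL.mk B.d B.L (v b e)) β ε) =
      comb B.L fun a => 2 * B.curv v (.T i a) β ε := by
  rw [curvE, map_conv]
  simp only [fieldY_bracket11_mk B.rel, conv_comb, conv_symm]

theorem two_mul_eq_zero {x : A} : 2 * x = 0 ↔ x = 0 :=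
  ⟨fun h => eq_zero_of_add_self (two_mul x ▸ h), fun h => by rw [h, mul_zero]⟩

theorem Out.exists_eqn (o : Out) : (∃ n : Eqn, n.out = some o ∧ n.dg = o.dg) ∨ o = .twist ∨
    ∃ i, o = .sk i := by
  cases o with
  | ham => exact Or.inl ⟨.ham, rfl, rfl⟩
  | twist => exact Or.inr (Or.inl rfl)
  | sk i => exact Or.inr (Or.inr ⟨i, rfl⟩)
  | mom i => exact Or.inl ⟨.mom i, rfl, rfl⟩
  | skA i => exact Or.inl ⟨.skA i, rfl, rfl⟩
  | skB i => exact Or.inl ⟨.skB i, rfl, rfl⟩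
  | scal i => exact Or.inl ⟨.scal i, rfl, rfl⟩
  | k i => exact Or.inl ⟨.k i, rfl, rfl⟩
  | s0 => exact Or.inl ⟨.s0, rfl, rfl⟩
  | tw i => exact Or.inl ⟨.tw i, rfl, rfl⟩
  | cf i => exact Or.inl ⟨.cf i, rfl, rfl⟩
  | sy i => exact Or.inl ⟨.sy i, rfl, rfl⟩
  | rA i => exact Or.inl ⟨.rA i, rfl, rfl⟩
  | rB i => exact Or.inl ⟨.rB i, rfl, rfl⟩
  | sc i => exact Or.inl ⟨.sc i, rfl, rfl⟩

theorem Eqn.out_or (n : Eqn) : (∃ o : Out, n.out = some o ∧ n.dg = o.dg) ∨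
    (∃ i a, n = .e i a) ∨ ∃ i a, n = .T i a := by
  cases n with
  | e i a => exact Or.inr (Or.inl ⟨i, a, rfl⟩)
  | T i a => exact Or.inr (Or.inr ⟨i, a, rfl⟩)
  | _ => exact Or.inl ⟨_, rfl, rfl⟩

theorem sum_curvE_mem {v : Deg → Deg → Idx → A} (hv : ∀ b e a, B.L a (v b e .z) = 0)
    (S : Finset (Deg × Deg)) {P : Set Deg} :
    ∑ b ∈ S, curvE (fun b e => BKL.mk B.d B.L (v b e)) b.1 b.2 ∈ ⨆ β ∈ P, G2 A β ↔
      ∀ n : Eqn, n.dg ∉ P → ∑ b ∈ S, B.curv v n b.1 b.2 = 0 := by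
  have hc : ∀ c : Fin 3 → Deg → Deg → A, (∑ b ∈ S, comb B.L fun a => 2 * c a b.1 b.2) =
      comb B.L fun a => 2 * ∑ b ∈ S, c a b.1 b.2 := fun c => by
    simp only [comb, Finset.mul_sum, Finset.sum_smul]
    rw [Finset.sum_comm]
  have ho : ∀ {n : Eqn} {o : Out}, n.out = some o →
      coef2 o (∑ b ∈ S, curvE (fun b e => BKL.mk B.d B.L (v b e)) b.1 b.2) =
        2 * ∑ b ∈ S, B.curv v n b.1 b.2 := fun h => by
    rw [map_sum, Finset.mul_sum]
    exact Finset.sum_congr rfl fun b _ => coef2_curvE h ..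
  rw [mem_iSup_G2]
  simp only [map_sum (fieldX _), map_sum (fieldY _), fieldX_curvE hv, fieldY_curvE, hc (fun a => B.curv v (.e _ a)),
    hc (fun a => B.curv v (.T _ a)), comb_eq_zero, two_mul_eq_zero]
  constructor
  · rintro ⟨h1, h2, h3⟩ n hn
    rcases Eqn.out_or n with ⟨o, h, h'⟩ | ⟨i, a, rfl⟩ | ⟨i, a, rfl⟩
    · exact two_mul_eq_zero.mp ((ho h).symm.trans (h1 o (h' ▸ hn)))
    · exact h2 i hn a
    · exact h3 i hn a
  · refine fun h => ⟨fun o hn => ?_, fun i hn a => h _ hn, fun i hn a => h _ hn⟩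
    rcases Out.exists_eqn o with ⟨n, h1, h2⟩ | rfl | ⟨i, rfl⟩
    · rw [ho h1, h n (h2 ▸ hn), mul_zero]
    · rw [map_sum]
      refine Finset.sum_eq_zero fun b _ => ?_
      rw [curvE, map_conv]
      exact conv_eq_zero fun b e b' e' _ _ => coef2_twist_mk ..
    · rw [map_sum]
      refine Finset.sum_eq_zero fun b _ => ?_
      rw [curvE, map_conv]
      exact conv_eq_zero fun b e b' e' _ _ => coef2_sk_mk ..

theorem curvE_mem {v : Deg → Deg → Idx → A} (hv : ∀ b e a, B.L a (v b e .z) = 0) {β ε : Deg}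
    {P : Set Deg} : curvE (fun b e => BKL.mk B.d B.L (v b e)) β ε ∈ ⨆ β ∈ P, G2 A β ↔
      ∀ n : Eqn, n.dg ∉ P → B.curv v n β ε = 0 := by
  simpa using sum_curvE_mem hv {(β, ε)} (P := P)

theorem sum_curvE_eq_zero {v : Deg → Deg → Idx → A} (hv : ∀ b e a, B.L a (v b e .z) = 0)
    (S : Finset (Deg × Deg)) :
    ∑ b ∈ S, curvE (fun b e => BKL.mk B.d B.L (v b e)) b.1 b.2 = 0 ↔
      ∀ n : Eqn, ∑ b ∈ S, B.curv v n b.1 b.2 = 0 := by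
  simpa using sum_curvE_mem hv S (P := ∅)

theorem curvE_eq_zero {v : Deg → Deg → Idx → A} (hv : ∀ b e a, B.L a (v b e .z) = 0) {β ε : Deg} :
    curvE (fun b e => BKL.mk B.d B.L (v b e)) β ε = 0 ↔ ∀ n : Eqn, B.curv v n β ε = 0 := by
  simpa using curvE_mem hv (β := β) (ε := ε) (P := ∅)

end AnisotropicBackground

end

section
/-- The unknowns that occur in leading terms in the gauge, other than the time derivative. -/
def Idx.IsFree (m : Idx) : Prop := m ≠ .z ∧ ∀ i, m ≠ .sy i

/-- The generators of the gauge subspace. -/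
def Idx.gen {R : Type*} [CommRing R] [Algebra ℝ R] (L : Fin 3 → Derivation ℝ R R) : Idx → EPhi1 R
  | .z | .sy _ => 0
  | .k i => Co1.gen (.k i)
  | .s0 => Co1.gen .s0
  | .tw i => Co1.gen (.tw i)
  | .cf i => Co1.gen (.cf i)
  | .rA i => Co1.gen (.rA i)
  | .rB i => Co1.gen (.rB i)
  | .sc i => Co1.gen (.sc i)
  | .e i a => th (ax i) (ofDer (L a))

section Gauge
variable {R : Type*} [CommRing R] [Algebra ℝ R] (d : Derivation ℝ R R)
  {L : Fin 3 → Derivation ℝ R R}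

theorem mk_single (L : Fin 3 → Derivation ℝ R R) [DecidableEq Idx] {m : Idx} (hm : m.IsFree) :
    mk d L (Pi.single m 1) = m.gen L := by
  classical
  have key : ∀ c : Co1, (∀ c' : Co1, c'.val (mk d L (Pi.single m 1)) =
      if c' = c then (c'.fac : R) else 0) →
      (∀ i a, m ≠ .e i a) → mk d L (Pi.single m 1) = c.gen := fun c hc he => by
    refine EPhi1_ext (fun c' => by rw [hc, Co1.val_gen]) (forall_ax.mpr ⟨?_, fun i => ?_⟩)
    · rw [fieldAt_zero_mk, Pi.single_eq_of_ne (Ne.symm hm.1), zero_smul, fieldAt_gen]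
    · rw [fieldAt_ax_mk, fieldAt_gen, frameD]
      exact Finset.sum_eq_zero fun a _ => by rw [Pi.single_eq_of_ne (Ne.symm (he i a)), zero_smul]
  cases m with
  | z => exact absurd rfl hm.1
  | sy i => exact absurd rfl (hm.2 i)
  | e i a =>
    refine EPhi1_ext (fun c => ?_) (forall_ax.mpr ⟨?_, fun j => ?_⟩)
    · rw [val_mk, Idx.gen, val_th_ofDer]; cases c <;> simp
    · rw [fieldAt_zero_mk, Idx.gen, fieldAt_th_ofDer, if_neg (zero_ne_ax i)]; simp
    · rw [fieldAt_ax_mk, Idx.gen, fieldAt_th_ofDer, frameD]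
      by_cases h : j = i
      · subst h; simp [Pi.single_apply]
      · simp [h, ax_inj]
  | _ =>
    rw [Idx.gen]
    refine key _ (fun c' => ?_) fun _ _ h => by simp at h
    rw [val_mk]
    cases c' <;> simp [Pi.single_apply, Co1.fac]

theorem genGauge_iff {α : Deg} {u : EPhi1 R} :
    GenGauge L α u ↔ ∃ m : Idx, m.IsFree ∧ m.dg = α ∧ m.gen L = u := by
  constructor
  · rintro (i | _ | i | ⟨i, a⟩ | i | i | i | i)
    exacts [⟨.k i, by simp [Idx.IsFree], rfl, rfl⟩, ⟨.s0, by simp [Idx.IsFree], rfl, rfl⟩,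
      ⟨.tw i, by simp [Idx.IsFree], rfl, rfl⟩, ⟨.e i a, by simp [Idx.IsFree], rfl, rfl⟩,
      ⟨.cf i, by simp [Idx.IsFree], rfl, rfl⟩, ⟨.rA i, by simp [Idx.IsFree], rfl, rfl⟩,
      ⟨.rB i, by simp [Idx.IsFree], rfl, rfl⟩, ⟨.sc i, by simp [Idx.IsFree], rfl, rfl⟩]
  · rintro ⟨m, hm, rfl, rfl⟩
    cases m with
    | z => exact absurd rfl hm.1
    | sy i => exact absurd rfl (hm.2 i)
    | k i => exact .kasner i
    | s0 => exact .scalar0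
    | tw i => exact .twist i
    | cf i => exact .conf i
    | rA i => exact .rotA i
    | rB i => exact .rotB i
    | sc i => exact .scalar i
    | e i a => exact .frame i a

instance : Finite Idx := by
  let f : Idx → ((Fin 10) × Fin 3 × Fin 3) := fun m => match m with
    | .z => (0, 0, 0) | .k i => (1, i, 0) | .s0 => (2, 0, 0) | .tw i => (3, i, 0)
    | .cf i => (4, i, 0) | .sy i => (5, i, 0) | .rA i => (6, i, 0) | .rB i => (7, i, 0)
    | .sc i => (8, i, 0) | .e i a => (9, i, a)
  refine Finite.of_injective f fun m n h => ?_
  cases m <;> cases n <;> simp_all [f]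

theorem mem_gaugeSubspace {α : Deg} {u : EPhi1 R} : u ∈ gaugeSubspace L α ↔
    ∃ w : Idx → R, mk d L w = u ∧ ∀ m : Idx, ¬(m.IsFree ∧ m.dg = α) → w m = 0 := by
  classical
  have := Fintype.ofFinite Idx
  constructor
  · intro hu
    induction hu using Submodule.span_induction with
    | mem u hu =>
      obtain ⟨m, h1, h2, rfl⟩ := genGauge_iff.mp hu
      exact ⟨Pi.single m 1, mk_single d L h1, fun n hn => Pi.single_eq_of_ne (by
        rintro rfl; exact hn ⟨h1, h2⟩) _⟩
    | zero => exact ⟨0, map_zero (mkₗ d L), fun _ _ => rfl⟩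
    | add u v _ _ hu hv =>
      obtain ⟨w, rfl, h⟩ := hu
      obtain ⟨w', rfl, h'⟩ := hv
      exact ⟨w + w', map_add (mkₗ d L) w w', fun m hm => by simp [h m hm, h' m hm]⟩
    | smul c u _ hu =>
      obtain ⟨w, rfl, h⟩ := hu
      exact ⟨c • w, map_smul (mkₗ d L) c w, fun m hm => by simp [h m hm]⟩
  · rintro ⟨w, rfl, h⟩
    rw [← mkₗ_apply, pi_eq_sum_univ' w, map_sum]
    refine Submodule.sum_mem _ fun m _ => ?_
    rw [map_smul]
    by_cases hm : m.IsFree ∧ m.dg = α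
    · rw [mkₗ_apply, mk_single d L hm.1]
      exact Submodule.smul_mem _ _ (Submodule.subset_span (genGauge_iff.mpr ⟨m, hm.1, hm.2, rfl⟩))
    · rw [h m hm, zero_smul]
      exact zero_mem (gaugeSubspace L α)

end Gauge

namespace AnisotropicBackground
variable {A : Type*} [CommRing A] [Algebra ℝ A] (B : AnisotropicBackground A)

/-- Families of Maurer-Cartan elements of the associated graded algebra in the affine gauge
subspace, with the leading exponents of the background. -/
structure IsGaugedFamily (X : Deg → Deg → EPhi1 A) : Prop where
  mc : IsMCGradedFamily X
  gauged : ∀ β α, X β α - (if β = 0 then thetaPartial B.d α else 0) ∈ gaugeSubspace B.L α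
  p : ∀ i, leadingExponent (X 0) i = B.p i

/-- Elements whose components have the time dependence given by a degree. -/
structure CoMem (α : Deg) (u : EPhi1 A) : Prop where
  val : ∀ c : Co1, c.val u ∈ B.Cl α
  time : ∀ p, B.c0 (fieldAt p u) ∈ B.Cl α
  space : ∀ p a, B.cL a (fieldAt p u) ∈ B.Cl α

/-- The defining properties of the formal solution. -/
structure IsSol (X γ : Deg → Deg → EPhi1 A) : Prop where
  mc : IsMCReesFamily γ
  leading : ∀ β, IsSRees1 (γ β - X β)
  gauged : ∀ β α, γ β α - (if β = 0 then thetaPartial B.d α else 0) ∈ F1gauge A α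
  mem : ∀ β α, B.CoMem α (γ β α)

variable {B}

theorem L_z {v : Deg → Deg → Idx → A} (h : ∀ b e, v b e .z = if b = 0 ∧ e = 0 then 1 else 0)
    (b e : Deg) (a : Fin 3) : B.L a (v b e .z) = 0 := by
  rw [h]
  split_ifs <;> simp

theorem IsGaugedFamily.exists_tops {X : Deg → Deg → EPhi1 A} (h : B.IsGaugedFamily X) :
    ∃ V, B.IsTops V ∧ ∀ β α, X β α = BKL.mk B.d B.L (top α (V β)) := by
  choose w hw hw0 using fun β α => (mem_gaugeSubspace B.d).mp (h.gauged β α)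
  let zi : Idx → A := fun m => match m with | .z => 1 | _ => 0
  let u : Deg → Deg → Idx → A := fun β α m => (if β = 0 ∧ α = 0 then zi m else 0) + w β α m
  have hX : ∀ β α, X β α = BKL.mk B.d B.L (u β α) := fun β α => by
    have h1 := hw β α
    have h2 : BKL.mk B.d B.L (fun m => if β = 0 ∧ α = 0 then zi m else 0) =
        if β = 0 then thetaPartial B.d α else 0 := by
      by_cases hb : β = 0
      · by_cases ha : α = 0
        · simp only [hb, ha, and_self, if_true, thetaPartial]
          exact mk_z_one
        · simp only [ha, and_false, if_false, thetaPartial, ite_self]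
          exact map_zero (mkₗ B.d B.L)
      · simp only [hb, false_and, if_false]
        exact map_zero (mkₗ B.d B.L)
    have h3 : BKL.mk B.d B.L (u β α) = _ + _ := map_add (mkₗ B.d B.L)
      (fun m => if β = 0 ∧ α = 0 then zi m else 0) (w β α)
    rw [h3, mkₗ_apply, mkₗ_apply, h2, h1, add_sub_cancel]
  have hu : ∀ β α (m : Idx), m.dg ≠ α → u β α m = 0 := fun β α m hm => by
    simp only [u]
    rw [hw0 β α m fun h' => hm h'.2, add_zero]
    split_ifs with h'
    · cases m with
      | z => exact absurd h'.2.symm hm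
      | _ => rfl
    · rfl
  have hut : ∀ β α, u β α = top α fun m => u β m.dg m := fun β α => by
    funext m
    by_cases hm : m.dg = α
    · rw [top_of_eq hm, hm]
    · rw [top_of_ne hm, hu β α m hm]
  have hz : ∀ b e, u b e .z = if b = 0 ∧ e = 0 then 1 else 0 := fun b e => by
    simp only [u, zi]
    rw [hw0 b e .z fun h' => h'.1.1 rfl, add_zero]
  refine ⟨fun β m => u β m.dg m, ⟨fun β => ?_, fun i => ?_, fun β i => ?_, fun n β => ?_⟩,
    fun β α => by rw [hX, hut]⟩
  · simp [hz, Idx.dg]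
  · have := h.p i
    rw [leadingExponent, hX, CDer.mat_zero_ax] at this
    rw [← this]
    exact (val_mk B.d B.L (u 0 0) (.k i)).symm
  · simp [u, zi, hw0 β _ (.sy i) fun h' => h'.1.2 i rfl]
  · simp only [← hut]
    have := h.mc.2 β n.dg
    rw [show (∑ b ∈ antidiagonal β, seriesBracket11 (X b.1) (X b.2) n.dg) =
      curvE (fun b e => BKL.mk B.d B.L (u b e)) β n.dg by simp only [← hX]; rfl] at this
    exact (curvE_mem (L_z hz) (P := {β | β < n.dg})).mp this n (lt_irrefl n.dg)

theorem coMem_mk {α : Deg} {v : Idx → A} (h : ∀ m, v m ∈ B.Cl α) : B.CoMem α (BKL.mk B.d B.L v) where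
  val c := by
    rw [val_mk]
    cases c with
    | tw i => change 2 * _ ∈ _; rw [two_mul]; exact add_mem (h _) (h _)
    | sy i => change 2 * _ ∈ _; rw [two_mul]; exact add_mem (h _) (h _)
    | sk _ | z0 | zb _ | zr _ => exact zero_mem (B.Cl α)
    | _ => exact h _
  time := forall_ax.mpr ⟨by
    rw [fieldAt_zero_mk, map_smul, B.c0_d, smul_eq_mul, mul_one]; exact h _, fun i => by
    rw [fieldAt_ax_mk]
    exact B.c0_comb _ ▸ zero_mem (B.Cl α)⟩
  space := forall_ax.mpr ⟨fun a => by
    rw [fieldAt_zero_mk, map_smul, B.cL_d, smul_zero]; exact zero_mem (B.Cl α), fun i a => by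
    rw [fieldAt_ax_mk]
    exact B.cL_comb (fun a => v (.e i a)) a ▸ h (.e i a)⟩

theorem mk_sub (v w : Idx → A) : BKL.mk B.d B.L v - BKL.mk B.d B.L w = BKL.mk B.d B.L (v - w) :=
  (map_sub (mkₗ B.d B.L) v w).symm

theorem mk_add (v w : Idx → A) : BKL.mk B.d B.L v + BKL.mk B.d B.L w = BKL.mk B.d B.L (v + w) :=
  (map_add (mkₗ B.d B.L) v w).symm

theorem mk_sub_top_mem {α : Deg} {v : Idx → A} (h : SuppLE α v) :
    BKL.mk B.d B.L v - BKL.mk B.d B.L (top α v) ∈ F1lt A α := by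
  rw [mk_sub]
  refine mk_mem_F1lt fun m hm => ?_
  by_cases h' : m.dg = α
  · rw [Pi.sub_apply, top_of_eq h', sub_self]
  · rw [Pi.sub_apply, top_of_ne h', h m fun h'' => hm (lt_of_le_of_ne h'' h'), sub_zero]

theorem isSol_of_good {X : Deg → Deg → EPhi1 A} {v : Deg → Deg → Idx → A}
    (hv : ∀ β ε, B.Good v (β, ε)) (hX : ∀ β α, X β α = BKL.mk B.d B.L (top α (v β α))) :
    B.IsSol X fun β α => BKL.mk B.d B.L (v β α) where
  mc := ⟨fun β α => mk_mem_F1 (hv β α).1.supp, fun β α =>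
    (curvE_eq_zero (L_z fun b e => (hv b e).1.z)).mpr (hv β α).2⟩
  leading β α := by
    rw [Pi.sub_apply, hX]
    exact mk_sub_top_mem (hv β α).1.supp
  gauged β α := by
    have hz := (hv β α).1.z
    by_cases h : β = 0 ∧ α = 0
    · rw [if_pos h.1, thetaPartial, if_pos h.2, ← mk_z_one (L := B.L), mk_sub]
      refine mk_mem_F1gauge (fun m hm => ?_) ?_
      · rw [Pi.sub_apply, (hv β α).1.supp m hm, zero_sub]
        cases m with
        | z => exact absurd zero_le hm
        | _ => exact neg_zero
      · rw [Pi.sub_apply, hz, if_pos h]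
        exact sub_self _
    · have : (if β = 0 then thetaPartial B.d α else 0) = 0 := by
        split_ifs with hb
        · rw [thetaPartial, if_neg fun ha => h ⟨hb, ha⟩]
        · rfl
      rw [this, sub_zero]
      exact mk_mem_F1gauge (hv β α).1.supp (by rw [hz, if_neg h])
  mem β α := coMem_mk (hv β α).1.mem

theorem eq_zero_of_mem_F1lt_zero {u : EPhi1 A} (h : u ∈ F1lt A 0) : u = 0 := by
  have : F1lt A 0 = ⊥ := by
    rw [F1lt, eq_bot_iff]
    exact iSup₂_le fun β hβ => absurd hβ not_lt_zero
  rwa [this, Submodule.mem_bot] at h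

theorem IsSol.zero {X γ : Deg → Deg → EPhi1 A} (h : B.IsSol X γ) (β : Deg) : γ β 0 = X β 0 :=
  sub_eq_zero.mp (eq_zero_of_mem_F1lt_zero (h.leading β 0))

theorem IsSol.setTeqS_mem {X γ : Deg → Deg → EPhi1 A} (h : B.IsSol X γ) : setTeqS γ ∈ fiber (X 0) := by
  classical
  refine ⟨⟨fun α => ?_, fun α => ?_⟩, fun α => ?_⟩
  · refine Submodule.sum_mem _ fun b hb => ?_
    have : b.2 ≤ α := mem_antidiagonal.mp hb ▸ le_add_self
    rcases this.lt_or_eq with hlt | heq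
    · exact F1lt_le_F1 α (F1_le_F1lt hlt (h.mc.1 b.1 b.2))
    · exact heq ▸ h.mc.1 b.1 b.2
  · rw [seriesBracket11_setTeqS]
    exact Finset.sum_eq_zero fun b _ => h.mc.2 b.1 b.2
  · have hm : ((0 : Deg), α) ∈ antidiagonal α := mem_antidiagonal.mpr (zero_add α)
    rw [Pi.sub_apply, setTeqS, ← Finset.add_sum_erase _ _ hm, add_sub_right_comm]
    refine add_mem (h.leading 0 α) (Submodule.sum_mem _ fun b hb => ?_)
    obtain ⟨hb1, hb2⟩ := Finset.mem_erase.mp hb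
    have hb3 := mem_antidiagonal.mp hb2
    refine F1_le_F1lt ?_ (h.mc.1 b.1 b.2)
    refine lt_of_le_of_ne (hb3 ▸ le_add_self) fun hc => hb1 ?_
    have : b.1 = 0 := by rw [hc] at hb3; exact add_eq_right.mp hb3
    exact Prod.ext this hc

end AnisotropicBackground

end

section
namespace AnisotropicBackground
variable {A : Type*} [CommRing A] [Algebra ℝ A] {B : AnisotropicBackground A}

theorem mk_leading {g : Idx → A} (hg : B.Adm 0 0 g) :
    BKL.mk B.d B.L g = leadE B.d B.p (g .s0) := by
  rw [mk_eq_leadE _ B.L hg.isLeading]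
  congr 1
  exact funext fun i => hg.k ⟨rfl, rfl⟩ i

theorem CoMem.coord {α : Deg} {u : EPhi1 A} (h : B.CoMem α u) (m : Idx) : B.coord m u ∈ B.Cl α := by
  have hh : ∀ x ∈ B.Cl α, algebraMap ℝ A 2⁻¹ • x ∈ B.Cl α := fun x hx => by
    rw [algebraMap_smul]
    exact Submodule.smul_mem _ _ hx
  cases m with
  | z => exact h.time 0
  | k i => exact h.val (.k i)
  | s0 => exact h.val .s0
  | tw i => exact hh _ (h.val (.tw i))
  | sy i => exact hh _ (h.val (.sy i))
  | cf i => exact h.val (.cf i)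
  | rA i => exact h.val (.rA i)
  | rB i => exact h.val (.rB i)
  | sc i => exact h.val (.sc i)
  | e i a => exact h.space _ a

theorem CoMem.sub {α : Deg} {u v : EPhi1 A} (hu : B.CoMem α u) (hv : B.CoMem α v) :
    B.CoMem α (u - v) where
  val c := by
    rw [← Co1.valₗ_apply, map_sub]
    exact sub_mem (hu.val c) (hv.val c)
  time p := by
    rw [map_sub, map_sub]
    exact sub_mem (hu.time p) (hv.time p)
  space p a := by
    rw [map_sub, map_sub]
    exact sub_mem (hu.space p a) (hv.space p a)

/-- The components of the adjoint action of the leading term on an element in the gauge. -/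
theorem lead_coord {g w : Idx → A} (hg : B.Adm 0 0 g) (hw : w .z = 0)
    (h : bracket11 (BKL.mk B.d B.L g) (BKL.mk B.d B.L w) = 0) {m : Idx} (hm : m ≠ .z) :
    (m.lead : A) * (B.d (w m) + wt B.p m.rate * w m) + m.drift B.L g w = 0 := by
  have hp : (fun i => g (.k i)) = B.p := funext fun i => hg.k ⟨rfl, rfl⟩ i
  rw [← hp, ← hg.isLeading.quadR_add (C := B.C) hw hm]
  rcases Eqn.out_or m.eqn with ⟨o, ho, _⟩ | ⟨i, a, hi⟩ | ⟨i, a, hi⟩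
  · rw [← coef2_bracket11_mk _ _ B.C _ _ _ o ho, h, map_zero]
  · have := fieldX_bracket11_mk B.rel g w (fun a => by rw [hg.z]; simp) (fun a => by rw [hw, map_zero]) i
    rw [h, map_zero] at this
    rw [hi]
    exact B.comb_eq_zero.mp this.symm a
  · have := Idx.isConstraint_eqn hm
    rw [hi] at this
    cases this

/-- The leading term acts injectively on elements in the gauge with prescribed time
dependence. -/
theorem eq_zero_of_lead {α : Deg} {g : Idx → A} (hg : B.Adm 0 0 g) {u : EPhi1 A}
    (h1 : u ∈ F1lt A α) (h2 : u ∈ F1gauge A α) (h3 : B.CoMem α u)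
    (h : bracket11 (BKL.mk B.d B.L g) u = 0) : u = 0 := by
  obtain ⟨-, hng, hf0⟩ := mem_F1gauge.mp h2
  obtain ⟨hc1, -, hc3⟩ := (mem_iSup_G1 (P := {β | β < α})).mp h1
  have hu := @B.solve_unique
  have h' := h
  rw [mk_leading hg] at h'
  have hG : B.InGauge u := by
    refine ⟨fun i => ?_, hng _ id, fun i => hng _ id, fun i => hng _ id, fun a => by rw [hf0, map_zero],
      fun i => ?_⟩
    · by_cases hd : deg i 2 1 < α
      · refine hu hd (h3.val _) ?_
        have := coef2_sk_bracket11_leadE B.d B.p (g .s0) u i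
        rw [h', map_zero] at this
        rw [wt_deg]
        push_cast
        linear_combination -this
      · exact hc1 _ hd
    · by_cases hd : deg i 0 1 < α
      · refine hu hd (h3.time _) ?_
        have := congrArg B.c0 (fieldX_bracket11_leadE B.d B.p (g .s0) u i)
        rw [h', map_zero, map_zero, hng (.zb i) id, zero_smul, add_zero, map_add, map_smul, c0_lie_d,
          smul_eq_mul] at this
        rw [wt_deg]
        push_cast
        linear_combination -this
      · rw [hc3 i hd, map_zero]
  have hmk := hG.mk_coord
  set w : Idx → A := fun m => B.coord m u with hw
  have hz : w .z = 0 := by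
    change B.c0 (fieldAt 0 u) = 0
    rw [hf0, map_zero]
  rw [← hmk] at h
  have hl := fun m hm => lead_coord hg hz h (m := m) hm
  have key : ∀ m : Idx, m ≠ .z → m.drift B.L g w = 0 → w m = 0 := fun m hm hd => by
    by_cases hlt : m.dg < α
    · refine hu (m.rate_le.trans_lt hlt) (h3.coord m) ?_
      have := hl m hm
      rw [hd, add_zero] at this
      cases m with
      | tw i | sy i => exact two_mul_eq_zero.mp (by simpa [Idx.lead] using this)
      | _ => simpa [Idx.lead] using this
    · exact coord_eq_zero (P := {β | β < α}) h1 hlt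
  have he : ∀ i a, w (.e i a) = 0 := fun i a => key _ (by simp) rfl
  have hall : w = 0 := funext fun m => by
    by_cases hm : m = .z
    · rw [hm]; exact hz
    · exact key m hm (by cases m <;> simp [Idx.drift, he])
  rw [← hmk, hall]
  exact map_zero (mkₗ B.d B.L)

theorem curvE_split {R : Type*} [CommRing R] [Algebra ℝ R] (γ : Deg → Deg → EPhi1 R) {β ε : Deg}
    (h : β ≠ 0 ∨ ε ≠ 0) : curvE γ β ε = 2 • bracket11 (γ 0 0) (γ β ε) +
      convRest β ε fun b e b' e' => bracket11 (γ b e) (γ b' e') := by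
  rw [curvE, conv_split h, bracket11_comm (γ β ε), two_smul]

theorem IsSol.unique {X γ γ' : Deg → Deg → EPhi1 A} {g : Idx → A} (hg : B.Adm 0 0 g)
    (h0 : X 0 0 = BKL.mk B.d B.L g) (h : B.IsSol X γ) (h' : B.IsSol X γ') : γ = γ' := by
  suffices hs : ∀ q : Deg × Deg, γ q.1 q.2 = γ' q.1 q.2 from
    funext fun β => funext fun α => hs (β, α)
  intro q
  induction q using WellFoundedLT.induction with
  | ind q ih =>
    obtain ⟨β, α⟩ := q
    dsimp only
    by_cases hα : α = 0
    · rw [hα, h.zero, h'.zero]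
    have hc := curvE_split γ (β := β) (Or.inr hα)
    have hc' := curvE_split γ' (β := β) (Or.inr hα)
    rw [show curvE γ β α = 0 from h.mc.2 β α, h.zero] at hc
    have hr : (convRest β α fun b e b' e' => bracket11 (γ b e) (γ b' e')) =
        convRest β α fun b e b' e' => bracket11 (γ' b e) (γ' b' e') :=
      convRest_congr fun b e b' e' _ _ h1 h2 => by
        rw [show γ b e = _ from ih (b, e) h1, show γ b' e' = _ from ih (b', e') h2]
    rw [show curvE γ' β α = 0 from h'.mc.2 β α, h'.zero, ← hr] at hc'
    rw [← sub_eq_zero]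
    refine eq_zero_of_lead hg (α := α) ?_ ?_ ((h.mem β α).sub (h'.mem β α)) ?_
    · have := sub_mem (h.leading β α) (h'.leading β α)
      rwa [Pi.sub_apply, Pi.sub_apply, sub_sub_sub_cancel_right] at this
    · have := sub_mem (h.gauged β α) (h'.gauged β α)
      rwa [sub_sub_sub_cancel_right] at this
    · rw [← h0, ← br11_apply, map_sub, br11_apply, br11_apply]
      refine two_smul_cancel (R := A) ?_
      have := hc.symm.trans hc'
      rw [← two_smul ℕ, smul_sub, sub_eq_zero]
      exact add_right_cancel this

/-- Existence and uniqueness of the formal solution. -/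
theorem IsGaugedFamily.existsUnique {X : Deg → Deg → EPhi1 A} (h : B.IsGaugedFamily X) :
    ∃! γ, B.IsSol X γ := by
  obtain ⟨V, hV, hX⟩ := h.exists_tops
  obtain ⟨v, hv⟩ := hV.exists_good
  exact ⟨_, isSol_of_good (fun β ε => (hv β ε).1) fun β α => by rw [hX, (hv β α).2], fun γ hγ =>
    hγ.unique hV.adm_zero (hX 0 0) (isSol_of_good (fun β ε => (hv β ε).1) fun β α => by
      rw [hX, (hv β α).2])⟩

end AnisotropicBackground

end

section
section Series
variable {R : Type*} [CommRing R] [Algebra ℝ R]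

theorem F1_mono {β α : Deg} (h : β ≤ α) : F1 R β ≤ F1 R α :=
  h.lt_or_eq.elim (fun h => (F1_le_F1lt h).trans (F1lt_le_F1 α)) fun h => h ▸ le_rfl

theorem setTeqS_mem_F1 {γ : Deg → Deg → EPhi1 R} {α : Deg}
    (h : ∀ β ε, β + ε = α → γ β ε ∈ F1 R ε) : setTeqS γ α ∈ F1 R α :=
  Submodule.sum_mem _ fun b hb => F1_mono (mem_antidiagonal.mp hb ▸ le_add_self)
    (h b.1 b.2 (mem_antidiagonal.mp hb))

theorem setTeqS_sub_mem {γ : Deg → Deg → EPhi1 R} {α : Deg}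
    (h : ∀ β ε, β + ε = α → γ β ε ∈ F1 R ε) : setTeqS γ α - γ 0 α ∈ F1lt R α := by
  classical
  have hm : ((0 : Deg), α) ∈ antidiagonal α := mem_antidiagonal.mpr (zero_add α)
  rw [setTeqS, ← Finset.add_sum_erase _ _ hm, add_sub_cancel_left]
  refine Submodule.sum_mem _ fun b hb => ?_
  obtain ⟨hb1, hb2⟩ := Finset.mem_erase.mp hb
  have hb3 := mem_antidiagonal.mp hb2
  refine F1_le_F1lt ?_ (h b.1 b.2 hb3)
  refine lt_of_le_of_ne (hb3 ▸ le_add_self) fun hc => hb1 ?_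
  have : b.1 = 0 := by rw [hc] at hb3; exact add_eq_right.mp hb3
  exact Prod.ext this hc

theorem setTeqS_congr {γ γ' : Deg → Deg → EPhi1 R} {α : Deg}
    (h : ∀ β ε, β + ε = α → γ β ε = γ' β ε) : setTeqS γ α = setTeqS γ' α :=
  Finset.sum_congr rfl fun b hb => h b.1 b.2 (mem_antidiagonal.mp hb)

theorem setTeqS_zero (γ : Deg → Deg → EPhi1 R) : setTeqS γ 0 = γ 0 0 := by
  simp [setTeqS]

theorem expAct_zero (a : Deg → CDer R) (y : Deg → EPhi1 R) : expAct a y 0 = y 0 := by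
  simp [expAct]

theorem seriesBracket11_congr {y y' : Deg → EPhi1 R} {α : Deg} (h : ∀ β ≤ α, y β = y' β) :
    seriesBracket11 y y α = seriesBracket11 y' y' α :=
  Finset.sum_congr rfl fun b hb => by
    have := mem_antidiagonal.mp hb
    rw [h b.1 (this ▸ le_self_add), h b.2 (this ▸ le_add_self)]

theorem seriesBracket11_change {y y' : Deg → EPhi1 R} {α : Deg} (hα : α ≠ 0)
    (h : ∀ β < α, y β = y' β) : seriesBracket11 y' y' α =
      seriesBracket11 y y α + 2 • bracket11 (y 0) (y' α - y α) := by
  classical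
  have h0 : y 0 = y' 0 := h 0 (pos_iff_ne_zero.mpr hα)
  have hm1 : ((0 : Deg), α) ∈ antidiagonal α := mem_antidiagonal.mpr (zero_add α)
  have hm2 : (α, (0 : Deg)) ∈ (antidiagonal α).erase (0, α) :=
    Finset.mem_erase.mpr ⟨fun hc => hα (congrArg Prod.fst hc), mem_antidiagonal.mpr (add_zero α)⟩
  rw [seriesBracket11, seriesBracket11, ← Finset.add_sum_erase _ _ hm1,
    ← Finset.add_sum_erase _ _ hm1, ← Finset.add_sum_erase _ _ hm2, ← Finset.add_sum_erase _ _ hm2]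
  have hr : ∀ b ∈ ((antidiagonal α).erase (0, α)).erase (α, 0),
      bracket11 (y' b.1) (y' b.2) = bracket11 (y b.1) (y b.2) := fun b hb => by
    obtain ⟨h1, h2⟩ := Finset.mem_erase.mp hb
    obtain ⟨h2, h3⟩ := Finset.mem_erase.mp h2
    have h4 := mem_antidiagonal.mp h3
    rw [h b.1 (lt_of_le_of_ne (h4 ▸ le_self_add) fun hc => h1 (Prod.ext hc (by
        rw [hc] at h4; exact add_eq_left.mp h4))),
      h b.2 (lt_of_le_of_ne (h4 ▸ le_add_self) fun hc => h2 (Prod.ext (by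
        rw [hc] at h4; exact add_eq_right.mp h4) hc))]
  rw [Finset.sum_congr rfl hr]
  dsimp only
  rw [← h0, bracket11_comm (y' α), bracket11_comm (y α)]
  simp only [← br11_apply, map_sub]
  abel

end Series

namespace AnisotropicBackground
open Background (rest_congr curv_eq curv_eq_zero_of_not_le top_mem propagate lin_congr rest_mem
  exists_lower)
variable {A : Type*} [CommRing A] [Algebra ℝ A] {B : AnisotropicBackground A}

/-- Passing to the gauge by an infinitesimal gauge transformation. -/
theorem exists_gauge {α : Deg} (hα : α ≠ 0) {g : Idx → A} (hg : B.Adm 0 0 g) {u : EPhi1 A}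
    (hu : u ∈ F1lt A α) : ∃ x ∈ F0lt A α, u - bracket01 x (BKL.mk B.d B.L g) ∈ F1lt A α ∧
      Co1.val (u - bracket01 x (BKL.mk B.d B.L g)) .z0 = 0 ∧
      fieldAt 0 (u - bracket01 x (BKL.mk B.d B.L g)) = 0 ∧
      (∀ i, B.c0 (fieldAt (ax i) (u - bracket01 x (BKL.mk B.d B.L g))) = 0) ∧
      ∀ i, Co1.val (u - bracket01 x (BKL.mk B.d B.L g)) (.sy i) = 0 := by
  obtain ⟨hc1, -, hc3⟩ := (mem_iSup_G1 (P := {β | β < α})).mp hu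
  obtain ⟨w, hw⟩ := B.prim (-Co1.val u .z0)
  obtain ⟨E0, hE0⟩ := B.prim (w - B.c0 (fieldAt 0 u))
  choose E hE using fun a => B.prim (-B.cL a (fieldAt 0 u))
  choose q hq using fun i => (B.unit i).exists_right_inv
  let x : CDer A := cd w (fun i => B.c0 (fieldAt (ax i) u))
    (fun i => -(algebraMap ℝ A 2⁻¹ * (q i * Co1.val u (.sy i)))) (E0 • B.d + comb B.L E)
  have hx : x ∈ F0lt A α := (mem_iSup_G0 (P := {β | β < α})).mpr
    ⟨fun h => absurd (pos_iff_ne_zero.mpr hα) h, fun i hi => ⟨by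
      rw [b_cd, hc3 i hi, map_zero], by rw [r_cd, hc1 (.sy i) hi, mul_zero, mul_zero, neg_zero]⟩⟩
  have hval : ∀ c : Co1, c.val (u - bracket01 x (BKL.mk B.d B.L g)) =
      c.val u - c.val (bracket01 x (BKL.mk B.d B.L g)) := fun c => map_sub c.valₗ _ _
  refine ⟨x, hx, sub_mem hu ?_, ?_, ?_, fun i => ?_, fun i => ?_⟩
  · have := bracket01_mem hx (ε := 0) (u := BKL.mk B.d B.L g) (mk_mem_F1 hg.supp)
    rwa [add_zero] at this
  · rw [hval, mk_leading hg, z0_bracket01_leadE, w_cd, hw, neg_neg, sub_self]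
  · rw [map_sub, mk_leading hg, fieldAt_zero_bracket01_leadE, field_cd, w_cd, sub_eq_zero,
      ← lie_skew]
    refine B.field_ext ?_ fun a => ?_
    · rw [map_add, map_neg, map_smul, B.c0_d, c0_lie_d, map_add, map_smul, B.c0_d, c0_comb, smul_eq_mul,
        smul_eq_mul, mul_one, mul_one, add_zero, hE0]
      ring
    · rw [map_add, map_neg, map_smul, B.cL_d, cL_lie_d, map_add, map_smul, B.cL_d, cL_comb, smul_zero,
        smul_zero, zero_add, add_zero, hE, neg_neg]
  · rw [map_sub, mk_leading hg, fieldAt_ax_bracket01_leadE, b_cd, map_sub, map_smul, B.c0_d,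
      smul_eq_mul, mul_one, sub_self]
  · rw [hval, mk_leading hg, sy_bracket01_leadE, r_cd]
    have h2 := two_mul_half (q i * Co1.val u (.sy i))
    linear_combination (-Co1.val u (.sy i)) * hq i - (B.p (i + 1) - B.p (i + 2)) * h2

theorem inGauge_of_bracket {g : Idx → A} (hg : B.Adm 0 0 g) {u : EPhi1 A}
    (h1 : Co1.val u .z0 = 0) (h2 : fieldAt 0 u = 0) (h3 : ∀ i, B.c0 (fieldAt (ax i) u) = 0)
    (h4 : ∀ i, Co1.val u (.sy i) = 0)
    (h5 : ∀ i, coef2 (.sy i) (bracket11 (BKL.mk B.d B.L g) u) = 0)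
    (h6 : ∀ i, B.c0 (fieldX i (bracket11 (BKL.mk B.d B.L g) u)) = 0)
    (h7 : ∀ i, B.c0 (fieldY i (bracket11 (BKL.mk B.d B.L g) u)) = 0) : B.InGauge u where
  sk i := by
    have := h7 i
    rwa [mk_leading hg, fieldY_bracket11_leadE, map_smul, B.c0_d, smul_eq_mul, mul_one] at this
  z0 := h1
  zb i := by
    have := h6 i
    rwa [mk_leading hg, fieldX_bracket11_leadE, map_add, map_add, map_smul, map_smul, B.c0_d,
      c0_lie_d, h3, map_zero, smul_zero, smul_eq_mul, mul_one, zero_add, zero_add] at this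
  zr i := by
    have := h5 i
    rw [mk_leading hg, coef2_sy_bracket11_leadE, h4, map_zero, zero_sub, neg_eq_zero, mul_assoc] at this
    obtain ⟨q, hq⟩ := (B.unit i).exists_right_inv
    have h := two_mul_eq_zero.mp this
    linear_combination q * h - Co1.val u (.zr i) * hq
  time a := by rw [h2, map_zero]
  space := h3

/-- Solutions of the evolution equations below leading order, corrected in such a way that the
Maurer-Cartan equation is satisfied in total. -/
theorem good_of_sum {α : Deg} (hα : α ≠ 0) {v v' : Deg → Deg → Idx → A} {w : Idx → A}
    (hlow : ∀ β ε, β + ε < α → B.Good v (β, ε)) (h0 : B.Good v (0, α))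
    (hadm : ∀ β ε, β + ε = α → β ≠ 0 → B.Adm β ε (v β ε))
    (heq : ∀ β ε, β + ε = α → β ≠ 0 → ∀ m : Idx, m ≠ .z → m.dg < ε →
      B.lin (v 0 0) (v β ε) m + B.rest v m.eqn β ε = 0)
    (hz : w .z = 0) (hsy : ∀ i, w (.sy i) = 0) (hw : ∀ m : Idx, ¬m.dg < α → w m = 0)
    (hv : ∀ β ε, β + ε < α → v' β ε = v β ε)
    (hv' : ∀ β ε, β + ε = α → v' β ε = v β ε + top ε w)
    (hsum : ∀ n, ∑ b ∈ antidiagonal α, B.curv v' n b.1 b.2 = 0) {β ε : Deg} (hβε : β + ε = α) :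
    B.Good v' (β, ε) := by
  classical
  have hlt : ∀ {b e β ε : Deg}, (b, e) < (β, ε) → b + e < β + ε := fun {b e β ε} h => by
    rcases Prod.lt_iff.mp h with ⟨h1, h2⟩ | ⟨h1, h2⟩
    · exact add_lt_add_of_lt_of_le h1 h2
    · exact add_lt_add_of_le_of_lt h1 h2
  have htop0 : top α w = 0 := funext fun m => by
    by_cases h : m.dg = α
    · rw [top_of_eq h, hw m (by rw [h]; exact lt_irrefl _)]; rfl
    · rw [top_of_ne h]; rfl
  have hv0 : ∀ b e, (b, e) ≤ (0, α) → v b e = v' b e := fun b e h => by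
    have hb : b = 0 := le_antisymm h.1 zero_le
    have he : e ≤ α := h.2
    subst hb
    rcases he.lt_or_eq with h | h
    · exact (hv 0 e (by rwa [zero_add])).symm
    · rw [hv' 0 e (by rw [h, zero_add]), h, htop0, add_zero]
  have h0' : B.Good v' (0, α) := h0.congr hv0
  have h00 : v' 0 0 = v 0 0 := hv 0 0 (by rw [add_zero]; exact pos_iff_ne_zero.mpr hα)
  have hg : B.Adm 0 0 (v' 0 0) := h00 ▸ (hlow 0 0 (by rw [add_zero]; exact pos_iff_ne_zero.mpr hα)).1
  have hlow' : ∀ {β ε}, β + ε = α → ∀ q, q < (β, ε) → B.Good v' q := fun {β ε} h q hq => by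
    have hq' : q.1 + q.2 < α := h ▸ hlt (b := q.1) (e := q.2) hq
    exact (hlow q.1 q.2 hq').congr fun b e hbe => (hv b e
      ((add_le_add (Prod.mk_le_mk.mp hbe).1 (Prod.mk_le_mk.mp hbe).2).trans_lt hq')).symm
  have hrest : ∀ {β ε}, β + ε = α → ∀ n, B.rest v' n β ε = B.rest v n β ε := fun {β ε} h n =>
    rest_congr n fun b e hbe => hv b e (h ▸ hlt hbe)
  have hsupp : ∀ {β ε}, β + ε = α → β ≠ 0 → SuppLE ε (v' β ε) := fun {β ε} h hb m hm => by
    rw [hv' β ε h, Pi.add_apply, (hadm β ε h hb).supp m hm, top_of_ne fun hc => hm hc.le, add_zero]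
  have hvz : ∀ {β ε}, β + ε = α → β ≠ 0 → v' β ε .z = 0 := fun {β ε} h hb => by
    have h1 : top ε w .z = 0 := by
      by_cases he : Idx.z.dg = ε
      · rw [top_of_eq he, hz]
      · rw [top_of_ne he]
    rw [hv' β ε h, Pi.add_apply, h1, (hadm β ε h hb).z, if_neg fun hc => hb hc.1, add_zero]
  have hall : ∀ {β ε}, β + ε = α → β ≠ 0 → ∀ b e, (b, e) ≤ (β, ε) → SuppLE e (v' b e) :=
    fun {β ε} h hb b e hbe => by
      rcases hbe.lt_or_eq with h' | h'
      · exact (hlow' h (b, e) h').1.supp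
      · rw [Prod.mk.injEq] at h'
        obtain ⟨rfl, rfl⟩ := h'
        exact hsupp h hb
  have hev : ∀ {β ε}, β + ε = α → ∀ n : Eqn, n.isConstraint = false → n.dg ≠ ε →
      B.curv v' n β ε = 0 := fun {β ε} h n hn hne => by
    by_cases hb : β = 0
    · subst hb
      rw [zero_add] at h
      subst h
      exact h0'.2 n
    obtain ⟨m, hm, rfl⟩ := n.exists_idx hn
    by_cases hle : m.dg ≤ ε
    · rw [m.dg_eqn] at hne
      rw [curv_eq hg (Or.inl hb) (hvz h hb) hm, hrest h, h00, ← heq β ε h hb m hm (lt_of_le_of_ne hle hne)]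
      congr 1
      refine lin_congr fun m' hm' => ?_
      rw [hv' β ε h, Pi.add_apply, top_of_ne (hm' ▸ hne), add_zero]
    · exact curv_eq_zero_of_not_le (hall h hb) (by rwa [m.dg_eqn])
  have hsingle : ∀ {β ε}, β + ε = α → ∀ n : Eqn, n.dg = ε →
      (∀ β' ε', β' + ε' = α → n.dg ≠ ε' → B.curv v' n β' ε' = 0) → B.curv v' n β ε = 0 :=
    fun {β ε} h n hn hne => by
      have h1 : ∑ b ∈ antidiagonal α, B.curv v' n b.1 b.2 = B.curv v' n (β, ε).1 (β, ε).2 := by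
        refine Finset.sum_eq_single_of_mem (β, ε) (mem_antidiagonal.mpr h) fun b hb hbe => ?_
        have hb' := mem_antidiagonal.mp hb
        refine hne b.1 b.2 hb' fun hc => hbe ?_
        have he : b.2 = ε := hc.symm.trans hn
        exact Prod.ext (add_right_cancel (b := b.2) (by rw [hb', he, h])) he
      exact h1.symm.trans (hsum n)
  have hevol : ∀ {β ε}, β + ε = α → ∀ n : Eqn, n.isConstraint = false → B.curv v' n β ε = 0 :=
    fun {β ε} h n hn => by
      by_cases hne : n.dg = ε
      · exact hsingle h n hne fun β' ε' h' hne' => hev h' n hn hne'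
      · exact hev h n hn hne
  have hadm' : ∀ {β ε}, β + ε = α → β ≠ 0 → B.Adm β ε (v' β ε) := fun {β ε} h hb => by
    have ha := hadm β ε h hb
    have hsy' : ∀ i, (Idx.sy i).dg = ε → v' β ε (.sy i) = 0 := fun i hi => by
      rw [hv' β ε h, Pi.add_apply, top_of_eq hi, hsy, add_zero, ha.sy i hi.symm]
    refine ⟨hsupp h hb, fun m => ?_, ?_, fun hc => absurd hc.1 hb, fun hc => absurd hc.1 hb,
      fun i hi => hsy' i hi.symm⟩
    · by_cases hm : m.dg = ε
      · refine top_mem hg (fun n => B.rest v' n β ε) (fun n => rest_mem n fun b e hbe =>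
          (hlow' h (b, e) hbe).1.mem) hsy' (hvz h hb) (fun m hm _ => ?_) m hm
        rw [← curv_eq hg (Or.inl hb) (hvz h hb) hm]
        exact hevol h _ (Idx.isConstraint_eqn hm)
      · rw [hv' β ε h, Pi.add_apply, top_of_ne hm, add_zero]
        exact ha.mem m
    · rw [hvz h hb, if_neg fun hc => hb hc.1]
  have hcon : ∀ {β ε}, β + ε = α → ∀ n : Eqn, n.dg ≠ ε → B.curv v' n β ε = 0 :=
    fun {β ε} h n hne => by
      by_cases hb : β = 0
      · subst hb
        rw [zero_add] at h
        subst h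
        exact h0'.2 n
      · exact propagate (hlow' h) (hadm' h hb) (hevol h) n fun _ hc => absurd hc hne
  by_cases hb : β = 0
  · subst hb
    rw [zero_add] at hβε
    subst hβε
    exact h0'
  refine ⟨hadm' hβε hb, fun n => ?_⟩
  by_cases hne : n.dg = ε
  · exact hsingle hβε n hne fun β' ε' h' hne' => hcon h' n hne'
  · exact hcon hβε n hne

theorem sum_top {α : Deg} {w : Idx → A} (hw : ∀ m : Idx, ¬m.dg < α → w m = 0) :
    ∑ b ∈ antidiagonal α, top b.2 w = w := by
  funext m
  rw [Finset.sum_apply]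
  by_cases h : m.dg < α
  · rw [Finset.sum_eq_single_of_mem (f := fun b => top b.2 w m) (α - m.dg, m.dg)
      (mem_antidiagonal.mpr (tsub_add_cancel_of_le h.le)), top_of_eq rfl]
    intro b hb hne
    refine top_of_ne (fun hc => hne (Prod.ext ?_ hc.symm)) w
    have := mem_antidiagonal.mp hb
    rw [← this, hc, add_tsub_cancel_right]
  · rw [hw m h]
    refine Finset.sum_eq_zero fun b _ => ?_
    by_cases hb : m.dg = b.2
    · rw [top_of_eq hb, hw m h]
    · rw [top_of_ne hb]

/-- The coefficients of a given order of a gauge transformation and of a solution in the gauge. -/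
theorem exists_step {x y : Deg → EPhi1 A} (hy : y ∈ fiber x) {v0 : Deg → Idx → A}
    (hx : ∀ α, x α = BKL.mk B.d B.L (top α (v0 α))) {α : Deg} (hα : α ≠ 0)
    {v : Deg → Deg → Idx → A} {a : Deg → CDer A} (ha : ∀ β < α, a β ∈ F0lt A β)
    (hlow : ∀ β ε, β + ε < α → B.Good v (β, ε)) (hv00 : v 0 0 = v0 0)
    (hgood : ∀ v' : Deg → Deg → Idx → A, (∀ β ε, β + ε < α → v' β ε = v β ε) → v' 0 α = v0 α →
      B.Good v' (0, α))
    (hya : ∀ β < α, expAct a (setTeqS fun b e => BKL.mk B.d B.L (v b e)) β = y β) :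
    ∃ x ∈ F0lt A α, ∃ v', (∀ β ε, β + ε < α → v' β ε = v β ε) ∧
      (∀ β ε, β + ε = α → B.Good v' (β, ε)) ∧ v' 0 α = v0 α ∧
      ∀ a', (∀ β < α, a' β = a β) → a' α = x →
        expAct a' (setTeqS fun b e => BKL.mk B.d B.L (v' b e)) α = y α := by
  classical
  have hα0 : 0 < α := pos_iff_ne_zero.mpr hα
  have hg : B.Adm 0 0 (v 0 0) := (hlow 0 0 (by rwa [add_zero])).1
  have hlt : ∀ {b e β ε : Deg}, (b, e) < (β, ε) → b + e < β + ε := fun {b e β ε} h => by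
    rcases Prod.lt_iff.mp h with ⟨h1, h2⟩ | ⟨h1, h2⟩
    · exact add_lt_add_of_lt_of_le h1 h2
    · exact add_lt_add_of_le_of_lt h1 h2
  have hex : ∀ β ε, ∃ u, β + ε = α → β ≠ 0 → B.Adm β ε u ∧
      ∀ m : Idx, m ≠ .z → m.dg < ε → B.lin (v 0 0) u m + B.rest v m.eqn β ε = 0 := fun β ε => by
    by_cases h : β + ε = α ∧ β ≠ 0
    · obtain ⟨u, h1, -, h2⟩ := exists_lower (Or.inl h.2)
        (fun q hq => hlow q.1 q.2 (h.1 ▸ hlt (b := q.1) (e := q.2) hq)) 0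
        (fun m _ => zero_mem (B.Cl ε)) rfl fun _ _ => rfl
      exact ⟨u, fun _ _ => ⟨h1, h2⟩⟩
    · exact ⟨0, fun h1 h2 => absurd ⟨h1, h2⟩ h⟩
  choose u hu using hex
  let v1 : Deg → Deg → Idx → A := fun β ε =>
    if β + ε = α then (if β = 0 then v0 ε else u β ε) else if β + ε < α then v β ε else 0
  have hv1 : ∀ β ε, β + ε < α → v1 β ε = v β ε := fun β ε h => by
    simp only [v1, if_neg h.ne, if_pos h]
  have hv1u : ∀ β ε, β + ε = α → β ≠ 0 → v1 β ε = u β ε := fun β ε h hb => by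
    simp only [v1, if_pos h, if_neg hb]
  have hv10 : v1 0 α = v0 α := by simp only [v1, zero_add, if_true]
  have hv1g : v1 0 0 = v 0 0 := hv1 0 0 (by rwa [add_zero])
  have hgood0 : B.Good v1 (0, α) := hgood v1 hv1 hv10
  have hlow1 : ∀ β ε, β + ε < α → B.Good v1 (β, ε) := fun β ε h =>
    (hlow β ε h).congr fun b e hbe => (hv1 b e
      ((add_le_add (Prod.mk_le_mk.mp hbe).1 (Prod.mk_le_mk.mp hbe).2).trans_lt h)).symm
  have hadm1 : ∀ β ε, β + ε = α → β ≠ 0 → B.Adm β ε (v1 β ε) := fun β ε h hb =>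
    hv1u β ε h hb ▸ (hu β ε h hb).1
  have heq1 : ∀ β ε, β + ε = α → β ≠ 0 → ∀ m : Idx, m ≠ .z → m.dg < ε →
      B.lin (v1 0 0) (v1 β ε) m + B.rest v1 m.eqn β ε = 0 := fun β ε h hb m hm hme => by
    rw [hv1u β ε h hb, hv1g, rest_congr m.eqn fun b e hbe => hv1 b e (h ▸ hlt hbe)]
    exact (hu β ε h hb).2 m hm hme
  have hadm1' : ∀ β ε, β + ε = α → B.Adm β ε (v1 β ε) := fun β ε h => by
    by_cases hb : β = 0
    · subst hb
      rw [zero_add] at h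
      exact h ▸ hgood0.1
    · exact hadm1 β ε h hb
  have hadmle : ∀ β ε, β + ε ≤ α → B.Adm β ε (v1 β ε) := fun β ε h =>
    h.lt_or_eq.elim (fun h => (hlow1 β ε h).1) (hadm1' β ε)
  have hLz1 : ∀ b e c, B.L c (v1 b e .z) = 0 := fun b e c => by
    by_cases h : b + e ≤ α
    · rw [(hadmle b e h).z]
      split_ifs <;> simp
    · simp only [v1, if_neg fun hc => h (le_of_eq hc), if_neg fun hc => h (le_of_lt hc),
        Pi.zero_apply, map_zero]
  let γ1 : Deg → Deg → EPhi1 A := fun b e => BKL.mk B.d B.L (v1 b e)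
  let y1 := setTeqS γ1
  have hγ1 : ∀ β ≤ α, ∀ b e, b + e = β → γ1 b e ∈ F1 A e := fun β hβ b e h =>
    mk_mem_F1 (hadmle b e (h ▸ hβ)).supp
  have hy1 : ∀ β ≤ α, y1 β ∈ F1 A β := fun β hβ => setTeqS_mem_F1 (hγ1 β hβ)
  have hy1v : ∀ β < α, y1 β = setTeqS (fun b e => BKL.mk B.d B.L (v b e)) β := fun β hβ =>
    setTeqS_congr fun b e h => by simp only [γ1]; rw [hv1 b e (h ▸ hβ)]
  let a0 : Deg → CDer A := fun β => if β < α then a β else 0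
  have ha0 : IsSRees0 a0 := fun β => by
    by_cases h : β < α
    · simp only [a0, if_pos h]; exact ha β h
    · simp only [a0, if_neg h]; exact zero_mem (F0lt A β)
  have ha00 : a0 0 = 0 := eq_zero_of_mem_F0lt_zero (ha0 0)
  have hE0 : ∀ β < α, expAct a0 y1 β = y β := fun β hβ => by
    rw [← hya β hβ]
    exact expAct_congr (fun b hb => if_pos (hb.trans_lt hβ)) fun b hb => hy1v b (hb.trans_lt hβ)
  have hρ : y α - expAct a0 y1 α ∈ F1lt A α := by
    have e1 := hy.2 α
    have e2 := expAct_sub_mem ha0 hy1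
    have e3 := setTeqS_sub_mem (hγ1 α le_rfl)
    have e4 : γ1 0 α - x α ∈ F1lt A α := by
      simp only [γ1]
      rw [hx, hv10]
      exact mk_sub_top_mem (hv10 ▸ hgood0.1.supp)
    have := sub_mem (sub_mem (sub_mem e1 e2) e3) e4
    simp only [Pi.sub_apply] at this
    convert this using 1
    simp only [y1]
    abel
  obtain ⟨ξ, hξ, hw1, hw2, hw3, hw4, hw5⟩ := exists_gauge hα hg hρ
  set ρ := y α - expAct a0 y1 α - bracket01 ξ (BKL.mk B.d B.L (v 0 0)) with hρdef
  let a1 : Deg → CDer A := fun β => if β = α then ξ else a0 β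
  have ha1 : ∀ β < α, a1 β = a0 β := fun β hβ => if_neg hβ.ne
  have ha1α : a1 α = ξ := if_pos rfl
  have ha10 : a1 0 = 0 := (ha1 0 hα0).trans ha00
  have hy10 : y1 0 = BKL.mk B.d B.L (v 0 0) := by
    rw [← hv1g]
    exact setTeqS_zero γ1
  have hE1 : expAct a1 y1 α = y α - ρ := by
    rw [expAct_change hα ha00 (fun β hβ => (ha1 β hβ).symm) (fun β _ => rfl) (a := a0) (y := y1), sub_self,
      add_zero, ha1α, hy10, hρdef, show a0 α = 0 from if_neg (lt_irrefl α), sub_zero]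
    abel
  have hE1lt : ∀ β < α, expAct a1 y1 β = y β := fun β hβ => by
    rw [← hE0 β hβ]
    exact expAct_congr (fun b hb => ha1 b (hb.trans_lt hβ)) fun _ _ => rfl
  have hcurv : ∀ β < α, seriesBracket11 y1 y1 β = 0 := fun β hβ => by
    rw [seriesBracket11_setTeqS]
    exact Finset.sum_eq_zero fun b hb => (curvE_eq_zero hLz1).mpr
      (hlow1 b.1 b.2 ((mem_antidiagonal.mp hb).symm ▸ hβ)).2
  have hbr : bracket11 (BKL.mk B.d B.L (v 0 0)) ρ =
      -(algebraMap ℝ A 2⁻¹ • ∑ b ∈ antidiagonal α, curvE γ1 b.1 b.2) := by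
    have h1 := seriesBracket11_change hα hE1lt
    rw [hy.1.2 α, seriesBracket11_expAct ha10 hcurv, seriesBracket11_setTeqS, expAct_zero, hy10, hE1,
      sub_sub_cancel] at h1
    have h2 : (algebraMap ℝ A 2⁻¹) • (2 : ℕ) • bracket11 (BKL.mk B.d B.L (v 0 0)) ρ =
        bracket11 (BKL.mk B.d B.L (v 0 0)) ρ := by
      rw [← Nat.cast_smul_eq_nsmul A, smul_smul, Nat.cast_ofNat, mul_comm, ← map_ofNat (algebraMap ℝ A),
        ← map_mul, mul_inv_cancel₀ two_ne_zero, map_one, one_smul]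
    rw [← h2, eq_neg_iff_add_eq_zero, ← smul_add, add_comm, ← h1, smul_zero]
  have hG : B.InGauge ρ := by
    refine inGauge_of_bracket hg hw2 hw3 hw4 hw5 (fun i => ?_) (fun i => ?_) fun i => ?_
    · rw [hbr, map_neg, map_smul, map_sum, Finset.sum_eq_zero, smul_zero, neg_zero]
      intro b hb
      have hb' := mem_antidiagonal.mp hb
      rw [coef2_curvE (n := .sy i) rfl, two_mul_eq_zero]
      by_cases hb0 : b.1 = 0
      · have : b.2 = α := by rw [← hb', hb0, zero_add]
        rw [hb0, this]
        exact hgood0.2 _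
      by_cases hd : deg i 0 1 < b.2
      · rw [show (Eqn.sy i) = (Idx.sy i).eqn from rfl, curv_eq (hv1g ▸ hg) (Or.inl hb0) (by
          rw [(hadm1 b.1 b.2 hb' hb0).z, if_neg fun hc => hb0 hc.1]) (by simp)]
        exact heq1 b.1 b.2 hb' hb0 (.sy i) (by simp) hd
      have hle : ∀ b' e', (b', e') ≤ (b.1, b.2) → B.Adm b' e' (v1 b' e') := fun b' e' h =>
        hadmle b' e' (hb' ▸ add_le_add (Prod.mk_le_mk.mp h).1 (Prod.mk_le_mk.mp h).2)
      by_cases hd' : deg i 0 1 = b.2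
      · rw [← hd']
        exact Background.curv_sy_top fun b' e' h => hle b' e' (hd' ▸ h)
      · exact curv_eq_zero_of_not_le (fun b' e' h => (hle b' e' h).supp) fun hc =>
          hd (lt_of_le_of_ne hc hd')
    · rw [hbr, map_neg, map_smul, map_sum, map_neg, map_smul, map_sum, Finset.sum_eq_zero, smul_zero,
        neg_zero]
      intro b _
      rw [fieldX_curvE hLz1]
      exact B.c0_comb _
    · rw [hbr, map_neg, map_smul, map_sum, map_neg, map_smul, map_sum, Finset.sum_eq_zero, smul_zero,
        neg_zero]
      intro b _
      rw [fieldY_curvE]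
      exact B.c0_comb _
  let w : Idx → A := fun m => B.coord m ρ
  have hwρ : BKL.mk B.d B.L w = ρ := hG.mk_coord
  have hwlt : ∀ m : Idx, ¬m.dg < α → w m = 0 := fun m hm =>
    coord_eq_zero (P := {β | β < α}) hw1 hm
  have hwz : w .z = 0 := by
    change B.c0 (fieldAt 0 ρ) = 0
    rw [hw3, map_zero]
  have hwsy : ∀ i, w (.sy i) = 0 := fun i => by
    change algebraMap ℝ A 2⁻¹ * Co1.val ρ (.sy i) = 0
    rw [hw5, mul_zero]
  let v2 : Deg → Deg → Idx → A := fun β ε => v1 β ε + if β + ε = α then top ε w else 0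
  have hv2 : ∀ β ε, β + ε < α → v2 β ε = v1 β ε := fun β ε h => by
    simp only [v2, if_neg h.ne, add_zero]
  have hv2' : ∀ β ε, β + ε = α → v2 β ε = v1 β ε + top ε w := fun β ε h => by
    simp only [v2, if_pos h]
  have hLz2 : ∀ b e c, B.L c (v2 b e .z) = 0 := fun b e c => by
    have : v2 b e .z = v1 b e .z := by
      simp only [v2, Pi.add_apply]
      split_ifs
      · by_cases hz : Idx.z.dg = e
        · rw [top_of_eq hz, hwz, add_zero]
        · rw [top_of_ne hz, add_zero]
      · exact add_zero _
    rw [this, hLz1]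
  let y2 := setTeqS fun b e => BKL.mk B.d B.L (v2 b e)
  have hy2 : ∀ β < α, y1 β = y2 β := fun β hβ =>
    setTeqS_congr fun b e h => by simp only [γ1]; rw [hv2 b e (h ▸ hβ)]
  have hy2α : y2 α = y1 α + ρ := by
    have h1 : y2 α = ∑ b ∈ antidiagonal α, (γ1 b.1 b.2 + mkₗ B.d B.L (top b.2 w)) :=
      Finset.sum_congr rfl fun b hb => by
        dsimp only
        rw [hv2' _ _ (mem_antidiagonal.mp hb), ← mk_add]
        rfl
    rw [h1, Finset.sum_add_distrib, ← map_sum, sum_top hwlt, mkₗ_apply, hwρ]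
    rfl
  have hfin : ∀ a', (∀ β < α, a' β = a1 β) → a' α = ξ → expAct a' y2 α = y α := fun a' h1 h2 => by
    rw [expAct_change hα ha10 (fun β hβ => (h1 β hβ).symm) hy2, hE1, hy2α, h2, ha1α, sub_self,
      zero_bracket01]
    abel
  refine ⟨ξ, hξ, v2, fun β ε h => (hv2 β ε h).trans (hv1 β ε h), fun β ε h =>
    good_of_sum hα hlow1 hgood0 hadm1 heq1 hwz hwsy hwlt hv2 hv2' ?_ h, ?_, fun a' h1 h2 =>
    hfin a' (fun β hβ => by rw [h1 β hβ, ha1 β hβ]; exact (if_pos hβ).symm) h2⟩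
  · rw [← sum_curvE_eq_zero hLz2, ← seriesBracket11_setTeqS]
    have hc2 : ∀ β < α, seriesBracket11 y2 y2 β = 0 := fun β hβ => by
      rw [← hcurv β hβ]
      exact seriesBracket11_congr fun b hb => (hy2 b (hb.trans_lt hβ)).symm
    rw [← seriesBracket11_expAct ha10 hc2, ← hy.1.2 α]
    refine seriesBracket11_congr fun β hβ => ?_
    rcases hβ.lt_or_eq with h | rfl
    · rw [← hE1lt β h]
      exact expAct_congr (fun _ _ => rfl) fun b hb => (hy2 b (hb.trans_lt h)).symm
    · exact hfin a1 (fun _ _ => rfl) ha1α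
  · rw [hv2' 0 α (zero_add α), hv10]
    have : top α w = 0 := funext fun m => by
      by_cases h : m.dg = α
      · rw [top_of_eq h, hwlt m (by rw [h]; exact lt_irrefl _)]; rfl
      · rw [top_of_ne h]; rfl
    rw [this, add_zero]

/-- Every Maurer-Cartan element in the fiber is a gauge transform of a specialized solution. -/
theorem exists_solution {x y : Deg → EPhi1 A} (hx : B.IsGaugedFamily fun β => if β = 0 then x else 0)
    (hy : y ∈ fiber x) : ∃ (a : Deg → CDer A) (X γ : Deg → Deg → EPhi1 A), IsSRees0 a ∧
      IsMCGradedFamily X ∧ X 0 = x ∧ (∀ β, β ≠ 0 → ∀ α, X β α ∈ gaugeSubspace B.L α) ∧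
      B.IsSol X γ ∧ expAct a (setTeqS γ) = y := by
  classical
  obtain ⟨V, hV, hX⟩ := hx.exists_tops
  obtain ⟨v0, hv0⟩ := hV.exists_good
  have hx0 : ∀ α, x α = BKL.mk B.d B.L (top α (v0 0 α)) := fun α => by
    have := hX 0 α
    rwa [if_pos rfl, ← (hv0 0 α).2] at this
  let vOf : (Deg → CDer A × (Deg → Deg → Idx → A)) → Deg → Deg → Idx → A := fun V b e =>
    (V (b + e)).2 b e
  have hvOf : ∀ {V V' α}, (∀ β ≤ α, V β = V' β) → ∀ b e, b + e ≤ α → vOf V b e = vOf V' b e :=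
    fun h b e hbe => by simp only [vOf, h _ hbe]
  let P : (Deg → CDer A × (Deg → Deg → Idx → A)) → Deg → Prop := fun V α =>
    (V α).1 ∈ F0lt A α ∧ (∀ β ε, β + ε = α → B.Good (vOf V) (β, ε)) ∧ vOf V 0 α = v0 0 α ∧
      expAct (fun α => (V α).1) (setTeqS fun b e => BKL.mk B.d B.L (vOf V b e)) α = y α
  have hle : ∀ {b e β ε α : Deg}, (b, e) ≤ (β, ε) → β + ε = α → b + e ≤ α := fun h hα =>
    hα ▸ add_le_add (Prod.mk_le_mk.mp h).1 (Prod.mk_le_mk.mp h).2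
  obtain ⟨V, hP⟩ := exists_forall_of_step (T := fun _ => CDer A × (Deg → Deg → Idx → A)) P
    (fun V V' α h hV => by
      obtain ⟨h1, h2, h3, h4⟩ := hV
      have hv := hvOf h
      refine ⟨h α le_rfl ▸ h1, fun β ε hβε => (h2 β ε hβε).congr fun b e hbe =>
        hv b e (hle hbe hβε), ?_, ?_⟩
      · rw [← hv 0 α (zero_add α).le, h3]
      · rw [← h4]
        exact expAct_congr (fun β hβ => by rw [h β hβ]) fun β hβ => setTeqS_congr fun b e hbe => by
          rw [hv b e (hbe ▸ hβ)])
    (fun V α hlow => by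
      by_cases hα : α = 0
      · subst hα
        refine ⟨Function.update V 0 (0, fun _ _ => v0 0 0), fun j hj => absurd hj not_lt_zero, ?_⟩
        have hv : vOf (Function.update V 0 (0, fun _ _ => v0 0 0)) 0 0 = v0 0 0 := by
          simp only [vOf, add_zero, Function.update_self]
        refine ⟨?_, fun β ε h => ?_, hv, ?_⟩
        · rw [Function.update_self]
          exact zero_mem (F0lt A 0)
        · obtain ⟨rfl, rfl⟩ := add_eq_zero.mp h
          refine (hv0 0 0).1.congr fun b e hbe => ?_
          obtain ⟨rfl, rfl⟩ := add_eq_zero.mp (le_antisymm (hle hbe h) zero_le)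
          exact hv.symm
        · rw [expAct_zero, setTeqS_zero, hv]
          have h1 := sub_eq_zero.mp (eq_zero_of_mem_F1lt_zero (hy.2 0))
          rw [h1, hx0]
          congr 1
          funext m
          by_cases hm : m.dg = 0
          · rw [top_of_eq hm]
          · rw [top_of_ne hm, (hv0 0 0).1.1.supp m fun hc => hm (le_antisymm hc zero_le)]
      · obtain ⟨ξ, hξ, v', h1, h2, h3, h4⟩ := exists_step hy hx0 hα (v := vOf V)
          (a := fun α => (V α).1) (fun β hβ => (hlow β hβ).1)
          (fun β ε h => (hlow (β + ε) h).2.1 β ε rfl)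
          (hlow 0 (pos_iff_ne_zero.mpr hα)).2.2.1 (fun v' h1 h2 => by
            refine (hv0 0 α).1.congr fun b e hbe => ?_
            obtain rfl : b = 0 := le_antisymm (Prod.mk_le_mk.mp hbe).1 zero_le
            rcases (Prod.mk_le_mk.mp hbe).2.lt_or_eq with h | rfl
            · rw [h1 0 e (by rwa [zero_add]), (hlow e h).2.2.1]
            · exact h2.symm) fun β hβ => (hlow β hβ).2.2.2
        have hV' : ∀ β < α, Function.update V α (ξ, v') β = V β := fun β hβ =>
          Function.update_of_ne hβ.ne _ _
        have hv' : ∀ b e, b + e ≤ α → v' b e = vOf (Function.update V α (ξ, v')) b e :=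
          fun b e hbe => by
            rcases hbe.lt_or_eq with h | h
            · simp only [vOf, hV' _ h]
              exact h1 b e h
            · simp only [vOf, h, Function.update_self]
        refine ⟨Function.update V α (ξ, v'), hV', ?_, fun β ε h => (h2 β ε h).congr fun b e hbe =>
          hv' b e (hle hbe h), ?_, ?_⟩
        · rw [Function.update_self]
          exact hξ
        · rw [← hv' 0 α (zero_add α).le, h3]
        · rw [← h4 (fun β => (Function.update V α (ξ, v') β).1) (fun β hβ => by rw [hV' β hβ]) (by
            rw [Function.update_self])]
          exact expAct_congr (fun _ _ => rfl) fun β hβ => setTeqS_congr fun b e hbe => by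
            rw [hv' b e (hbe ▸ hβ)])
  have hgood : ∀ β ε, B.Good (vOf V) (β, ε) := fun β ε => (hP (β + ε)).2.1 β ε rfl
  refine ⟨fun α => (V α).1, fun β α => BKL.mk B.d B.L (top α (vOf V β α)), _, fun α => (hP α).1,
    ⟨fun β α => mk_mem_G1 fun m hm => top_of_ne hm _, fun β α => ?_⟩, ?_, fun β hβ α => ?_,
    isSol_of_good hgood fun β α => rfl, funext fun α => (hP α).2.2.2⟩
  · have hz : ∀ b e c, B.L c (top e (vOf V b e) .z) = 0 := fun b e c => by
      by_cases h : Idx.z.dg = e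
      · rw [top_of_eq h]
        exact L_z (fun b e => (hgood b e).1.z) b e c
      · rw [top_of_ne h, map_zero]
    refine (curvE_mem hz (P := {β | β < α})).mpr fun n hn => ?_
    have hs : ∀ b e, SuppLE e (top e (vOf V b e)) := fun b e m hm => top_of_ne (fun hc => hm hc.le) _
    by_cases hd : n.dg = α
    · subst hd
      rw [← (hgood β n.dg).2 n]
      exact Background.curv_top (fun b e _ => hs b e) (fun b e _ => Background.top_top _)
        fun b e _ => (hgood b e).1.supp
    · exact curv_eq_zero_of_not_le (fun b e _ => hs b e) fun hc => hn (lt_of_le_of_ne hc hd)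
  · funext α
    dsimp only
    rw [(hP α).2.2.1, ← hx0]
  · refine (mem_gaugeSubspace B.d).mpr ⟨_, rfl, fun m hm => ?_⟩
    by_cases hd : m.dg = α
    · rw [top_of_eq hd]
      have hf : ¬m.IsFree := fun hf => hm ⟨hf, hd⟩
      cases m with
      | z => rw [(hgood β α).1.z, if_neg fun hc => hβ hc.1]
      | sy i => exact (hgood β α).1.sy i hd.symm
      | _ => exact absurd ⟨by simp, by simp⟩ hf
    · exact top_of_ne hd _

end AnisotropicBackground

end

section
/-! ### Primitives with parameters -/

section Primitive
open Set Filter Topology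
variable {E : Type} [NormedAddCommGroup E] [NormedSpace ℝ E] [ProperSpace E] {U : Set E}
  (hU : IsOpen U)
include hU

theorem continuousOn_primitive {F : Type} [NormedAddCommGroup F] [NormedSpace ℝ F]
    {g : ℝ × E → F} (hg : ContinuousOn g (univ ×ˢ U)) :
    ContinuousOn (fun q : ℝ × E => ∫ s in (0 : ℝ)..q.1, g (s, q.2)) (univ ×ˢ U) := by
  have h1 : Continuous fun p : U × ℝ => ∫ s in (0 : ℝ)..p.2, g (s, p.1) :=
    intervalIntegral.continuous_parametric_primitive_of_continuous
      (f := fun (x : U) s => g (s, x)) (hg.comp_continuous (by fun_prop) fun p => ⟨trivial, p.1.2⟩)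
  rw [continuousOn_iff_continuous_restrict]
  exact h1.comp (f := fun q : (univ ×ˢ U : Set (ℝ × E)) => ((⟨q.1.2, q.2.2⟩ : U), q.1.1)) (by fun_prop)

theorem hasFDerivAt_primitive {F : Type} [NormedAddCommGroup F] [NormedSpace ℝ F] [CompleteSpace F]
    {g : ℝ × E → F} {g' : ℝ × E → E →L[ℝ] F} (hg : ContinuousOn g (univ ×ˢ U))
    (hg' : ContinuousOn g' (univ ×ˢ U))
    (h : ∀ s, ∀ x ∈ U, HasFDerivAt (fun x => g (s, x)) (g' (s, x)) x) {t : ℝ} {x : E} (hx : x ∈ U) :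
    HasFDerivAt (fun q : ℝ × E => ∫ s in (0 : ℝ)..q.1, g (s, q.2))
      ((ContinuousLinearMap.toSpanSingleton ℝ (g (t, x))).coprod (∫ s in (0 : ℝ)..t, g' (s, x)))
      (t, x) := by
  have hopen : IsOpen (univ ×ˢ U : Set (ℝ × E)) := isOpen_univ.prod hU
  have hmem : ∀ᶠ v : ℝ × E in 𝓝 (t, x), v ∈ (univ ×ˢ U : Set (ℝ × E)) :=
    hopen.mem_nhds ⟨trivial, hx⟩
  have hc : ∀ y ∈ U, Continuous fun s : ℝ => g (s, y) := fun y hy =>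
    hg.comp_continuous (by fun_prop) fun s => ⟨trivial, hy⟩
  have hc' : ∀ y ∈ U, Continuous fun s : ℝ => g' (s, y) := fun y hy =>
    hg'.comp_continuous (by fun_prop) fun s => ⟨trivial, hy⟩
  refine (hasStrictFDerivAt_uncurry_coprod (u := (t, x))
    (f := fun t x => ∫ s in (0 : ℝ)..t, g (s, x))
    (f₁ := fun t x => ContinuousLinearMap.toSpanSingleton ℝ (g (t, x)))
    (f₂ := fun t x => ∫ s in (0 : ℝ)..t, g' (s, x)) ?_ ?_ ?_ ?_).hasFDerivAt
  · filter_upwards [hmem] with v hv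
    exact (intervalIntegral.integral_hasDerivAt_right ((hc _ hv.2).intervalIntegrable _ _)
      ((hc _ hv.2).stronglyMeasurableAtFilter _ _) (hc _ hv.2).continuousAt).hasFDerivAt
  · filter_upwards [hmem] with v hv
    obtain ⟨r, hr, hrU⟩ := Metric.nhds_basis_closedBall.mem_iff.mp (hU.mem_nhds hv.2)
    obtain ⟨K, hK⟩ := (isCompact_uIcc.prod (isCompact_closedBall v.2 r)).exists_bound_of_continuousOn
      (hg'.mono fun q (hq : q ∈ uIcc 0 v.1 ×ˢ Metric.closedBall v.2 r) => ⟨trivial, hrU hq.2⟩)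
    refine intervalIntegral.hasFDerivAt_integral_of_dominated_of_fderiv_le (bound := fun _ => K)
      (F := fun x s => g (s, x)) (F' := fun x s => g' (s, x)) (Metric.closedBall_mem_nhds v.2 hr) ?_
      ((hc _ hv.2).intervalIntegrable _ _) (hc' _ hv.2).aestronglyMeasurable ?_
      intervalIntegrable_const ?_
    · filter_upwards [hU.mem_nhds hv.2] with y hy
      exact (hc y hy).aestronglyMeasurable
    · exact .of_forall fun s hs y hy => hK (s, y) ⟨uIoc_subset_uIcc hs, hy⟩
    · exact .of_forall fun s _ y hy => h s y (hrU hy)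
  · exact (ContinuousLinearMap.toSpanSingletonCLE (𝕜 := ℝ) (E := F)).continuous.continuousAt.comp
      (hg.continuousAt hmem)
  · exact (continuousOn_primitive hU hg').continuousAt hmem

theorem contDiffOn_primitive_nat (n : ℕ) : ∀ {F : Type} [NormedAddCommGroup F] [NormedSpace ℝ F]
    [CompleteSpace F] {f : ℝ × E → F}, ContDiffOn ℝ n f (Ici 0 ×ˢ U) →
    ContDiffOn ℝ n (fun q : ℝ × E => ∫ s in (0 : ℝ)..q.1, f (s, q.2)) (Ici 0 ×ˢ U) := by
  have hmax : ∀ {F : Type} [NormedAddCommGroup F] {f : ℝ × E → F}, ContinuousOn f (Ici 0 ×ˢ U) →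
      ContinuousOn (fun q : ℝ × E => f (max q.1 0, q.2)) (univ ×ˢ U) := fun hf =>
    hf.comp (by fun_prop) fun q hq => ⟨Set.mem_Ici.mpr (le_max_right _ _), hq.2⟩
  have heq : ∀ {F : Type} [NormedAddCommGroup F] [NormedSpace ℝ F] (f : ℝ × E → F) (t : ℝ) (x : E),
      0 ≤ t → ∫ s in (0 : ℝ)..t, f (max s 0, x) = ∫ s in (0 : ℝ)..t, f (s, x) := fun f t x ht =>
    intervalIntegral.integral_congr fun s hs => by
      rw [uIcc_of_le ht] at hs
      simp only [max_eq_left hs.1]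
  induction n with
  | zero =>
    intro F _ _ _ f hf
    rw [Nat.cast_zero, contDiffOn_zero] at hf ⊢
    exact ((continuousOn_primitive hU (hmax hf)).mono (prod_mono (subset_univ _) le_rfl)).congr
      fun q hq => (heq f q.1 q.2 hq.1).symm
  | succ n ih =>
    intro F _ _ _ f hf
    rw [Nat.cast_succ] at hf ⊢
    have hud : UniqueDiffOn ℝ (Ici (0 : ℝ) ×ˢ U) := (uniqueDiffOn_Ici 0).prod hU.uniqueDiffOn
    obtain ⟨-, f', hf', hd⟩ := (contDiffOn_succ_iff_hasFDerivWithinAt_of_uniqueDiffOn hud).mp hf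
    refine (contDiffOn_succ_iff_hasFDerivWithinAt_of_uniqueDiffOn hud).mpr ⟨fun h => by simp at h,
      fun q => (ContinuousLinearMap.toSpanSingleton ℝ (f q)).comp (.fst ℝ ℝ E) +
        (∫ s in (0 : ℝ)..q.1, (f' (s, q.2)).comp (.inr ℝ ℝ E)).comp (.snd ℝ ℝ E), ?_, ?_⟩
    · refine ContDiffOn.add (ContDiffOn.clm_comp ?_ contDiffOn_const) (ContDiffOn.clm_comp
        (ih (hf'.clm_comp contDiffOn_const)) contDiffOn_const)
      exact (ContinuousLinearMap.toSpanSingletonCLE (𝕜 := ℝ) (E := F)).contDiff.comp_contDiffOn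
        (hf.of_le (by norm_cast; omega))
    · rintro ⟨t, x⟩ ⟨ht, hx⟩
      have hc : ContinuousOn (fun q : ℝ × E => (f' q).comp (.inr ℝ ℝ E)) (Ici 0 ×ˢ U) :=
        (hf'.continuousOn).clm_comp continuousOn_const
      have key := hasFDerivAt_primitive hU (t := t) (hmax hf.continuousOn) (hmax hc)
        (fun s y hy => by
          have h1 : HasFDerivWithinAt (fun y : E => ((max s 0, y) : ℝ × E)) (.inr ℝ ℝ E) U y :=
            (hasFDerivAt_prodMk_right (max s 0) y).hasFDerivWithinAt
          exact ((hd (max s 0, y) ⟨Set.mem_Ici.mpr (le_max_right _ _), hy⟩).comp y h1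
            fun z hz => ⟨Set.mem_Ici.mpr (le_max_right _ _), hz⟩).hasFDerivAt (hU.mem_nhds hy)) hx
      dsimp only at key
      rw [max_eq_left ht, heq (fun q => (f' q).comp (.inr ℝ ℝ E)) t x ht] at key
      have := (key.hasFDerivWithinAt (s := Ici 0 ×ˢ U)).congr
        (f₁ := fun q : ℝ × E => ∫ s in (0 : ℝ)..q.1, f (s, q.2))
        (fun q hq => (heq f q.1 q.2 hq.1).symm) (heq f t x ht).symm
      refine this.congr_fderiv (ContinuousLinearMap.ext fun v => ?_)
      simp

theorem contDiffOn_primitive {f : ℝ × E → ℝ} (hf : ContDiffOn ℝ ∞ f (Ici 0 ×ˢ U)) :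
    ContDiffOn ℝ ∞ (fun q : ℝ × E => ∫ s in (0 : ℝ)..q.1, f (s, q.2)) (Ici 0 ×ˢ U) :=
  contDiffOn_infty.mpr fun n => contDiffOn_primitive_nat hU n (contDiffOn_infty.mp hf n)

end Primitive

end

section
/-! ### Differentiation and integration along the first factor -/

section Product
variable {M : Type*} [TopologicalSpace M] [ChartedSpace (EuclideanSpace ℝ (Fin 3)) M]

/-- The point of the half line with coordinate `max t 0`. -/
def halfLine (t : ℝ) : EuclideanHalfSpace 1 := (𝓡∂ 1).symm (EuclideanSpace.single 0 t)

theorem halfLine_val (t : ℝ) (ht : 0 ≤ t) : (halfLine t).1 = EuclideanSpace.single 0 t :=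
  (𝓡∂ 1).right_inv (by
    rw [range_modelWithCornersEuclideanHalfSpace]
    simpa using ht)

theorem halfLine_coord (t : EuclideanHalfSpace 1) : halfLine (t.1 0) = t := by
  ext i
  rw [halfLine_val _ t.2]
  rw [Subsingleton.elim i 0]
  simp

theorem single_eq_smul : (fun t : ℝ => (EuclideanSpace.single 0 t : EuclideanSpace ℝ (Fin 1))) =
    fun t => t • EuclideanSpace.single 0 1 := by
  funext t
  ext i
  simp

theorem contMDiffOn_halfLine : ContMDiffOn 𝓘(ℝ, ℝ) (𝓡∂ 1) ∞ halfLine (Set.Ici 0) := by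
  refine (contMDiffOn_model_symm (I := 𝓡∂ 1) (n := ∞)).comp (t := Set.range (𝓡∂ 1))
    (f := fun t : ℝ => (EuclideanSpace.single 0 t : EuclideanSpace ℝ (Fin 1))) ?_ ?_
  · rw [single_eq_smul]
    exact (contDiff_id.smul contDiff_const).contMDiff.contMDiffOn
  · intro t ht
    rw [range_modelWithCornersEuclideanHalfSpace]
    simpa using ht

theorem hasDerivAt_single (t : ℝ) : HasDerivAt
    (fun t : ℝ => (EuclideanSpace.single 0 t : EuclideanSpace ℝ (Fin 1)))
    (EuclideanSpace.single 0 1) t := by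
  rw [single_eq_smul]
  simpa using (hasDerivAt_id t).smul_const (EuclideanSpace.single (0 : Fin 1) (1 : ℝ))

variable [IsManifold (𝓡 3) ∞ M]

theorem hasDerivWithinAt_partial0 (f : Smooth M) (t : ℝ) (ht : 0 ≤ t) (m : M) :
    HasDerivWithinAt (fun s => f (halfLine s, m)) (partial0 M f (halfLine t, m)) (Set.Ici 0) t := by
  have h : MDifferentiableAt spacetimeModel 𝓘(ℝ, ℝ) f (halfLine t, m) := f.mdifferentiableAt
  have h1 := h.hasMFDerivAt.2
  have h2 : HasDerivWithinAt (fun s : ℝ => ((EuclideanSpace.single 0 s : EuclideanSpace ℝ (Fin 1)),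
      extChartAt (𝓡 3) m m)) (EuclideanSpace.single 0 1, 0) (Set.Ici 0) t :=
    (hasDerivAt_single t).hasDerivWithinAt.prodMk (hasDerivWithinAt_const _ _ _)
  have h3 : ((EuclideanSpace.single 0 t : EuclideanSpace ℝ (Fin 1)), extChartAt (𝓡 3) m m) =
      extChartAt spacetimeModel ((halfLine t, m) : Spacetime M) (halfLine t, m) := by
    rw [← halfLine_val t ht]
    rfl
  rw [← h3] at h1
  have := h1.comp_hasDerivWithinAt t h2 (by
    intro s hs
    rw [modelWithCorners_prod_coe]
    rw [Set.range_prodMap]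
    refine ⟨?_, ?_⟩
    · rw [range_modelWithCornersEuclideanHalfSpace]
      simpa using hs
    · simp)
  refine this.congr (fun s hs => ?_) ?_
  · change f (halfLine s, m) = f ((𝓡∂ 1).symm (EuclideanSpace.single 0 s),
      (extChartAt (𝓡 3) m).symm (extChartAt (𝓡 3) m m))
    rw [extChartAt_to_inv]
    rfl
  · change f (halfLine t, m) = f ((𝓡∂ 1).symm (EuclideanSpace.single 0 t),
      (extChartAt (𝓡 3) m).symm (extChartAt (𝓡 3) m m))
    rw [extChartAt_to_inv]
    rfl

theorem ext_of_halfLine {f g : Smooth M} (h : ∀ t, 0 ≤ t → ∀ m, f (halfLine t, m) = g (halfLine t, m)) :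
    f = g := by
  ext ⟨t, m⟩
  rw [← halfLine_coord t]
  exact h _ t.2 m

theorem contMDiff_primitive (f : Smooth M) : ContMDiff spacetimeModel 𝓘(ℝ, ℝ) ∞
    fun q : Spacetime M => ∫ s in (0 : ℝ)..(tau M q), f (halfLine s, q.2) := by
  rintro ⟨t, m⟩
  have h1 : ContDiffOn ℝ ∞ (fun q : ℝ × EuclideanSpace ℝ (Fin 3) =>
      f (halfLine q.1, (extChartAt (𝓡 3) m).symm q.2))
      (Set.Ici 0 ×ˢ (extChartAt (𝓡 3) m).target) := by
    rw [← contMDiffOn_iff_contDiffOn]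
    refine f.contMDiff.comp_contMDiffOn (ContMDiffOn.prodMk ?_ ?_)
    · exact contMDiffOn_halfLine.comp contDiff_fst.contMDiff.contMDiffOn fun q hq => hq.1
    · exact (contMDiffOn_extChartAt_symm m).comp contDiff_snd.contMDiff.contMDiffOn fun q hq => hq.2
  have h2 := (contDiffOn_primitive (isOpen_extChartAt_target m) h1).contMDiffOn
  have h3 : ContMDiffOn spacetimeModel 𝓘(ℝ, ℝ × EuclideanSpace ℝ (Fin 3)) ∞
      (fun q : Spacetime M => (tau M q, extChartAt (𝓡 3) m q.2))
      (Prod.snd ⁻¹' (chartAt (EuclideanSpace ℝ (Fin 3)) m).source) :=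
    (tau M).contMDiff.contMDiffOn.prodMk_space
      ((contMDiffOn_extChartAt (I := 𝓡 3) (x := m) (n := ∞)).comp contMDiff_snd.contMDiffOn fun q hq => hq)
  have h4 := h2.comp h3 fun q hq => ⟨q.1.2, (extChartAt (𝓡 3) m).map_source (by simpa using hq)⟩
  refine (h4.congr fun q hq => ?_).contMDiffAt (((chartAt _ m).open_source.preimage continuous_snd).mem_nhds
    (mem_chart_source _ m))
  simp only [Function.comp]
  rw [(extChartAt (𝓡 3) m).left_inv (by simpa using hq)]

/-- The primitive along the first factor that vanishes on the boundary. -/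
def primitive (f : Smooth M) : Smooth M := ⟨_, contMDiff_primitive f⟩

theorem partial0_primitive (f : Smooth M) : partial0 M (primitive f) = f := by
  refine ext_of_halfLine fun t ht m => ?_
  have hc : Continuous fun s => f (halfLine s, m) := f.contMDiff.continuous.comp
    (((𝓡∂ 1).continuous_symm.comp (f := fun t : ℝ => (EuclideanSpace.single 0 t : EuclideanSpace ℝ (Fin 1)))
      (single_eq_smul ▸ by fun_prop)).prodMk continuous_const)
  have h1 := hasDerivWithinAt_partial0 (primitive f) t ht m
  have h2 : HasDerivWithinAt (fun s => primitive f (halfLine s, m)) (f (halfLine t, m)) (Set.Ici 0) t := by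
    refine HasDerivWithinAt.congr (f := fun t => ∫ s in (0 : ℝ)..t, f (halfLine s, m)) ?_ ?_ ?_
    · exact (intervalIntegral.integral_hasDerivAt_right (hc.intervalIntegrable _ _)
        (hc.stronglyMeasurableAtFilter _ _) hc.continuousAt).hasDerivWithinAt
    · intro s hs
      change (∫ s in (0 : ℝ)..(halfLine s).1 0, _) = _
      rw [halfLine_val s hs]
      simp
    · change (∫ s in (0 : ℝ)..(halfLine t).1 0, _) = _
      rw [halfLine_val t ht]
      simp
  exact ((uniqueDiffOn_Ici 0) t ht).eq_deriv _ h1 h2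

theorem partial0_eq_of_hasDerivWithinAt {f : Smooth M} {t c : ℝ} (ht : 0 ≤ t) {m : M}
    (h : HasDerivWithinAt (fun s => f (halfLine s, m)) c (Set.Ici 0) t) :
    partial0 M f (halfLine t, m) = c :=
  ((uniqueDiffOn_Ici 0) t ht).eq_deriv _ (hasDerivWithinAt_partial0 f t ht m) h

theorem tau_halfLine {t : ℝ} (ht : 0 ≤ t) (m : M) : tau M (halfLine t, m) = t := by
  change (halfLine t).1 0 = t
  rw [halfLine_val t ht]
  simp

theorem partial0_tau : partial0 M (tau M) = 1 :=
  ext_of_halfLine fun t ht m => partial0_eq_of_hasDerivWithinAt ht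
    ((hasDerivWithinAt_id t _).congr (fun _ hs => tau_halfLine hs m) (tau_halfLine ht m))

/-- The function on `[0, ∞) × M` that is constant along the first factor. -/
def pull (h : C^∞⟮𝓡 3, M; ℝ⟯) : Smooth M := h.comp ⟨Prod.snd, contMDiff_snd⟩

theorem partial0_pull (h : C^∞⟮𝓡 3, M; ℝ⟯) : partial0 M (pull h) = 0 :=
  ext_of_halfLine fun t ht m => partial0_eq_of_hasDerivWithinAt ht (hasDerivWithinAt_const _ _ (h m))

theorem eq_pull_of_partial0_eq_zero {f : Smooth M} (hf : partial0 M f = 0) : ∃ h, f = pull h := by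
  refine ⟨⟨fun m => f (halfLine 0, m), f.contMDiff.comp (contMDiff_const.prodMk contMDiff_id)⟩,
    ext_of_halfLine fun t ht m => ?_⟩
  have := (convex_Ici (0 : ℝ)).norm_image_sub_le_of_norm_hasDerivWithin_le (C := 0)
    (fun s hs => hasDerivWithinAt_partial0 f s hs m) (fun s hs => by rw [hf]; simp)
    (Set.self_mem_Ici (a := (0 : ℝ))) ht
  rw [zero_mul, norm_le_zero_iff, sub_eq_zero] at this
  exact this

namespace SpatialFrame
variable (L : SpatialFrame M)

theorem der_tau (a : Fin 3) : L.der a (tau M) = 0 := by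
  ext q
  have h1 : MDifferentiableAt (𝓡∂ 1) 𝓘(ℝ, ℝ) (fun t : EuclideanHalfSpace 1 => t.1 0) q.1 :=
    (((EuclideanSpace.proj (𝕜 := ℝ) (0 : Fin 1)).contDiff.contMDiff (n := ∞)).comp
      ((𝓡∂ 1).contMDiff (n := ∞))).mdifferentiableAt (by simp)
  have h2 := mfderiv_comp (I := spacetimeModel) q h1 mdifferentiableAt_fst
  change mfderiv spacetimeModel 𝓘(ℝ, ℝ) ((fun t : EuclideanHalfSpace 1 => t.1 0) ∘ Prod.fst) q
    ((EuclideanSpace.single 0 0 : EuclideanSpace ℝ (Fin 1)), L.field a q.2) = 0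
  rw [h2, mfderiv_fst]
  change mfderiv (𝓡∂ 1) 𝓘(ℝ, ℝ) _ q.1 (EuclideanSpace.single 0 0 : EuclideanSpace ℝ (Fin 1)) = 0
  have h3 : (EuclideanSpace.single 0 0 : EuclideanSpace ℝ (Fin 1)) = 0 := by ext; simp
  rw [h3]
  exact map_zero _

theorem der_pull (a : Fin 3) (h : C^∞⟮𝓡 3, M; ℝ⟯) :
    L.der a (pull h) = pull (fieldDerivation (𝓡 3) (L.field a) (L.smooth a) h) := by
  ext q
  have h1 : MDifferentiableAt (𝓡 3) 𝓘(ℝ, ℝ) h q.2 := h.mdifferentiableAt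
  have h2 := mfderiv_comp (I := spacetimeModel) q h1 mdifferentiableAt_snd
  change mfderiv spacetimeModel 𝓘(ℝ, ℝ) (h ∘ Prod.snd) q
    ((EuclideanSpace.single 0 0 : EuclideanSpace ℝ (Fin 1)), L.field a q.2) = _
  rw [h2, mfderiv_snd]
  rfl

theorem eq_zero_of_forall_pull [T2Space M] {b : Fin 3 → Smooth M}
    (hb : ∀ h, ∑ a, b a * L.der a (pull h) = 0) (a : Fin 3) : b a = 0 := by
  ext q
  refine Fintype.linearIndependent_iff.mp (L.linearIndependent q.2) (fun a => b a q) ?_ a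
  have hinv : (mfderiv (𝓡 3) 𝓘(ℝ, EuclideanSpace ℝ (Fin 3)) (extChartAt (𝓡 3) q.2) q.2).IsInvertible :=
    isInvertible_mfderiv_extChartAt (mem_extChartAt_source _)
  refine hinv.injective ?_
  rw [map_zero, map_sum]
  refine PiLp.ext fun i => ?_
  obtain ⟨χ⟩ : Nonempty (SmoothBumpFunction (𝓡 3) q.2) := inferInstance
  let π : EuclideanSpace ℝ (Fin 3) →L[ℝ] ℝ := EuclideanSpace.proj i
  have hs : ContMDiff (𝓡 3) 𝓘(ℝ, ℝ) ∞ fun m => χ m • π (extChartAt (𝓡 3) q.2 m) :=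
    χ.contMDiff_smul (π.contDiff.contMDiff.comp_contMDiffOn
      (contMDiffOn_extChartAt (I := 𝓡 3) (x := q.2) (n := ∞)))
  have hd : mfderiv (𝓡 3) 𝓘(ℝ, ℝ) (fun m => χ m • π (extChartAt (𝓡 3) q.2 m)) q.2 =
      π.comp (mfderiv (𝓡 3) 𝓘(ℝ, EuclideanSpace ℝ (Fin 3)) (extChartAt (𝓡 3) q.2) q.2) := by
    have e : (fun m => χ m • π (extChartAt (𝓡 3) q.2 m)) =ᶠ[nhds q.2] π ∘ extChartAt (𝓡 3) q.2 :=
      χ.eventuallyEq_one.mono fun m hm => by simp [hm]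
    rw [e.mfderiv_eq, mfderiv_comp (I' := 𝓘(ℝ, EuclideanSpace ℝ (Fin 3))) q.2
      (π.contMDiff.mdifferentiableAt (n := ∞) (by simp))
      ((contMDiffAt_extChartAt (n := ∞)).mdifferentiableAt (by simp)),
      ContinuousLinearMap.mfderiv_eq]
    rfl
  let χi : C^∞⟮𝓡 3, M; ℝ⟯ := ⟨_, hs⟩
  have hq := DFunLike.congr_fun (hb χi) q
  refine (map_sum π (fun a => mfderiv (𝓡 3) 𝓘(ℝ, EuclideanSpace ℝ (Fin 3)) (extChartAt (𝓡 3) q.2) q.2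
      (b a q • L.field a q.2)) Finset.univ).trans (Eq.trans ?_ hq)
  refine Eq.trans (Finset.sum_congr rfl fun a _ => ?_) (map_sum (ContMDiffMap.evalRingHom q)
    (fun a => b a * L.der a (pull χi)) Finset.univ).symm
  have h1 : L.der a (pull χi) q =
      π (mfderiv (𝓡 3) 𝓘(ℝ, EuclideanSpace ℝ (Fin 3)) (extChartAt (𝓡 3) q.2) q.2 (L.field a q.2)) := by
    rw [der_pull]
    exact DFunLike.congr_fun hd (L.field a q.2)
  rw [map_smul]
  exact (map_smul π _ _).trans (congrArg (b a q * ·) h1.symm)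

end SpatialFrame

end Product

end

section
/-! ### Generalized solutions of linear evolution equations -/

section GenKer
variable {A : Type*} [CommRing A] [Algebra ℝ A] (d : Derivation ℝ A A)

/-- The operator `x ↦ d x + w x`. -/
def evolution (w : A) : Module.End ℝ A := (d : A →ₗ[ℝ] A) + LinearMap.mulLeft ℝ w

theorem evolution_apply (w x : A) : evolution d w x = d x + w * x := rfl

/-- The elements annihilated by a power of `d + w`. -/
def genKer (w : A) : Submodule ℝ A := Module.End.maxGenEigenspace (evolution d w) 0

variable {d} {v w x y P : A}

theorem mem_genKer : x ∈ genKer d w ↔ ∃ n, (evolution d w ^ n) x = 0 := by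
  rw [genKer, Module.End.mem_maxGenEigenspace]
  simp

theorem evolution_pow_succ (n : ℕ) :
    (evolution d w ^ (n + 1)) x = (evolution d w ^ n) (d x + w * x) := by
  rw [pow_succ, Module.End.mul_apply, evolution_apply]

theorem mem_genKer_of_evolution_mem (h : d x + w * x ∈ genKer d w) : x ∈ genKer d w := by
  obtain ⟨n, hn⟩ := mem_genKer.mp h
  exact mem_genKer.mpr ⟨n + 1, (evolution_pow_succ n).trans hn⟩

theorem genKer_induction {q : (x : A) → x ∈ genKer d w → Prop} (zero : q 0 (zero_mem _))
    (step : ∀ x hx h, q (d x + w * x) h → q x hx) (hx : x ∈ genKer d w) : q x hx := by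
  obtain ⟨n, hn⟩ := mem_genKer.mp hx
  induction n generalizing x with
  | zero =>
    obtain rfl : x = 0 := hn
    exact zero
  | succ n ih =>
    have h := (evolution_pow_succ n).symm.trans hn
    exact step x hx (mem_genKer.mpr ⟨_, h⟩) (ih _ h)

theorem mul_mem_genKer (hx : x ∈ genKer d v) (hy : y ∈ genKer d w) : x * y ∈ genKer d (v + w) := by
  induction hx using genKer_induction generalizing y with
  | zero => rw [zero_mul]; exact zero_mem _
  | step x _ _ ihx =>
    induction hy using genKer_induction with
    | zero => rw [mul_zero]; exact zero_mem _
    | step y hy _ ihy =>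
      refine mem_genKer_of_evolution_mem ?_
      have e : d (x * y) + (v + w) * (x * y) = (d x + v * x) * y + x * (d y + w * y) := by
        rw [d.leibniz, smul_eq_mul, smul_eq_mul]
        ring
      rw [e]
      exact add_mem (ihx hy) ihy

theorem mem_genKer_zero_of_ker (hx : d x = 0) : x ∈ genKer d 0 := by
  refine mem_genKer_of_evolution_mem ?_
  rw [hx, zero_mul, add_zero]
  exact zero_mem _

theorem mul_mem_genKer_of_ker (hv : d v = 0) (hx : x ∈ genKer d w) : v * x ∈ genKer d w := by
  have := mul_mem_genKer (mem_genKer_zero_of_ker hv) hx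
  rwa [zero_add] at this

theorem d_mem_genKer (hw : d w = 0) (hx : x ∈ genKer d w) : d x ∈ genKer d w := by
  induction hx using genKer_induction with
  | zero => rw [map_zero]; exact zero_mem _
  | step x hx h ih =>
    have e : d x = (d x + w * x) - w * x := by ring
    rw [e]
    exact sub_mem h (mul_mem_genKer_of_ker hw hx)

theorem derivation_mem_genKer {D : Derivation ℝ A A} (hD : ∀ f, d (D f) = D (d f)) (hw : d w = 0)
    (hx : x ∈ genKer d w) : D x ∈ genKer d w := by
  induction hx using genKer_induction with
  | zero => rw [map_zero]; exact zero_mem _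
  | step x hx h ih =>
    refine mem_genKer_of_evolution_mem ?_
    have e : d (D x) + w * D x = D (d x + w * x) - D w * x := by
      rw [map_add, D.leibniz, hD, smul_eq_mul, smul_eq_mul]
      ring
    rw [e]
    exact sub_mem ih (mul_mem_genKer_of_ker (by rw [hD, hw, map_zero]) hx)

theorem exists_evolution_eq (hP : IsUnit P) (hd : d P = 0) (hx : x ∈ genKer d (w + P)) :
    ∃ c ∈ genKer d (w + P), d c + w * c = x := by
  obtain ⟨Q, hQ⟩ := hP.exists_left_inv
  have hdQ : d Q = 0 := by
    have h := congrArg d hQ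
    rw [d.leibniz, hd, smul_zero, zero_add, smul_eq_mul, d.map_one_eq_zero] at h
    exact hP.mul_right_eq_zero.mp h
  induction hx using genKer_induction with
  | zero => exact ⟨0, zero_mem _, by simp⟩
  | step x hx h ih =>
    obtain ⟨c, hc, e⟩ := ih
    refine ⟨Q * (c - x), mul_mem_genKer_of_ker hdQ (sub_mem hc hx), ?_⟩
    rw [d.leibniz, hdQ, smul_zero, add_zero, smul_eq_mul, map_sub]
    linear_combination Q * e + x * hQ

theorem eq_zero_of_evolution_eq_zero (hP : IsUnit P) (hx : x ∈ genKer d (w + P))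
    (h : d x + w * x = 0) (hd : d P = 0) : x = 0 := by
  obtain ⟨n, hn⟩ := mem_genKer.mp hx
  have e : ∀ n, (evolution d (w + P) ^ n) x = P ^ n * x := by
    intro n
    induction n with
    | zero => simp
    | succ n ih =>
      have : d (P ^ n) = 0 := by rw [d.leibniz_pow, hd]; simp
      rw [pow_succ', Module.End.mul_apply, ih, evolution_apply, d.leibniz, this, smul_eq_mul, smul_zero]
      linear_combination P ^ n * h
  rw [e] at hn
  exact (hP.pow n).mul_right_eq_zero.mp hn

theorem mul_mem_genKer_iff {E : A} (hE : IsUnit E) (hd : d E = -w * E) :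
    E * x ∈ genKer d w ↔ x ∈ genKer d 0 := by
  have e : ∀ n, (evolution d w ^ n) (E * x) = E * (evolution d 0 ^ n) x := by
    intro n
    induction n with
    | zero => rfl
    | succ n ih =>
      rw [pow_succ', pow_succ', Module.End.mul_apply, ih, Module.End.mul_apply, evolution_apply,
        evolution_apply, d.leibniz, hd, smul_eq_mul, smul_eq_mul]
      ring
  simp only [mem_genKer, e, hE.mul_right_eq_zero]

theorem mem_adjoin_of_mem_genKer {t : A} (ht : d t = 1) (hx : x ∈ genKer d 0) :
    x ∈ Algebra.adjoin ℝ ({t} ∪ {f | d f = 0}) := by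
  obtain ⟨n, hn⟩ := mem_genKer.mp hx
  clear hx
  induction n generalizing x with
  | zero =>
    obtain rfl : x = 0 := hn
    exact zero_mem _
  | succ n ih =>
    set h := (evolution d 0 ^ n) x with hh
    have hd : d h = 0 := by
      rw [pow_succ', Module.End.mul_apply, evolution_apply, zero_mul, add_zero] at hn
      exact hn
    have key : ∀ n, (evolution d 0 ^ n) (t ^ n * h) = (n.factorial : ℝ) • h := by
      intro n
      induction n with
      | zero => simp
      | succ n ih' =>
        have e : d (t ^ (n + 1) * h) + 0 * (t ^ (n + 1) * h) = ((n + 1 : ℕ) : ℝ) • (t ^ n * h) := by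
          rw [d.leibniz, hd, d.leibniz_pow, ht, Nat.cast_smul_eq_nsmul]
          simp
          ring
        rw [evolution_pow_succ, e, map_smul, ih', smul_smul, Nat.factorial_succ, Nat.cast_mul]
    have h1 : x - (n.factorial : ℝ)⁻¹ • (t ^ n * h) ∈ Algebra.adjoin ℝ ({t} ∪ {f | d f = 0}) := by
      refine ih ?_
      rw [map_sub, map_smul, key, smul_smul,
        inv_mul_cancel₀ (Nat.cast_ne_zero.mpr n.factorial_ne_zero), one_smul, sub_self]
    rw [← sub_add_cancel x ((n.factorial : ℝ)⁻¹ • (t ^ n * h))]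
    exact add_mem h1 (Subalgebra.smul_mem _ (mul_mem (pow_mem (Algebra.subset_adjoin (.inl rfl)) n)
      (Algebra.subset_adjoin (.inr hd))) _)

theorem adjoin_le_genKer {t : A} (ht : d t = 1) (hx : x ∈ Algebra.adjoin ℝ ({t} ∪ {f | d f = 0})) :
    x ∈ genKer d 0 := by
  induction hx using Algebra.adjoin_induction with
  | mem x hx =>
    rcases hx with rfl | hx
    · refine mem_genKer_of_evolution_mem ?_
      rw [ht, zero_mul, add_zero]
      exact mem_genKer_zero_of_ker d.map_one_eq_zero
    · exact mem_genKer_zero_of_ker hx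
  | algebraMap r => exact mem_genKer_zero_of_ker (d.map_algebraMap r)
  | add x y _ _ hx hy => exact add_mem hx hy
  | mul x y _ _ hx hy => simpa using mul_mem_genKer hx hy

end GenKer

end

section
theorem derivation_leadingExponent {A : Type*} [CommRing A] [Algebra ℝ A] {d : Derivation ℝ A A}
    {L : Fin 3 → Derivation ℝ A A} {x : Deg → EPhi1 A} (hx : IsMCGraded x)
    (hg : ∀ α, x α - thetaPartial d α ∈ gaugeSubspace L α) (i : Fin 3) :
    d (leadingExponent x i) = 0 := by
  obtain ⟨w, hw, h0⟩ := (mem_gaugeSubspace d).mp (hg 0)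
  let zi : Idx → A := fun m => match m with | .z => 1 | _ => 0
  have e : x 0 = mk d L (zi + w) := by
    have h3 : mk d L (zi + w) = mk d L zi + mk d L w := map_add (mkₗ d L) zi w
    have h4 : mk d L zi = th 0 (ofDer d) := mk_z_one
    rw [h3, h4, hw, thetaPartial, if_pos rfl, add_sub_cancel]
  have hb : bracket11 (x 0) (x 0) = 0 := by
    have h := hx.2 0
    have hbot : F2lt A 0 = ⊥ := eq_bot_iff.mpr (iSup₂_le fun β hβ => absurd hβ not_lt_zero)
    rw [hbot, Submodule.mem_bot] at h
    simpa [seriesBracket11] using h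
  have hk := coef2_bracket11_mk (C := 0) d L (zi + w) (zi + w) (.k i) (.k i) rfl
  rw [← e, hb, map_zero] at hk
  have hz : (zi + w) .z = 1 := by
    rw [Pi.add_apply, h0 .z fun h => h.1.1 rfl, add_zero]
  have hm : ∀ m : Idx, m.dg ≠ 0 → (zi + w) m = 0 := fun m hm => by
    rw [Pi.add_apply, h0 m fun h => hm h.2, add_zero]
    cases m with
    | z => exact absurd rfl hm
    | _ => rfl
  have h2 : ∀ j, deg j 2 0 ≠ 0 := fun j h => by simpa [deg_apply] using DFunLike.congr_fun h j
  have h1 : ∀ j, deg j 0 1 ≠ 0 := fun j h => by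
    simpa [deg_apply, cyc_ne1'] using DFunLike.congr_fun h (j + 1)
  have hq : quadR d L 0 (.k i) (zi + w) (zi + w) = d ((zi + w) (.k i)) := by
    simp only [quadR, quad, evL_cons, evL_nil, Tm.ev, hz, hm (.cf _) (h1 _), hm (.rA _) (h1 _),
      hm (.rB _) (h1 _), hm (.sc _) (h1 _), hm (.tw _) (h2 _), map_zero, mul_zero,
      Finset.sum_const_zero, add_zero, Int.cast_one, one_mul]
  have hl : leadingExponent x i = (zi + w) (.k i) := by
    rw [leadingExponent, CDer.mat_zero_ax, e]
    exact val_mk d L (zi + w) (.k i)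
  have h3 : (2 : ℝ) • d (leadingExponent x i) = 0 := by
    rw [two_smul, hl, ← hq, ← hk]
  exact (smul_eq_zero_iff_right two_ne_zero).mp h3

theorem comb_injective {A : Type*} [CommRing A] [Algebra ℝ A] {L : Fin 3 → Derivation ℝ A A}
    (hL : ∀ c, comb L c = 0 → ∀ a, c a = 0) {c c' : Fin 3 → A} (h : comb L c = comb L c') : c = c' := by
  funext a
  refine sub_eq_zero.mp (hL (c - c') ?_ a)
  rw [← sub_eq_zero.mpr h]
  simp only [comb, Pi.sub_apply, sub_smul, Finset.sum_sub_distrib]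

section Spacetime
variable {M : Type*} [TopologicalSpace M] [ChartedSpace (EuclideanSpace ℝ (Fin 3)) M]
  [IsManifold (𝓡 3) ∞ M]

theorem isUnit_of_ne_zero {f : Smooth M} (hf : ∀ q, f q ≠ 0) : IsUnit f :=
  .of_mul_eq_one ⟨fun q => (f q)⁻¹, f.contMDiff.inv₀ hf⟩ (by
    ext q
    exact mul_inv_cancel₀ (hf q))

namespace SpatialFrame
variable (L : SpatialFrame M)

theorem comb_eq_zero [T2Space M] {c : Fin 3 → Smooth M} (h : comb L.der c = 0) (a : Fin 3) : c a = 0 :=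
  L.eq_zero_of_forall_pull (fun h' => by rw [← comb_apply, h]; rfl) a

theorem comb_tau (c : Fin 3 → Smooth M) : comb L.der c (tau M) = 0 := by
  simp only [comb_apply, der_tau, mul_zero, Finset.sum_const_zero]

variable {L} {c0 : Derivation ℝ (Smooth M) (Smooth M) →ₗ[Smooth M] Smooth M}
  {cL : Fin 3 → Derivation ℝ (Smooth M) (Smooth M) →ₗ[Smooth M] Smooth M}

theorem exists_components {u : EPhi1 (Smooth M)} (hu : IsNondegenerate u)
    (h0 : fieldAt 0 u = partial0 M) (hi : ∀ i, ∃ c, fieldAt (ax i) u = comb L.der c) :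
    ∃ (c0 : Derivation ℝ (Smooth M) (Smooth M) →ₗ[Smooth M] Smooth M)
      (cL : Fin 3 → Derivation ℝ (Smooth M) (Smooth M) →ₗ[Smooth M] Smooth M),
      ∀ D, D = c0 D • partial0 M + comb L.der fun a => cL a D := by
  choose η hη using fun p : Fin 4 => hu.2 (Pi.single p 1)
  choose c hc using hi
  refine ⟨η 0, fun a => ∑ i, c i a • η (ax i), fun D => Derivation.ext fun f => ?_⟩
  let ev : Module.Dual (Smooth M) (Derivation ℝ (Smooth M) (Smooth M)) :=
    { toFun := fun D => D f, map_add' := fun _ _ => rfl, map_smul' := fun _ _ => rfl }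
  have h1 : ev = ∑ p, fieldAt p u f • η p := hu.1 (by
    have hl : ∀ ζ, frameMap u ζ = fun p => ζ (fieldAt p u) := fun ζ => rfl
    funext q
    rw [hl, hl]
    dsimp only
    rw [LinearMap.sum_apply, Finset.sum_eq_single q]
    · have : η q (fieldAt q u) = 1 := (congrFun (hη q) q).trans (Pi.single_eq_same _ _)
      rw [LinearMap.smul_apply, this, smul_eq_mul, mul_one]
      rfl
    · intro p _ hp
      have : η p (fieldAt q u) = 0 := (congrFun (hη p) q).trans (Pi.single_eq_of_ne hp.symm _)
      rw [LinearMap.smul_apply, this, smul_zero]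
    · simp)
  have h2 : D f = ∑ p, fieldAt p u f * η p D := by
    refine (DFunLike.congr_fun h1 D).trans ?_
    rw [LinearMap.sum_apply]
    rfl
  rw [h2, Fin.sum_univ_succ, h0, Derivation.add_apply, Derivation.smul_apply, smul_eq_mul, mul_comm,
    comb_apply]
  congr 1
  simp only [LinearMap.sum_apply, LinearMap.smul_apply, Finset.sum_mul, smul_eq_mul]
  rw [Finset.sum_comm]
  refine Finset.sum_congr rfl fun i _ => ?_
  change fieldAt (ax i) u f * η (ax i) D = _
  rw [hc, comb_apply, Finset.sum_mul]
  exact Finset.sum_congr rfl fun a _ => by ring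

theorem c0_eq (h : ∀ D, D = c0 D • partial0 M + comb L.der fun a => cL a D)
    (D : Derivation ℝ (Smooth M) (Smooth M)) : c0 D = D (tau M) := by
  conv_rhs => rw [h D]
  rw [Derivation.add_apply, comb_tau, Derivation.smul_apply, partial0_tau, add_zero, smul_eq_mul,
    mul_one]

theorem eq_comb (h : ∀ D, D = c0 D • partial0 M + comb L.der fun a => cL a D)
    {D : Derivation ℝ (Smooth M) (Smooth M)} (hD : D (tau M) = 0) : D = comb L.der fun a => cL a D := by
  conv_lhs => rw [h D]
  rw [c0_eq h, hD, zero_smul, zero_add]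

theorem partial0_der_pull (a : Fin 3) (f : C^∞⟮𝓡 3, M; ℝ⟯) : partial0 M (L.der a (pull f)) = 0 := by
  rw [der_pull, partial0_pull]

theorem lie_partial0_der [T2Space M] (h : ∀ D, D = c0 D • partial0 M + comb L.der fun a => cL a D) (a : Fin 3) :
    ⁅partial0 M, L.der a⁆ = 0 := by
  have h1 : ⁅partial0 M, L.der a⁆ (tau M) = 0 := by
    rw [Derivation.commutator_apply, der_tau, partial0_tau, map_zero, Derivation.map_one_eq_zero,
      sub_zero]
  have h2 := eq_comb h h1
  have h3 : ∀ b, cL b ⁅partial0 M, L.der a⁆ = 0 := L.eq_zero_of_forall_pull fun f => by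
    rw [← comb_apply, ← h2, Derivation.commutator_apply, partial0_der_pull, partial0_pull, map_zero,
      sub_zero]
  rw [h2]
  simp [h3, comb]

end SpatialFrame

theorem fieldAt_gauge {L : SpatialFrame M} {α : Deg} {u : EPhi1 (Smooth M)}
    (hu : u ∈ gaugeSubspace L.der α) :
    fieldAt 0 u = 0 ∧ ∀ i, ∃ c, fieldAt (ax i) u = comb L.der c := by
  obtain ⟨w, rfl, h⟩ := (mem_gaugeSubspace (partial0 M)).mp hu
  refine ⟨?_, fun i => ⟨fun a => w (.e i a), fieldAt_ax_mk ..⟩⟩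
  rw [fieldAt_zero_mk, h .z fun h => h.1.1 rfl, zero_smul]

theorem IsGaugedMCPos.exists_components {L : SpatialFrame M} {x : Deg → EPhi1 (Smooth M)}
    (hx : IsGaugedMCPos L x) :
    ∃ (c0 : Derivation ℝ (Smooth M) (Smooth M) →ₗ[Smooth M] Smooth M)
      (cL : Fin 3 → Derivation ℝ (Smooth M) (Smooth M) →ₗ[Smooth M] Smooth M),
      ∀ D, D = c0 D • partial0 M + comb L.der fun a => cL a D := by
  choose h0 c hc using fun α => fieldAt_gauge (hx.gauged α)
  have key : ∀ p, fieldAt p (atOne x) = (if p = 0 then partial0 M else 0) +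
      ∑ α ∈ Finset.Iic (deg 0 2 2), fieldAt p (x α - thetaPartial (partial0 M) α) := fun p => by
    rw [← map_sum, Finset.sum_sub_distrib, map_sub]
    have : ∑ α ∈ Finset.Iic (deg 0 2 2), thetaPartial (partial0 M) α = th 0 (ofDer (partial0 M)) := by
      simp only [thetaPartial, Finset.sum_ite_eq', Finset.mem_Iic, zero_le, if_true]
    rw [this, fieldAt_th_ofDer, atOne]
    abel
  refine SpatialFrame.exists_components hx.nondegenerate ?_ fun i =>
    ⟨fun a => ∑ α ∈ Finset.Iic (deg 0 2 2), c α i a, ?_⟩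
  · rw [key, if_pos rfl, Finset.sum_eq_zero fun α _ => h0 α, add_zero]
  · rw [key, if_neg (ax_ne_zero i), zero_add, Finset.sum_congr rfl fun α _ => hc α i]
    simp only [comb, Finset.sum_smul]
    exact Finset.sum_comm

theorem IsGaugedMCPos.exists_background [T2Space M] {L : SpatialFrame M} {x : Deg → EPhi1 (Smooth M)}
    (hx : IsGaugedMCPos L x) (hani : IsAnisotropic x) :
    ∃ B : AnisotropicBackground (Smooth M), B.d = partial0 M ∧ B.L = L.der ∧
      B.p = leadingExponent x ∧ ∀ κ, B.Cl κ = genKer (partial0 M) (wt (leadingExponent x) κ) := by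
  obtain ⟨c0, cL, h⟩ := hx.exists_components
  have hlie := SpatialFrame.lie_partial0_der h
  have hLL : ∀ a b, ⁅L.der a, L.der b⁆ = comb L.der fun c => cL c ⁅L.der a, L.der b⁆ := fun a b =>
    SpatialFrame.eq_comb h (by
      rw [Derivation.commutator_apply, L.der_tau, L.der_tau, map_zero, map_zero, sub_zero])
  have hcomm : ∀ a f, partial0 M (L.der a f) = L.der a (partial0 M f) := fun a f => by
    have := DFunLike.congr_fun (hlie a) f
    rwa [Derivation.commutator_apply, Derivation.zero_apply, sub_eq_zero] at this
  have hdC : ∀ a b c, partial0 M (cL c ⁅L.der a, L.der b⁆) = 0 := fun a b =>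
    L.eq_zero_of_forall_pull fun f => by
      have e := DFunLike.congr_fun (hLL a b) (pull f)
      have e' := congrArg (partial0 M) e
      rw [Derivation.commutator_apply, comb_apply, map_sub, map_sum] at e'
      simp only [hcomm, Derivation.leibniz, partial0_pull, map_zero, sub_zero,
        smul_eq_mul] at e'
      rw [e']
      exact Finset.sum_congr rfl fun c _ => by
        rw [mul_zero, zero_add, mul_comm]
  have hp := derivation_leadingExponent hx.mc hx.gauged
  have hw : ∀ κ, partial0 M (wt (leadingExponent x) κ) = 0 := fun κ => by
    simp [wt, hp]
  have hunit : ∀ {δ κ : Deg}, δ < κ → IsUnit (wt (leadingExponent x) (κ - δ)) := fun {δ κ} hlt => by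
    refine isUnit_of_ne_zero fun q => ne_of_gt ?_
    change 0 < ContMDiffMap.evalRingHom q (wt (leadingExponent x) (κ - δ))
    simp only [wt, map_sum, map_mul, map_natCast]
    obtain ⟨i, hi⟩ : ∃ i, (κ - δ) i ≠ 0 := by
      by_contra! h0
      exact (tsub_pos_of_lt hlt).ne' (Finsupp.ext h0)
    exact Finset.sum_pos' (fun j _ => mul_nonneg (Nat.cast_nonneg _) (hx.pos j q).le)
      ⟨i, Finset.mem_univ _, mul_pos (Nat.cast_pos.mpr (Nat.pos_of_ne_zero hi)) (hx.pos i q)⟩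
  have hsub : ∀ {δ κ : Deg}, δ < κ → wt (leadingExponent x) κ =
      wt (leadingExponent x) δ + wt (leadingExponent x) (κ - δ) := fun {δ κ} hlt => by
    rw [← wt_add, add_tsub_cancel_of_le hlt.le]
  exact ⟨{
    d := partial0 M, L := L.der, C := fun a b c => cL c ⁅L.der a, L.der b⁆, p := leadingExponent x
    Cl := fun κ => genKer (partial0 M) (wt (leadingExponent x) κ)
    rel := ⟨hlie, hLL, fun a b c => by rw [← lie_skew, map_neg]⟩
    d_C := hdC
    C_mem := fun a b c => by
      rw [wt_zero]
      exact mem_genKer_zero_of_ker (hdC a b c)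
    d_p := hp
    mul_mem := fun hx hy => by
      rw [wt_add]
      exact mul_mem_genKer hx hy
    d_mem := d_mem_genKer (hw _)
    L_mem := fun a => derivation_mem_genKer (hcomm a) (hw _)
    ker_mem := fun hx => by
      rw [wt_zero]
      exact mem_genKer_zero_of_ker hx
    solve := fun hlt hb => by
      rw [hsub hlt] at hb ⊢
      exact exists_evolution_eq (hunit hlt) (hw _) hb
    solve_unique := fun hlt hc e => by
      rw [hsub hlt] at hc
      exact eq_zero_of_evolution_eq_zero (hunit hlt) hc e (hw _)
    mem_of_eq := fun hb e => mem_genKer_of_evolution_mem (e ▸ hb)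
    c0 := c0, cL := cL, decomp := h
    c0_d := (SpatialFrame.c0_eq h _).trans partial0_tau
    c0_L := fun a => (SpatialFrame.c0_eq h _).trans (L.der_tau a)
    cL_d := L.comb_eq_zero (by
      have := h (partial0 M)
      rwa [SpatialFrame.c0_eq h, partial0_tau, one_smul, left_eq_add] at this)
    cL_L := fun a b => by
      have e := SpatialFrame.eq_comb h (L.der_tau b)
      have e' : comb L.der (fun a => if b = a then 1 else 0) = L.der b := by simp [comb]
      exact congrFun (comb_injective (fun _ => L.comb_eq_zero) (e.symm.trans e'.symm)) a
    prim := fun f => ⟨primitive f, partial0_primitive f⟩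
    unit := fun i => isUnit_of_ne_zero fun q => sub_ne_zero.mpr (hani _ _ (by revert i; decide) q) },
    rfl, rfl, rfl, fun _ => rfl⟩

end Spacetime

end

section
theorem Co1.val_mem {A : Type*} [CommRing A] [Algebra ℝ A] {S : Subalgebra ℝ A} {u : EPhi1 A}
    (hw : ∀ p, (u.1 p).w ∈ S) (hb : ∀ p i, (u.1 p).b i ∈ S) (hr : ∀ p i, (u.1 p).r i ∈ S)
    (hs : ∀ p, u.2 p ∈ S) (c : Co1) : c.val u ∈ S := by
  cases c with
  | k i => exact hb _ _
  | s0 => exact hs _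
  | tw i => exact add_mem (hr _ _) (hr _ _)
  | cf i => exact hw _
  | sy i => exact add_mem (hb _ _) (hb _ _)
  | rA i => exact hr _ _
  | rB i => exact hr _ _
  | sc i => exact hs _
  | sk i => exact sub_mem (hb _ _) (hb _ _)
  | z0 => exact sub_mem (hw _) (sum_mem fun i _ => hb _ _)
  | zb i => exact sub_mem (hb _ _) (hw _)
  | zr i => exact hr _ _

theorem val_th_mem {A : Type*} [CommRing A] [Algebra ℝ A] {S : Subalgebra ℝ A} {δ : CDer A}
    (hw : δ.w ∈ S) (hb : ∀ i, δ.b i ∈ S) (hr : ∀ i, δ.r i ∈ S) (p : Fin 4) (c : Co1) :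
    c.val (th p δ) ∈ S := by
  refine Co1.val_mem (fun q => ?_) (fun q i => ?_) (fun q i => ?_) (fun q => zero_mem S) c
  · rw [w_th]
    split_ifs
    exacts [hw, zero_mem S]
  · rw [b_th]
    split_ifs
    exacts [hb i, zero_mem S]
  · rw [r_th]
    split_ifs
    exacts [hr i, zero_mem S]

section Spacetime
variable {M : Type*} [TopologicalSpace M] [ChartedSpace (EuclideanSpace ℝ (Fin 3)) M]
  [IsManifold (𝓡 3) ∞ M]

theorem mem_spatialPoly {f : Smooth M} : f ∈ spatialPoly M ↔ f ∈ genKer (partial0 M) 0 := by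
  have e : spatialPoly M = Algebra.adjoin ℝ ({tau M} ∪ {f | partial0 M f = 0}) := by
    rw [spatialPoly]
    congr 2
    ext f
    constructor
    · rintro ⟨h, rfl⟩
      exact partial0_pull h
    · intro hf
      obtain ⟨h, rfl⟩ := eq_pull_of_partial0_eq_zero hf
      exact ⟨h, rfl⟩
  rw [e]
  exact ⟨adjoin_le_genKer partial0_tau, mem_adjoin_of_mem_genKer partial0_tau⟩

theorem partial0_expNeg (f : Smooth M) : partial0 M (expNeg f) = -partial0 M f * expNeg f :=
  ext_of_halfLine fun t ht m => partial0_eq_of_hasDerivWithinAt ht (by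
    have h := (hasDerivWithinAt_partial0 f t ht m).fun_neg.exp
    rwa [mul_comm] at h)

theorem isUnit_expNeg (f : Smooth M) : IsUnit (expNeg f) :=
  isUnit_of_ne_zero fun _ => (Real.exp_pos _).ne'

theorem partial0_damping {x : Deg → EPhi1 (Smooth M)} (hp : ∀ i, partial0 M (leadingExponent x i) = 0)
    (κ : Deg) : partial0 M (damping x κ) = -wt (leadingExponent x) κ * damping x κ := by
  have hw : ∑ i, (κ i : ℝ) • leadingExponent x i = wt (leadingExponent x) κ := by
    simp only [wt, Nat.cast_smul_eq_nsmul, nsmul_eq_mul]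
  have h0 : partial0 M (wt (leadingExponent x) κ) = 0 := by simp [wt, hp]
  rw [damping, hw, partial0_expNeg, Derivation.leibniz, h0, partial0_tau, smul_zero, add_zero,
    smul_eq_mul, mul_one]

section PolyPart
variable {L : SpatialFrame M}

theorem map_mem_of_mem_polyPart {φ : EPhi1 (Smooth M) →ₗ[Smooth M] Smooth M}
    (hφ : ∀ u ∈ basis1 L, φ u ∈ spatialPoly M) {u : EPhi1 (Smooth M)} (hu : u ∈ polyPart L) :
    φ u ∈ spatialPoly M := by
  induction hu using Submodule.span_induction with
  | mem u hu => exact hφ u hu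
  | zero => rw [map_zero]; exact zero_mem _
  | add u v _ _ hu hv => rw [map_add]; exact add_mem hu hv
  | smul c u _ hu =>
    change φ (c.1 • u) ∈ _
    rw [map_smul]
    exact mul_mem c.2 hu

theorem val_basis1_mem {u : EPhi1 (Smooth M)} (hu : u ∈ basis1 L) (c : Co1) :
    c.val u ∈ spatialPoly M := by
  have hite : ∀ (P : Prop) [Decidable P], (if P then 1 else 0 : Smooth M) ∈ spatialPoly M :=
    fun P _ => by
      split_ifs
      exacts [one_mem _, zero_mem _]
  obtain ⟨p, rfl | rfl | ⟨j, rfl⟩ | ⟨j, rfl⟩ | rfl | ⟨a, rfl⟩⟩ := hu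
  · refine Co1.val_mem (fun q => zero_mem _) (fun q i => zero_mem _) (fun q i => zero_mem _)
      (fun q => ?_) c
    rw [snd_uth]
    exact hite _
  · exact val_th_mem (by simp) (by simp) (by simp) p c
  · exact val_th_mem (by simp) (fun i => by rw [b_boost]; exact hite _) (by simp) p c
  · exact val_th_mem (by simp) (by simp) (fun i => by rw [r_rot]; exact hite _) p c
  · rw [val_th_ofDer]; exact zero_mem _
  · rw [val_th_ofDer]; exact zero_mem _

theorem map_fieldAt_basis1_mem {φ : Derivation ℝ (Smooth M) (Smooth M) →ₗ[Smooth M] Smooth M}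
    (hd : φ (partial0 M) ∈ spatialPoly M) (hL : ∀ a, φ (L.der a) ∈ spatialPoly M)
    {u : EPhi1 (Smooth M)} (hu : u ∈ basis1 L) (p : Fin 4) : φ (fieldAt p u) ∈ spatialPoly M := by
  have h0 : φ 0 ∈ spatialPoly M := by rw [map_zero]; exact zero_mem _
  have hth : ∀ q δ, φ (CDer.field δ) ∈ spatialPoly M → φ (fieldAt p (th q δ)) ∈ spatialPoly M :=
    fun q δ h => by
      rw [fieldAt_apply, field_th]
      split_ifs
      exacts [h, h0]
  obtain ⟨q, rfl | rfl | ⟨j, rfl⟩ | ⟨j, rfl⟩ | rfl | ⟨a, rfl⟩⟩ := hu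
  · exact h0
  · exact hth _ _ h0
  · exact hth _ _ h0
  · exact hth _ _ h0
  · exact hth _ _ hd
  · exact hth _ _ (hL a)

theorem smul_mem_polyPart {f : Smooth M} (hf : f ∈ spatialPoly M) {u : EPhi1 (Smooth M)}
    (hu : u ∈ polyPart L) : f • u ∈ polyPart L :=
  (polyPart L).smul_mem ⟨f, hf⟩ hu

theorem gen_mem_polyPart (c : Co1) : c.gen ∈ polyPart L := by
  have hu : ∀ p, uth p ∈ polyPart L := fun p => Submodule.subset_span ⟨p, .inl rfl⟩
  have h0 : ∀ p, th p sigma0 ∈ polyPart L := fun p => Submodule.subset_span ⟨p, .inr (.inl rfl)⟩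
  have hb : ∀ p j, th p (boost j) ∈ polyPart L := fun p j =>
    Submodule.subset_span ⟨p, .inr (.inr (.inl ⟨j, rfl⟩))⟩
  have hr : ∀ p j, th p (rot j) ∈ polyPart L := fun p j =>
    Submodule.subset_span ⟨p, .inr (.inr (.inr (.inl ⟨j, rfl⟩)))⟩
  cases c with
  | k i => exact add_mem (h0 _) (hb _ _)
  | s0 => exact hu _
  | tw i => exact add_mem (add_mem (neg_mem (hr _ _)) (hr _ _)) (hr _ _)
  | cf i => exact add_mem (hb _ _) (h0 _)
  | sy i => exact add_mem (hb _ _) (hb _ _)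
  | rA i => exact hr _ _
  | rB i => exact hr _ _
  | sc i => exact hu _
  | sk i => exact sub_mem (hb _ _) (hb _ _)
  | z0 => exact h0 _
  | zb i => exact hb _ _
  | zr i => exact hr _ _

theorem th_ofDer_mem_polyPart {f : Smooth M} {c : Fin 3 → Smooth M} (hf : f ∈ spatialPoly M)
    (hc : ∀ a, c a ∈ spatialPoly M) (p : Fin 4) :
    th p (ofDer (f • partial0 M + comb L.der c)) ∈ polyPart L := by
  have e : th p (ofDer (f • partial0 M + comb L.der c)) =
      f • th p (ofDer (partial0 M)) + ∑ a, c a • th p (ofDer (L.der a)) := by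
    refine EPhi1_ext (fun k => ?_) fun q => ?_
    · rw [val_th_ofDer, ← Co1.valₗ_apply, map_add, map_sum]
      simp only [map_smul, Co1.valₗ_apply, val_th_ofDer, smul_zero, Finset.sum_const_zero, add_zero]
    · rw [map_add, map_sum]
      simp only [map_smul, fieldAt_th_ofDer]
      by_cases h : q = p <;> simp [h, comb]
  rw [e]
  refine add_mem (smul_mem_polyPart hf (Submodule.subset_span ⟨p, ?_⟩)) (sum_mem fun a _ =>
    smul_mem_polyPart (hc a) (Submodule.subset_span ⟨p, ?_⟩))
  exacts [.inr (.inr (.inr (.inr (.inl rfl)))), .inr (.inr (.inr (.inr (.inr ⟨a, rfl⟩))))]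

theorem mem_polyPart_iff (B : AnisotropicBackground (Smooth M)) (hd : B.d = partial0 M)
    (hL : B.L = L.der) {u : EPhi1 (Smooth M)} : u ∈ polyPart L ↔
      (∀ c : Co1, c.val u ∈ spatialPoly M) ∧ (∀ p, B.c0 (fieldAt p u) ∈ spatialPoly M) ∧
        ∀ p a, B.cL a (fieldAt p u) ∈ spatialPoly M := by
  constructor
  · intro hu
    refine ⟨fun c => map_mem_of_mem_polyPart (φ := c.valₗ) (fun u hu => val_basis1_mem hu c) hu,
      fun p => map_mem_of_mem_polyPart (φ := B.c0 ∘ₗ fieldAt p)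
        (fun u hu => map_fieldAt_basis1_mem ?_ (fun b => ?_) hu p) hu,
      fun p a => map_mem_of_mem_polyPart (φ := B.cL a ∘ₗ fieldAt p)
        (fun u hu => map_fieldAt_basis1_mem ?_ (fun b => ?_) hu p) hu⟩
    · rw [← hd, B.c0_d]; exact one_mem _
    · rw [← hL, B.c0_L]; exact zero_mem _
    · rw [← hd, B.cL_d]; exact zero_mem _
    · rw [← hL, B.cL_L]
      split_ifs
      exacts [one_mem _, zero_mem _]
  · rintro ⟨hc, h0, hs⟩
    rw [eq_sum_gen u]
    refine add_mem (sum_mem fun c _ => smul_mem_polyPart (mul_mem (Subalgebra.algebraMap_mem _ _) (hc c))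
      (gen_mem_polyPart c)) (sum_mem fun p _ => ?_)
    rw [B.decomp (fieldAt p u), hd, hL]
    exact th_ofDer_mem_polyPart (h0 p) (hs p) p

end PolyPart

theorem exists_polyPart_iff_coMem {L : SpatialFrame M} {x : Deg → EPhi1 (Smooth M)}
    {B : AnisotropicBackground (Smooth M)} (hd : B.d = partial0 M)
    (hL : B.L = L.der) (hp : B.p = leadingExponent x)
    (hC : ∀ κ, B.Cl κ = genKer (partial0 M) (wt (leadingExponent x) κ))
    {α : Deg} {u : EPhi1 (Smooth M)} :
    (∃ v ∈ polyPart L, u = damping x α • v) ↔ B.CoMem α u := by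
  have hE : IsUnit (damping x α) := isUnit_expNeg _
  have hdE := partial0_damping (x := x) (fun i => by rw [← hd, ← hp, B.d_p]) α
  obtain ⟨Q, hQ⟩ := hE.exists_left_inv
  have hmem : ∀ f, Q * f ∈ spatialPoly M ↔ f ∈ B.Cl α := fun f => by
    rw [mem_spatialPoly, hC, ← mul_mem_genKer_iff hE hdE, ← mul_assoc, mul_comm _ Q, hQ, one_mul]
  have h1 : (∃ v ∈ polyPart L, u = damping x α • v) ↔ Q • u ∈ polyPart L := by
    constructor
    · rintro ⟨v, hv, rfl⟩
      rwa [smul_smul, hQ, one_smul]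
    · intro h
      refine ⟨_, h, ?_⟩
      rw [smul_smul, mul_comm, hQ, one_smul]
  rw [h1, mem_polyPart_iff B hd hL]
  simp only [← Co1.valₗ_apply, map_smul, smul_eq_mul, hmem]
  exact ⟨fun h => ⟨h.1, h.2.1, h.2.2⟩, fun h => ⟨h.val, h.time, h.space⟩⟩

end Spacetime

end

section
theorem IsMCGraded.family {R : Type*} [CommRing R] [Algebra ℝ R] {x : Deg → EPhi1 R}
    (hx : IsMCGraded x) : IsMCGradedFamily fun β => if β = 0 then x else 0 := by
  refine ⟨fun β α => ?_, fun β α => Submodule.sum_mem _ fun b _ => ?_⟩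
  · dsimp only
    split_ifs
    exacts [hx.1 α, zero_mem _]
  · dsimp only
    by_cases h : b.1 = 0 ∧ b.2 = 0
    · rw [if_pos h.1, if_pos h.2]
      exact hx.2 α
    · have e : seriesBracket11 (if b.1 = 0 then x else 0) (if b.2 = 0 then x else 0) α = 0 :=
        Finset.sum_eq_zero fun c _ => by
          rw [← br11_apply]
          rcases not_and_or.mp h with h | h
          · rw [if_neg h, Pi.zero_apply, map_zero, AddMonoidHom.zero_apply]
          · rw [if_neg h, Pi.zero_apply, map_zero]
      rw [e]
      exact zero_mem _

section Spacetime
variable {M : Type*} [TopologicalSpace M] [ChartedSpace (EuclideanSpace ℝ (Fin 3)) M]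
  [IsManifold (𝓡 3) ∞ M] {L : SpatialFrame M} {x : Deg → EPhi1 (Smooth M)}

theorem isGaugedFamily_of_mem {B : AnisotropicBackground (Smooth M)} (hd : B.d = partial0 M)
    (hL : B.L = L.der) (hp : B.p = leadingExponent x) (hx : IsGaugedMCPos L x)
    {X : Deg → Deg → EPhi1 (Smooth M)} (hX : X ∈ formalFamilies L x) : B.IsGaugedFamily X where
  mc := hX.1
  gauged β α := by
    rw [hd, hL]
    split_ifs with h
    · rw [h, hX.2.1]
      exact hx.gauged α
    · rw [sub_zero]
      exact hX.2.2 β h α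
  p i := by rw [hX.2.1, hp]

theorem isFormalSolution_iff {B : AnisotropicBackground (Smooth M)} (hd : B.d = partial0 M)
    (hL : B.L = L.der) (hp : B.p = leadingExponent x)
    (hC : ∀ κ, B.Cl κ = genKer (partial0 M) (wt (leadingExponent x) κ))
    {X γ : Deg → Deg → EPhi1 (Smooth M)} (hX : X 0 = x) : IsFormalSolution L X γ ↔ B.IsSol X γ := by
  have h : ∀ β α, (∃ u ∈ polyPart L, γ β α = damping (X 0) α • u) ↔ B.CoMem α (γ β α) := fun β α => by
    rw [hX]
    exact exists_polyPart_iff_coMem hd hL hp hC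
  exact ⟨fun s => ⟨s.mc, s.leading, hd ▸ s.gauged, fun β α => (h β α).mp (s.poly β α)⟩,
    fun s => ⟨s.mc, s.leading, hd ▸ s.gauged, fun β α => (h β α).mpr (s.mem β α)⟩⟩

theorem isFormalSolution_sFormal {X γ : Deg → Deg → EPhi1 (Smooth M)} (h : IsFormalSolution L X γ) :
    IsFormalSolution L X (sFormal L X) := by
  have hex : ∃ γ, IsFormalSolution L X γ := ⟨γ, h⟩
  rw [sFormal, dif_pos hex]
  exact hex.choose_spec

end Spacetime

end

end BKL

end

theorem lemma5 {M : Type*} [TopologicalSpace M] [T2Space M] [CompactSpace M]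
    [ChartedSpace (EuclideanSpace ℝ (Fin 3)) M] [IsManifold (𝓡 3) ∞ M]
    (L : BKL.SpatialFrame M) (x : BKL.Deg → BKL.EPhi1 (BKL.Smooth M))
    (hx : BKL.IsGaugedMCPos L x) (hani : BKL.IsAnisotropic x) :
    (∀ X ∈ BKL.formalFamilies L x,
      (∃! γ, BKL.IsFormalSolution L X γ) ∧
        BKL.IsFormalSolution L X (BKL.sFormal L X) ∧
        BKL.setTeqS (BKL.sFormal L X) ∈ BKL.fiber x) ∧
    ∀ y ∈ BKL.fiber x, ∃ X ∈ BKL.formalFamilies L x,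
      BKL.GaugeEquivalent (BKL.setTeqS (BKL.sFormal L X)) y := by
  obtain ⟨B, hd, hL, hp, hC⟩ := hx.exists_background hani
  have huniq : ∀ X ∈ BKL.formalFamilies L x, ∃! γ, BKL.IsFormalSolution L X γ := fun X hX => by
    simp only [BKL.isFormalSolution_iff hd hL hp hC hX.2.1]
    exact (BKL.isGaugedFamily_of_mem hd hL hp hx hX).existsUnique
  refine ⟨fun X hX => ?_, fun y hy => ?_⟩
  · have hs := BKL.isFormalSolution_sFormal (huniq X hX).exists.choose_spec
    have hf := ((BKL.isFormalSolution_iff hd hL hp hC hX.2.1).mp hs).setTeqS_mem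
    rw [hX.2.1] at hf
    exact ⟨huniq X hX, hs, hf⟩
  · have hx0 : (fun β => if β = 0 then x else 0) ∈ BKL.formalFamilies L x :=
      ⟨hx.mc.family, if_pos rfl, fun β hβ α => by
        dsimp only
        rw [if_neg hβ]
        exact zero_mem (BKL.gaugeSubspace L.der α)⟩
    obtain ⟨a, X, γ, ha, hmc, hX0, hg, hsol, hexp⟩ :=
      BKL.AnisotropicBackground.exists_solution (BKL.isGaugedFamily_of_mem hd hL hp hx hx0) hy
    have hX : X ∈ BKL.formalFamilies L x := ⟨hmc, hX0, hL ▸ hg⟩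
    have hγ := (BKL.isFormalSolution_iff hd hL hp hC hX0).mpr hsol
    have e : BKL.sFormal L X = γ :=
      (huniq X hX).unique (BKL.isFormalSolution_sFormal hγ) hγ
    exact ⟨X, hX, a, ha, e ▸ hexp⟩
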